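/- Let $G$ be an undirected graph with $n$ vertices, $m$ edges and non-negative real edge weights, let $T$ be a (spanning) shortest path tree of $G$ rooted at a vertex $r$, and let $f\ge 1$ be an integer. A path failure with deepest endpoint $v$ is a set $F$ of $|F|\ge 1$ edges that consists of the last $|F|$ edges of the path from $r$ to $v$ in $T$. Write $d_{G-F}(t)$ for the weighted distance from $r$ to $t$ in $G-F$ ($=\infty$ if $t$ is not reachable). Running times are the numbers of steps on a random access machine with unit-cost words of $O(\log(n+f))$ bits (with $+,-,\times$, integer division and comparison) and with real registers that admit only $+,-$ and comparison. There are three fixed programs of such a machine (a preprocessing, a distance query and a path query program), such that for all $G$, $T$, $r$, $f$ as above the following holds. Given $f$, $r$, the list of the weighted edges of $G$ and the parent of each vertex in $T$, the preprocessing builds, in $O(n(m+f^2))$ time, an oracle of size $O(nf^2)$ (memory cells). For every path failure $F$ with $|F|\le f$, given by its deepest endpoint $v$ and by $|F|$, and for every vertex $t$, the query programs, which have access to the oracle and to $(v,|F|,t)$ only and leave the oracle unchanged, do the following. If $d_{G-F}(t)=\infty$, then both query programs report this in $O(1)$ time. Otherwise there is a (simple) path $P$ from $r$ to $t$ in $G-F$,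 whose length $w(P)$ satisfies $$d_{G-F}(t)\le w(P)\le (2|F|+1)\,d_{G-F}(t),$$ such that - the distance query returns the number $w(P)$ in $O(1)$ time; - the path query returns $P$, as the sequence of its vertices from $r$ to $t$, in $O(\ell+1)$ time, where $\ell$ is the number of edges of $P$. All constants hidden in the $O$-notation are absolute. -/

import Mathlib

open scoped NNReal ENNReal

namespace PathOracle

/-! ## A random access machine for graphs with real edge weights

Programs are finite, and every program uses a fixed finite number of scalar variables and of arrays.
There are two kinds of data: natural numbers ("words", used for counters and addresses, with
`+`, truncated `-`, `*`, integer `/` and comparison), and real numbers (with `+`, `-` and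
comparison only). -/

/-- A machine state: word variables, word arrays, real variables, real arrays
(the first argument of `ia`, `ra` is the name of the array, the second one the index). -/
structure State where
  iv : ℕ → ℕ
  ia : ℕ → ℕ → ℕ
  rv : ℕ → ℝ
  ra : ℕ → ℕ → ℝ

/-- Expressions over words. -/
inductive NExpr where
  | lit (k : ℕ)
  | var (x : ℕ)
  | get (a : ℕ) (i : NExpr)
  | add (d e : NExpr)
  | sub (d e : NExpr)
  | mul (d e : NExpr)
  | div (d e : NExpr)

def NExpr.eval (s : State) : NExpr → ℕ
  | lit k => k
  | var x => s.iv x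
  | get a i => s.ia a (i.eval s)
  | add d e => d.eval s + e.eval s
  | sub d e => d.eval s - e.eval s
  | mul d e => d.eval s * e.eval s
  | div d e => d.eval s / e.eval s

/-- Number of elementary operations of an expression. -/
def NExpr.cost : NExpr → ℕ
  | lit _ => 1
  | var _ => 1
  | get _ i => i.cost + 1
  | add d e => d.cost + e.cost + 1
  | sub d e => d.cost + e.cost + 1
  | mul d e => d.cost + e.cost + 1
  | div d e => d.cost + e.cost + 1

/-- Expressions over reals. -/
inductive RExpr where
  | zero
  | var (x : ℕ)
  | get (a : ℕ) (i : NExpr)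
  | add (d e : RExpr)
  | sub (d e : RExpr)

noncomputable def RExpr.eval (s : State) : RExpr → ℝ
  | zero => 0
  | var x => s.rv x
  | get a i => s.ra a (i.eval s)
  | add d e => d.eval s + e.eval s
  | sub d e => d.eval s - e.eval s

def RExpr.cost : RExpr → ℕ
  | zero => 1
  | var _ => 1
  | get _ i => i.cost + 1
  | add d e => d.cost + e.cost + 1
  | sub d e => d.cost + e.cost + 1

/-- Tests. -/
inductive Test where
  | nle (d e : NExpr)
  | rle (d e : RExpr)
  | neg (b : Test)
  | conj (b c : Test)

def Test.Holds (s : State) : Test → Prop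
  | nle d e => d.eval s ≤ e.eval s
  | rle d e => d.eval s ≤ e.eval s
  | neg b => ¬ b.Holds s
  | conj b c => b.Holds s ∧ c.Holds s

def Test.cost : Test → ℕ
  | nle d e => d.cost + e.cost + 1
  | rle d e => d.cost + e.cost + 1
  | neg b => b.cost + 1
  | conj b c => b.cost + c.cost + 1

/-- Programs. -/
inductive Cmd where
  | nop
  | setN (x : ℕ) (e : NExpr)
  | setR (x : ℕ) (e : RExpr)
  | putN (a : ℕ) (i e : NExpr)
  | putR (a : ℕ) (i : NExpr) (e : RExpr)
  | seq (p q : Cmd)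
  | branch (b : Test) (p q : Cmd)
  | loop (b : Test) (p : Cmd)

def State.setN (s : State) (x k : ℕ) : State :=
  { s with iv := Function.update s.iv x k }

noncomputable def State.setR (s : State) (x : ℕ) (y : ℝ) : State :=
  { s with rv := Function.update s.rv x y }

def State.putN (s : State) (a i k : ℕ) : State :=
  { s with ia := Function.update s.ia a (Function.update (s.ia a) i k) }

noncomputable def State.putR (s : State) (a i : ℕ) (y : ℝ) : State :=
  { s with ra := Function.update s.ra a (Function.update (s.ra a) i y) }

/-- `Exec B p s k s'`: started in the state `s`, the program `p` halts in the state `s'` after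
exactly `k` elementary steps, and every word and every address that it writes is at most `B`.
(The execution is stuck, so that there is no such `k` and `s'`, if a larger word is to be stored.) -/
inductive Exec (B : ℕ) : Cmd → State → ℕ → State → Prop
  | nop (s : State) : Exec B .nop s 1 s
  | setN (s : State) (x : ℕ) (e : NExpr) (he : e.eval s ≤ B) :
      Exec B (.setN x e) s (e.cost + 1) (s.setN x (e.eval s))
  | setR (s : State) (x : ℕ) (e : RExpr) :
      Exec B (.setR x e) s (e.cost + 1) (s.setR x (e.eval s))
  | putN (s : State) (a : ℕ) (i e : NExpr) (hi : i.eval s ≤ B) (he : e.eval s ≤ B) :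
      Exec B (.putN a i e) s (i.cost + e.cost + 1) (s.putN a (i.eval s) (e.eval s))
  | putR (s : State) (a : ℕ) (i : NExpr) (e : RExpr) (hi : i.eval s ≤ B) :
      Exec B (.putR a i e) s (i.cost + e.cost + 1) (s.putR a (i.eval s) (e.eval s))
  | seq {p q : Cmd} {s s' s'' : State} {k l : ℕ}
      (hp : Exec B p s k s') (hq : Exec B q s' l s'') : Exec B (.seq p q) s (k + l) s''
  | branchTrue {b : Test} {p q : Cmd} {s s' : State} {k : ℕ} (hb : b.Holds s)
      (hp : Exec B p s k s') : Exec B (.branch b p q) s (b.cost + k + 1) s'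
  | branchFalse {b : Test} {p q : Cmd} {s s' : State} {k : ℕ} (hb : ¬ b.Holds s)
      (hq : Exec B q s k s') : Exec B (.branch b p q) s (b.cost + k + 1) s'
  | loopDone {b : Test} {p : Cmd} {s : State} (hb : ¬ b.Holds s) :
      Exec B (.loop b p) s (b.cost + 1) s
  | loopStep {b : Test} {p : Cmd} {s s' s'' : State} {k l : ℕ} (hb : b.Holds s)
      (hp : Exec B p s k s') (hl : Exec B (.loop b p) s' l s'') :
      Exec B (.loop b p) s (b.cost + k + l + 1) s''

/-- The machine is deterministic: the number of steps and the final state are determined by the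
program and by the initial state. -/
theorem Exec.det {B : ℕ} {p : Cmd} {s s₁ s₂ : State} {k₁ k₂ : ℕ}
    (h₁ : Exec B p s k₁ s₁) (h₂ : Exec B p s k₂ s₂) : k₁ = k₂ ∧ s₁ = s₂ := by
  induction h₁ generalizing k₂ s₂ with
  | nop | setN | setR | putN | putR => cases h₂; exact ⟨rfl, rfl⟩
  | seq _ _ ih ih' =>
    cases h₂ with
    | seq hp hq =>
      obtain ⟨rfl, rfl⟩ := ih hp
      obtain ⟨rfl, rfl⟩ := ih' hq
      exact ⟨rfl, rfl⟩
  | branchTrue hb _ ih =>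
    cases h₂ with
    | branchTrue _ hp =>
      obtain ⟨rfl, rfl⟩ := ih hp
      exact ⟨rfl, rfl⟩
    | branchFalse hb' _ => exact absurd hb hb'
  | branchFalse hb _ ih =>
    cases h₂ with
    | branchTrue hb' _ => exact absurd hb' hb
    | branchFalse _ hp =>
      obtain ⟨rfl, rfl⟩ := ih hp
      exact ⟨rfl, rfl⟩
  | loopDone hb =>
    cases h₂ with
    | loopDone => exact ⟨rfl, rfl⟩
    | loopStep hb' _ _ => exact absurd hb' hb
  | loopStep hb _ _ ih ih' =>
    cases h₂ with
    | loopDone hb' => exact absurd hb hb'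
    | loopStep _ hp hl =>
      obtain ⟨rfl, rfl⟩ := ih hp
      obtain ⟨rfl, rfl⟩ := ih' hl
      exact ⟨rfl, rfl⟩

/-! ## Weighted graphs, shortest path trees, path failures -/

variable {n : ℕ}

/-- The total weight of the edges of a walk. -/
noncomputable def wlen {G : SimpleGraph (Fin n)} (w : Sym2 (Fin n) → ℝ≥0) {x y : Fin n}
    (p : G.Walk x y) : ℝ≥0 :=
  (p.edges.map w).sum

/-- The weighted distance between two vertices (`⊤` if no path joins them). -/
noncomputable def wdist (G : SimpleGraph (Fin n)) (w : Sym2 (Fin n) → ℝ≥0) (x y : Fin n) :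
    ℝ≥0∞ :=
  ⨅ p : G.Walk x y, (wlen w p : ℝ≥0∞)

/-- The graph that consists of the edges between the vertices and their parents. -/
def parentTree (par : Fin n → Fin n) : SimpleGraph (Fin n) :=
  SimpleGraph.fromRel fun x y => par x = y

/-- `par` is the parent function of a shortest path tree of `G` rooted at `r`:
a spanning tree, all of whose distances from `r` agree with those of `G`. -/
structure IsSPT (G : SimpleGraph (Fin n)) (w : Sym2 (Fin n) → ℝ≥0) (r : Fin n)
    (par : Fin n → Fin n) : Prop where
  root : par r = r
  reaches_root : ∀ v, ∃ k, par^[k] v = r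
  le : parentTree par ≤ G
  dist_eq : ∀ v, wdist (parentTree par) w r v = wdist G w r v

/-- The number of edges of the tree path from the root to `v`. -/
noncomputable def level (r : Fin n) (par : Fin n → Fin n) (v : Fin n) : ℕ :=
  (parentTree par).dist r v

/-- `F` is a path failure with deepest endpoint `v`: it consists of the last `|F| ≥ 1` edges of the
tree path from the root `r` to `v`. -/
def IsPathFailure (r : Fin n) (par : Fin n → Fin n) (F : Finset (Sym2 (Fin n))) (v : Fin n) :
    Prop :=
  0 < F.card ∧ F.card ≤ level r par v ∧
    F = (Finset.range F.card).image fun i => s(par^[i] v, par^[i + 1] v)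

/-! ## Input and output of the algorithms -/

/-- `e` lists every edge of `G` exactly once. -/
def IsEdgeList {m : ℕ} (G : SimpleGraph (Fin n)) (e : Fin m → Fin n × Fin n) : Prop :=
  Set.BijOn (fun j => s((e j).1, (e j).2)) Set.univ G.edgeSet

/-- The initial state of the preprocessing. Word variables: `n`, `m`, `f`, `r`.
Word arrays: the parents of the vertices, the first and the second endpoints of the edges.
Real array: the weights of the edges. Everything else is zero. -/
noncomputable def inputState {m : ℕ} (f : ℕ) (w : Sym2 (Fin n) → ℝ≥0) (r : Fin n)
    (par : Fin n → Fin n) (e : Fin m → Fin n × Fin n) : State where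
  iv x := match x with
    | 0 => n
    | 1 => m
    | 2 => f
    | 3 => r
    | _ => 0
  ia a i := match a with
    | 0 => if h : i < n then par ⟨i, h⟩ else 0
    | 1 => if h : i < m then (e ⟨i, h⟩).1 else 0
    | 2 => if h : i < m then (e ⟨i, h⟩).2 else 0
    | _ => 0
  rv _ := 0
  ra a i := match a with
    | 0 => if h : i < m then w s((e ⟨i, h⟩).1, (e ⟨i, h⟩).2) else 0
    | _ => 0

/-- The two states agree on the first `L` cells of the first `K` word arrays and of the first
`K` real arrays: these `2 * K * L` cells are the ones that hold the oracle. -/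
def SameOracle (K L : ℕ) (s s' : State) : Prop :=
  ∀ a < K, ∀ i < L, s.ia a i = s'.ia a i ∧ s.ra a i = s'.ra a i

/-- `q` is a state in which a query is asked: the oracle is the one built in the state `σ`, the
first three word variables hold the query `(v, k, t)`, where `v` and `k` are the deepest endpoint
and the number of edges of the failure. All other variables and cells are arbitrary. -/
def IsQuery (K L : ℕ) (σ : State) (v : Fin n) (k : ℕ) (t : Fin n) (q : State) : Prop :=
  SameOracle K L σ q ∧ q.iv 0 = v ∧ q.iv 1 = k ∧ q.iv 2 = t

/-- Started in `q`, the program `p` halts in at most `N` steps, does not change the oracle, and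
the final state satisfies `P`. -/
def Answers (B K L : ℕ) (p : Cmd) (q : State) (N : ℕ) (P : State → Prop) : Prop :=
  ∃ (k : ℕ) (q' : State), Exec B p q k q' ∧ k ≤ N ∧ SameOracle K L q q' ∧ P q'

end PathOracle

open PathOracle

/-!
Let `d` be the distance from the root `r` in the shortest path tree `T`, which is also the distance in
`G`. The failure `F` of the last `k` edges of the path to `v` splits `T` into `k + 1` components, one of
which contains `r`. Give every edge `x y` outside of `T` the cost `d x + w(x, y) + d y`, and let a
minimum spanning tree of the graph of the components be rooted at the component of `r`, where missing
edges are added with infinite cost. The detour to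
`t` enters the components on the tree path from the root to that of `t` by the edges of this spanning
tree, and runs within `T` otherwise; if `t` is not cut off, it is a simple path in `G - F`, because no
component is entered twice (`Inst.exists_route`).

*Stretch.* Let a walk of length `ω` lead from `r` to `t` in `G - F`. An edge `x y` of it that joins two
components satisfies `d x ≤ ω - w(x, y)` and `d y ≤ ω`, so that its cost is at most `2 ω`. By the cycle
property of minimum spanning trees the tree path to the component of `t` has no edge that costs more
(`Inst.chain_of_adj`). As `d` counts the tree paths to and from the root, the detour is at most as long
as the tree path to `t` together with one closed walk through the root for each of the at most `k`
edges. Its length is at most `ω + k * 2 ω` (`Inst.ask_le_of_chain`).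

*Oracle.* For a failure `(v, k)` and every component other than that of the root, the oracle holds the
ends `x`, `y` of the edge by which it is entered and the number of edges and the length of the detour
up to `y`: these are `O(n f²)` cells. The component of `t` is determined by the depth of the lowest
common ancestor of `v` and `t`, and so are the number of edges and the length of the tree path from `y`
to `t`. Lowest common ancestors are range minima in a preorder numbering (`Inst.LcaOk.at_eq_lc`), and
they take constant time by the tables `Rmq`, in which the range is divided into blocks of logarithmic
length; minima within a block are found by bit masks. So the distance query takes constant time, and
the path query, which goes from `t` backwards and enters every component by an edge of the detour,
takes time proportional to the number of edges (`Inst.runs_cParts`).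

*Preprocessing.* For a fixed `v`, let `h` be the length of the longest failure. A matrix of the cheapest
edges between the components after this failure is built in `O(m + h²)` steps, and Prim's algorithm
on it takes `O(h²)` steps (`Prim.step`). The failures are treated in the order of decreasing length:
shortening the failure by one edge identifies a vertex of the component graph with the root, and the
minimum spanning tree is updated in `O(h)` steps, by deleting a most expensive edge of the tree path
from this vertex to the root and reversing the path before that edge (`Span.contract`). The tree and its
tables take `O(n²)` steps, and `n ≤ m + 1`.

Minimum spanning trees are described by the cycle property in the form of `Span.closed`, which is
preserved by contraction and implies the bound on the cost of the tree paths; no total weight is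
minimized. Programs are verified by Hoare triples with time bounds (`Runs`); what a program does not
assign to is inferred from its text (`Frame`), and for loop-free programs (`Fn`) so is the time bound.
-/

namespace PathOracle

/-! ### A program logic with time bounds -/

/-- Does the program contain an assignment to the word variable `x`? -/
def Cmd.wv (x : ℕ) : Cmd → Bool
  | .setN y _ => x == y
  | .seq p q => p.wv x || q.wv x
  | .branch _ p q => p.wv x || q.wv x
  | .loop _ p => p.wv x
  | _ => false

/-- Does the program contain an assignment to a cell of the word array `a`? -/
def Cmd.wa (a : ℕ) : Cmd → Bool
  | .putN b _ _ => a == b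
  | .seq p q => p.wa a || q.wa a
  | .branch _ p q => p.wa a || q.wa a
  | .loop _ p => p.wa a
  | _ => false

/-- Does the program contain an assignment to the real variable `x`? -/
def Cmd.wr (x : ℕ) : Cmd → Bool
  | .setR y _ => x == y
  | .seq p q => p.wr x || q.wr x
  | .branch _ p q => p.wr x || q.wr x
  | .loop _ p => p.wr x
  | _ => false

/-- Does the program contain an assignment to a cell of the real array `a`? -/
def Cmd.wb (a : ℕ) : Cmd → Bool
  | .putR b _ _ => a == b
  | .seq p q => p.wb a || q.wb a
  | .branch _ p q => p.wb a || q.wb a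
  | .loop _ p => p.wb a
  | _ => false

/-- The variables and arrays to which `p` contains no assignment are the same in `s` and `s'`. -/
structure Frame (p : Cmd) (s s' : State) : Prop where
  iv : ∀ x, p.wv x = false → s'.iv x = s.iv x
  ia : ∀ a, p.wa a = false → s'.ia a = s.ia a
  rv : ∀ x, p.wr x = false → s'.rv x = s.rv x
  ra : ∀ a, p.wb a = false → s'.ra a = s.ra a

theorem Frame.refl (p : Cmd) (s : State) : Frame p s s :=
  ⟨fun _ _ => rfl, fun _ _ => rfl, fun _ _ => rfl, fun _ _ => rfl⟩

theorem Frame.trans {p : Cmd} {s s' s'' : State} (h : Frame p s s') (h' : Frame p s' s'') :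
    Frame p s s'' :=
  ⟨fun x hx => (h'.iv x hx).trans (h.iv x hx), fun x hx => (h'.ia x hx).trans (h.ia x hx),
    fun x hx => (h'.rv x hx).trans (h.rv x hx), fun x hx => (h'.ra x hx).trans (h.ra x hx)⟩

/-- `q` assigns at least to what `p` assigns. -/
theorem Frame.mono {p q : Cmd} {s s' : State} (h : Frame p s s')
    (hv : ∀ x, q.wv x = false → p.wv x = false) (ha : ∀ x, q.wa x = false → p.wa x = false)
    (hr : ∀ x, q.wr x = false → p.wr x = false) (hb : ∀ x, q.wb x = false → p.wb x = false) :
    Frame q s s' :=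
  ⟨fun x hx => h.iv x (hv x hx), fun x hx => h.ia x (ha x hx),
    fun x hx => h.rv x (hr x hx), fun x hx => h.ra x (hb x hx)⟩

theorem Frame.loop {b : Test} {p : Cmd} {s s' : State} (h : Frame p s s') :
    Frame (.loop b p) s s' :=
  h.mono (fun _ h => h) (fun _ h => h) (fun _ h => h) (fun _ h => h)

theorem Frame.seq_left {p : Cmd} (q : Cmd) {s s' : State} (h : Frame p s s') :
    Frame (.seq p q) s s' := by
  refine h.mono ?_ ?_ ?_ ?_ <;> intro x hx <;> simp_all [Cmd.wv, Cmd.wa, Cmd.wr, Cmd.wb]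

theorem Frame.seq_right (p : Cmd) {q : Cmd} {s s' : State} (h : Frame q s s') :
    Frame (.seq p q) s s' := by
  refine h.mono ?_ ?_ ?_ ?_ <;> intro x hx <;> simp_all [Cmd.wv, Cmd.wa, Cmd.wr, Cmd.wb]

theorem Frame.branch_left {b : Test} {p : Cmd} (q : Cmd) {s s' : State} (h : Frame p s s') :
    Frame (.branch b p q) s s' := by
  refine h.mono ?_ ?_ ?_ ?_ <;> intro x hx <;> simp_all [Cmd.wv, Cmd.wa, Cmd.wr, Cmd.wb]

theorem Frame.branch_right {b : Test} (p : Cmd) {q : Cmd} {s s' : State} (h : Frame q s s') :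
    Frame (.branch b p q) s s' := by
  refine h.mono ?_ ?_ ?_ ?_ <;> intro x hx <;> simp_all [Cmd.wv, Cmd.wa, Cmd.wr, Cmd.wb]

/-- The frame rule: what a program leaves alone is read off from its text. -/
theorem Exec.frame {B : ℕ} {p : Cmd} {s s' : State} {k : ℕ} (h : Exec B p s k s') :
    Frame p s s' := by
  induction h with
  | nop => exact Frame.refl _ _
  | setN s x e =>
    refine ⟨fun y hy => ?_, fun _ _ => rfl, fun _ _ => rfl, fun _ _ => rfl⟩
    exact Function.update_of_ne (by simpa [Cmd.wv] using hy) _ _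
  | setR s x e =>
    refine ⟨fun _ _ => rfl, fun _ _ => rfl, fun y hy => ?_, fun _ _ => rfl⟩
    exact Function.update_of_ne (by simpa [Cmd.wr] using hy) _ _
  | putN s a i e =>
    refine ⟨fun _ _ => rfl, fun y hy => ?_, fun _ _ => rfl, fun _ _ => rfl⟩
    exact Function.update_of_ne (by simpa [Cmd.wa] using hy) _ _
  | putR s a i e =>
    refine ⟨fun _ _ => rfl, fun _ _ => rfl, fun _ _ => rfl, fun y hy => ?_⟩
    exact Function.update_of_ne (by simpa [Cmd.wb] using hy) _ _
  | seq _ _ ih ih' => exact (ih.seq_left _).trans (ih'.seq_right _)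
  | branchTrue _ _ ih => exact ih.branch_left _
  | branchFalse _ _ ih => exact ih.branch_right _
  | loopDone => exact Frame.refl _ _
  | loopStep _ _ _ ih ih' => exact ih.loop.trans ih'

/-- Started in `s`, the program `p` halts within `N` steps in a state that satisfies `Q`. -/
def Runs (B : ℕ) (p : Cmd) (s : State) (N : ℕ) (Q : State → Prop) : Prop :=
  ∃ k s', Exec B p s k s' ∧ k ≤ N ∧ Q s'

/-- Started in `s`, the program `p` halts in a state that satisfies `Q`. -/
def Fn (B : ℕ) (p : Cmd) (s : State) (Q : State → Prop) : Prop :=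
  ∃ k s', Exec B p s k s' ∧ Q s'

theorem Runs.mono {B : ℕ} {p : Cmd} {s : State} {N N' : ℕ} {Q Q' : State → Prop}
    (h : Runs B p s N Q) (hN : N ≤ N') (hQ : ∀ s', Frame p s s' → Q s' → Q' s') :
    Runs B p s N' Q' := by
  obtain ⟨k, s', he, hk, hq⟩ := h
  exact ⟨k, s', he, hk.trans hN, hQ s' he.frame hq⟩

theorem Runs.seq {B : ℕ} {p q : Cmd} {s : State} {N₁ N₂ N : ℕ} {Q R : State → Prop}
    (h : Runs B p s N₁ R) (h' : ∀ s', Frame p s s' → R s' → Runs B q s' N₂ Q)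
    (hN : N₁ + N₂ ≤ N) : Runs B (.seq p q) s N Q := by
  obtain ⟨k, s', he, hk, hr⟩ := h
  obtain ⟨l, s'', he', hl, hq⟩ := h' s' he.frame hr
  exact ⟨_, _, he.seq he', by omega, hq⟩

theorem Fn.mono {B : ℕ} {p : Cmd} {s : State} {Q Q' : State → Prop}
    (h : Fn B p s Q) (hQ : ∀ s', Frame p s s' → Q s' → Q' s') : Fn B p s Q' := by
  obtain ⟨k, s', he, hq⟩ := h
  exact ⟨k, s', he, hQ s' he.frame hq⟩

/-- Worst case number of steps of a program without loops. -/
def Cmd.time : Cmd → ℕ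
  | .nop => 1
  | .setN _ e => e.cost + 1
  | .setR _ e => e.cost + 1
  | .putN _ i e => i.cost + e.cost + 1
  | .putR _ i e => i.cost + e.cost + 1
  | .seq p q => p.time + q.time
  | .branch b p q => b.cost + max p.time q.time + 1
  | .loop _ _ => 0

/-- Does the program contain no loop? -/
def Cmd.loopFree : Cmd → Bool
  | .seq p q => p.loopFree && q.loopFree
  | .branch _ p q => p.loopFree && q.loopFree
  | .loop _ _ => false
  | _ => true

/-- Without loops the number of steps is bounded by a constant that is computed from the text of the
program. -/
theorem Exec.le_time {B : ℕ} {p : Cmd} {s s' : State} {k : ℕ} (h : Exec B p s k s')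
    (hp : p.loopFree = true) : k ≤ p.time := by
  induction h with
  | nop | setN | setR | putN | putR => exact le_rfl
  | seq _ _ ih ih' =>
    simp only [Cmd.loopFree, Bool.and_eq_true] at hp
    exact Nat.add_le_add (ih hp.1) (ih' hp.2)
  | branchTrue _ _ ih =>
    simp only [Cmd.loopFree, Bool.and_eq_true] at hp
    have := ih hp.1
    simp only [Cmd.time]; omega
  | branchFalse _ _ ih =>
    simp only [Cmd.loopFree, Bool.and_eq_true] at hp
    have := ih hp.2
    simp only [Cmd.time]; omega
  | loopDone | loopStep => simp [Cmd.loopFree] at hp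

theorem Fn.runs {B : ℕ} {p : Cmd} {s : State} {N : ℕ} {Q : State → Prop} (h : Fn B p s Q)
    (hp : p.loopFree = true) (hN : p.time ≤ N) : Runs B p s N Q := by
  obtain ⟨k, s', he, hq⟩ := h
  exact ⟨k, s', he, (he.le_time hp).trans hN, hq⟩

theorem fn_nop {B : ℕ} {s : State} {Q : State → Prop} : Fn B .nop s Q ↔ Q s :=
  ⟨fun ⟨_, _, he, hq⟩ => by cases he; exact hq, fun h => ⟨_, _, .nop s, h⟩⟩

theorem fn_setN {B x : ℕ} {e : NExpr} {s : State} {Q : State → Prop} :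
    Fn B (.setN x e) s Q ↔ e.eval s ≤ B ∧ Q (s.setN x (e.eval s)) :=
  ⟨fun ⟨_, _, he, hq⟩ => by cases he; exact ⟨‹_›, hq⟩, fun h => ⟨_, _, .setN s x e h.1, h.2⟩⟩

theorem fn_setR {B x : ℕ} {e : RExpr} {s : State} {Q : State → Prop} :
    Fn B (.setR x e) s Q ↔ Q (s.setR x (e.eval s)) :=
  ⟨fun ⟨_, _, he, hq⟩ => by cases he; exact hq, fun h => ⟨_, _, .setR s x e, h⟩⟩

theorem fn_putN {B a : ℕ} {i e : NExpr} {s : State} {Q : State → Prop} :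
    Fn B (.putN a i e) s Q ↔
      i.eval s ≤ B ∧ e.eval s ≤ B ∧ Q (s.putN a (i.eval s) (e.eval s)) :=
  ⟨fun ⟨_, _, he, hq⟩ => by cases he; exact ⟨‹_›, ‹_›, hq⟩,
    fun h => ⟨_, _, .putN s a i e h.1 h.2.1, h.2.2⟩⟩

theorem fn_putR {B a : ℕ} {i : NExpr} {e : RExpr} {s : State} {Q : State → Prop} :
    Fn B (.putR a i e) s Q ↔ i.eval s ≤ B ∧ Q (s.putR a (i.eval s) (e.eval s)) :=
  ⟨fun ⟨_, _, he, hq⟩ => by cases he; exact ⟨‹_›, hq⟩,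
    fun h => ⟨_, _, .putR s a i e h.1, h.2⟩⟩

theorem fn_seq {B : ℕ} {p q : Cmd} {s : State} {Q : State → Prop} :
    Fn B (.seq p q) s Q ↔ Fn B p s (fun s' => Fn B q s' Q) :=
  ⟨fun ⟨_, _, he, hq⟩ => by cases he with | seq h h' => exact ⟨_, _, h, _, _, h', hq⟩,
    fun ⟨_, _, h, _, _, h', hq⟩ => ⟨_, _, h.seq h', hq⟩⟩

theorem fn_branch {B : ℕ} {b : Test} {p q : Cmd} {s : State} {Q : State → Prop} :
    Fn B (.branch b p q) s Q ↔ (b.Holds s → Fn B p s Q) ∧ (¬ b.Holds s → Fn B q s Q) := by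
  constructor
  · rintro ⟨_, _, he, hq⟩
    cases he with
    | branchTrue hb hp => exact ⟨fun _ => ⟨_, _, hp, hq⟩, fun h => absurd hb h⟩
    | branchFalse hb hp => exact ⟨fun h => absurd h hb, fun _ => ⟨_, _, hp, hq⟩⟩
  · rintro ⟨h, h'⟩
    by_cases hb : b.Holds s
    · obtain ⟨_, _, hp, hq⟩ := h hb
      exact ⟨_, _, .branchTrue hb hp, hq⟩
    · obtain ⟨_, _, hp, hq⟩ := h' hb
      exact ⟨_, _, .branchFalse hb hp, hq⟩

theorem Runs.branch {B : ℕ} {b : Test} {p q : Cmd} {s : State} {N N' : ℕ} {Q : State → Prop}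
    (h : b.Holds s → Runs B p s N Q) (h' : ¬ b.Holds s → Runs B q s N Q)
    (hN : b.cost + N + 1 ≤ N') : Runs B (.branch b p q) s N' Q := by
  by_cases hb : b.Holds s
  · obtain ⟨_, _, hp, hk, hq⟩ := h hb
    exact ⟨_, _, .branchTrue hb hp, by omega, hq⟩
  · obtain ⟨_, _, hp, hk, hq⟩ := h' hb
    exact ⟨_, _, .branchFalse hb hp, by omega, hq⟩

/-- A loop with invariant `I` and variant `μ`; the invariant may be combined with the fact that
nothing changes outside the write set of the body. -/
theorem Runs.while {B c : ℕ} {b : Test} {p : Cmd} {s₀ : State} {I : State → Prop} (μ : State → ℕ)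
    (h₀ : I s₀)
    (step : ∀ s, Frame p s₀ s → I s → b.Holds s →
      Runs B p s c (fun s' => I s' ∧ μ s' < μ s)) :
    Runs B (.loop b p) s₀ (μ s₀ * (c + b.cost + 1) + b.cost + 1)
      (fun s' => I s' ∧ ¬ b.Holds s') := by
  suffices h : ∀ k s, μ s = k → Frame p s₀ s → I s →
      Runs B (.loop b p) s (k * (c + b.cost + 1) + b.cost + 1) (fun s' => I s' ∧ ¬ b.Holds s') from
    h _ s₀ rfl (Frame.refl _ _) h₀
  intro k
  induction k using Nat.strong_induction_on with
  | _ k ih =>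
    intro s hk hf hI
    by_cases hb : b.Holds s
    · obtain ⟨l, s', he, hl, hI', hμ⟩ := step s hf hI hb
      obtain ⟨l', s'', he', hl', hQ⟩ := ih _ (hk ▸ hμ) s' rfl (hf.trans he.frame) hI'
      refine ⟨_, _, .loopStep hb he he', ?_, hQ⟩
      have : (μ s' + 1) * (c + b.cost + 1) ≤ k * (c + b.cost + 1) :=
        Nat.mul_le_mul_right _ (by omega)
      rw [Nat.add_mul] at this
      omega
    · exact ⟨_, _, .loopDone hb, by omega, hI, hb⟩

instance : Add NExpr := ⟨NExpr.add⟩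
instance : Sub NExpr := ⟨NExpr.sub⟩
instance : Mul NExpr := ⟨NExpr.mul⟩
instance : Div NExpr := ⟨NExpr.div⟩
instance : Add RExpr := ⟨RExpr.add⟩
instance : Sub RExpr := ⟨RExpr.sub⟩
/-- A numeral is a constant of the program, never the name of a variable. -/
instance (k : ℕ) : OfNat NExpr k := ⟨.lit k⟩

/-- The test `d < e`. -/
def Test.lt (d e : NExpr) : Test := .neg (.nle e d)

/-- The test `d = e`. -/
def Test.eq (d e : NExpr) : Test := .conj (.nle d e) (.nle e d)

/-- `p ;; q` runs `p`, then `q`. -/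
infixr:60 " ;; " => Cmd.seq

/-- `for i in 0, …, x - 1 do p`, where `x` is a word variable. -/
def Cmd.forUp (i x : ℕ) (p : Cmd) : Cmd :=
  .setN i 0 ;; .loop (.lt (.var i) (.var x)) (p ;; .setN i (.var i + 1))

section Eval
variable (s : State)

@[simp] theorem eval_lit (k : ℕ) : (NExpr.lit k).eval s = k := rfl
@[simp] theorem eval_ofNat (k : ℕ) :
    (no_index (OfNat.ofNat k) : NExpr).eval s = (OfNat.ofNat k : ℕ) := rfl
@[simp] theorem eval_var (x : ℕ) : (NExpr.var x).eval s = s.iv x := rfl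
@[simp] theorem eval_get (a : ℕ) (i : NExpr) : (NExpr.get a i).eval s = s.ia a (i.eval s) := rfl
@[simp] theorem eval_add (d e : NExpr) : (d + e).eval s = d.eval s + e.eval s := rfl
@[simp] theorem eval_sub (d e : NExpr) : (d - e).eval s = d.eval s - e.eval s := rfl
@[simp] theorem eval_mul (d e : NExpr) : (d * e).eval s = d.eval s * e.eval s := rfl
@[simp] theorem eval_div (d e : NExpr) : (d / e).eval s = d.eval s / e.eval s := rfl
@[simp] theorem reval_zero : RExpr.zero.eval s = 0 := rfl
@[simp] theorem reval_var (x : ℕ) : (RExpr.var x).eval s = s.rv x := rfl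
@[simp] theorem reval_get (a : ℕ) (i : NExpr) : (RExpr.get a i).eval s = s.ra a (i.eval s) := rfl
@[simp] theorem reval_add (d e : RExpr) : (d + e).eval s = d.eval s + e.eval s := rfl
@[simp] theorem reval_sub (d e : RExpr) : (d - e).eval s = d.eval s - e.eval s := rfl
@[simp] theorem holds_nle (d e : NExpr) : (Test.nle d e).Holds s ↔ d.eval s ≤ e.eval s := Iff.rfl
@[simp] theorem holds_rle (d e : RExpr) : (Test.rle d e).Holds s ↔ d.eval s ≤ e.eval s := Iff.rfl
@[simp] theorem holds_neg (b : Test) : (Test.neg b).Holds s ↔ ¬ b.Holds s := Iff.rfl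
@[simp] theorem holds_conj (b c : Test) :
    (Test.conj b c).Holds s ↔ b.Holds s ∧ c.Holds s := Iff.rfl
@[simp] theorem holds_lt (d e : NExpr) : (Test.lt d e).Holds s ↔ d.eval s < e.eval s := by
  simp [Test.lt]
@[simp] theorem holds_eq (d e : NExpr) : (Test.eq d e).Holds s ↔ d.eval s = e.eval s := by
  simp [Test.eq, le_antisymm_iff]

variable (x y k a b i j : ℕ) (z : ℝ)
@[simp] theorem setN_iv_self : (s.setN x k).iv x = k := by simp [State.setN]
@[simp] theorem setN_iv_ne (h : y ≠ x) : (s.setN x k).iv y = s.iv y := by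
  simp [State.setN, Function.update_of_ne h]
@[simp] theorem setN_ia : (s.setN x k).ia = s.ia := rfl
@[simp] theorem setN_rv : (s.setN x k).rv = s.rv := rfl
@[simp] theorem setN_ra : (s.setN x k).ra = s.ra := rfl
@[simp] theorem setR_rv_self : (s.setR x z).rv x = z := by simp [State.setR]
@[simp] theorem setR_ia : (s.setR x z).ia = s.ia := rfl
@[simp] theorem setR_iv : (s.setR x z).iv = s.iv := rfl
@[simp] theorem setR_ra : (s.setR x z).ra = s.ra := rfl
@[simp] theorem putN_iv : (s.putN a i k).iv = s.iv := rfl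
@[simp] theorem putN_rv : (s.putN a i k).rv = s.rv := rfl
@[simp] theorem putN_ra : (s.putN a i k).ra = s.ra := rfl
@[simp] theorem putN_ia_self : (s.putN a i k).ia a = Function.update (s.ia a) i k := by
  simp [State.putN]
@[simp] theorem putN_ia_ne (h : b ≠ a) : (s.putN a i k).ia b = s.ia b := by
  simp [State.putN, Function.update_of_ne h]
@[simp] theorem putR_iv : (s.putR a i z).iv = s.iv := rfl
@[simp] theorem putR_rv : (s.putR a i z).rv = s.rv := rfl
@[simp] theorem putR_ia : (s.putR a i z).ia = s.ia := rfl
@[simp] theorem putR_ra_self : (s.putR a i z).ra a = Function.update (s.ra a) i z := by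
  simp [State.putR]
@[simp] theorem putR_ra_ne (h : b ≠ a) : (s.putR a i z).ra b = s.ra b := by
  simp [State.putR, Function.update_of_ne h]
end Eval

/-- A counting loop with invariant `I`, where the round `j` takes at most `c` steps. -/
theorem Runs.forUp {B c i x N : ℕ} {p : Cmd} {s₀ : State} (I : ℕ → State → Prop)
    (hN : s₀.iv x = N) (hB : N ≤ B)
    (hx : (Cmd.forUp i x p).wv x = false) (hi : p.wv i = false)
    (h₀ : I 0 (s₀.setN i 0))
    (step : ∀ j s, j < N → Frame (Cmd.forUp i x p) s₀ s → s.iv i = j → I j s →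
      Runs B p s c (fun s' => I (j + 1) (s'.setN i (j + 1)))) :
    Runs B (Cmd.forUp i x p) s₀ (N * (c + 9) + 9) (fun s' => I N s') := by
  have hix : x ≠ i := by
    simp only [Cmd.forUp, Cmd.wv, Bool.or_eq_false_iff] at hx
    simpa using hx.1
  have hfr : ∀ s s', Frame (p ;; .setN i (.var i + 1)) s s' → Frame (Cmd.forUp i x p) s s' :=
    fun s s' h => Frame.seq_right _ h.loop
  have h1 : Runs B (.setN i 0) s₀ 2 (fun s => s = s₀.setN i 0) :=
    (fn_setN.2 ⟨Nat.zero_le _, by simp⟩ : Fn B (.setN i 0) s₀ _).runs rfl le_rfl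
  refine h1.seq (N₂ := N * (c + 9) + 5) ?_ (by omega)
  rintro s hf rfl
  have h2 := Runs.while (B := B) (c := c + 4) (b := .lt (.var i) (.var x))
    (p := p ;; .setN i (.var i + 1)) (s₀ := s₀.setN i 0)
    (I := fun s => ∃ j ≤ N, s.iv i = j ∧ I j s) (fun s => N - s.iv i)
    ⟨0, Nat.zero_le _, by simp, h₀⟩ ?_
  · refine h2.mono (by simp [Test.lt, Test.cost, NExpr.cost]) ?_
    rintro s hf' ⟨⟨j, hj, hij, hI⟩, hb⟩
    have hsx : s.iv x = N := by
      rw [(hf.seq_left _ |>.trans (hfr _ _ ?_) : Frame (Cmd.forUp i x p) s₀ s).iv x hx, hN]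
      exact ⟨fun y hy => hf'.iv y hy, fun y hy => hf'.ia y hy, fun y hy => hf'.rv y hy,
        fun y hy => hf'.ra y hy⟩
    simp only [holds_lt, eval_var, hij, hsx] at hb
    obtain rfl : j = N := by omega
    exact hI
  · rintro s hf' ⟨j, hj, hij, hI⟩ hb
    have hF : Frame (Cmd.forUp i x p) s₀ s := (hf.seq_left _).trans (hfr _ _ hf')
    have hsx : s.iv x = N := by rw [hF.iv x hx, hN]
    simp only [holds_lt, eval_var, hij, hsx] at hb
    refine (step j s hb hF hij hI).seq (N₂ := 4) ?_ le_rfl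
    intro s' hf'' hI'
    have hi' : s'.iv i = j := by rw [hf''.iv i hi, hij]
    refine Fn.runs (fn_setN.2 ?_) rfl le_rfl
    simp only [eval_add, eval_var, eval_ofNat, hi', setN_iv_self]
    exact ⟨by omega, ⟨j + 1, by omega, rfl, hI'⟩, by omega⟩

/-! ### Rooted trees given by a parent function -/

/-- `par` is the parent function of a tree with root `r` (the root is its own parent). -/
structure IsTree (r : ℕ) (par : ℕ → ℕ) : Prop where
  root : par r = r
  reach : ∀ v, ∃ k, par^[k] v = r

/-- The depth of a vertex. -/
noncomputable def dep (r : ℕ) (par : ℕ → ℕ) (v : ℕ) : ℕ := sInf {k | par^[k] v = r}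

/-- `a` is an ancestor of `v` (or `v` itself). -/
def Anc (par : ℕ → ℕ) (a v : ℕ) : Prop := ∃ k, par^[k] v = a

/-- The number of steps from `u` up to the lowest common ancestor of `u` and `v`. -/
noncomputable def idx (par : ℕ → ℕ) (u v : ℕ) : ℕ := sInf {k | Anc par (par^[k] u) v}

/-- The lowest common ancestor. -/
noncomputable def lca (par : ℕ → ℕ) (u v : ℕ) : ℕ := par^[idx par u v] u

/-- The length of the tree path from the root to `v`, for the edge lengths `W`. -/
noncomputable def tdist (r : ℕ) (par : ℕ → ℕ) (W : ℕ → ℕ → ℝ) (v : ℕ) : ℝ :=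
  ∑ i ∈ Finset.range (dep r par v), W (par^[i] v) (par^[i + 1] v)

theorem Anc.refl (par : ℕ → ℕ) (v : ℕ) : Anc par v v := ⟨0, rfl⟩

theorem Anc.trans {par : ℕ → ℕ} {a b c : ℕ} (h : Anc par a b) (h' : Anc par b c) :
    Anc par a c := by
  obtain ⟨k, rfl⟩ := h
  obtain ⟨l, rfl⟩ := h'
  exact ⟨k + l, Function.iterate_add_apply _ _ _ _⟩

theorem anc_iterate (par : ℕ → ℕ) (k v : ℕ) : Anc par (par^[k] v) v := ⟨k, rfl⟩

theorem anc_par (par : ℕ → ℕ) (v : ℕ) : Anc par (par v) v := ⟨1, rfl⟩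

theorem Anc.par_of_ne {par : ℕ → ℕ} {a v : ℕ} (h : Anc par a v) (hne : a ≠ v) :
    Anc par a (par v) := by
  obtain ⟨k, rfl⟩ := h
  cases k with
  | zero => exact absurd rfl hne
  | succ k => exact ⟨k, rfl⟩

namespace IsTree

variable {r : ℕ} {par : ℕ → ℕ} (T : IsTree r par)
include T

theorem iterate_root (k : ℕ) : par^[k] r = r := Function.iterate_fixed T.root k

theorem iterate_dep (v : ℕ) : par^[dep r par v] v = r := Nat.sInf_mem (T.reach v)

omit T in
theorem dep_le {k v : ℕ} (h : par^[k] v = r) : dep r par v ≤ k := Nat.sInf_le h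

theorem iterate_of_dep_le {k v : ℕ} (h : dep r par v ≤ k) : par^[k] v = r := by
  obtain ⟨j, rfl⟩ := Nat.exists_eq_add_of_le' h
  rw [Function.iterate_add_apply, T.iterate_dep, T.iterate_root]

theorem dep_le_iff {k v : ℕ} : dep r par v ≤ k ↔ par^[k] v = r :=
  ⟨T.iterate_of_dep_le, dep_le⟩

omit T in
theorem dep_root : dep r par r = 0 := Nat.le_zero.1 (dep_le rfl)

theorem dep_eq_zero {v : ℕ} : dep r par v = 0 ↔ v = r := by
  rw [← Nat.le_zero, T.dep_le_iff]; rfl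

theorem dep_iterate (k v : ℕ) : dep r par (par^[k] v) = dep r par v - k := by
  refine eq_of_forall_ge_iff fun j => ?_
  rw [T.dep_le_iff, Nat.sub_le_iff_le_add, T.dep_le_iff, Function.iterate_add_apply]

theorem dep_par (v : ℕ) : dep r par (par v) = dep r par v - 1 := T.dep_iterate 1 v

theorem dep_eq_succ {v : ℕ} (h : v ≠ r) : dep r par v = dep r par (par v) + 1 := by
  have := mt T.dep_eq_zero.1 h
  rw [T.dep_par]; omega

theorem anc_root (v : ℕ) : Anc par r v := ⟨_, T.iterate_dep v⟩

theorem dep_le_of_anc {a v : ℕ} (h : Anc par a v) : dep r par a ≤ dep r par v := by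
  obtain ⟨k, rfl⟩ := h
  rw [T.dep_iterate]; omega

theorem iterate_of_anc {a v : ℕ} (h : Anc par a v) :
    par^[dep r par v - dep r par a] v = a := by
  obtain ⟨k, rfl⟩ := h
  rw [T.dep_iterate]
  rcases le_total k (dep r par v) with hk | hk
  · congr 2; omega
  · rw [T.iterate_of_dep_le hk, T.iterate_of_dep_le (by omega)]

theorem anc_eq {a v : ℕ} (h : Anc par a v) (hd : dep r par v ≤ dep r par a) : a = v := by
  have := T.iterate_of_anc h
  rw [Nat.sub_eq_zero_of_le hd] at this
  exact this.symm

theorem anc_antisymm {a b : ℕ} (h : Anc par a b) (h' : Anc par b a) : a = b :=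
  T.anc_eq h (T.dep_le_of_anc h')

theorem iterate_inj {i j v : ℕ} (hi : i ≤ dep r par v) (hj : j ≤ dep r par v)
    (h : par^[i] v = par^[j] v) : i = j := by
  have := congrArg (dep r par) h
  rw [T.dep_iterate, T.dep_iterate] at this
  omega

theorem par_ne {v : ℕ} (h : v ≠ r) : par v ≠ v := fun h' => by
  have := T.dep_eq_succ h
  rw [h'] at this
  omega

theorem lca_anc_right (u v : ℕ) : Anc par (lca par u v) v :=
  Nat.sInf_mem (s := {k | Anc par (par^[k] u) v})
    ⟨dep r par u, by rw [Set.mem_ofPred_eq, T.iterate_dep]; exact T.anc_root v⟩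

omit T in
theorem lca_anc_left (u v : ℕ) : Anc par (lca par u v) u := anc_iterate _ _ _

omit T in
theorem idx_le {k u v : ℕ} (h : Anc par (par^[k] u) v) : idx par u v ≤ k := Nat.sInf_le h

omit T in
theorem anc_lca {c u v : ℕ} (hu : Anc par c u) (hv : Anc par c v) :
    Anc par c (lca par u v) := by
  obtain ⟨j, rfl⟩ := hu
  refine ⟨j - idx par u v, ?_⟩
  rw [lca, ← Function.iterate_add_apply, Nat.sub_add_cancel (idx_le hv)]

theorem eq_lca {l u v : ℕ} (hu : Anc par l u) (hv : Anc par l v)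
    (h : ∀ c, Anc par c u → Anc par c v → Anc par c l) : l = lca par u v :=
  T.anc_antisymm (anc_lca hu hv) (h _ (lca_anc_left u v) (T.lca_anc_right u v))

theorem lca_comm (u v : ℕ) : lca par u v = lca par v u :=
  T.eq_lca (T.lca_anc_right _ _) (lca_anc_left _ _) fun _ h h' => anc_lca h' h

theorem lca_self (u : ℕ) : lca par u u = u :=
  (T.eq_lca (Anc.refl _ _) (Anc.refl _ _) fun _ h _ => h).symm

theorem idx_le_dep (u v : ℕ) : idx par u v ≤ dep r par u :=
  idx_le (by rw [T.iterate_dep]; exact T.anc_root v)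

theorem idx_eq (u v : ℕ) : idx par u v = dep r par u - dep r par (lca par u v) := by
  have := T.idx_le_dep u v
  rw [lca, T.dep_iterate]; omega

theorem idx_mono {a t : ℕ} (v : ℕ) (h : Anc par a t) : idx par v t ≤ idx par v a :=
  idx_le ((T.lca_anc_right v a).trans h)

theorem idx_root (v : ℕ) : idx par v r = dep r par v := by
  refine le_antisymm (T.idx_le_dep _ _) (dep_le ?_)
  exact T.anc_antisymm (T.lca_anc_right v r) (T.anc_root _)

theorem idx_iterate {i v : ℕ} (h : i ≤ dep r par v) : idx par v (par^[i] v) = i := by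
  refine le_antisymm (idx_le (Anc.refl _ _)) ?_
  have := T.dep_le_of_anc (T.lca_anc_right v (par^[i] v))
  rw [lca, T.dep_iterate, T.dep_iterate] at this
  have := T.idx_le_dep v (par^[i] v)
  omega

theorem eq_of_idx_par_ne {v t : ℕ} (h : idx par v (par t) ≠ idx par v t) :
    t = par^[idx par v t] v := by
  by_contra hne
  have h1 : Anc par (par^[idx par v t] v) (par t) :=
    (T.lca_anc_right v t).par_of_ne fun h => hne h.symm
  exact h (le_antisymm (idx_le h1) (T.idx_mono v (anc_par par t)))

/-- Every vertex between a vertex `a` and `lca a b` is in the same component as `a` and `b`, if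
these are in the same component. -/
theorem idx_of_between {v a b c : ℕ} (hab : idx par v a = idx par v b) (hca : Anc par c a)
    (hc : Anc par (lca par a b) c) : idx par v c = idx par v a := by
  refine le_antisymm ?_ (T.idx_mono v hca)
  have h1 : Anc par (par^[idx par v a] v) (lca par a b) :=
    anc_lca (T.lca_anc_right v a) (hab ▸ T.lca_anc_right v b)
  exact idx_le (h1.trans hc)

variable (W : ℕ → ℕ → ℝ)

omit T in
theorem tdist_root : tdist r par W r = 0 := by simp [tdist, dep_root]

theorem tdist_eq {v : ℕ} (h : v ≠ r) :
    tdist r par W v = tdist r par W (par v) + W v (par v) := by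
  rw [tdist, T.dep_eq_succ h, Finset.sum_range_succ', tdist]
  simp

theorem tdist_sub {a v : ℕ} (h : Anc par a v) :
    ∑ i ∈ Finset.range (dep r par v - dep r par a), W (par^[i] v) (par^[i + 1] v)
      = tdist r par W v - tdist r par W a := by
  have hd := T.dep_le_of_anc h
  have he : ∀ j, par^[j + (dep r par v - dep r par a)] v = par^[j] a := fun j => by
    rw [Function.iterate_add_apply, T.iterate_of_anc h]
  have h1 := Finset.sum_range_add (fun i => W (par^[i] v) (par^[i + 1] v))
    (dep r par v - dep r par a) (dep r par a)
  rw [Nat.sub_add_cancel hd] at h1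
  have h2 : tdist r par W a = ∑ i ∈ Finset.range (dep r par a),
      W (par^[dep r par v - dep r par a + i] v) (par^[dep r par v - dep r par a + i + 1] v) := by
    rw [tdist]
    refine Finset.sum_congr rfl fun i _ => ?_
    rw [show dep r par v - dep r par a + i + 1 = (i + 1) + (dep r par v - dep r par a) by omega,
      show dep r par v - dep r par a + i = i + (dep r par v - dep r par a) by omega, he, he]
  rw [h2, tdist, h1]; ring

omit T in
theorem tdist_nonneg (hW : ∀ x y, 0 ≤ W x y) (v : ℕ) : 0 ≤ tdist r par W v :=
  Finset.sum_nonneg fun _ _ => hW _ _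

/-- If all parents are less than `n`, the depths are less than `n` as well. -/
theorem dep_lt {n v : ℕ} (hv : v < n) (hp : ∀ v, par v < n) : dep r par v < n := by
  have h1 : ∀ i, par^[i] v < n := fun i => by
    cases i with
    | zero => exact hv
    | succ i => rw [Function.iterate_succ_apply']; exact hp _
  have h2 := Finset.card_le_card_of_injOn (s := Finset.range (dep r par v + 1))
    (t := Finset.range n) (fun i => par^[i] v) (fun i _ => by simpa using h1 i)
    (fun i hi j hj h => T.iterate_inj (by simp at hi; omega) (by simp at hj; omega) h)
  simpa using h2

end IsTree

/-! ### Preorder numberings -/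

/-- The numbers `pos x`, for `x` in `S`, are a preorder numbering of the tree restricted to `S`:
ancestors come first, and the descendants of a vertex are consecutive. -/
structure IsPre (par : ℕ → ℕ) (S : Set ℕ) (pos : ℕ → ℕ) : Prop where
  inj : ∀ x ∈ S, ∀ y ∈ S, pos x = pos y → x = y
  le_of_anc : ∀ x ∈ S, ∀ y ∈ S, Anc par x y → pos x ≤ pos y
  anc_of_le : ∀ x ∈ S, ∀ y ∈ S, ∀ z ∈ S, pos x ≤ pos y → pos y ≤ pos z → Anc par x z →
    Anc par x y

/-- A new leaf may be inserted right after its parent. -/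
theorem IsPre.insert {par : ℕ → ℕ} {S : Set ℕ} {pos pos' : ℕ → ℕ}
    (h : IsPre par S pos) {v : ℕ} (hv : v ∉ S) (hpv : par v ∈ S) (hS : ∀ x ∈ S, par x ∈ S)
    (h' : ∀ x ∈ S, pos' x = if pos (par v) < pos x then pos x + 1 else pos x)
    (hv' : pos' v = pos (par v) + 1) : IsPre par (insert v S) pos' := by
  have hit : ∀ x ∈ S, ∀ k, par^[k] x ∈ S := fun x hx k => by
    induction k with
    | zero => exact hx
    | succ k ih => rw [Function.iterate_succ_apply']; exact hS _ ih
  have hvx : ∀ x ∈ S, ¬ Anc par v x := fun x hx ⟨k, hk⟩ => hv (hk ▸ hit x hx k)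
  have hxv : ∀ x ∈ S, Anc par x v → Anc par x (par v) := fun x hx hxv =>
    hxv.par_of_ne fun h => hv (h ▸ hx)
  have hpar : ∀ x ∈ S, Anc par x (par v) → Anc par x v := fun x _ h => h.trans (anc_par _ _)
  have hlt : ∀ x ∈ S, ∀ y ∈ S, pos' x ≤ pos' y ↔ pos x ≤ pos y := fun x hx y hy => by
    rw [h' x hx, h' y hy]; split_ifs <;> omega
  have hxlev : ∀ x ∈ S, pos' x ≤ pos' v ↔ pos x ≤ pos (par v) := fun x hx => by
    rw [h' x hx, hv']; split_ifs <;> omega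
  have hvlex : ∀ x ∈ S, pos' v ≤ pos' x ↔ pos (par v) < pos x := fun x hx => by
    rw [h' x hx, hv']; split_ifs <;> omega
  refine ⟨?_, ?_, ?_⟩
  · rintro x (rfl | hx) y (rfl | hy) hxy
    · rfl
    · have h1 := (hvlex y hy).1 hxy.le
      have h2 := (hxlev y hy).1 hxy.ge
      omega
    · have h1 := (hvlex x hx).1 hxy.ge
      have h2 := (hxlev x hx).1 hxy.le
      omega
    · exact h.inj x hx y hy (le_antisymm ((hlt x hx y hy).1 hxy.le) ((hlt y hy x hx).1 hxy.ge))
  · rintro x (rfl | hx) y (rfl | hy) hxy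
    · rfl
    · exact absurd hxy (hvx y hy)
    · exact (hxlev x hx).2 (h.le_of_anc x hx _ hpv (hxv x hx hxy))
    · exact (hlt x hx y hy).2 (h.le_of_anc x hx y hy hxy)
  · rintro x (rfl | hx) y (rfl | hy) z (rfl | hz) h1 h2 hxz
    · exact hxz
    · exact Anc.refl _ _
    · have := (hvlex y hy).1 h1
      have := (hxlev y hy).1 h2
      omega
    · exact absurd hxz (hvx z hz)
    · exact hxz
    · have h3 := (hxlev x hx).1 h1
      have h4 := (hvlex z hz).1 h2
      exact hpar x hx (h.anc_of_le x hx _ hpv z hz h3 h4.le hxz)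
    · exact h.anc_of_le x hx y hy _ hpv ((hlt x hx y hy).1 h1) ((hxlev y hy).1 h2)
        (hxv x hx hxz)
    · exact h.anc_of_le x hx y hy z hz ((hlt x hx y hy).1 h1) ((hlt y hy z hz).1 h2) hxz

/-- In a preorder numbering, the lowest common ancestor of `u` and `v` is the first one of the
parents of the vertices after `u` up to `v`. -/
theorem IsPre.lca_min {r n : ℕ} {par pos : ℕ → ℕ} (T : IsTree r par) (hp : ∀ v, par v < n)
    (h : IsPre par {x | x < n} pos) {u v : ℕ} (hu : u < n) (hv : v < n) (huv : pos u < pos v) :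
    (∀ z < n, pos u < pos z → pos z ≤ pos v → pos (lca par u v) ≤ pos (par z)) ∧
    ∃ z < n, pos u < pos z ∧ pos z ≤ pos v ∧ par z = lca par u v := by
  have hit : ∀ k, par^[k] v < n := fun k => by
    cases k with
    | zero => exact hv
    | succ k => rw [Function.iterate_succ_apply']; exact hp _
  have hl : lca par u v < n := by
    obtain ⟨k, hk⟩ := T.lca_anc_right u v
    exact hk ▸ hit k
  have hlu := h.le_of_anc _ hl u hu (IsTree.lca_anc_left u v)
  constructor
  · intro z hz h1 h2
    have h3 : Anc par (lca par u v) z :=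
      h.anc_of_le _ hl z hz v hv (by omega) h2 (T.lca_anc_right u v)
    have h4 : lca par u v ≠ z := fun h => by rw [h] at hlu; omega
    exact h.le_of_anc _ hl _ (hp z) (h3.par_of_ne h4)
  · obtain ⟨k, hk⟩ : ∃ k, par^[k + 1] v = lca par u v := by
      obtain ⟨k, hk⟩ := T.lca_anc_right u v
      cases k with
      | zero =>
        rw [← hk] at hlu
        simp only [Function.iterate_zero, id] at hlu
        omega
      | succ k => exact ⟨k, hk⟩
    -- the child `par^[k] v` of the lowest common ancestor towards `v`
    by_cases hroot : par^[k] v = r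
    · have h1 : lca par u v = r := by
        rw [← hk, Function.iterate_succ_apply', hroot, T.root]
      -- `k` is chosen again, so that the child is not the root
      have h0 : v ≠ r := fun h => by rw [h1, ← h] at hlu; omega
      have hd := mt T.dep_eq_zero.1 h0
      refine ⟨par^[dep r par v - 1] v, hit _, ?_, h.le_of_anc _ (hit _) v hv (anc_iterate _ _ _),
        ?_⟩
      · by_contra hlt
        have h3 := h.anc_of_le _ (hit _) u hu v hv (not_lt.1 hlt) huv.le
          (anc_iterate par (dep r par v - 1) v)
        have h4 := T.dep_le_of_anc (IsTree.anc_lca h3 (anc_iterate par (dep r par v - 1) v))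
        rw [h1, IsTree.dep_root, T.dep_iterate] at h4
        omega
      · rw [← Function.iterate_succ_apply' par, show (dep r par v - 1).succ = dep r par v by omega,
          T.iterate_dep, h1]
    · refine ⟨par^[k] v, hit _, ?_, h.le_of_anc _ (hit _) v hv (anc_iterate _ _ _), ?_⟩
      · by_contra hlt
        have h3 := h.anc_of_le _ (hit _) u hu v hv (not_lt.1 hlt) huv.le (anc_iterate par k v)
        have h4 := T.dep_le_of_anc (IsTree.anc_lca h3 (anc_iterate par k v))
        rw [← hk, Function.iterate_succ_apply'] at h4
        have := T.dep_eq_succ hroot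
        omega
      · rw [← hk, Function.iterate_succ_apply']

/-! ### Minimum spanning trees of the component graph -/

/-- A minimum spanning tree of the graph that arises from a graph on the vertices `0, …, h` by
identifying the vertices `k, …, h` to one root. Edges have names; `Mt e i j` says that `e` joins
`i` and `j`, and the name `0`, of infinite cost, is used where an edge is missing. The tree is
given by the parent `p u` of `u < k` and the name `pe u` of the edge to it, and `seq` lists all
vertices such that parents come first. Minimality is expressed by the cycle property: the ends of
an edge `e` are not separated by any set whose boundary contains only tree edges that cost more
than `e`. -/
structure Span (cost : ℕ → WithTop ℝ) (Mt : ℕ → ℕ → ℕ → Prop) (h k : ℕ) (seq : List ℕ)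
    (p pe : ℕ → ℕ) : Prop where
  mem : ∀ u, u ∈ seq ↔ u ≤ h
  nodup : seq.Nodup
  topo : seq.Pairwise fun a b => a < k → p a ≠ b
  p_le : ∀ u < k, p u ≤ h
  p_ne : ∀ u < k, p u ≠ u
  pe_spec : ∀ u < k, pe u = 0 ∨ Mt (pe u) u (p u)
  closed : ∀ (β : WithTop ℝ) (S : Set ℕ),
    (∀ i j, k ≤ i → i ≤ h → k ≤ j → j ≤ h → (i ∈ S ↔ j ∈ S)) →
    (∀ u < k, cost (pe u) ≤ β → (u ∈ S ↔ p u ∈ S)) →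
    ∀ e i j, Mt e i j → cost e ≤ β → (i ∈ S ↔ j ∈ S)

theorem Span.length {cost : ℕ → WithTop ℝ} {Mt : ℕ → ℕ → ℕ → Prop} {h k : ℕ} {seq : List ℕ}
    {p pe : ℕ → ℕ} (H : Span cost Mt h k seq p pe) : seq.length = h + 1 := by
  rw [← List.toFinset_card_of_nodup H.nodup,
    show seq.toFinset = Finset.range (h + 1) by ext u; simp [H.mem]]
  simp

theorem Span.rank_lt {cost : ℕ → WithTop ℝ} {Mt : ℕ → ℕ → ℕ → Prop} {h k : ℕ} {seq : List ℕ}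
    {p pe : ℕ → ℕ} (H : Span cost Mt h k seq p pe) (hk : k ≤ h) {u : ℕ} (hu : u < k) :
    seq.idxOf (p u) < seq.idxOf u := by
  have h1 : u ∈ seq := (H.mem u).2 (by omega)
  have h2 : p u ∈ seq := (H.mem _).2 (H.p_le u hu)
  by_contra hlt
  rcases (not_lt.1 hlt).lt_or_eq with hlt | heq
  · have := List.pairwise_iff_getElem.1 H.topo _ _ (List.idxOf_lt_length_iff.2 h1)
      (List.idxOf_lt_length_iff.2 h2) hlt
    simp only [List.getElem_idxOf] at this
    exact this hu rfl
  · exact H.p_ne u hu ((List.idxOf_inj h1).1 heq).symm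

/-- Identifying the vertex `k` with the root of a minimum spanning tree: a most expensive edge of
the tree path `u 0 = k, u 1, …` from `k` to the root (the one from `u J` to `u (J + 1)`) is
deleted, and the path `u 0, …, u J` is reversed. -/
theorem Span.contract {cost : ℕ → WithTop ℝ} {Mt : ℕ → ℕ → ℕ → Prop} {h k J : ℕ}
    {seq : List ℕ} {p pe p' pe' : ℕ → ℕ} (H : Span cost Mt h (k + 1) seq p pe) (hk : k < h)
    (hsymm : ∀ e i j, Mt e i j → Mt e j i)
    (hJ : ∀ i ≤ J, p^[i] k < k + 1)
    (hmax : ∀ i, (∀ l ≤ i, p^[l] k < k + 1) → cost (pe (p^[i] k)) ≤ cost (pe (p^[J] k)))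
    (hp : ∀ i < J, p' (p^[i + 1] k) = p^[i] k) (hpe : ∀ i < J, pe' (p^[i + 1] k) = pe (p^[i] k))
    (hp' : ∀ u, (∀ i ≤ J, u ≠ p^[i] k) → p' u = p u)
    (hpe' : ∀ u, (∀ i ≤ J, u ≠ p^[i] k) → pe' u = pe u) :
    Span cost Mt h k ((List.range (J + 1)).map (fun i => p^[i] k) ++
      seq.filter fun u => u ∉ (List.range (J + 1)).map (fun i => p^[i] k)) p' pe' := by
  have hrk : ∀ i, p^[i] k < k + 1 → seq.idxOf (p^[i + 1] k) < seq.idxOf (p^[i] k) := fun i hi => by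
    rw [Function.iterate_succ_apply']
    exact H.rank_lt hk hi
  -- the tree path is strictly decreasing in rank, so that its vertices are distinct
  have hanti : ∀ i, (∀ l < i, p^[l] k < k + 1) → ∀ j < i,
      seq.idxOf (p^[i] k) < seq.idxOf (p^[j] k) := fun i => by
    induction i with
    | zero => intro _ j hj; omega
    | succ i ih =>
      intro hl j hj
      have h1 := hrk i (hl i (by omega))
      rcases Nat.lt_succ_iff_lt_or_eq.1 hj with h2 | rfl
      · exact h1.trans (ih (fun l hl' => hl l (by omega)) j h2)
      · exact h1
  have hne : ∀ i, (∀ l < i, p^[l] k < k + 1) → ∀ j < i, p^[i] k ≠ p^[j] k := fun i hl j hj he => by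
    have := hanti i hl j hj
    rw [he] at this
    exact lt_irrefl _ this
  have hneJ : ∀ i ≤ J, ∀ j ≤ J, i ≠ j → p^[i] k ≠ p^[j] k := fun i hi j hj hij => by
    rcases lt_or_gt_of_ne hij with h1 | h1
    · exact (hne j (fun l hl => hJ l (by omega)) i h1).symm
    · exact hne i (fun l hl => hJ l (by omega)) j h1
  obtain ⟨E, hE1, hE2⟩ : ∃ E, (∀ l < E, p^[l] k < k + 1) ∧ k + 1 ≤ p^[E] k := by
    by_contra hcon
    push Not at hcon
    have hall : ∀ i, ∀ l < i, p^[l] k < k + 1 := fun i => by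
      induction i with
      | zero => intro l hl; omega
      | succ i ih =>
        intro l hl
        rcases Nat.lt_succ_iff_lt_or_eq.1 hl with h2 | rfl
        · exact ih l h2
        · exact hcon l ih
    have hdec : ∀ i, seq.idxOf (p^[i] k) + i ≤ seq.idxOf k := fun i => by
      induction i with
      | zero => simp
      | succ i ih =>
        have := hrk i (hall (i + 1) i (by omega))
        omega
    have := hdec (seq.idxOf k + 1)
    omega
  have hJE : J < E := by
    by_contra hlt
    have := hJ E (by omega)
    omega
  have hEh : p^[E] k ≤ h := by
    obtain ⟨E', rfl⟩ : ∃ E', E = E' + 1 := ⟨E - 1, by omega⟩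
    rw [Function.iterate_succ_apply']
    exact H.p_le _ (hE1 E' (by omega))
  have hmaxE : ∀ i < E, cost (pe (p^[i] k)) ≤ cost (pe (p^[J] k)) := fun i hi =>
    hmax i fun l hl => hE1 l (by omega)
  have hk0 : ∀ i, 0 < i → i < E → p^[i] k < k := fun i hi hiE => by
    have h1 := hE1 i hiE
    have h2 := hne i (fun l hl => hE1 l (by omega)) 0 hi
    simp only [Function.iterate_zero, id] at h2
    omega
  -- a vertex below `k` is on the reversed path, or its parent has not changed
  have hcase : ∀ u < k, (∃ i < J, u = p^[i + 1] k ∧ p' u = p^[i] k ∧ pe' u = pe (p^[i] k)) ∨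
      ((∀ i ≤ J, u ≠ p^[i] k) ∧ p' u = p u ∧ pe' u = pe u) := fun u hu => by
    by_cases hex : ∃ i ≤ J, u = p^[i] k
    · obtain ⟨i, hi, rfl⟩ := hex
      cases i with
      | zero => exact absurd hu (lt_irrefl _)
      | succ i => exact Or.inl ⟨i, hi, rfl, hp i hi, hpe i hi⟩
    · push Not at hex
      exact Or.inr ⟨hex, hp' u hex, hpe' u hex⟩
  refine ⟨?_, ?_, ?_, ?_, ?_, ?_, ?_⟩
  · intro u
    simp only [List.mem_append, List.mem_filter, decide_eq_true_eq, H.mem]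
    by_cases hu : u ∈ (List.range (J + 1)).map (fun i => p^[i] k)
    · simp only [hu, true_or, true_iff]
      obtain ⟨i, hi, rfl⟩ := List.mem_map.1 hu
      have := hJ i (by simpa [Nat.lt_succ_iff] using hi)
      omega
    · exact ⟨fun h => h.elim (fun h => absurd h hu) And.left, fun h => Or.inr ⟨h, hu⟩⟩
  · refine List.Nodup.append ?_ (H.nodup.filter _) ?_
    · refine List.Nodup.map_on ?_ List.nodup_range
      intro i hi j hj hij
      by_contra hne'
      exact hneJ i (by simpa [Nat.lt_succ_iff] using hi) j (by simpa [Nat.lt_succ_iff] using hj)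
        hne' hij
    · intro u hu hu'
      have := (List.mem_filter.1 hu').2
      simp only [decide_eq_true_eq] at this
      exact this hu
  · refine List.pairwise_append.2 ⟨?_, ?_, ?_⟩
    · rw [List.pairwise_map]
      refine List.pairwise_lt_range.imp_of_mem ?_
      intro i j hi hj hij hik he
      simp only [List.mem_range, Nat.lt_succ_iff] at hi hj
      rcases hcase _ hik with ⟨l, hl, h1, h2, -⟩ | ⟨h1, -⟩
      · rw [h2] at he
        have : l = j := by
          by_contra hne'
          exact hneJ l (by omega) j hj hne' he
        exact hneJ i hi (l + 1) (by omega) (by omega) h1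
      · exact h1 i hi rfl
    · refine (H.topo.filter _).imp_of_mem ?_
      intro a b ha hb hab hak he
      have ha' := (List.mem_filter.1 ha).2
      simp only [decide_eq_true_eq, List.mem_map, List.mem_range, Nat.lt_succ_iff] at ha'
      push Not at ha'
      rw [hp' a fun i hi => (ha' i hi).symm] at he
      exact hab (by omega) he
    · intro a ha b hb hak he
      have hb' := (List.mem_filter.1 hb).2
      simp only [decide_eq_true_eq] at hb'
      rcases hcase _ hak with ⟨l, hl, h1, h2, -⟩ | ⟨h1, -⟩
      · refine hb' (List.mem_map.2 ⟨l, by simp; omega, ?_⟩)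
        rw [← h2, he]
      · obtain ⟨i, hi, rfl⟩ := List.mem_map.1 ha
        exact h1 i (by simpa [Nat.lt_succ_iff] using hi) rfl
  · intro u hu
    rcases hcase _ hu with ⟨l, hl, h1, h2, -⟩ | ⟨-, h2, -⟩
    · rw [h2]
      have := hJ l (by omega)
      omega
    · rw [h2]; exact H.p_le u (by omega)
  · intro u hu
    rcases hcase _ hu with ⟨l, hl, h1, h2, -⟩ | ⟨-, h2, -⟩
    · rw [h2, h1]
      exact hneJ l (by omega) (l + 1) (by omega) (by omega)
    · rw [h2]; exact H.p_ne u (by omega)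
  · intro u hu
    rcases hcase _ hu with ⟨l, hl, h1, h2, h3⟩ | ⟨-, h2, h3⟩
    · rw [h2, h3, h1]
      refine (H.pe_spec _ (hJ l (by omega))).imp id fun h4 => hsymm _ _ _ ?_
      rwa [← Function.iterate_succ_apply' p] at h4
    · rw [h2, h3]; exact H.pe_spec u (by omega)
  · intro β S hroot htree
    refine H.closed β S (fun i j hi hi' hj hj' => hroot i j (by omega) hi' (by omega) hj') ?_
    have hlow : ∀ i < J, cost (pe (p^[i] k)) ≤ β → (p^[i] k ∈ S ↔ p^[i + 1] k ∈ S) :=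
      fun i hi hb => by
        have := htree (p^[i + 1] k) (hk0 _ (by omega) (by omega)) (by rwa [hpe i hi])
        rw [hp i hi] at this
        exact this.symm
    have hhigh : ∀ i, J < i → i < E → cost (pe (p^[i] k)) ≤ β →
        (p^[i] k ∈ S ↔ p^[i + 1] k ∈ S) := fun i hi hiE hb => by
      have hn : ∀ l ≤ J, p^[i] k ≠ p^[l] k := fun l hl =>
        hne i (fun l hl => hE1 l (by omega)) l (by omega)
      have := htree (p^[i] k) (hk0 _ (by omega) hiE) (by rwa [hpe' _ hn])
      rw [hp' _ hn] at this
      rwa [Function.iterate_succ_apply']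
    intro u hu hb
    by_cases hex : ∃ i ≤ J, u = p^[i] k
    · obtain ⟨i, hi, rfl⟩ := hex
      rw [← Function.iterate_succ_apply' p]
      rcases hi.lt_or_eq with hi | rfl
      · exact hlow i hi hb
      · -- the deleted edge: its ends are joined through the rest of the path and the root
        have h1 : ∀ j ≤ i, (k ∈ S ↔ p^[j] k ∈ S) := fun j => by
          induction j with
          | zero => intro _; exact Iff.rfl
          | succ j ih =>
            intro hj
            exact (ih (by omega)).trans (hlow j (by omega) ((hmaxE j (by omega)).trans hb))
        have h2 : ∀ j, i + 1 + j ≤ E → (p^[i + 1] k ∈ S ↔ p^[i + 1 + j] k ∈ S) := fun j => by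
          induction j with
          | zero => intro _; exact Iff.rfl
          | succ j ih =>
            intro hj
            exact (ih (by omega)).trans
              (hhigh (i + 1 + j) (by omega) (by omega) ((hmaxE _ (by omega)).trans hb))
        have h3 := h2 (E - (i + 1)) (by omega)
        rw [show i + 1 + (E - (i + 1)) = E by omega] at h3
        rw [h3, ← h1 i le_rfl]
        exact hroot k _ le_rfl hk.le (by omega) hEh
    · push Not at hex
      have hu0 : u ≠ k := hex 0 (Nat.zero_le _)
      have := htree u (by omega) (by rwa [hpe' u hex])
      rwa [hp' u hex] at this

/-- The state of Prim's algorithm on the vertices `0, …, h` when the vertices in `l` have been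
visited: `c i j` is a cheapest edge between `i` and `j`, and `p u`, `pe u` are the parent and the
parent edge of a visited vertex `u`, and the cheapest connection to `l` of any other one. -/
structure Prim (cost : ℕ → WithTop ℝ) (c : ℕ → ℕ → ℕ) (h : ℕ) (l : List ℕ) (p pe : ℕ → ℕ) :
    Prop where
  le : ∀ u ∈ l, u ≤ h
  root : h ∈ l
  nodup : l.Nodup
  p_mem : ∀ u < h, p u ∈ l
  p_ne : ∀ u < h, p u ≠ u
  topo : l.Pairwise fun a b => a < h → p a ≠ b
  pe_eq : ∀ u < h, pe u = c (p u) u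
  key : ∀ u < h, u ∉ l → ∀ a ∈ l, cost (pe u) ≤ cost (c a u)
  /-- vertices with cheap connections to the outside are joined by cheap tree edges -/
  join : ∀ (β : WithTop ℝ) (S : Set ℕ),
    (∀ u ∈ l, u < h → cost (pe u) ≤ β → (u ∈ S ↔ p u ∈ S)) →
    ∀ a ∈ l, ∀ a' ∈ l, ∀ u ≤ h, ∀ u' ≤ h, u ∉ l → u' ∉ l → cost (c a u) ≤ β →
      cost (c a' u') ≤ β → (a ∈ S ↔ a' ∈ S)
  closed : ∀ (β : WithTop ℝ) (S : Set ℕ),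
    (∀ u ∈ l, u < h → cost (pe u) ≤ β → (u ∈ S ↔ p u ∈ S)) →
    ∀ a ∈ l, ∀ b ∈ l, cost (c a b) ≤ β → (a ∈ S ↔ b ∈ S)

/-- One round of Prim's algorithm: the vertex `b` of least key is visited, and the keys of the
other vertices are updated. -/
theorem Prim.step {cost : ℕ → WithTop ℝ} {c : ℕ → ℕ → ℕ} {h b : ℕ} {l : List ℕ}
    {p pe p' pe' : ℕ → ℕ} (H : Prim cost c h l p pe) (hb : b < h) (hbl : b ∉ l)
    (hc : ∀ i ≤ h, ∀ j ≤ h, c i j = c j i)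
    (hmin : ∀ u < h, u ∉ l → cost (pe b) ≤ cost (pe u))
    (hold : ∀ u, u ∈ l ∨ u = b → p' u = p u ∧ pe' u = pe u)
    (hnew : ∀ u < h, u ∉ l → u ≠ b → (p' u = p u ∧ pe' u = pe u ∧
      cost (pe u) ≤ cost (c b u)) ∨ (p' u = b ∧ pe' u = c b u ∧ cost (c b u) ≤ cost (pe u))) :
    Prim cost c h (l ++ [b]) p' pe' := by
  have hcb : ∀ β : WithTop ℝ, ∀ a ∈ l, ∀ u ≤ h, u ∉ l → cost (c a u) ≤ β → cost (pe b) ≤ β :=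
    fun β a ha u hu hul h1 => by
      have : u ≠ h := fun h => hul (h ▸ H.root)
      exact (hmin u (by omega) hul).trans ((H.key u (by omega) hul a ha).trans h1)
  have hcase : ∀ u < h, p' u = p u ∧ pe' u = pe u ∨
      (u ∉ l ∧ u ≠ b ∧ p' u = b ∧ pe' u = c b u) := fun u hu => by
    by_cases hul : u ∈ l
    · exact Or.inl (hold u (Or.inl hul))
    · by_cases hub : u = b
      · exact Or.inl (hold u (Or.inr hub))
      · rcases hnew u hu hul hub with h1 | h1
        · exact Or.inl ⟨h1.1, h1.2.1⟩
        · exact Or.inr ⟨hul, hub, h1.1, h1.2.1⟩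
  have htr : ∀ (β : WithTop ℝ) (S : Set ℕ),
      (∀ u ∈ l ++ [b], u < h → cost (pe' u) ≤ β → (u ∈ S ↔ p' u ∈ S)) →
      (∀ u ∈ l, u < h → cost (pe u) ≤ β → (u ∈ S ↔ p u ∈ S)) ∧
      (cost (pe b) ≤ β → (b ∈ S ↔ p b ∈ S)) := fun β S hS => by
    refine ⟨fun u hu huh h1 => ?_, fun h1 => ?_⟩
    · have := hold u (Or.inl hu)
      rw [← this.2] at h1
      rw [← this.1]
      exact hS u (List.mem_append_left _ hu) huh h1
    · have := hold b (Or.inr rfl)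
      rw [← this.2] at h1
      rw [← this.1]
      exact hS b (by simp) hb h1
  have hjb : ∀ (β : WithTop ℝ) (S : Set ℕ),
      (∀ u ∈ l ++ [b], u < h → cost (pe' u) ≤ β → (u ∈ S ↔ p' u ∈ S)) →
      ∀ a ∈ l, ∀ u ≤ h, u ∉ l → cost (c a u) ≤ β → (b ∈ S ↔ a ∈ S) :=
    fun β S hS a ha u hu hul h1 => by
      have h2 := hcb β a ha u hu hul h1
      rw [(htr β S hS).2 h2]
      exact H.join β S (htr β S hS).1 _ (H.p_mem b hb) a ha b hb.le u hu hbl hul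
        (by rwa [← H.pe_eq b hb]) h1
  refine ⟨?_, ?_, ?_, ?_, ?_, ?_, ?_, ?_, ?_, ?_⟩
  · intro u hu
    rcases List.mem_append.1 hu with hu | hu
    · exact H.le u hu
    · rw [List.mem_singleton.1 hu]; exact hb.le
  · exact List.mem_append_left _ H.root
  · exact List.Nodup.append H.nodup (List.nodup_singleton b) (by simpa using hbl)
  · intro u hu
    rcases hcase u hu with h1 | h1
    · rw [h1.1]; exact List.mem_append_left _ (H.p_mem u hu)
    · rw [h1.2.2.1]; simp
  · intro u hu
    rcases hcase u hu with h1 | h1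
    · rw [h1.1]; exact H.p_ne u hu
    · rw [h1.2.2.1]; exact h1.2.1.symm
  · refine List.pairwise_append.2 ⟨?_, List.pairwise_singleton _ _, ?_⟩
    · refine H.topo.imp_of_mem fun {a a'} ha _ h1 => ?_
      rwa [(hold a (Or.inl ha)).1]
    · intro a ha b' hb' hah he
      rw [List.mem_singleton.1 hb', (hold a (Or.inl ha)).1] at he
      exact hbl (he ▸ H.p_mem a hah)
  · intro u hu
    rcases hcase u hu with h1 | h1
    · rw [h1.1, h1.2]; exact H.pe_eq u hu
    · rw [h1.2.2.1, h1.2.2.2]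
  · intro u hu hul a ha
    simp only [List.mem_append, List.mem_singleton, not_or] at hul ha
    rcases hnew u hu hul.1 hul.2 with ⟨-, h1, h2⟩ | ⟨-, h1, h2⟩ <;> rw [h1] <;>
      rcases ha with ha | rfl
    · exact H.key u hu hul.1 a ha
    · exact h2
    · exact h2.trans (H.key u hu hul.1 a ha)
    · exact le_rfl
  · intro β S hS a ha a' ha' u hu u' hu' hul hul' h1 h2
    simp only [List.mem_append, List.mem_singleton, not_or] at hul hul' ha ha'
    rcases ha with ha | rfl <;> rcases ha' with ha' | rfl
    · exact H.join β S (htr β S hS).1 a ha a' ha' u hu u' hu' hul.1 hul'.1 h1 h2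
    · exact (hjb β S hS a ha u hu hul.1 h1).symm
    · exact hjb β S hS a' ha' u' hu' hul'.1 h2
    · exact Iff.rfl
  · intro β S hS a ha a' ha' h1
    simp only [List.mem_append, List.mem_singleton] at ha ha'
    rcases ha with ha | rfl <;> rcases ha' with ha' | rfl
    · exact H.closed β S (htr β S hS).1 a ha a' ha' h1
    · exact (hjb β S hS a ha _ hb.le hbl h1).symm
    · rw [hc _ hb.le _ (H.le _ ha')] at h1
      exact hjb β S hS a' ha' _ hb.le hbl h1
    · exact Iff.rfl

theorem Prim.start {cost : ℕ → WithTop ℝ} {c : ℕ → ℕ → ℕ} {h : ℕ} {p pe : ℕ → ℕ}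
    (hp : ∀ u < h, p u = h) (hpe : ∀ u < h, pe u = c h u) : Prim cost c h [h] p pe where
  le u hu := by rw [List.mem_singleton.1 hu]
  root := List.mem_singleton_self h
  nodup := List.nodup_singleton h
  p_mem u hu := by rw [hp u hu]; exact List.mem_singleton_self h
  p_ne u hu := by rw [hp u hu]; omega
  topo := List.pairwise_singleton _ _
  pe_eq u hu := by rw [hp u hu, hpe u hu]
  key u hu _ a ha := by rw [List.mem_singleton.1 ha, hpe u hu]
  join β S _ a ha a' ha' _ _ _ _ _ _ _ _ := by
    rw [List.mem_singleton.1 ha, List.mem_singleton.1 ha']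
  closed β S _ a ha a' ha' _ := by
    rw [List.mem_singleton.1 ha, List.mem_singleton.1 ha']

theorem Prim.span {cost : ℕ → WithTop ℝ} {Mt : ℕ → ℕ → ℕ → Prop} {c : ℕ → ℕ → ℕ} {h : ℕ}
    {l : List ℕ} {p pe : ℕ → ℕ} (H : Prim cost c h l p pe) (hl : ∀ u ≤ h, u ∈ l)
    (hsymm : ∀ e i j, Mt e i j → Mt e j i)
    (hle : ∀ e i j, Mt e i j → i ≤ h ∧ j ≤ h)
    (hc : ∀ i ≤ h, ∀ j ≤ h, c i j = 0 ∨ Mt (c i j) i j)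
    (hmin : ∀ e i j, Mt e i j → cost (c i j) ≤ cost e) : Span cost Mt h h l p pe where
  mem u := ⟨H.le u, hl u⟩
  nodup := H.nodup
  topo := H.topo
  p_le u hu := H.le _ (H.p_mem u hu)
  p_ne := H.p_ne
  pe_spec u hu := by
    rw [H.pe_eq u hu]
    exact (hc _ (H.le _ (H.p_mem u hu)) u hu.le).imp id (hsymm _ _ _)
  closed β S _ hS e i j he hb :=
    H.closed β S (fun u _ => hS u) i (hl i (hle e i j he).1) j (hl j (hle e i j he).2)
      ((hmin e i j he).trans hb)

/-! ### Detours around a path failure -/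

/-- A weighted graph on the vertices `0, …, n - 1` with the edges `ea j`, `eb j` (`j < m`), together
with a shortest path tree, and the bound `f` on the number of failing edges. -/
structure Inst where
  (n m f r : ℕ)
  (par ea eb : ℕ → ℕ)
  W : ℕ → ℕ → ℝ
  tree : IsTree r par
  r_lt : r < n
  f_pos : 1 ≤ f
  par_lt : ∀ v, par v < n
  ea_lt : ∀ j < m, ea j < n
  eb_lt : ∀ j < m, eb j < n
  W_nonneg : ∀ x y, 0 ≤ W x y
  W_symm : ∀ x y, W x y = W y x
  tree_edge : ∀ v < n, v ≠ r → ∃ j < m, (ea j = v ∧ eb j = par v) ∨ (ea j = par v ∧ eb j = v)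
  spt : ∀ j < m, tdist r par W (eb j) ≤ tdist r par W (ea j) + W (ea j) (eb j) ∧
    tdist r par W (ea j) ≤ tdist r par W (eb j) + W (ea j) (eb j)

namespace Inst

variable (I : Inst)

/-- The depth of a vertex in the tree. -/
noncomputable def dp (v : ℕ) : ℕ := dep I.r I.par v
/-- The distance of a vertex from the root. -/
noncomputable def ds (v : ℕ) : ℝ := tdist I.r I.par I.W v
/-- The number of steps from `v` up to the tree path to `t`. -/
noncomputable def ix (v t : ℕ) : ℕ := idx I.par v t
/-- The lowest common ancestor. -/
noncomputable def lc (v t : ℕ) : ℕ := lca I.par v t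
/-- The number of edges of the tree path between two vertices. -/
noncomputable def hops (a b : ℕ) : ℕ := (I.dp a - I.dp (I.lc a b)) + (I.dp b - I.dp (I.lc a b))
/-- The length of the tree path between two vertices. -/
noncomputable def tlen (a b : ℕ) : ℝ := (I.ds a - I.ds (I.lc a b)) + (I.ds b - I.ds (I.lc a b))

/-- `e ≠ 0` names the edge `e - 1`, which joins `x` and `y` and is not in the tree. -/
def Ends (e x y : ℕ) : Prop :=
  1 ≤ e ∧ e ≤ I.m ∧ I.par x ≠ y ∧ I.par y ≠ x ∧
    ((I.ea (e - 1) = x ∧ I.eb (e - 1) = y) ∨ (I.ea (e - 1) = y ∧ I.eb (e - 1) = x))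

/-- The cost of an edge: the length of the closed walk from the root along the tree to one end,
through the edge, and along the tree back to the root. The name `0` means a missing edge. -/
noncomputable def cost : ℕ → WithTop ℝ
  | 0 => ⊤
  | e + 1 => ((I.ds (I.ea e) + I.W (I.ea e) (I.eb e) + I.ds (I.eb e) : ℝ) : WithTop ℝ)

/-- The non-tree edge `e` joins the components `i` and `j` of the tree after the failure of the
last `h` edges of the path to `v`; the component of the root has number `h`. -/
def Mt (v h e i j : ℕ) : Prop := ∃ x y, I.Ends e x y ∧ min h (I.ix v x) = i ∧ min h (I.ix v y) = j

/-- The edge `x y` is one of the last `k` edges of the tree path to `v`. -/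
def Fails (v k x y : ℕ) : Prop :=
  ∃ i < k, (x = I.par^[i] v ∧ y = I.par^[i + 1] v) ∨ (y = I.par^[i] v ∧ x = I.par^[i + 1] v)

/-- Adjacency after the failure of the last `k` edges of the tree path to `v`. -/
def Adj (v k x y : ℕ) : Prop :=
  (∃ j < I.m, (I.ea j = x ∧ I.eb j = y) ∨ (I.ea j = y ∧ I.eb j = x)) ∧ ¬ I.Fails v k x y

variable {I}

theorem Ends.symm {e x y : ℕ} (h : I.Ends e x y) : I.Ends e y x :=
  ⟨h.1, h.2.1, h.2.2.2.1, h.2.2.1, h.2.2.2.2.symm⟩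

theorem Mt.symm {v h e i j : ℕ} (H : I.Mt v h e i j) : I.Mt v h e j i := by
  obtain ⟨x, y, h1, h2, h3⟩ := H
  exact ⟨y, x, h1.symm, h3, h2⟩

theorem Mt.le {v h e i j : ℕ} (H : I.Mt v h e i j) : i ≤ h ∧ j ≤ h := by
  obtain ⟨x, y, -, rfl, rfl⟩ := H
  exact ⟨min_le_left _ _, min_le_left _ _⟩

theorem Ends.lt {e x y : ℕ} (h : I.Ends e x y) : x < I.n ∧ y < I.n := by
  obtain ⟨h1, h2, -, -, h | h⟩ := h <;> rw [← h.1, ← h.2]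
  · exact ⟨I.ea_lt _ (by omega), I.eb_lt _ (by omega)⟩
  · exact ⟨I.eb_lt _ (by omega), I.ea_lt _ (by omega)⟩

theorem Ends.cost_eq {e x y : ℕ} (h : I.Ends e x y) :
    I.cost e = ((I.ds x + I.W x y + I.ds y : ℝ) : WithTop ℝ) := by
  obtain ⟨h1, h2, -, -, h⟩ := h
  obtain ⟨e, rfl⟩ : ∃ e', e = e' + 1 := ⟨e - 1, by omega⟩
  simp only [Nat.add_sub_cancel] at h
  rw [cost]
  rcases h with ⟨rfl, rfl⟩ | ⟨rfl, rfl⟩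
  · rfl
  · rw [I.W_symm (I.eb e), show I.ds (I.ea e) + I.W (I.ea e) (I.eb e) + I.ds (I.eb e) =
      I.ds (I.eb e) + I.W (I.ea e) (I.eb e) + I.ds (I.ea e) by ring]

theorem Ends.adj {e x y v k : ℕ} (h : I.Ends e x y) : I.Adj v k x y := by
  obtain ⟨h1, h2, h3, h4, h⟩ := h
  refine ⟨⟨e - 1, by omega, h⟩, ?_⟩
  rintro ⟨i, -, ⟨rfl, rfl⟩ | ⟨rfl, rfl⟩⟩
  · exact h3 (Function.iterate_succ_apply' _ _ _).symm
  · exact h4 (Function.iterate_succ_apply' _ _ _).symm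

theorem ds_nonneg (x : ℕ) : 0 ≤ I.ds x := IsTree.tdist_nonneg _ I.W_nonneg x

theorem Adj.symm {v k x y : ℕ} (h : I.Adj v k x y) : I.Adj v k y x := by
  obtain ⟨⟨j, hj, h⟩, h'⟩ := h
  exact ⟨⟨j, hj, h.symm⟩, fun ⟨i, hi, h⟩ => h' ⟨i, hi, h.symm⟩⟩

/-- The tree is a shortest path tree. -/
theorem Adj.ds_le {v k x y : ℕ} (h : I.Adj v k x y) : I.ds y ≤ I.ds x + I.W x y := by
  obtain ⟨⟨j, hj, ⟨rfl, rfl⟩ | ⟨rfl, rfl⟩⟩, -⟩ := h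
  · exact (I.spt j hj).1
  · rw [I.W_symm]; exact (I.spt j hj).2

/-- A tree edge within a component does not fail. -/
theorem adj_par {v k x : ℕ} (hx : x < I.n) (hr : x ≠ I.r) (hk : k ≤ I.dp v)
    (h : min k (I.ix v x) = min k (I.ix v (I.par x))) : I.Adj v k x (I.par x) := by
  obtain ⟨j, hj, he⟩ := I.tree_edge x hx hr
  refine ⟨⟨j, hj, he⟩, ?_⟩
  simp only [dp] at hk
  rintro ⟨i, hi, ⟨h1, h2⟩ | ⟨h1, h2⟩⟩
  · have h3 : I.ix v x = i := by rw [h1]; exact I.tree.idx_iterate (by omega)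
    have h4 : I.ix v (I.par x) = i + 1 := by rw [h2]; exact I.tree.idx_iterate (by omega)
    omega
  · have h3 := congrArg (dep I.r I.par) h1
    have h4 := congrArg (dep I.r I.par) h2
    have h5 := I.tree.dep_eq_succ hr
    rw [I.tree.dep_iterate] at h3 h4
    omega

theorem lt_of_anc {a x : ℕ} (hx : x < I.n) (h : Anc I.par a x) : a < I.n := by
  obtain ⟨k, rfl⟩ := h
  cases k with
  | zero => exact hx
  | succ k => rw [Function.iterate_succ_apply']; exact I.par_lt _

/-- All vertices of the tree path between two vertices of a component are in this component. -/
theorem ix_between {v k a b c : ℕ} (hab : min k (I.ix v a) = min k (I.ix v b))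
    (hca : Anc I.par c a) (hc : Anc I.par (I.lc a b) c) :
    min k (I.ix v c) = min k (I.ix v a) := by
  have h1 := I.tree.idx_mono v hca
  simp only [ix] at *
  rcases lt_or_ge (idx I.par v a) k with hlt | hge
  · rw [I.tree.idx_of_between (by omega) hca hc]
  · omega

/-- The sequence of the vertices of the tree path from `y` to `t`, at the positions from `o` on. -/
def IsTreeSeq (I : Inst) (g : ℕ → ℕ) (o y t : ℕ) : Prop :=
  (∀ j ≤ I.dp y - I.dp (I.lc y t), g (o + j) = I.par^[j] y) ∧
  ∀ j ≤ I.dp t - I.dp (I.lc y t), g (o + I.hops y t - j) = I.par^[j] t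

theorem IsTreeSeq.valid {g : ℕ → ℕ} {o y t v k : ℕ} (H : I.IsTreeSeq g o y t) (hk : k ≤ I.dp v)
    (hy : y < I.n) (ht : t < I.n) (hyt : min k (I.ix v y) = min k (I.ix v t)) :
    (∀ j < I.hops y t, I.Adj v k (g (o + j)) (g (o + j + 1))) ∧
    (∑ j ∈ Finset.range (I.hops y t), I.W (g (o + j)) (g (o + j + 1)) = I.tlen y t) ∧
    (∀ i ≤ I.hops y t, ∀ j ≤ I.hops y t, g (o + i) = g (o + j) → i = j) ∧
    ∀ j ≤ I.hops y t, min k (I.ix v (g (o + j))) = min k (I.ix v t) ∧ g (o + j) < I.n := by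
  have hly : Anc I.par (I.lc y t) y := IsTree.lca_anc_left y t
  have hlt : Anc I.par (I.lc y t) t := I.tree.lca_anc_right y t
  have hcomm : I.lc t y = I.lc y t := I.tree.lca_comm t y
  have hdy := I.tree.dep_le_of_anc hly
  have hdt := I.tree.dep_le_of_anc hlt
  obtain ⟨h1, h2⟩ := H
  have hh : I.hops y t = (I.dp y - I.dp (I.lc y t)) + (I.dp t - I.dp (I.lc y t)) := rfl
  set a := I.dp y - I.dp (I.lc y t) with ha
  set b := I.dp t - I.dp (I.lc y t) with hb
  have h2' : ∀ j, a ≤ j → j ≤ a + b → g (o + j) = I.par^[a + b - j] t := fun j hj hj' => by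
    rw [← h2 _ (by omega), hh]; congr 1; omega
  have hyl : I.par^[a] y = I.lc y t := I.tree.iterate_of_anc hly
  have htl : I.par^[b] t = I.lc y t := I.tree.iterate_of_anc hlt
  have hancy : ∀ j ≤ a, Anc I.par (I.lc y t) (I.par^[j] y) := fun j hj =>
    ⟨a - j, by rw [← Function.iterate_add_apply, Nat.sub_add_cancel hj, hyl]⟩
  have hanct : ∀ j ≤ b, Anc I.par (I.lc y t) (I.par^[j] t) := fun j hj =>
    ⟨b - j, by rw [← Function.iterate_add_apply, Nat.sub_add_cancel hj, htl]⟩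
  have hcy : ∀ j ≤ a, min k (I.ix v (I.par^[j] y)) = min k (I.ix v t) := fun j hj => by
    rw [ix_between hyt (anc_iterate _ _ _) (hancy j hj), hyt]
  have hct : ∀ j ≤ b, min k (I.ix v (I.par^[j] t)) = min k (I.ix v t) := fun j hj =>
    ix_between hyt.symm (anc_iterate _ _ _) (hcomm ▸ hanct j hj)
  have hdj : ∀ x j, I.dp (I.par^[j] x) = I.dp x - j := fun x j => I.tree.dep_iterate j x
  have hup : ∀ x j, I.dp (I.par^[j] x) ≠ 0 → x < I.n →
      min k (I.ix v (I.par^[j] x)) = min k (I.ix v (I.par^[j + 1] x)) →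
      I.Adj v k (I.par^[j] x) (I.par^[j + 1] x) := fun x j hj hx hc => by
    rw [Function.iterate_succ_apply'] at hc ⊢
    exact adj_par (lt_of_anc hx (anc_iterate _ _ _)) (fun h => hj (I.tree.dep_eq_zero.2 h)) hk hc
  simp only [dp] at hdy hdt ha hb hdj hup
  have hstep : ∀ j < a + b, (j < a ∧ g (o + j) = I.par^[j] y ∧ g (o + j + 1) = I.par^[j + 1] y) ∨
      (a ≤ j ∧ g (o + j) = I.par^[a + b - 1 - j + 1] t ∧ g (o + j + 1) = I.par^[a + b - 1 - j] t) :=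
    fun j hj => by
      rcases lt_or_ge j a with hja | hja
      · exact Or.inl ⟨hja, h1 j hja.le, h1 (j + 1) hja⟩
      · refine Or.inr ⟨hja, ?_, ?_⟩
        · rw [h2' j hja hj.le]; congr 1; omega
        · rw [add_assoc, h2' (j + 1) (by omega) hj]; congr 1; omega
  rw [hh]
  refine ⟨?_, ?_, ?_, ?_⟩
  · intro j hj
    rcases hstep j hj with ⟨hja, h3, h4⟩ | ⟨hja, h3, h4⟩ <;> rw [h3, h4]
    · exact hup y j (by rw [hdj]; omega) hy (by rw [hcy j hja.le, hcy (j + 1) hja])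
    · exact (hup t _ (by rw [hdj]; omega) ht
        (by rw [hct _ (by omega), hct _ (by omega)])).symm
  · rw [Finset.sum_range_add, tlen]
    congr 1
    · rw [ds, ds, ← I.tree.tdist_sub I.W hly]
      refine Finset.sum_congr rfl fun j hj => ?_
      rw [h1 j (Finset.mem_range.1 hj).le, add_assoc, h1 (j + 1) (Finset.mem_range.1 hj)]
    · rw [ds, ds, ← I.tree.tdist_sub I.W hlt, ← Finset.sum_range_reflect]
      refine Finset.sum_congr rfl fun j hj => ?_
      have hj := Finset.mem_range.1 hj
      rw [I.W_symm, add_assoc, h2' (a + (b - 1 - j)) (by omega) (by omega),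
        h2' (a + (b - 1 - j) + 1) (by omega) (by omega)]
      congr 2 <;> omega
  · have key : ∀ i j, i ≤ a → a < j → j ≤ a + b → I.par^[i] y ≠ I.par^[a + b - j] t :=
      fun i j hi hj hj' he => by
        have h3 : Anc I.par (I.par^[a + b - j] t) (I.lc y t) :=
          IsTree.anc_lca (he ▸ anc_iterate _ _ _) (anc_iterate _ _ _)
        have h4 := I.tree.dep_le_of_anc h3
        rw [hdj] at h4
        omega
    intro i hi j hj hij
    rcases le_or_gt i a with hia | hia <;> rcases le_or_gt j a with hja | hja
    · rw [h1 i hia, h1 j hja] at hij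
      exact I.tree.iterate_inj (by omega) (by omega) hij
    · rw [h1 i hia, h2' j hja.le hj] at hij
      exact absurd hij (key i j hia hja hj)
    · rw [h1 j hja, h2' i hia.le hi] at hij
      exact absurd hij.symm (key j i hja hia hi)
    · rw [h2' i hia.le hi, h2' j hja.le hj] at hij
      have := I.tree.iterate_inj (by omega) (by omega) hij
      omega
  · intro j hj
    rcases le_or_gt j a with hja | hja
    · rw [h1 j hja]
      exact ⟨hcy j hja, lt_of_anc hy (anc_iterate _ _ _)⟩
    · rw [h2' j hja.le hj]
      exact ⟨hct _ (by omega), lt_of_anc ht (anc_iterate _ _ _)⟩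

end Inst

namespace Inst

/-! ### The detours of the oracle and their lengths -/

variable {I : Inst}

/-- Is the vertex `t` marked as reachable, if `fl` are the marks of the components? -/
noncomputable def askFl (I : Inst) (v k : ℕ) (fl : ℕ → ℕ) (t : ℕ) : ℕ :=
  if k ≤ I.ix v t then 1 else fl (I.ix v t)

/-- The number of edges of the detour to `t`, if the detour to the component `i` enters it at the
vertex `Y i` after `H i` edges. -/
noncomputable def askLen (I : Inst) (v k : ℕ) (Y H : ℕ → ℕ) (t : ℕ) : ℕ :=
  if k ≤ I.ix v t then I.dp t else H (I.ix v t) + I.hops (Y (I.ix v t)) t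

/-- The length of the detour to `t`, if the detour to the component `i` enters it at the
vertex `Y i` and has the length `D i` up to there. -/
noncomputable def askD (I : Inst) (v k : ℕ) (Y : ℕ → ℕ) (D : ℕ → ℝ) (t : ℕ) : ℝ :=
  if k ≤ I.ix v t then I.ds t else D (I.ix v t) + I.tlen (Y (I.ix v t)) t

/-- The entry that the oracle has for the component `i`, if the component tree has the parents `p`
and the parent edges `pe`. -/
def EntryOk (I : Inst) (v h k : ℕ) (p pe fl X Y H : ℕ → ℕ) (D : ℕ → ℝ) (i : ℕ) : Prop :=
  (pe i = 0 ∧ fl i = 0) ∨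
  ∃ x y, I.Ends (pe i) x y ∧ min h (I.ix v x) = p i ∧ min h (I.ix v y) = i ∧
    fl i = I.askFl v k fl x ∧
    (fl i ≠ 0 → X i = x ∧ Y i = y ∧ H i = I.askLen v k Y H x + 1 ∧
      D i = I.askD v k Y D x + I.W x y)

/-- The vertices of a detour to `t` with `ℓ` edges and the length `d` are `g 0, …, g ℓ`. -/
inductive Route (I : Inst) (v k : ℕ) (X Y H : ℕ → ℕ) (D : ℕ → ℝ) (g : ℕ → ℕ) :
    ℕ → ℕ → ℝ → Prop
  | base (t : ℕ) (ht : k ≤ I.ix v t) (hg : I.IsTreeSeq g 0 I.r t) :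
      Route I v k X Y H D g t (I.dp t) (I.ds t)
  | step (t ℓ : ℕ) (d : ℝ) (ht : I.ix v t < k)
      (hr : Route I v k X Y H D g (X (I.ix v t)) ℓ d)
      (hH : H (I.ix v t) = ℓ + 1) (hX : X (I.ix v t) < I.n) (hY : Y (I.ix v t) < I.n)
      (hg : I.IsTreeSeq g (ℓ + 1) (Y (I.ix v t)) t) :
      Route I v k X Y H D g t (ℓ + 1 + I.hops (Y (I.ix v t)) t)
        (D (I.ix v t) + I.tlen (Y (I.ix v t)) t)

theorem IsTreeSeq.congr {g g' : ℕ → ℕ} {o y t : ℕ} (h : I.IsTreeSeq g o y t)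
    (hg : ∀ j ≤ I.hops y t, g' (o + j) = g (o + j)) : I.IsTreeSeq g' o y t := by
  have hh : I.hops y t = (I.dp y - I.dp (I.lc y t)) + (I.dp t - I.dp (I.lc y t)) := rfl
  refine ⟨fun j hj => (hg j (by omega)).trans (h.1 j hj), fun j hj => ?_⟩
  rw [← h.2 j hj, show o + I.hops y t - j = o + (I.hops y t - j) by omega]
  exact hg _ (by omega)

theorem Route.congr {v k : ℕ} {X Y H : ℕ → ℕ} {D : ℕ → ℝ} {g g' : ℕ → ℕ} {t ℓ : ℕ} {d : ℝ}
    (h : I.Route v k X Y H D g t ℓ d) (hg : ∀ j ≤ ℓ, g' j = g j) :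
    I.Route v k X Y H D g' t ℓ d := by
  induction h with
  | base t ht hs =>
    refine .base t ht (hs.congr fun j hj => ?_)
    have h1 : I.lc I.r t = I.r := (I.tree.eq_lca (Anc.refl _ _) (I.tree.anc_root t)
      fun _ h _ => h).symm
    have h2 : I.dp I.r = 0 := IsTree.dep_root
    rw [hops, h1, h2] at hj
    exact hg _ (by omega)
  | step t ℓ d ht _ hH hX hY hs ih =>
    exact .step t ℓ d ht (ih fun j hj => hg j (by omega)) hH hX hY
      (hs.congr fun j hj => hg _ (by omega))

theorem lc_root (t : ℕ) : I.lc I.r t = I.r :=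
  (I.tree.eq_lca (Anc.refl _ _) (I.tree.anc_root t) fun _ h _ => h).symm

theorem hops_root (t : ℕ) : I.hops I.r t = I.dp t := by
  have h2 : I.dp I.r = 0 := IsTree.dep_root
  rw [hops, lc_root, h2]; omega

theorem tlen_root (t : ℕ) : I.tlen I.r t = I.ds t := by
  have h2 : I.ds I.r = 0 := IsTree.tdist_root _
  rw [tlen, lc_root, h2]; ring

/-- A sequence of vertices from `o` to `y`, prolonged by the tree path from `y` to `t`. -/
theorem exists_isTreeSeq (I : Inst) (g : ℕ → ℕ) (o y t : ℕ) :
    ∃ g', I.IsTreeSeq g' o y t ∧ ∀ j < o, g' j = g j := by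
  have hyl : I.par^[I.dp y - I.dp (I.lc y t)] y = I.lc y t :=
    I.tree.iterate_of_anc (IsTree.lca_anc_left y t)
  have htl : I.par^[I.dp t - I.dp (I.lc y t)] t = I.lc y t :=
    I.tree.iterate_of_anc (I.tree.lca_anc_right y t)
  have hh : I.hops y t = (I.dp y - I.dp (I.lc y t)) + (I.dp t - I.dp (I.lc y t)) := rfl
  refine ⟨fun j => if j < o then g j else if j ≤ o + (I.dp y - I.dp (I.lc y t)) then
    I.par^[j - o] y else I.par^[o + I.hops y t - j] t, ⟨fun j hj => ?_, fun j hj => ?_⟩,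
    fun j hj => if_pos hj⟩
  · simp only [add_lt_iff_neg_left, Nat.not_lt_zero, if_false]
    rw [if_pos (by omega), Nat.add_sub_cancel_left]
  · dsimp only
    rw [if_neg (by omega)]
    split_ifs with h1
    · obtain rfl : j = I.dp t - I.dp (I.lc y t) := by omega
      rw [show o + I.hops y t - (I.dp t - I.dp (I.lc y t)) - o = I.dp y - I.dp (I.lc y t) by omega,
        hyl, htl]
    · congr 1; omega

/-- What makes the sequence `g 0, …, g ℓ` a simple path of length `d` from the root to `t` after
the failure; the numbers `rk` of the components on it are bounded by that of the last one. -/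
structure ValidSeq (I : Inst) (v k : ℕ) (rk : ℕ → ℕ) (g : ℕ → ℕ) (t ℓ : ℕ) (d : ℝ) : Prop where
  first : g 0 = I.r
  last : g ℓ = t
  lt : ∀ j ≤ ℓ, g j < I.n
  adj : ∀ j < ℓ, I.Adj v k (g j) (g (j + 1))
  sum : ∑ j ∈ Finset.range ℓ, I.W (g j) (g (j + 1)) = d
  inj : ∀ i ≤ ℓ, ∀ j ≤ ℓ, g i = g j → i = j
  rank : ∀ j ≤ ℓ, rk (min k (I.ix v (g j))) ≤ rk (min k (I.ix v t))

theorem ValidSeq.congr {v k : ℕ} {rk g g' : ℕ → ℕ} {t ℓ : ℕ} {d : ℝ}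
    (h : I.ValidSeq v k rk g t ℓ d) (hg : ∀ j ≤ ℓ, g' j = g j) : I.ValidSeq v k rk g' t ℓ d where
  first := (hg 0 (by omega)).trans h.first
  last := (hg ℓ le_rfl).trans h.last
  lt j hj := by rw [hg j hj]; exact h.lt j hj
  adj j hj := by rw [hg j hj.le, hg (j + 1) hj]; exact h.adj j hj
  sum := by
    rw [← h.sum]
    refine Finset.sum_congr rfl fun j hj => ?_
    rw [hg j (Finset.mem_range.1 hj).le, hg (j + 1) (Finset.mem_range.1 hj)]
  inj i hi j hj hij := h.inj i hi j hj (by rwa [hg i hi, hg j hj] at hij)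
  rank j hj := by rw [hg j hj]; exact h.rank j hj

theorem ValidSeq.base {v k : ℕ} {rk g : ℕ → ℕ} {t : ℕ} (hk : k ≤ I.dp v) (ht : t < I.n)
    (htk : k ≤ I.ix v t) (hg : I.IsTreeSeq g 0 I.r t) : I.ValidSeq v k rk g t (I.dp t) (I.ds t) := by
  have hr : I.ix v I.r = I.dp v := I.tree.idx_root v
  obtain ⟨h1, h2, h3, h4⟩ := hg.valid hk I.r_lt ht (by omega)
  rw [hops_root] at *
  rw [tlen_root] at h2
  simp only [zero_add] at *
  refine ⟨?_, ?_, fun j hj => (h4 j hj).2, h1, h2, h3, fun j hj => (congrArg rk (h4 j hj).1).le⟩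
  · simpa using hg.1 0 (Nat.zero_le _)
  · simpa [hops_root] using hg.2 0 (Nat.zero_le _)

/-- A detour to `x` is prolonged by an edge `x y` and by the tree path from `y` to `t`. The result is
simple, since the components on the way are passed in the order of the component tree. -/
theorem ValidSeq.step {v k : ℕ} {rk g : ℕ → ℕ} {x y t ℓ : ℕ} {d : ℝ} (hk : k ≤ I.dp v)
    (h : I.ValidSeq v k rk g x ℓ d) (hy : y < I.n) (ht : t < I.n)
    (hyt : min k (I.ix v y) = min k (I.ix v t)) (hxy : I.Adj v k x y)
    (hrk : rk (min k (I.ix v x)) < rk (min k (I.ix v t)))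
    (hg : I.IsTreeSeq g (ℓ + 1) y t) :
    I.ValidSeq v k rk g t (ℓ + 1 + I.hops y t) (d + I.W x y + I.tlen y t) := by
  obtain ⟨h1, h2, h3, h4⟩ := hg.valid hk hy ht hyt
  have hgy : g (ℓ + 1) = y := by simpa using hg.1 0 (Nat.zero_le _)
  have hsplit : ∀ j ≤ ℓ + 1 + I.hops y t, j ≤ ℓ ∨ ∃ i ≤ I.hops y t, j = ℓ + 1 + i := fun j hj => by
    rcases le_or_gt j ℓ with h | h
    · exact Or.inl h
    · exact Or.inr ⟨j - (ℓ + 1), by omega, by omega⟩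
  have hne : ∀ i ≤ ℓ, ∀ j ≤ I.hops y t, g i ≠ g (ℓ + 1 + j) := fun i hi j hj he => by
    have h5 := h.rank i hi
    rw [he, (h4 j hj).1] at h5
    omega
  refine ⟨h.first, ?_, ?_, ?_, ?_, ?_, ?_⟩
  · simpa using hg.2 0 (Nat.zero_le _)
  · intro j hj
    rcases hsplit j hj with hj | ⟨i, hi, rfl⟩
    · exact h.lt j hj
    · exact (h4 i hi).2
  · intro j hj
    rcases hsplit j hj.le with hj' | ⟨i, hi, rfl⟩
    · rcases hj'.lt_or_eq with hj' | rfl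
      · exact h.adj j hj'
      · rw [h.last, hgy]; exact hxy
    · exact h1 i (by omega)
  · rw [Finset.sum_range_add, Finset.sum_range_succ, h.sum, h2, h.last, hgy]
  · intro i hi j hj hij
    rcases hsplit i hi with hi | ⟨i, hi', rfl⟩ <;> rcases hsplit j hj with hj | ⟨j, hj', rfl⟩
    · exact h.inj i hi j hj hij
    · exact absurd hij (hne i hi j hj')
    · exact absurd hij.symm (hne j hj i hi')
    · rw [h3 i hi' j hj' hij]
  · intro j hj
    rcases hsplit j hj with hj | ⟨i, hi, rfl⟩
    · exact (h.rank j hj).trans hrk.le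
    · rw [(h4 i hi).1]

/-- The number of a component in the order of the tree, where the root has the number `0`. -/
noncomputable def rank (seq : List ℕ) (k i : ℕ) : ℕ := if i < k then seq.idxOf i + 1 else 0

theorem rank_lt {v h k : ℕ} {seq : List ℕ} {p pe : ℕ → ℕ}
    (HS : Span I.cost (I.Mt v h) h k seq p pe) (hkh : k ≤ h) {i : ℕ} (hi : i < k) :
    rank seq k (p i) < rank seq k i := by
  have := HS.rank_lt hkh hi
  rw [rank, rank, if_pos hi]
  split_ifs <;> omega

/-- The detours described by the oracle are simple paths that avoid the failing edges. -/
theorem exists_route {v h k : ℕ} {fl X Y H : ℕ → ℕ} {D : ℕ → ℝ} {seq : List ℕ} {p pe : ℕ → ℕ}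
    (hkh : k ≤ h) (hk : k ≤ I.dp v)
    (HS : Span I.cost (I.Mt v h) h k seq p pe)
    (HE : ∀ i < k, I.EntryOk v h k p pe fl X Y H D i) :
    ∀ t < I.n, I.askFl v k fl t ≠ 0 → ∃ g,
      I.Route v k X Y H D g t (I.askLen v k Y H t) (I.askD v k Y D t) ∧
      I.ValidSeq v k (rank seq k) g t (I.askLen v k Y H t) (I.askD v k Y D t) := by
  suffices hs : ∀ N, ∀ t < I.n, rank seq k (min k (I.ix v t)) = N → I.askFl v k fl t ≠ 0 → ∃ g,
      I.Route v k X Y H D g t (I.askLen v k Y H t) (I.askD v k Y D t) ∧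
      I.ValidSeq v k (rank seq k) g t (I.askLen v k Y H t) (I.askD v k Y D t) from
    fun t ht => hs _ t ht rfl
  intro N
  induction N using Nat.strong_induction_on with
  | _ N ih =>
    rintro t ht rfl hfl
    rcases le_or_gt k (I.ix v t) with hkt | hkt
    · obtain ⟨g, hg, -⟩ := I.exists_isTreeSeq (fun _ => 0) 0 I.r t
      rw [askLen, if_pos hkt, askD, if_pos hkt]
      exact ⟨g, .base t hkt hg, .base hk ht hkt hg⟩
    · rw [askFl, if_neg (by omega)] at hfl
      rcases HE _ hkt with ⟨-, h0⟩ | ⟨x, y, hxy, hx, hy, hf, hent⟩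
      · exact absurd h0 hfl
      · obtain ⟨hX, hY, hH, hD⟩ := hent hfl
        have hmx : rank seq k (min k (I.ix v x)) < rank seq k (min k (I.ix v t)) := by
          have h1 := rank_lt HS hkh hkt
          rw [← hx] at h1
          rw [min_eq_right hkt.le]
          refine lt_of_eq_of_lt ?_ h1
          rcases lt_or_ge (I.ix v x) k with h2 | h2
          · congr 1; omega
          · rw [rank, rank, if_neg (by omega), if_neg (by omega)]
        obtain ⟨g₀, hr₀, hv₀⟩ := ih _ hmx x hxy.lt.1 rfl (hf ▸ hfl)
        obtain ⟨g, hg, hgg⟩ := I.exists_isTreeSeq g₀ (I.askLen v k Y H x + 1) y t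
        have hr := hr₀.congr fun j hj => hgg j (Nat.lt_succ_of_le hj)
        have hv := hv₀.congr fun j hj => hgg j (Nat.lt_succ_of_le hj)
        refine ⟨g, ?_, ?_⟩
        · have := Route.step (D := D) (H := H) (g := g) t _ _ hkt (by rw [hX]; exact hr) hH
            (hX.symm ▸ hxy.lt.1) (hY.symm ▸ hxy.lt.2) (hY.symm ▸ hg)
          rw [askLen, if_neg (by omega), askD, if_neg (by omega)]
          rwa [← hH] at this
        · have := hv.step hk hxy.lt.2 ht (by omega) hxy.adj hmx hg
          rw [← hH, ← hD, ← hY] at this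
          rw [askLen, if_neg (by omega), askD, if_neg (by omega)]
          exact this

/-- The tree path from `i` to the root of the component tree has no edge that costs more
than `β`. -/
inductive Chain (cost : ℕ → WithTop ℝ) (k : ℕ) (p pe : ℕ → ℕ) (β : WithTop ℝ) : ℕ → Prop
  | root (i : ℕ) (hi : k ≤ i) : Chain cost k p pe β i
  | step (u : ℕ) (hu : u < k) (hc : cost (pe u) ≤ β) (hp : Chain cost k p pe β (p u)) :
      Chain cost k p pe β u

theorem chain_iff {cost : ℕ → WithTop ℝ} {k : ℕ} {p pe : ℕ → ℕ} {β : WithTop ℝ} {u : ℕ}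
    (hu : u < k) (hc : cost (pe u) ≤ β) : Chain cost k p pe β u ↔ Chain cost k p pe β (p u) := by
  refine ⟨fun h => ?_, .step u hu hc⟩
  cases h with
  | root _ hi => omega
  | step _ _ _ hp => exact hp

/-- If a walk of length at most `ω` from the root leads through the edge `x y`, and the component
of `x` is joined to the root by edges of cost at most `2 ω`, so is that of `y`. -/
theorem chain_of_adj {v h k : ℕ} {seq : List ℕ} {p pe : ℕ → ℕ} (hkh : k ≤ h)
    (HS : Span I.cost (I.Mt v h) h k seq p pe) {x y : ℕ} {ω : ℝ} (hxy : I.Adj v k x y)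
    (hω : I.ds x + I.W x y ≤ ω)
    (hx : Chain I.cost k p pe ((2 * ω : ℝ) : WithTop ℝ) (min h (I.ix v x))) :
    Chain I.cost k p pe ((2 * ω : ℝ) : WithTop ℝ) (min h (I.ix v y)) := by
  have htree : ∀ a, I.ix v a ≠ I.ix v (I.par a) → ¬ I.Fails v k a (I.par a) →
      k ≤ min h (I.ix v a) ∧ k ≤ min h (I.ix v (I.par a)) := fun a ha hf => by
    have h1 : a = I.par^[I.ix v a] v := I.tree.eq_of_idx_par_ne ha.symm
    have h2 : I.ix v a ≤ I.ix v (I.par a) := I.tree.idx_mono v (anc_par _ a)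
    have h3 : k ≤ I.ix v a := by
      by_contra hlt
      refine hf ⟨_, not_le.1 hlt, Or.inl ⟨h1, ?_⟩⟩
      rw [Function.iterate_succ_apply', ← h1]
    omega
  by_cases hy : I.par x = y
  · subst hy
    by_cases he : I.ix v x = I.ix v (I.par x)
    · rwa [← he]
    · exact .root _ (htree x he hxy.2).2
  by_cases hx' : I.par y = x
  · subst hx'
    by_cases he : I.ix v y = I.ix v (I.par y)
    · rwa [he]
    · exact .root _ (htree y he hxy.symm.2).1
  obtain ⟨⟨j, hj, hends⟩, -⟩ := id hxy
  have hE : I.Ends (j + 1) x y := ⟨by omega, hj, hy, hx', by simpa using hends⟩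
  refine (HS.closed ((2 * ω : ℝ) : WithTop ℝ) {i | Chain I.cost k p pe ((2 * ω : ℝ) : WithTop ℝ) i}
    (fun i j hi _ hj _ => ⟨fun _ => .root _ hj, fun _ => .root _ hi⟩)
    (fun u hu hc => chain_iff hu hc) (j + 1) _ _ ⟨x, y, hE, rfl, rfl⟩ ?_).1 hx
  rw [hE.cost_eq, WithTop.coe_le_coe]
  have := hxy.ds_le
  linarith

/-- The detour to a component at the end of a chain of `q` edges of cost at most `2 ω` is at most
`2 ω q` longer than a path in the shortest path tree. -/
theorem ask_of_chain {v h k : ℕ} {fl X Y H : ℕ → ℕ} {D : ℕ → ℝ} {seq : List ℕ} {p pe : ℕ → ℕ}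
    (hkh : k ≤ h) (HS : Span I.cost (I.Mt v h) h k seq p pe)
    (HE : ∀ i < k, I.EntryOk v h k p pe fl X Y H D i) {ω : ℝ} {i : ℕ}
    (hi : Chain I.cost k p pe ((2 * ω : ℝ) : WithTop ℝ) i) :
    ∃ A ⊆ Finset.range k, (∀ a ∈ A, rank seq k a ≤ rank seq k i) ∧
      ∀ t, min h (I.ix v t) = i → I.askFl v k fl t = 1 ∧
        I.askD v k Y D t ≤ I.ds t + A.card * (2 * ω) := by
  induction hi with
  | root i hi =>
    refine ⟨∅, by simp, by simp, fun t ht => ?_⟩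
    have h1 : k ≤ I.ix v t := by omega
    rw [askFl, if_pos h1, askD, if_pos h1]
    simp
  | step u hu hc hp ih =>
    obtain ⟨A, hA, hrk, hask⟩ := ih
    have hlt := rank_lt HS hkh hu
    have huA : u ∉ A := fun h => by
      have := hrk u h
      omega
    refine ⟨insert u A, Finset.insert_subset (Finset.mem_range.2 hu) hA, ?_, ?_⟩
    · intro a ha
      rcases Finset.mem_insert.1 ha with rfl | ha
      · exact le_rfl
      · exact (hrk a ha).trans hlt.le
    · intro t ht
      have hut : I.ix v t = u := by omega
      rcases HE u hu with ⟨h0, -⟩ | ⟨x, y, hxy, hx, hy, hf, hent⟩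
      · rw [h0, cost] at hc
        exact absurd (top_le_iff.1 hc) (WithTop.coe_ne_top)
      · obtain ⟨h1, h2⟩ := hask x hx
        rw [h1] at hf
        obtain ⟨hX, hY, hH, hD⟩ := hent (by omega)
        rw [askFl, if_neg (by omega), askD, if_neg (by omega), hut, hf, hY, hD,
          Finset.card_insert_of_notMem huA]
        refine ⟨rfl, ?_⟩
        rw [hxy.cost_eq, WithTop.coe_le_coe] at hc
        have h3 : 0 ≤ I.ds (I.lc y t) := ds_nonneg _
        rw [tlen]
        push_cast
        linarith

/-- The stretch: a chain has at most `k` edges, each of which costs at most twice the length `ω` of the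
walk that is compared with. -/
theorem ask_le_of_chain {v h k : ℕ} {fl X Y H : ℕ → ℕ} {D : ℕ → ℝ} {seq : List ℕ} {p pe : ℕ → ℕ}
    (hkh : k ≤ h) (HS : Span I.cost (I.Mt v h) h k seq p pe)
    (HE : ∀ i < k, I.EntryOk v h k p pe fl X Y H D i) {ω : ℝ} (hω : 0 ≤ ω) {t : ℕ}
    (ht : Chain I.cost k p pe ((2 * ω : ℝ) : WithTop ℝ) (min h (I.ix v t))) (htω : I.ds t ≤ ω) :
    I.askFl v k fl t = 1 ∧ I.askD v k Y D t ≤ (2 * k + 1) * ω := by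
  obtain ⟨A, hA, -, hask⟩ := ask_of_chain hkh HS HE ht
  obtain ⟨h1, h2⟩ := hask t rfl
  refine ⟨h1, h2.trans ?_⟩
  have h3 : (A.card : ℝ) ≤ k := by
    exact_mod_cast (Finset.card_le_card hA).trans (Finset.card_range k).le
  nlinarith

end Inst

/-! ### Range minima in constant time -/

/-- `v` is the least one of the values `A lo, …, A hi`. -/
def IsMin (A : ℕ → ℕ) (lo hi v : ℕ) : Prop :=
  (∀ q, lo ≤ q → q ≤ hi → v ≤ A q) ∧ ∃ q, lo ≤ q ∧ q ≤ hi ∧ v = A q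

theorem IsMin.min {A : ℕ → ℕ} {lo hi lo₁ hi₁ lo₂ hi₂ v₁ v₂ : ℕ} (h₁ : IsMin A lo₁ hi₁ v₁)
    (h₂ : IsMin A lo₂ hi₂ v₂) (h : ∀ q, (lo ≤ q ∧ q ≤ hi) ↔ (lo₁ ≤ q ∧ q ≤ hi₁) ∨
      (lo₂ ≤ q ∧ q ≤ hi₂)) : IsMin A lo hi (min v₁ v₂) := by
  refine ⟨fun q hq hq' => ?_, ?_⟩
  · rcases (h q).1 ⟨hq, hq'⟩ with h3 | h3
    · exact (min_le_left _ _).trans (h₁.1 q h3.1 h3.2)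
    · exact (min_le_right _ _).trans (h₂.1 q h3.1 h3.2)
  · rcases le_total v₁ v₂ with hle | hle
    · obtain ⟨q, hq, hq', he⟩ := h₁.2
      rw [min_eq_left hle]
      have := (h q).2 (Or.inl ⟨hq, hq'⟩)
      exact ⟨q, this.1, this.2, he⟩
    · obtain ⟨q, hq, hq', he⟩ := h₂.2
      rw [min_eq_right hle]
      have := (h q).2 (Or.inr ⟨hq, hq'⟩)
      exact ⟨q, this.1, this.2, he⟩

/-- Tables for range minima of `A` on `0, …, n`, which is divided into blocks of length `b`.
The bit mask of a position `q` holds the positions of its block at which the values from there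
up to `q` are minimal; `mn` holds the minima of `2 ^ j` consecutive blocks. -/
structure Rmq (n b : ℕ) (A mask low log pw mn : ℕ → ℕ) : Prop where
  b_pos : 1 ≤ b
  lt_pow : n < 2 ^ b
  pw_eq : ∀ j < b, pw j = 2 ^ j
  low_spec : ∀ x < 2 ^ b, x ≠ 0 → x.testBit (low x) = true ∧ ∀ j < low x, x.testBit j = false
  log_eq : ∀ x < 2 ^ b, 1 ≤ x → log x = Nat.log 2 x
  mask_spec : ∀ q ≤ n, ∀ j, (mask q).testBit j = true ↔ q / b * b + j ≤ q ∧
    ∀ q', q / b * b + j ≤ q' → q' ≤ q → A (q / b * b + j) ≤ A q'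
  mn_spec : ∀ x ≤ n / b, ∀ j < b, (x + 2 ^ j) * b ≤ n + 1 →
    IsMin A (x * b) ((x + 2 ^ j) * b - 1) (mn (x * b + j))

/-- Within a block: after the bits below `lo` have been shifted away, the lowest bit of the mask of `hi`
is the position of a minimum. -/
theorem Rmq.block {n b : ℕ} {A mask low log pw mn : ℕ → ℕ} (R : Rmq n b A mask low log pw mn)
    {lo hi : ℕ} (h : lo ≤ hi) (hn : hi ≤ n) (hb : lo / b = hi / b) :
    IsMin A lo hi (A (lo + low (mask hi / pw (lo - lo / b * b)))) := by
  have hb0 := R.b_pos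
  have h1 : lo / b * b ≤ lo := Nat.div_mul_le_self _ _
  have h2 : hi < hi / b * b + b := by
    have := Nat.lt_div_mul_add (a := hi) hb0; omega
  have hjb : lo - lo / b * b < b := by rw [← hb] at h2; omega
  rw [R.pw_eq _ hjb]
  have hbit : ∀ j, (mask hi / 2 ^ (lo - lo / b * b)).testBit j = true ↔ lo + j ≤ hi ∧
      ∀ q', lo + j ≤ q' → q' ≤ hi → A (lo + j) ≤ A q' := fun j => by
    rw [Nat.testBit_div_two_pow, R.mask_spec hi hn, ← hb,
      show lo / b * b + (j + (lo - lo / b * b)) = lo + j by omega]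
  -- the first one of the positions of the minimum is in the mask
  obtain ⟨q, hq1, hq2, hq3⟩ : ∃ q, lo ≤ q ∧ q ≤ hi ∧ ∀ q', lo ≤ q' → q' ≤ hi → A q ≤ A q' := by
    obtain ⟨q, hq, hq'⟩ := Finset.exists_min_image (Finset.Icc lo hi) A ⟨lo, by simp [h]⟩
    simp only [Finset.mem_Icc] at hq hq'
    exact ⟨q, hq.1, hq.2, fun q' h h' => hq' q' ⟨h, h'⟩⟩
  have hqbit : (mask hi / 2 ^ (lo - lo / b * b)).testBit (q - lo) = true := by
    rw [hbit, show lo + (q - lo) = q by omega]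
    exact ⟨hq2, fun q' h3 h4 => hq3 q' (by omega) h4⟩
  have hlt : mask hi / 2 ^ (lo - lo / b * b) < 2 ^ b := by
    refine (Nat.div_le_self _ _).trans_lt ?_
    refine Nat.lt_pow_two_of_testBit _ fun i hi' => ?_
    rw [Bool.eq_false_iff]
    intro h3
    have := ((R.mask_spec hi hn i).1 h3).1
    omega
  have hne : mask hi / 2 ^ (lo - lo / b * b) ≠ 0 := by
    intro h0
    rw [h0, Nat.zero_testBit] at hqbit
    exact absurd hqbit (by simp)
  obtain ⟨h3, h4⟩ := R.low_spec _ hlt hne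
  obtain ⟨h5, h6⟩ := (hbit _).1 h3
  set l := low (mask hi / 2 ^ (lo - lo / b * b))
  have hlq : l ≤ q - lo := by
    by_contra hcon
    rw [h4 _ (not_le.1 hcon)] at hqbit
    exact absurd hqbit (by simp)
  exact ⟨fun q' h7 h8 => (h6 q (by omega) hq2).trans (hq3 q' h7 h8), lo + l, by omega, h5, rfl⟩

/-- The minimum over the blocks `x, …, y - 1`: they are covered by two overlapping sequences of blocks
whose number is a power of two. -/
theorem Rmq.blocks {n b : ℕ} {A mask low log pw mn : ℕ → ℕ} (R : Rmq n b A mask low log pw mn)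
    {x y : ℕ} (h : x < y) (hn : y * b ≤ n) :
    y - x < 2 ^ b ∧ Nat.log 2 (y - x) < b ∧
    ∃ z₁ z₂, IsMin A (x * b) z₁ (mn (x * b + Nat.log 2 (y - x))) ∧
      IsMin A z₂ (y * b - 1) (mn ((y - 2 ^ Nat.log 2 (y - x)) * b + Nat.log 2 (y - x))) ∧
      z₁ < y * b ∧ x * b ≤ z₂ ∧ z₂ ≤ z₁ + 1 := by
  have hb0 := R.b_pos
  have hyn : y ≤ n := (Nat.le_mul_of_pos_right y hb0).trans hn
  have hlt : y - x < 2 ^ b := by have := R.lt_pow; omega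
  have hlog : Nat.log 2 (y - x) < b := Nat.log_lt_of_lt_pow (by omega) hlt
  have h1 : 2 ^ Nat.log 2 (y - x) ≤ y - x := Nat.pow_log_le_self 2 (by omega)
  have h2 : y - x < 2 ^ (Nat.log 2 (y - x) + 1) := Nat.lt_pow_succ_log_self (by norm_num) _
  rw [pow_succ] at h2
  set j := Nat.log 2 (y - x)
  have hyb : y ≤ n / b := (Nat.le_div_iff_mul_le hb0).2 hn
  have h3 : (x + 2 ^ j) * b ≤ y * b := Nat.mul_le_mul_right _ (by omega)
  have h4 : (y - 2 ^ j + 2 ^ j) * b = y * b := by congr 1; omega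
  have h5 : x * b ≤ (y - 2 ^ j) * b := Nat.mul_le_mul_right _ (by omega)
  have h6 : (y - 2 ^ j) * b ≤ (x + 2 ^ j) * b := Nat.mul_le_mul_right _ (by omega)
  have h7 : 0 < (x + 2 ^ j) * b := Nat.mul_pos (by positivity) hb0
  have e1 := R.mn_spec x (by omega) j hlog (by omega)
  have e2 := R.mn_spec (y - 2 ^ j) (by omega) j hlog (by omega)
  rw [h4] at e2
  exact ⟨hlt, hlog, _, _, e1, e2, by omega, h5, by omega⟩

/-! ### Names of variables and arrays -/

-- The word arrays of the oracle: parents; `f` (cell `0`) and the block length (cell `1`); depths;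
-- preorder numbers, which start from `1`; by these numbers, the number of the parent, and the vertex;
-- the five tables for range minima; and by the address of an entry, its mark, the ends `x` and `y` of
-- the edge by which the detour enters the component, and the number of edges up to `y`.
notation "aPar" => (0 : ℕ)
notation "aPrm" => (3 : ℕ)
notation "aDep" => (4 : ℕ)
notation "aPos" => (5 : ℕ)
notation "aTop" => (6 : ℕ)
notation "aAt" => (7 : ℕ)
notation "aPow" => (8 : ℕ)
notation "aLog" => (9 : ℕ)
notation "aLow" => (10 : ℕ)
notation "aMask" => (11 : ℕ)
notation "aMin" => (12 : ℕ)
notation "aFl" => (13 : ℕ)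
notation "aX" => (14 : ℕ)
notation "aY" => (15 : ℕ)
notation "aH" => (16 : ℕ)
-- The real arrays of the oracle: distances from the root, and the lengths of the detours up to `y`.
notation "bDs" => (1 : ℕ)
notation "bD" => (2 : ℕ)
-- variables of the computation of lowest common ancestors
notation "vU" => (10 : ℕ)
notation "vV" => (11 : ℕ)
notation "vLca" => (12 : ℕ)
notation "vLo" => (13 : ℕ)
notation "vHi" => (14 : ℕ)
notation "vBl" => (15 : ℕ)
notation "vBh" => (16 : ℕ)
notation "vRes" => (17 : ℕ)
notation "vTmp" => (18 : ℕ)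
notation "vJ" => (19 : ℕ)

/-! ### Lowest common ancestors in constant time -/

open NExpr Cmd
set_option linter.unusedSimpArgs false

/-- The block length, which is a cell of the oracle. -/
def eB : NExpr := get aPrm 1

/-- The least value between two positions of the same block. -/
def eBlock (lo hi : NExpr) : NExpr :=
  get aTop (lo + get aLow (get aMask hi / get aPow (lo - lo / eB * eB)))

/-- Replaces the value of `vRes` by that of `vTmp` if this is less. -/
def cUpd : Cmd := branch (.lt (var vTmp) (var vRes)) (setN vRes (var vTmp)) nop

/-- The least value between the positions `vLo` and `vHi`. -/
def cRmq : Cmd :=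
  setN vBl (var vLo / eB) ;; setN vBh (var vHi / eB) ;;
  branch (.eq (var vBl) (var vBh))
    (setN vRes (eBlock (var vLo) (var vHi)))
    (setN vRes (eBlock (var vLo) (var vBl * eB + eB - 1)) ;;
      setN vTmp (eBlock (var vBh * eB) (var vHi)) ;; cUpd ;;
      branch (.lt (var vBl + 1) (var vBh))
        (setN vJ (get aLog (var vBh - (var vBl + 1))) ;;
          setN vTmp (get aMin ((var vBl + 1) * eB + var vJ)) ;; cUpd ;;
          setN vTmp (get aMin ((var vBh - get aPow (var vJ)) * eB + var vJ)) ;; cUpd)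
        nop)

/-- The lowest common ancestor of `vU` and `vV`. -/
def cLca : Cmd :=
  setN vLo (get aPos (var vU) + 1) ;; setN vHi (get aPos (var vV)) ;;
  branch (.lt (var vHi) (var vLo))
    (setN vLo (get aPos (var vV) + 1) ;; setN vHi (get aPos (var vU))) nop ;;
  branch (.lt (var vHi) (var vLo)) (setN vLca (var vU))
    (cRmq ;; setN vLca (get aAt (var vRes)))

theorem setN_self (s : State) (x : ℕ) : s.setN x (s.iv x) = s := by
  simp [State.setN]

theorem fn_cUpd {B : ℕ} {s : State} {Q : State → Prop} (h : s.iv vTmp ≤ B) :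
    Fn B cUpd s Q ↔ Q (s.setN vRes (min (s.iv vRes) (s.iv vTmp))) := by
  rw [cUpd, fn_branch, fn_setN, fn_nop]
  simp only [holds_lt, eval_var]
  rcases lt_or_ge (s.iv vTmp) (s.iv vRes) with h1 | h1
  · simp [h1, min_eq_right h1.le, h]
  · rw [min_eq_left h1, setN_self]
    simp [not_lt.2 h1]

theorem fn_cRmq {B n : ℕ} {s : State}
    (R : Rmq n (s.ia aPrm 1) (s.ia aTop) (s.ia aMask) (s.ia aLow) (s.ia aLog) (s.ia aPow)
      (s.ia aMin))
    (hB : n + 1 ≤ B) (hA : ∀ q ≤ n, s.ia aTop q ≤ n) (h : s.iv vLo ≤ s.iv vHi)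
    (hn : s.iv vHi ≤ n) (hlog : ∀ x < 2 ^ s.ia aPrm 1, 1 ≤ x → s.ia aLog x ≤ B) :
    Fn B cRmq s (fun s' => IsMin (s.ia aTop) (s.iv vLo) (s.iv vHi) (s'.iv vRes)) := by
  have hAB : ∀ lo hi v, hi ≤ n → IsMin (s.ia aTop) lo hi v → v ≤ B := fun lo hi v h1 h2 => by
    obtain ⟨q, h3, h4, rfl⟩ := h2.2
    have := hA q (by omega)
    omega
  have hdl := Nat.div_le_self (s.iv vLo) (s.ia aPrm 1)
  have hdh := Nat.div_le_self (s.iv vHi) (s.ia aPrm 1)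
  have hb0 := R.b_pos
  simp only [cRmq, fn_seq, fn_setN, fn_branch, eB, eBlock, eval_div, eval_var, eval_get,
    eval_ofNat, eval_add, eval_sub, eval_mul, holds_eq, holds_lt, setN_ia, ne_eq,
    setN_iv_self, setN_iv_ne, not_false_eq_true, Nat.reduceEqDiff,
    true_and, eval_lit]
  refine ⟨by omega, by omega, fun he => ?_, fun hne => ?_⟩
  · have := R.block h hn he
    exact ⟨hAB _ _ _ hn this, this⟩
  · set b := s.ia aPrm 1
    have hlt : s.iv vLo / b < s.iv vHi / b :=
      lt_of_le_of_ne (Nat.div_le_div_right h) hne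
    have hbh : s.iv vHi / b * b ≤ s.iv vHi := Nat.div_mul_le_self _ _
    have hbl : s.iv vLo / b * b ≤ s.iv vLo := Nat.div_mul_le_self _ _
    have hblt : s.iv vLo < s.iv vLo / b * b + b := Nat.lt_div_mul_add hb0
    have hmul : s.iv vLo / b * b + b ≤ s.iv vHi / b * b := by
      rw [← Nat.succ_mul]; exact Nat.mul_le_mul_right _ hlt
    have e1 := R.block (lo := s.iv vLo) (hi := s.iv vLo / b * b + b - 1) (by omega) (by omega)
      (by
        rw [show s.iv vLo / b * b + b - 1 = (b - 1) + b * (s.iv vLo / b) by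
          rw [Nat.mul_comm b]; omega, Nat.add_mul_div_left _ _ hb0,
          Nat.div_eq_of_lt (show b - 1 < b by omega), zero_add])
    have e2 := R.block (lo := s.iv vHi / b * b) (hi := s.iv vHi) hbh hn
      (by rw [Nat.mul_div_cancel _ hb0])
    have b1 := hAB _ _ _ (by omega) e1
    have b2 := hAB _ _ _ hn e2
    refine ⟨b1, b2, ?_⟩
    rw [fn_cUpd (by simpa using b2)]
    simp only [setN_ia, ne_eq,
      setN_iv_self, setN_iv_ne, not_false_eq_true, Nat.reduceEqDiff]
    refine ⟨fun hgap => ?_, fun hgap => ?_⟩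
    · obtain ⟨l1, l2, z₁, z₂, m1, m2, hz1, hz2, hz⟩ :=
        R.blocks (x := s.iv vLo / b + 1) (y := s.iv vHi / b) hgap (by omega)
      rw [Nat.succ_mul] at m1 hz2
      have b3 := hAB _ _ _ (by omega) m1
      have b4 := hAB _ _ _ (by omega) m2
      have hl := R.log_eq _ l1 (by omega)
      have hp := R.pw_eq _ l2
      simp only [hl, hp, Nat.succ_mul]
      refine ⟨by rw [← hl]; exact hlog _ l1 (by omega), b3, ?_⟩
      rw [fn_cUpd (by simpa using b3)]
      simp only [setN_ia, ne_eq, hl, hp,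
        setN_iv_self, setN_iv_ne, not_false_eq_true, Nat.reduceEqDiff]
      refine ⟨b4, ?_⟩
      rw [fn_cUpd (by simpa using b4)]
      simp only [setN_ia, ne_eq,
        setN_iv_self, setN_iv_ne, not_false_eq_true, Nat.reduceEqDiff]
      obtain ⟨q1, hq1, hq1', -⟩ := m1.2
      obtain ⟨q2, hq2, hq2', -⟩ := m2.2
      rw [min_assoc, min_assoc]
      refine e1.min (e2.min (m1.min (lo := s.iv vLo / b * b + b) (hi := s.iv vHi / b * b - 1) m2
        fun q => ?_) (lo := s.iv vLo / b * b + b) (hi := s.iv vHi) fun q => ?_) fun q => ?_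
      all_goals omega
    · rw [fn_nop]
      simp only [ne_eq,
        setN_iv_self, setN_iv_ne, not_false_eq_true, Nat.reduceEqDiff]
      have h8 : s.iv vHi / b = s.iv vLo / b + 1 := by omega
      have h9 : s.iv vHi / b * b = s.iv vLo / b * b + b := by rw [h8, Nat.succ_mul]
      refine e1.min e2 fun q => ?_
      omega

namespace Inst

variable (I : Inst)

/-- The arrays of the state hold the tree. -/
structure TreeOk (s : State) : Prop where
  par : ∀ v < I.n, s.ia aPar v = I.par v
  dp : ∀ v < I.n, s.ia aDep v = I.dp v
  ds : ∀ v < I.n, s.ra bDs v = I.ds v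

/-- The arrays of the state hold the tables for lowest common ancestors: range minima of the
numbers of the parents, in the order of a preorder numbering. -/
structure LcaOk (s : State) : Prop where
  pre : IsPre I.par {x | x < I.n} (s.ia aPos)
  pos_pos : ∀ v < I.n, 1 ≤ s.ia aPos v
  pos_le : ∀ v < I.n, s.ia aPos v ≤ I.n
  at_pos : ∀ v < I.n, s.ia aAt (s.ia aPos v) = v
  top_pos : ∀ v < I.n, s.ia aTop (s.ia aPos v) = s.ia aPos (I.par v)
  top_le : ∀ q ≤ I.n, s.ia aTop q ≤ I.n
  b_le : s.ia aPrm 1 ≤ I.n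
  pow_le : 2 ^ s.ia aPrm 1 ≤ 2 * I.n
  rmq : Rmq I.n (s.ia aPrm 1) (s.ia aTop) (s.ia aMask) (s.ia aLow) (s.ia aLog) (s.ia aPow)
    (s.ia aMin)

variable {I}

/-- The preorder numbers are exactly `1, …, n`. -/
theorem LcaOk.surj {s : State} (h : I.LcaOk s) {q : ℕ} (hq : 1 ≤ q) (hqn : q ≤ I.n) :
    ∃ v < I.n, s.ia aPos v = q := by
  have h1 := Finset.surj_on_of_inj_on_of_card_le (s := Finset.range I.n) (t := Finset.Icc 1 I.n)
    (fun v _ => s.ia aPos v)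
    (fun v hv => by
      rw [Finset.mem_range] at hv
      exact Finset.mem_Icc.2 ⟨h.pos_pos v hv, h.pos_le v hv⟩)
    (fun v w hv hw he => h.pre.inj v (by simpa using hv) w (by simpa using hw) he)
    (by simp) q (Finset.mem_Icc.2 ⟨hq, hqn⟩)
  obtain ⟨v, hv, he⟩ := h1
  exact ⟨v, Finset.mem_range.1 hv, he.symm⟩

/-- Among the vertices that are numbered after `u` and up to `v`, one that has a parent of least number
is a child of the lowest common ancestor of `u` and `v`. -/
theorem LcaOk.at_eq_lc {s : State} (h : I.LcaOk s) {u v m : ℕ} (hu : u < I.n) (hv : v < I.n)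
    (huv : s.ia aPos u < s.ia aPos v)
    (hm : IsMin (s.ia aTop) (s.ia aPos u + 1) (s.ia aPos v) m) : s.ia aAt m = I.lc u v := by
  obtain ⟨h1, z, hz, hz1, hz2, hz3⟩ := h.pre.lca_min I.tree I.par_lt hu hv huv
  obtain ⟨h2, q, hq1, hq2, rfl⟩ := hm
  obtain ⟨w, hw, rfl⟩ := h.surj (q := q) (by omega) (hq2.trans (h.pos_le v hv))
  rw [h.top_pos w hw] at h2 ⊢
  have h3 := h1 w hw (by omega) hq2
  have h4 := h2 _ hz1 hz2
  rw [h.top_pos z hz, hz3] at h4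
  have hl : lca I.par u v < I.n := hz3 ▸ I.par_lt z
  rw [show s.ia aPos (I.par w) = s.ia aPos (lca I.par u v) from le_antisymm h4 h3,
    h.at_pos _ hl, lc]

theorem fn_cLca {B : ℕ} {s : State} (h : I.LcaOk s) (hB : I.n + 1 ≤ B) (hu : s.iv vU < I.n)
    (hv : s.iv vV < I.n) :
    Fn B cLca s (fun s' => s'.iv vLca = I.lc (s.iv vU) (s.iv vV)) := by
  have hpu := h.pos_le _ hu
  have hpv := h.pos_le _ hv
  have hl : I.lc (s.iv vU) (s.iv vV) < I.n := lt_of_anc hu (IsTree.lca_anc_left _ _)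
  have hlog : ∀ x < 2 ^ s.ia aPrm 1, 1 ≤ x → s.ia aLog x ≤ B := fun x hx hx1 => by
    rw [h.rmq.log_eq x hx hx1]
    have := Nat.log_lt_of_lt_pow (by omega) hx
    have := h.b_le
    omega
  have key : ∀ s₁ : State, s₁.ia = s.ia → s₁.iv vLo ≤ s₁.iv vHi → s₁.iv vHi ≤ I.n →
      (∀ m, IsMin (s.ia aTop) (s₁.iv vLo) (s₁.iv vHi) m →
        s.ia aAt m = I.lc (s.iv vU) (s.iv vV)) →
      Fn B cRmq s₁ (fun s' => s'.ia aAt (s'.iv vRes) ≤ B ∧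
        s'.ia aAt (s'.iv vRes) = I.lc (s.iv vU) (s.iv vV)) := fun s₁ h1 h2 h3 h4 => by
    refine (fn_cRmq (n := I.n) (h1 ▸ h.rmq) hB (h1 ▸ h.top_le) h2 h3 (h1 ▸ hlog)).mono ?_
    intro s₂ hf hm
    rw [h1] at hm
    rw [hf.ia aAt rfl, h1, h4 _ hm]
    omega
  simp only [cLca, fn_seq, fn_setN, fn_branch, fn_nop, eval_var, eval_get, eval_ofNat, eval_add,
    holds_lt, setN_ia, ne_eq, setN_iv_self, setN_iv_ne, not_false_eq_true, Nat.reduceEqDiff]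
  refine ⟨by omega, by omega, fun h1 => ⟨by omega, by omega, fun h2 => ⟨by omega, ?_⟩,
    fun h2 => ?_⟩, fun h1 => ⟨fun h2 => absurd h2 h1, fun h2 => ?_⟩⟩
  · rw [h.pre.inj _ hu _ hv (by omega), lc, I.tree.lca_self]
  · refine key _ rfl ?_ ?_ fun m hm => ?_
    · simp; omega
    · simp; omega
    simp only [setN_iv_self, setN_iv_ne, ne_eq, not_false_eq_true, Nat.reduceEqDiff] at hm
    rw [lc, I.tree.lca_comm]
    exact h.at_eq_lc hv hu (by omega) hm
  · refine key _ rfl ?_ ?_ fun m hm => ?_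
    · simp; omega
    · simp; omega
    simp only [setN_iv_self, setN_iv_ne, ne_eq, not_false_eq_true, Nat.reduceEqDiff] at hm
    exact h.at_eq_lc hu hv (by omega) hm

end Inst

/-! ### Building the tables for lowest common ancestors -/

-- the input
notation "vN" => (0 : ℕ)
notation "vM" => (1 : ℕ)
notation "vF" => (2 : ℕ)
notation "vR" => (3 : ℕ)
-- variables of the construction of the tables
notation "vB" => (46 : ℕ)
notation "vP" => (47 : ℕ)
notation "vX" => (48 : ℕ)
notation "vHalf" => (49 : ℕ)
notation "vN1" => (50 : ℕ)
notation "vQ" => (51 : ℕ)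
notation "vStart" => (52 : ℕ)
notation "vMsk" => (53 : ℕ)
notation "vCur" => (54 : ℕ)
notation "vNb" => (55 : ℕ)
notation "vI" => (56 : ℕ)

/-- The powers of two, and the block length. -/
def cPow : Cmd :=
  setN vB 0 ;; setN vP 1 ;; putN aPow 0 1 ;;
  loop (.nle (var vP) (var vN))
    (setN vB (var vB + 1) ;; setN vP (var vP * 2) ;; putN aPow (var vB) (var vP)) ;;
  putN aPrm 1 (var vB)

/-- Binary logarithms, and the positions of the lowest bits. -/
def cBits : Cmd :=
  forUp vX vP
    (setN vHalf (var vX / 2) ;;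
    branch (.nle (var vX) 1) (putN aLog (var vX) 0)
      (putN aLog (var vX) (get aLog (var vHalf) + 1)) ;;
    branch (.conj (.eq (var vHalf * 2) (var vX)) (.nle 1 (var vX)))
      (putN aLow (var vX) (get aLow (var vHalf) + 1)) (putN aLow (var vX) 0))

/-- The start of the computation of the mask of the position `vQ`. -/
def cMaskInit : Cmd :=
  setN vStart (var vQ / var vB * var vB) ;; setN vMsk 0 ;; setN vCur (get aTop (var vQ)) ;;
  setN vX (var vQ + 1)

/-- One more position, to the left, is taken into account in the mask. -/
def cMaskStep : Cmd :=
  setN vX (var vX - 1) ;; setN vMsk (var vMsk * 2) ;;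
  branch (.nle (get aTop (var vX)) (var vCur))
    (setN vMsk (var vMsk + 1) ;; setN vCur (get aTop (var vX))) nop

/-- The mask of the position `vQ`. -/
def cMaskOne : Cmd :=
  cMaskInit ;; loop (.lt (var vStart) (var vX)) cMaskStep ;; putN aMask (var vQ) (var vMsk)

/-- The masks of the suffix minima. -/
def cMask : Cmd := setN vN1 (var vN + 1) ;; forUp vQ vN1 cMaskOne

theorem runs_cPow {B n : ℕ} {s : State} (hn : s.iv vN = n) (hn1 : 1 ≤ n) (hB : 2 * n ≤ B) :
    Runs B cPow s (50 * n + 50) (fun s' => s'.ia aPrm 1 = s'.iv vB ∧ s'.iv vP = 2 ^ s'.iv vB ∧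
      1 ≤ s'.iv vB ∧ s'.iv vB ≤ n ∧ n < 2 ^ s'.iv vB ∧ 2 ^ s'.iv vB ≤ 2 * n ∧
      ∀ j ≤ s'.iv vB, s'.ia aPow j = 2 ^ j) := by
  have h1 : Runs B (setN vB 0) s 2 (fun s' => s' = s.setN vB 0) :=
    Fn.runs (by rw [fn_setN]; simp) rfl le_rfl
  refine h1.seq (N₂ := 50 * n + 48) ?_ (by omega)
  rintro s₁ - rfl
  have h2 : Runs B (setN vP 1) (s.setN vB 0) 2 (fun s' => s' = (s.setN vB 0).setN vP 1) :=
    Fn.runs (by rw [fn_setN]; simp; omega) rfl le_rfl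
  refine h2.seq (N₂ := 50 * n + 46) ?_ (by omega)
  rintro s₁ - rfl
  have h3 : Runs B (putN aPow 0 1) ((s.setN vB 0).setN vP 1) 3 (fun s' => s'.iv vB = 0 ∧
      s'.iv vP = 1 ∧ s'.ia aPow 0 = 1 ∧ s'.iv vN = n) :=
    Fn.runs (by rw [fn_putN]; simp [hn]; omega) rfl le_rfl
  refine h3.seq (N₂ := 50 * n + 43) ?_ (by omega)
  rintro s₁ - ⟨hb, hp, hpow, hn'⟩
  have h4 := Runs.while (B := B) (c := 12) (b := .nle (var vP) (var vN)) (s₀ := s₁)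
    (p := setN vB (var vB + 1) ;; setN vP (var vP * 2) ;; putN aPow (var vB) (var vP))
    (I := fun s => s.iv vP = 2 ^ s.iv vB ∧ s.iv vB ≤ n ∧ 2 ^ s.iv vB ≤ 2 * n ∧
      ∀ j ≤ s.iv vB, s.ia aPow j = 2 ^ j) (fun s => n - s.iv vB) ?_ ?_
  · refine h4.seq (N₂ := 4) ?_ ?_
    · rintro s₂ hf ⟨⟨i1, i2, i3, i4⟩, hb'⟩
      have hn2 : s₂.iv vN = n := by rw [hf.iv vN rfl, hn']
      simp only [holds_nle, eval_var, i1, hn2, not_le] at hb'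
      refine Fn.runs ?_ rfl (by decide)
      rw [fn_putN]
      have : 1 ≤ s₂.iv vB := by
        by_contra h0
        rw [show s₂.iv vB = 0 by omega] at hb'
        simp at hb'; omega
      simp [i1]
      exact ⟨by omega, by omega, this, i2, hb', i3, i4⟩
    · simp only [Test.cost, NExpr.cost, hb]
      omega
  · rw [hb, hp]
    refine ⟨rfl, by omega, by omega, fun j hj => ?_⟩
    rw [Nat.le_zero.1 hj, hpow]; rfl
  · rintro s₂ hf ⟨i1, i2, i3, i4⟩ hb'
    have hn2 : s₂.iv vN = n := by rw [hf.iv vN rfl, hn']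
    simp only [holds_nle, eval_var, i1, hn2] at hb'
    have hlt : s₂.iv vB < 2 ^ s₂.iv vB := Nat.lt_two_pow_self
    refine Fn.runs ?_ rfl (by decide)
    simp only [fn_seq, fn_setN, fn_putN, eval_var, eval_ofNat, eval_add, eval_mul, putN_iv,
      putN_ia_self, ne_eq, setN_iv_self, setN_iv_ne, not_false_eq_true, Nat.reduceEqDiff, i1,
      setN_ia, pow_succ, true_and]
    refine ⟨by omega, by omega, by omega, by omega, ⟨by omega, by omega, fun j hj => ?_⟩, by omega⟩
    rw [Function.update_apply]
    split_ifs with hj'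
    · rw [hj', pow_succ]
    · exact i4 j (by omega)

theorem testBit_double (x j : ℕ) : (x * 2).testBit (j + 1) = x.testBit j := by
  rw [Nat.testBit_succ, Nat.mul_div_cancel _ (by norm_num)]

theorem testBit_double_zero (x : ℕ) : (x * 2).testBit 0 = false := by
  rw [Nat.testBit_zero]; simp

theorem testBit_double_succ (x j : ℕ) : (x * 2 + 1).testBit (j + 1) = x.testBit j := by
  rw [Nat.testBit_succ]; congr 1; omega

theorem testBit_double_succ_zero (x : ℕ) : (x * 2 + 1).testBit 0 = true := by
  rw [Nat.testBit_zero]; simp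

theorem runs_cBits {B N : ℕ} {s : State} (hN : s.iv vP = N) (hB : N ≤ B) :
    Runs B cBits s (60 * N + 60) (fun s' => (∀ x < N, 1 ≤ x → s'.ia aLog x = Nat.log 2 x) ∧
      ∀ x < N, x ≠ 0 → x.testBit (s'.ia aLow x) = true ∧
        ∀ j < s'.ia aLow x, x.testBit j = false) := by
  have h1 := Runs.forUp (B := B) (c := 40) (i := vX) (x := vP) (s₀ := s) (N := N)
    (p := setN vHalf (var vX / 2) ;;
    branch (.nle (var vX) 1) (putN aLog (var vX) 0)
      (putN aLog (var vX) (get aLog (var vHalf) + 1)) ;;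
    branch (.conj (.eq (var vHalf * 2) (var vX)) (.nle 1 (var vX)))
      (putN aLow (var vX) (get aLow (var vHalf) + 1)) (putN aLow (var vX) 0))
    (fun j s => (∀ x < j, 1 ≤ x → s.ia aLog x = Nat.log 2 x) ∧
      (∀ x < j, s.ia aLow x ≤ x) ∧ ∀ x < j, x ≠ 0 → x.testBit (s.ia aLow x) = true ∧
        ∀ j < s.ia aLow x, x.testBit j = false) hN hB rfl rfl ?_ ?_
  · exact h1.mono (by omega) fun s' _ h => ⟨h.1, h.2.2⟩
  · exact ⟨fun x hx => absurd hx (by omega), fun x hx => absurd hx (by omega),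
      fun x hx => absurd hx (by omega)⟩
  · rintro j s hj - hij ⟨i1, i2, i3⟩
    refine Fn.runs ?_ rfl (by decide)
    have hext : ∀ (f : ℕ → ℕ) (v x : ℕ), x < j → Function.update f j v x = f x := fun f v x hx =>
      Function.update_of_ne (by omega) _ _
    have key : ∀ s' : State, s'.iv = (s.setN vHalf (j / 2)).iv →
        (∀ x, s'.ia aLow x = s.ia aLow x) → (∀ x < j + 1, 1 ≤ x → s'.ia aLog x = Nat.log 2 x) →
        Fn B (branch (.conj (.eq (var vHalf * 2) (var vX)) (.nle 1 (var vX)))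
          (putN aLow (var vX) (get aLow (var vHalf) + 1)) (putN aLow (var vX) 0)) s'
          (fun s' => (∀ x < j + 1, 1 ≤ x → (s'.setN vX (j + 1)).ia aLog x = Nat.log 2 x) ∧
          (∀ x < j + 1, (s'.setN vX (j + 1)).ia aLow x ≤ x) ∧
          ∀ x < j + 1, x ≠ 0 → x.testBit ((s'.setN vX (j + 1)).ia aLow x) = true ∧
          ∀ j_1 < (s'.setN vX (j + 1)).ia aLow x, x.testBit j_1 = false) := by
      intro s' h2 h3 h4
      simp only [fn_branch, fn_putN, holds_conj, holds_eq, holds_nle, eval_var, eval_ofNat,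
        eval_add, eval_mul, eval_get, h2, setN_ia, putN_ia_self, putN_ia_ne, ne_eq, setN_iv_self,
        setN_iv_ne, not_false_eq_true, Nat.reduceEqDiff, hij, h3]
      refine ⟨fun h5 => ?_, fun h5 => ?_⟩
      · have h6 := i2 (j / 2) (by omega)
        obtain ⟨h7, h8⟩ := i3 (j / 2) (by omega) (by omega)
        refine ⟨by omega, by omega, h4, fun x hx => ?_, fun x hx hx0 => ?_⟩ <;>
          rcases Nat.lt_succ_iff_lt_or_eq.1 hx with hx | rfl
        · rw [hext _ _ _ hx, h3]; exact i2 x hx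
        · rw [Function.update_self]; omega
        · rw [hext _ _ _ hx, h3]; exact i3 x hx hx0
        · rw [Function.update_self]
          generalize s.ia aLow (x / 2) = l at *
          have h9 : x = x / 2 * 2 := h5.1.symm
          constructor
          · rw [h9, testBit_double]; exact h7
          · rintro (_ | i) hi
            · rw [h9, testBit_double_zero]
            · rw [h9, testBit_double]; exact h8 i (by omega)
      · refine ⟨by omega, by omega, h4, fun x hx => ?_, fun x hx hx0 => ?_⟩ <;>
          rcases Nat.lt_succ_iff_lt_or_eq.1 hx with hx | rfl
        · rw [hext _ _ _ hx, h3]; exact i2 x hx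
        · rw [Function.update_self]; omega
        · rw [hext _ _ _ hx, h3]; exact i3 x hx hx0
        · rw [Function.update_self]
          refine ⟨?_, fun i hi => absurd hi (by omega)⟩
          rw [Nat.testBit_zero, decide_eq_true_eq]
          by_contra h6
          exact h5 ⟨by omega, by omega⟩
    simp only [fn_seq, fn_setN]
    refine ⟨by simp; omega, ?_⟩
    rw [fn_branch]
    simp only [fn_putN, holds_nle, eval_var, eval_ofNat, eval_div,
        eval_add, eval_mul, eval_get, setN_ia, putN_ia_self, putN_ia_ne, ne_eq, setN_iv_self,
        setN_iv_ne, not_false_eq_true, Nat.reduceEqDiff, hij]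
    refine ⟨fun h5 => ⟨by omega, by omega, key _ rfl (fun _ => by simp) fun x hx hx1 => ?_⟩,
      fun h5 => ?_⟩
    · simp only [setN_ia, putN_ia_self]
      rcases Nat.lt_succ_iff_lt_or_eq.1 hx with hx | rfl
      · rw [hext _ _ _ hx]; exact i1 x hx hx1
      · obtain rfl : x = 1 := by omega
        simp
    · have h6 := i1 (j / 2) (by omega) (by omega)
      have h7 : Nat.log 2 j = Nat.log 2 (j / 2) + 1 :=
        Nat.log_of_one_lt_of_le (by norm_num) (by omega)
      have h8 : Nat.log 2 j < j := Nat.log_lt_self 2 (by omega)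
      refine ⟨by omega, by omega, key _ rfl (fun _ => by simp) fun x hx hx1 => ?_⟩
      simp only [setN_ia, putN_ia_self]
      rcases Nat.lt_succ_iff_lt_or_eq.1 hx with hx | rfl
      · rw [hext _ _ _ hx]; exact i1 x hx hx1
      · rw [Function.update_self, h6, h7]

theorem runs_cMask {B n b : ℕ} {s : State} (hn : s.iv vN = n) (hb : s.iv vB = b) (hb1 : 1 ≤ b)
    (hbn : b ≤ n) (hB : 2 * n + 2 ≤ B) (hpow : 2 ^ b ≤ 2 * n) (hA : ∀ q ≤ n, s.ia aTop q ≤ n) :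
    Runs B cMask s (200 * (n * n) + 200) (fun s' => s'.iv vN1 = n + 1 ∧
      ∀ q ≤ n, ∀ j, (s'.ia aMask q).testBit j = true ↔ q / b * b + j ≤ q ∧
        ∀ q', q / b * b + j ≤ q' → q' ≤ q → s.ia aTop (q / b * b + j) ≤ s.ia aTop q') := by
  have h0 : Runs B (setN vN1 (var vN + 1)) s 4 (fun s' => s' = s.setN vN1 (n + 1)) :=
    Fn.runs (by rw [fn_setN]; simp [hn]; omega) rfl (by decide)
  refine h0.seq (N₂ := 200 * (n * n) + 190) ?_ (by omega)
  rintro s₁ - rfl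
  have h1 := Runs.forUp (B := B) (c := n * 40 + 50) (i := vQ) (x := vN1)
    (s₀ := s.setN vN1 (n + 1)) (N := n + 1)
    (p := cMaskOne)
    (fun i s' => ∀ q < i, ∀ j, (s'.ia aMask q).testBit j = true ↔ q / b * b + j ≤ q ∧
        ∀ q', q / b * b + j ≤ q' → q' ≤ q → s.ia aTop (q / b * b + j) ≤ s.ia aTop q')
    (by simp) (by omega) rfl rfl ?_ ?_
  · refine h1.mono ?_ fun s' hf h => ⟨by rw [hf.iv vN1 rfl]; simp, fun q hq => h q (by omega)⟩
    nlinarith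
  · exact fun q hq => absurd hq (by omega)
  · rintro q s₁ hq hf hiq hI
    have hb₁ : s₁.iv vB = b := by rw [hf.iv vB rfl]; simpa using hb
    have hA₁ : s₁.ia aTop = s.ia aTop := by rw [hf.ia aTop rfl]; simp
    have hqb : q / b * b ≤ q := Nat.div_mul_le_self _ _
    have hqb' : q < q / b * b + b := Nat.lt_div_mul_add hb1
    have h2 : Fn B cMaskInit s₁ (fun s' =>
        s'.iv vStart = q / b * b ∧ s'.iv vMsk = 0 ∧ s'.iv vCur = s.ia aTop q ∧
          s'.iv vX = q + 1 ∧ s'.iv vQ = q ∧ s'.ia = s₁.ia) := by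
      simp only [cMaskInit, fn_seq, fn_setN, eval_var, eval_ofNat, eval_div, eval_add, eval_mul,
        eval_get, setN_ia, ne_eq, setN_iv_self, setN_iv_ne, not_false_eq_true, Nat.reduceEqDiff, hiq, hb₁,
        hA₁, and_self, and_true]
      have := hA q (by omega)
      exact ⟨by omega, by omega, by omega, by omega⟩
    -- the invariant of the inner loop, which goes down from `q` to the start of the block
    let P : State → Prop := fun s' =>
      q / b * b ≤ s'.iv vX ∧ s'.iv vX ≤ q + 1 ∧ s'.iv vCur ≤ n ∧
      (∀ c, c ≤ s'.iv vCur ↔ c ≤ s.ia aTop q ∧ ∀ q', s'.iv vX ≤ q' → q' ≤ q → c ≤ s.ia aTop q') ∧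
      ∀ j, (s'.iv vMsk).testBit j = true ↔ s'.iv vX + j ≤ q ∧
        ∀ q', s'.iv vX + j ≤ q' → q' ≤ q → s.ia aTop (s'.iv vX + j) ≤ s.ia aTop q'
    have h3 : ∀ s₂ : State, s₂.ia = s₁.ia → s₂.iv vStart = q / b * b → s₂.iv vX = q + 1 → P s₂ →
        Runs B (loop (.lt (var vStart) (var vX)) cMaskStep) s₂ (n * 40 + 26)
          (fun s' => P s' ∧ s'.iv vX = q / b * b) := by
      intro s₂ hia hst hx hP
      refine (Runs.while (B := B) (c := 20) (s₀ := s₂) (I := P)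
        (fun s' => s'.iv vX - q / b * b) hP ?_).mono ?_ ?_
      · rintro s₃ hf₃ ⟨p1, p2, p3, p4, p5⟩ hlt
        have hst₃ : s₃.iv vStart = q / b * b := by rw [hf₃.iv vStart rfl, hst]
        have hA₃ : s₃.ia aTop = s.ia aTop := by rw [hf₃.ia aTop rfl, hia, hA₁]
        simp only [holds_lt, eval_var, hst₃] at hlt
        obtain ⟨x, hx⟩ : ∃ x, s₃.iv vX = x + 1 := ⟨s₃.iv vX - 1, by omega⟩
        have hmsk : s₃.iv vMsk < 2 ^ (q - x) := by
          refine Nat.lt_pow_two_of_testBit _ fun i hi => ?_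
          rw [Bool.eq_false_iff]
          intro h5
          have := ((p5 i).1 h5).1
          omega
        have hmsk2 : s₃.iv vMsk * 2 + 1 < 2 ^ b := by
          have h6 : 2 ^ (q - x + 1) ≤ 2 ^ b := Nat.pow_le_pow_right (by norm_num) (by omega)
          rw [pow_succ] at h6
          omega
        have hcase : ∀ q', x ≤ q' → q' = x ∨ x + 1 ≤ q' := fun q' h => by omega
        refine Fn.runs ?_ rfl (by decide)
        have hAx := hA x (by omega)
        simp only [cMaskStep, fn_seq, fn_setN, fn_branch, fn_nop, eval_var, eval_ofNat, eval_sub,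
          eval_add, eval_mul, eval_get, setN_ia, ne_eq, setN_iv_self, setN_iv_ne, not_false_eq_true,
          Nat.reduceEqDiff, hx, Nat.add_sub_cancel, holds_nle, hA₃, P] at p2 p4 p5 ⊢
        refine ⟨by omega, by omega, fun hle => ⟨by omega, by omega, ⟨by omega, by omega, hAx,
          fun c => ?_, fun j => ?_⟩, by omega⟩, fun hle => ⟨⟨by omega, by omega, p3, fun c => ?_,
          fun j => ?_⟩, by omega⟩⟩
        · constructor
          · intro hc
            have h7 := (p4 c).1 (hc.trans hle)
            refine ⟨h7.1, fun q' hq' hq'' => ?_⟩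
            rcases hcase q' hq' with rfl | h8
            · exact hc
            · exact h7.2 q' h8 hq''
          · intro hc
            exact hc.2 x le_rfl (by omega)
        · cases j with
          | zero =>
            rw [testBit_double_succ_zero]
            simp only [true_iff, add_zero]
            refine ⟨by omega, fun q' hq' hq'' => ?_⟩
            rcases hcase q' hq' with rfl | h8
            · exact le_rfl
            · exact ((p4 _).1 hle).2 q' h8 hq''
          | succ j =>
            rw [testBit_double_succ, p5, show x + 1 + j = x + (j + 1) by omega]
        · constructor
          · intro hc
            have h7 := (p4 c).1 hc
            refine ⟨h7.1, fun q' hq' hq'' => ?_⟩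
            rcases hcase q' hq' with rfl | h8
            · omega
            · exact h7.2 q' h8 hq''
          · intro hc
            exact (p4 c).2 ⟨hc.1, fun q' hq' hq'' => hc.2 q' (by omega) hq''⟩
        · cases j with
          | zero =>
            rw [testBit_double_zero]
            simp only [add_zero, Bool.false_eq_true, false_iff]
            intro h9
            refine hle ((p4 _).2 ⟨h9.2 q (by omega) le_rfl, fun q' hq' hq'' =>
              h9.2 q' (by omega) hq''⟩)
          | succ j =>
            rw [testBit_double, p5, show x + 1 + j = x + (j + 1) by omega]
      · have hcost : (Test.lt (var vStart) (var vX)).cost = 4 := rfl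
        rw [hcost, hx]
        have : q + 1 - q / b * b ≤ n := by omega
        nlinarith
      · rintro s₃ hf₃ ⟨hP₃, hnl⟩
        have hst₃ : s₃.iv vStart = q / b * b := by rw [hf₃.iv vStart rfl, hst]
        simp only [holds_lt, eval_var, hst₃, not_lt] at hnl
        exact ⟨hP₃, le_antisymm hnl hP₃.1⟩
    have h4 : ∀ s₃, s₃.iv vQ = q → s₃.ia aMask = s₁.ia aMask → (P s₃ ∧ s₃.iv vX = q / b * b) →
        Runs B (putN aMask (var vQ) (var vMsk)) s₃ 4 (fun s' => ∀ q_1 < q + 1, ∀ j,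
          ((s'.setN vQ (q + 1)).ia aMask q_1).testBit j = true ↔ q_1 / b * b + j ≤ q_1 ∧
          ∀ q', q_1 / b * b + j ≤ q' → q' ≤ q_1 →
            s.ia aTop (q_1 / b * b + j) ≤ s.ia aTop q') := by
      rintro s₃ hq₃ hm ⟨⟨p1, p2, p3, p4, p5⟩, hx⟩
      rw [hx] at p5
      have hmsk : s₃.iv vMsk < 2 ^ b := by
        refine Nat.lt_pow_two_of_testBit _ fun i hi => ?_
        rw [Bool.eq_false_iff]
        intro h5
        have := ((p5 i).1 h5).1
        omega
      refine Fn.runs ?_ rfl (by decide)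
      simp only [fn_putN, eval_var, hq₃, setN_ia, putN_ia_self]
      refine ⟨by omega, by omega, fun q₁ hq₁ => ?_⟩
      rcases Nat.lt_succ_iff_lt_or_eq.1 hq₁ with h | rfl
      · rw [Function.update_of_ne (by omega), hm]
        exact hI q₁ h
      · rw [Function.update_self]
        exact p5
    refine (h2.runs (N := 20) rfl (by decide)).seq (N₂ := n * 40 + 30) ?_ (by omega)
    rintro s₂ - ⟨q1, q2, q3, q4, q5, q6⟩
    refine (h3 s₂ q6 q1 q4 ⟨by omega, by omega, ?_, fun c => ?_, fun j => ?_⟩).seq (N₂ := 4)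
      (fun s₃ hf₃ hP₃ => h4 s₃ (by rw [hf₃.iv vQ rfl, q5]) (by rw [hf₃.ia aMask rfl, q6]) hP₃)
      (by omega)
    · rw [q3]; exact hA q (by omega)
    · rw [q3]
      exact ⟨fun h => ⟨h, fun q' h5 h6 => by omega⟩, fun h => h.1⟩
    · rw [q2, Nat.zero_testBit]
      simp only [Bool.false_eq_true, false_iff]
      rintro ⟨h5, -⟩
      omega

/-- The least value in the blocks from `vX` on, `2 ^ vI` in number. -/
def cMinOne : Cmd :=
  setN vCur (var vN) ;;
  forUp vQ vN1
    (branch (.conj (.nle (var vX * var vB) (var vQ))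
      (.conj (.lt (var vQ) ((var vX + get aPow (var vI)) * var vB))
        (.nle (get aTop (var vQ)) (var vCur))))
      (setN vCur (get aTop (var vQ))) nop)

theorem runs_cMinOne {B n b x i : ℕ} {s : State} (hn : s.iv vN = n) (hb : s.iv vB = b)
    (hn1 : s.iv vN1 = n + 1) (hx : s.iv vX = x) (hi : s.iv vI = i) (hB : 2 * n + 2 ≤ B)
    (hA : ∀ q ≤ n, s.ia aTop q ≤ n) (hp : s.ia aPow i = 2 ^ i) :
    Runs B cMinOne s (40 * n + 80) (fun s' => s'.iv vCur ≤ n ∧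
      (x * b < (x + 2 ^ i) * b → (x + 2 ^ i) * b ≤ n + 1 →
        IsMin (s.ia aTop) (x * b) ((x + 2 ^ i) * b - 1) (s'.iv vCur))) := by
  have h0 : Runs B (setN vCur (var vN)) s 2 (fun s' => s' = s.setN vCur n) :=
    Fn.runs (by rw [fn_setN]; simp [hn]; omega) rfl (by decide)
  refine h0.seq (N₂ := 40 * n + 78) ?_ (by omega)
  rintro s₁ - rfl
  refine (Runs.forUp (B := B) (c := 26) (i := vQ) (x := vN1) (N := n + 1)
    (fun q s' => s'.iv vCur ≤ n ∧
      (∀ q' < q, x * b ≤ q' → q' < (x + 2 ^ i) * b → s'.iv vCur ≤ s.ia aTop q') ∧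
      (s'.iv vCur = n ∨ ∃ q' < q, x * b ≤ q' ∧ q' < (x + 2 ^ i) * b ∧ s'.iv vCur = s.ia aTop q'))
    (by simp [hn1]) (by omega) rfl rfl ?_ ?_).mono (by omega) ?_
  · simp only [setN_iv_self, setN_iv_ne, ne_eq, not_false_eq_true, Nat.reduceEqDiff, true_or,
      and_true, le_refl, true_and]
    exact fun q' hq' => absurd hq' (by omega)
  · rintro q s₁ hq hf hiq ⟨i1, i2, i3⟩
    have e1 : s₁.iv vB = b := by rw [hf.iv vB rfl]; simpa using hb
    have e2 : s₁.iv vX = x := by rw [hf.iv vX rfl]; simpa using hx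
    have e3 : s₁.iv vI = i := by rw [hf.iv vI rfl]; simpa using hi
    have e4 : s₁.ia = s.ia := by
      funext a
      rw [hf.ia a rfl]; rfl
    refine Fn.runs ?_ rfl (by decide)
    simp only [fn_setN, fn_branch, fn_nop, eval_var, eval_ofNat, eval_sub,
      eval_add, eval_mul, eval_get, setN_ia, ne_eq, setN_iv_self, setN_iv_ne, not_false_eq_true,
      Nat.reduceEqDiff, holds_nle, holds_conj, holds_lt, e1, e2, e3, e4, hiq, hp]
    have hAq := hA q (by omega)
    refine ⟨fun h => ⟨by omega, hAq, fun q' hq' h1 h2 => ?_, Or.inr ⟨q, by omega, h.1, h.2.1, rfl⟩⟩,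
      fun h => ⟨i1, fun q' hq' h1 h2 => ?_, ?_⟩⟩
    · rcases Nat.lt_succ_iff_lt_or_eq.1 hq' with h3 | rfl
      · exact h.2.2.trans (i2 q' h3 h1 h2)
      · exact le_rfl
    · rcases Nat.lt_succ_iff_lt_or_eq.1 hq' with h3 | rfl
      · exact i2 q' h3 h1 h2
      · by_contra h4
        exact h ⟨h1, h2, by omega⟩
    · exact i3.imp_right fun ⟨q', h1, h2⟩ => ⟨q', by omega, h2⟩
  · rintro s₁ - ⟨i1, i2, i3⟩
    refine ⟨i1, fun hlt hle => ⟨fun q hq hq' => i2 q (by omega) hq (by omega), ?_⟩⟩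
    rcases i3 with i3 | ⟨q, h1, h2, h3, h4⟩
    · refine ⟨x * b, le_rfl, by omega, ?_⟩
      have := i2 (x * b) (by omega) le_rfl hlt
      have := hA (x * b) (by omega)
      omega
    · exact ⟨q, h2, by omega, h4⟩

/-- The minima of the sequences of blocks whose number is a power of two. -/
def cMin : Cmd :=
  setN vNb (var vN / var vB + 1) ;;
  forUp vX vNb (forUp vI vB (cMinOne ;; putN aMin (var vX * var vB + var vI) (var vCur)))

theorem runs_cMin {B n b : ℕ} {s : State} (hn : s.iv vN = n) (hb : s.iv vB = b)
    (hn1 : s.iv vN1 = n + 1) (hb1 : 1 ≤ b) (hbn : b ≤ n) (hB : 2 * n + 2 ≤ B)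
    (hA : ∀ q ≤ n, s.ia aTop q ≤ n) (hp : ∀ j < b, s.ia aPow j = 2 ^ j) :
    Runs B cMin s (500 * (n * n) + 500) (fun s' => ∀ x ≤ n / b, ∀ j < b, (x + 2 ^ j) * b ≤ n + 1 →
      IsMin (s.ia aTop) (x * b) ((x + 2 ^ j) * b - 1) (s'.ia aMin (x * b + j))) := by
  have hnb : n / b * b ≤ n := Nat.div_mul_le_self _ _
  have hnb' : n / b ≤ n := Nat.div_le_self _ _
  have h0 : Runs B (setN vNb (var vN / var vB + 1)) s 6 (fun s' => s' = s.setN vNb (n / b + 1)) :=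
    Fn.runs (by rw [fn_setN]; simp [hn, hb]; omega) rfl (by decide)
  refine h0.seq (N₂ := 500 * (n * n) + 490) ?_ (by omega)
  rintro s₁ - rfl
  have hne : ∀ x' x j i : ℕ, x' < x → j < b → x' * b + j ≠ x * b + i := fun x' x j i h1 h2 h3 => by
    have := Nat.mul_le_mul_right b h1
    rw [Nat.succ_mul] at this
    omega
  let K : ℕ → ℕ → State → Prop := fun x j s' => (x + 2 ^ j) * b ≤ n + 1 →
    IsMin (s.ia aTop) (x * b) ((x + 2 ^ j) * b - 1) (s'.ia aMin (x * b + j))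
  refine (Runs.forUp (B := B) (c := b * (40 * n + 99) + 9) (i := vX) (x := vNb) (N := n / b + 1)
    (fun x s' => ∀ x' < x, ∀ j < b, K x' j s')
    (by simp) (by omega) rfl rfl ?_ ?_).mono ?_ ?_
  · exact fun q' hq' => absurd hq' (by omega)
  · intro x s₁ hx hf hix hI
    have e1 : s₁.iv vB = b := by rw [hf.iv vB rfl]; simpa using hb
    refine (Runs.forUp (B := B) (c := 40 * n + 90) (i := vI) (x := vB) (N := b)
      (fun i s' => (∀ x' < x, ∀ j < b, K x' j s') ∧ ∀ j < i, K x j s')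
      e1 (by omega) rfl rfl ?_ ?_).mono le_rfl ?_
    · exact ⟨hI, fun q' hq' => absurd hq' (by omega)⟩
    · rintro i s₂ hi hf₂ hii ⟨j1, j2⟩
      have e2 : s₂.iv vB = b := by rw [hf₂.iv vB rfl, e1]
      have e3 : s₂.iv vN = n := by rw [hf₂.iv vN rfl, hf.iv vN rfl]; simpa using hn
      have e4 : s₂.iv vN1 = n + 1 := by rw [hf₂.iv vN1 rfl, hf.iv vN1 rfl]; simpa using hn1
      have e5 : s₂.iv vX = x := by rw [hf₂.iv vX rfl, hix]
      have e6 : s₂.ia aTop = s.ia aTop := by rw [hf₂.ia aTop rfl, hf.ia aTop rfl]; rfl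
      have e7 : s₂.ia aPow = s.ia aPow := by rw [hf₂.ia aPow rfl, hf.ia aPow rfl]; rfl
      refine (runs_cMinOne e3 e2 e4 e5 hii hB (e6 ▸ hA) (by rw [e7, hp i hi])).seq (N₂ := 10) ?_
        (by omega)
      rintro s₃ hf₃ ⟨k1, k2⟩
      have hxb : x * b ≤ n := (Nat.mul_le_mul_right b (by omega : x ≤ n / b)).trans hnb
      refine Fn.runs ?_ rfl (by decide)
      simp only [fn_putN, eval_var, eval_add, eval_mul, hf₃.iv vX rfl, hf₃.iv vB rfl,
        hf₃.iv vI rfl, e2, e5, hii, K, setN_ia, putN_ia_self, hf₃.ia aMin rfl]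
      refine ⟨by omega, by omega, fun x' hx' j hj => ?_, fun j hj => ?_⟩
      · rw [Function.update_of_ne (hne x' x j i hx' hj)]
        exact j1 x' hx' j hj
      · rcases Nat.lt_succ_iff_lt_or_eq.1 hj with hj | rfl
        · rw [Function.update_of_ne (by omega)]
          exact j2 j hj
        · rw [Function.update_self, ← e6]
          refine k2 (Nat.mul_lt_mul_of_pos_right ?_ hb1)
          have : 0 < 2 ^ j := by positivity
          omega
    · rintro s₂ - ⟨j1, j2⟩ x' hx' j hj
      rcases Nat.lt_succ_iff_lt_or_eq.1 hx' with hx' | rfl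
      · exact j1 x' hx' j hj
      · exact j2 j hj
  · have h3 : (n / b + 1) * (b * (40 * n + 99)) ≤ (2 * n) * (40 * n + 99) := by
      rw [← Nat.mul_assoc]
      refine Nat.mul_le_mul_right _ ?_
      rw [Nat.succ_mul]; omega
    nlinarith
  · exact fun s' _ h x hx => h x (by omega)

/-- All tables for the range minima. -/
def cTables : Cmd := cPow ;; cBits ;; cMask ;; cMin

theorem runs_cTables {B n : ℕ} {s : State} (hn : s.iv vN = n) (hn1 : 1 ≤ n) (hB : 2 * n + 2 ≤ B)
    (hA : ∀ q ≤ n, s.ia aTop q ≤ n) :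
    Runs B cTables s (2000 * (n * n)) (fun s' => s'.ia aPrm 1 ≤ n ∧ 2 ^ s'.ia aPrm 1 ≤ 2 * n ∧
      Rmq n (s'.ia aPrm 1) (s'.ia aTop) (s'.ia aMask) (s'.ia aLow) (s'.ia aLog) (s'.ia aPow)
        (s'.ia aMin)) := by
  have hnn : n ≤ n * n := Nat.le_mul_of_pos_left n hn1
  refine (runs_cPow hn hn1 (by omega)).seq (N₂ := 1900 * (n * n)) ?_ (by omega)
  rintro s₁ f₁ ⟨a1, a2, a3, a4, a5, a6, a7⟩
  refine (runs_cBits a2 (by omega)).seq (N₂ := 1720 * (n * n)) ?_ (by omega)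
  rintro s₂ f₂ ⟨b1, b2⟩
  have hb2 : s₂.iv vB = s₁.iv vB := f₂.iv vB rfl
  have hn2 : s₂.iv vN = n := by rw [f₂.iv vN rfl, f₁.iv vN rfl, hn]
  have hA2 : s₂.ia aTop = s.ia aTop := by rw [f₂.ia aTop rfl, f₁.ia aTop rfl]
  refine (runs_cMask hn2 hb2 a3 a4 hB a6 (hA2 ▸ hA)).seq (N₂ := 1000 * (n * n)) ?_ (by omega)
  rintro s₃ f₃ ⟨c1, c2⟩
  have hp3 : s₃.ia aPow = s₁.ia aPow := by rw [f₃.ia aPow rfl, f₂.ia aPow rfl]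
  refine (runs_cMin (by rw [f₃.iv vN rfl, hn2]) (by rw [f₃.iv vB rfl, hb2]) c1 a3 a4 hB
    (by rw [f₃.ia aTop rfl, hA2]; exact hA) (fun j hj => by rw [hp3, a7 j hj.le])).mono
    (by omega) ?_
  intro s₄ f₄ d1
  have e1 : s₄.ia aPrm 1 = s₁.iv vB := by
    rw [f₄.ia aPrm rfl, f₃.ia aPrm rfl, f₂.ia aPrm rfl, a1]
  have e2 : s₄.ia aTop = s₂.ia aTop := by rw [f₄.ia aTop rfl, f₃.ia aTop rfl]
  rw [e1]
  refine ⟨a4, a6, a3, a5, ?_, ?_, ?_, ?_, ?_⟩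
  · intro j hj
    rw [f₄.ia aPow rfl, hp3, a7 j hj.le]
  · rw [f₄.ia aLow rfl, f₃.ia aLow rfl]; exact b2
  · rw [f₄.ia aLog rfl, f₃.ia aLog rfl]; exact b1
  · rw [f₄.ia aMask rfl, e2]; exact c2
  · rw [e2, ← f₃.ia aTop rfl]; exact d1

/-! ### Building the tree data -/

-- The edges of the input with their weights, and the weights of the edges to the parents.
notation "aE1" => (1 : ℕ)
notation "aE2" => (2 : ℕ)
notation "bW" => (0 : ℕ)
notation "bPw" => (18 : ℕ)
-- variables of the construction of the tree data
notation "vE" => (40 : ℕ)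
notation "vEx" => (41 : ℕ)
notation "vEy" => (42 : ℕ)
notation "vNm" => (43 : ℕ)
notation "vIt" => (44 : ℕ)
notation "vUu" => (45 : ℕ)
notation "vPp" => (57 : ℕ)
notation "vNew" => (58 : ℕ)

/-- The length of the edge from every vertex to its parent. -/
def cPw : Cmd :=
  forUp vE vM
    (setN vEx (get aE1 (var vE)) ;; setN vEy (get aE2 (var vE)) ;;
    branch (.eq (get aPar (var vEx)) (var vEy)) (putR bPw (var vEx) (.get bW (var vE))) nop ;;
    branch (.eq (get aPar (var vEy)) (var vEx)) (putR bPw (var vEy) (.get bW (var vE))) nop)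

/-- Finds a vertex without a number whose parent has one. -/
def cFind : Cmd :=
  setN vNew 0 ;;
  forUp vUu vN
    (branch (.conj (.nle (get aPos (var vUu)) 0) (.nle 1 (get aPos (get aPar (var vUu)))))
      (setN vNew (var vUu)) nop)

/-- Makes room for the vertex `vNew` right after its parent. -/
def cShift : Cmd :=
  setN vPp (get aPos (get aPar (var vNew))) ;;
  forUp vUu vN
    (branch (.lt (var vPp) (get aPos (var vUu)))
      (putN aPos (var vUu) (get aPos (var vUu) + 1)) nop)

/-- Inserts the vertex `vNew`. -/
def cPlace : Cmd :=
  putN aPos (var vNew) (var vPp + 1) ;;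
  putN aDep (var vNew) (get aDep (get aPar (var vNew)) + 1) ;;
  putR bDs (var vNew) (.get bDs (get aPar (var vNew)) + .get bPw (var vNew))

/-- Numbers the root. -/
def cRoot : Cmd :=
  putN aPos (var vR) 1 ;; putN aDep (var vR) 0 ;;
  putR bDs (var vR) .zero ;; setN vNm (var vN - 1)

/-- The vertices, and the numbers of their parents, by their numbers. -/
def cOrder : Cmd :=
  putN aTop 0 0 ;;
  forUp vUu vN
    (putN aAt (get aPos (var vUu)) (var vUu) ;;
    putN aTop (get aPos (var vUu)) (get aPos (get aPar (var vUu))))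

/-- Depths, distances from the root, and a preorder numbering. -/
def cTree : Cmd := cPw ;; cRoot ;; forUp vIt vNm (cFind ;; cShift ;; cPlace) ;; cOrder

namespace Inst

variable (I : Inst)

/-- The state holds the input. -/
structure InOk (s : State) : Prop where
  n : s.iv vN = I.n
  m : s.iv vM = I.m
  f : s.iv vF = I.f
  r : s.iv vR = I.r
  par : ∀ v < I.n, s.ia aPar v = I.par v
  e1 : ∀ j < I.m, s.ia aE1 j = I.ea j
  e2 : ∀ j < I.m, s.ia aE2 j = I.eb j
  w : ∀ j < I.m, s.ra bW j = I.W (I.ea j) (I.eb j)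

variable {I}

theorem InOk.frame {p : Cmd} {s s' : State} (h : I.InOk s) (hf : Frame p s s')
    (hp : (p.wv vN || p.wv vM || p.wv vF || p.wv vR || p.wa aPar || p.wa aE1 || p.wa aE2 ||
      p.wb bW) = false) : I.InOk s' := by
  simp only [Bool.or_eq_false_iff] at hp
  obtain ⟨⟨⟨⟨⟨⟨⟨h0, h1⟩, h2⟩, h3⟩, h4⟩, h5⟩, h6⟩, h7⟩ := hp
  refine ⟨?_, ?_, ?_, ?_, ?_, ?_, ?_, ?_⟩
  · rw [hf.iv _ h0, h.n]
  · rw [hf.iv _ h1, h.m]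
  · rw [hf.iv _ h2, h.f]
  · rw [hf.iv _ h3, h.r]
  · rw [hf.ia _ h4]; exact h.par
  · rw [hf.ia _ h5]; exact h.e1
  · rw [hf.ia _ h6]; exact h.e2
  · rw [hf.ra _ h7]; exact h.w

theorem n_pos : 1 ≤ I.n := by have := I.r_lt; omega

theorem runs_cPw {B : ℕ} {s : State} (h : I.InOk s) (hn : I.n ≤ B) (hm : I.m ≤ B) :
    Runs B cPw s (60 * I.m + 60) (fun s' => ∀ v < I.n, v ≠ I.r → s'.ra bPw v = I.W v (I.par v)) := by
  refine (Runs.forUp (B := B) (c := 40) (N := I.m)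
    (fun j s' => ∀ v, (∃ e < j, (I.ea e = v ∧ I.eb e = I.par v) ∨ (I.ea e = I.par v ∧ I.eb e = v)) →
      s'.ra bPw v = I.W v (I.par v)) h.m hm rfl rfl ?_ ?_).mono (by omega) ?_
  · rintro v ⟨e, he, -⟩
    omega
  · rintro j s₁ hj hf hij hI
    have h₁ := h.frame hf rfl
    have hx := I.ea_lt j hj
    have hy := I.eb_lt j hj
    refine Fn.runs ?_ rfl (by decide)
    have e1 := h₁.e1 j hj
    have e2 := h₁.e2 j hj
    have e3 := h₁.par _ hx
    have e4 := h₁.par _ hy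
    have e5 := h₁.w j hj
    simp only [fn_seq, fn_setN, fn_putR, fn_branch, fn_nop, eval_var, eval_get, setN_ia, ne_eq,
      setN_iv_self, setN_iv_ne, not_false_eq_true, Nat.reduceEqDiff, holds_eq, hij, e1, e2, e3, e4,
      e5, setN_ra, putR_iv, putR_ia, putR_ra_self, putR_ra_ne, reval_get]
    have hsym := I.W_symm (I.ea j) (I.eb j)
    -- a cell is only overwritten by the value it must hold
    have key : ∀ (g : ℕ → ℝ) (x : ℕ) (P : ℕ → Prop), (∀ v, P v → g v = I.W v (I.par v)) →
        I.W (I.ea j) (I.eb j) = I.W x (I.par x) → ∀ v, v = x ∨ P v →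
        Function.update g x (I.W (I.ea j) (I.eb j)) v = I.W v (I.par v) := by
      intro g x P hP hx v hv
      rw [Function.update_apply]
      split_ifs with hvx
      · rw [hx, hvx]
      · exact hP v (hv.resolve_left hvx)
    have hx1 : I.par (I.ea j) = I.eb j → I.W (I.ea j) (I.eb j) = I.W (I.ea j) (I.par (I.ea j)) :=
      fun h => by rw [h]
    have hx2 : I.par (I.eb j) = I.ea j → I.W (I.ea j) (I.eb j) = I.W (I.eb j) (I.par (I.eb j)) :=
      fun h => by rw [h, hsym]
    have hcase : ∀ v, (∃ e < j + 1, (I.ea e = v ∧ I.eb e = I.par v) ∨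
        (I.ea e = I.par v ∧ I.eb e = v)) → (v = I.eb j ∧ I.par (I.eb j) = I.ea j) ∨
        (v = I.ea j ∧ I.par (I.ea j) = I.eb j) ∨ ∃ e < j, (I.ea e = v ∧ I.eb e = I.par v) ∨
        (I.ea e = I.par v ∧ I.eb e = v) := by
      rintro v ⟨e, he, hev⟩
      rcases Nat.lt_succ_iff_lt_or_eq.1 he with he' | rfl
      · exact Or.inr (Or.inr ⟨e, he', hev⟩)
      · rcases hev with ⟨rfl, h3⟩ | ⟨h3, rfl⟩
        · exact Or.inr (Or.inl ⟨rfl, h3.symm⟩)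
        · exact Or.inl ⟨rfl, h3.symm⟩
    refine ⟨by omega, by omega, fun h1 => ⟨by omega, fun h2 => ⟨by omega, fun v hv => ?_⟩,
      fun h2 v hv => ?_⟩, fun h1 => ⟨fun h2 => ⟨by omega, fun v hv => ?_⟩, fun h2 v hv => ?_⟩⟩
    · refine key _ _ (fun v => v = I.ea j ∨ _) (key _ _ _ hI (hx1 h1)) (hx2 h2) v ?_
      rcases hcase v hv with h | h | h
      exacts [Or.inl h.1, Or.inr (Or.inl h.1), Or.inr (Or.inr h)]
    · refine key _ _ _ hI (hx1 h1) v ?_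
      rcases hcase v hv with h | h | h
      exacts [absurd h.2 h2, Or.inl h.1, Or.inr h]
    · refine key _ _ _ hI (hx2 h2) v ?_
      rcases hcase v hv with h | h | h
      exacts [Or.inl h.1, absurd h.2 h1, Or.inr h]
    · rcases hcase v hv with h | h | h
      exacts [absurd h.2 h2, absurd h.2 h1, hI v h]
  · rintro s₁ - hI v hv hr
    obtain ⟨j, hj, hj'⟩ := I.tree_edge v hv hr
    exact hI v ⟨j, hj, hj'⟩

theorem runs_cFind {B : ℕ} {s : State} (h : I.InOk s) (hn : I.n ≤ B) :
    Runs B cFind s (40 * I.n + 40) (fun s' =>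
      (∃ u < I.n, s.ia aPos u = 0 ∧ 1 ≤ s.ia aPos (I.par u)) → s'.iv vNew < I.n ∧
        s.ia aPos (s'.iv vNew) = 0 ∧ 1 ≤ s.ia aPos (I.par (s'.iv vNew))) := by
  have h0 : Runs B (setN vNew 0) s 2 (fun s' => s' = s.setN vNew 0) :=
    Fn.runs (by rw [fn_setN]; simp) rfl (by decide)
  refine h0.seq (N₂ := 40 * I.n + 38) ?_ (by omega)
  rintro s₁ f₁ rfl
  refine (Runs.forUp (B := B) (c := 20) (N := I.n) (fun j s' =>
      (∃ u < j, s.ia aPos u = 0 ∧ 1 ≤ s.ia aPos (I.par u)) → s'.iv vNew < I.n ∧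
        s.ia aPos (s'.iv vNew) = 0 ∧ 1 ≤ s.ia aPos (I.par (s'.iv vNew)))
      (h.frame f₁ rfl).n hn rfl rfl ?_ ?_).mono (by omega) fun s' _ h => h
  · rintro ⟨u, hu, -⟩
    omega
  · rintro j s₁ hj hf hij hI
    have h₁ := (h.frame f₁ rfl).frame hf rfl
    have e1 : s₁.ia aPos = s.ia aPos := by rw [hf.ia aPos rfl]; rfl
    refine Fn.runs ?_ rfl (by decide)
    simp only [fn_setN, fn_branch, fn_nop, eval_var, eval_get, setN_ia, ne_eq, eval_ofNat,
      setN_iv_self, setN_iv_ne, not_false_eq_true, Nat.reduceEqDiff, holds_nle, holds_conj, hij,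
      h₁.par j hj, e1, Nat.le_zero]
    refine ⟨fun h2 => ⟨by omega, fun _ => ⟨hj, h2⟩⟩, fun h2 => ?_⟩
    rintro ⟨u, hu, hu'⟩
    rcases Nat.lt_succ_iff_lt_or_eq.1 hu with hu'' | rfl
    · exact hI ⟨u, hu'', hu'⟩
    · exact absurd hu' h2

theorem runs_cShift {B v : ℕ} {s : State} (h : I.InOk s) (hv : s.iv vNew = v) (hvn : v < I.n)
    (hB : I.n + 1 ≤ B) (hp : ∀ u < I.n, s.ia aPos u ≤ I.n) :
    Runs B cShift s (40 * I.n + 40) (fun s' => s'.iv vPp = s.ia aPos (I.par v) ∧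
      ∀ u < I.n, s'.ia aPos u = if s.ia aPos (I.par v) < s.ia aPos u then s.ia aPos u + 1
        else s.ia aPos u) := by
  have hpp := hp _ (I.par_lt v)
  have h0 : Runs B (setN vPp (get aPos (get aPar (var vNew)))) s 5
      (fun s' => s' = s.setN vPp (s.ia aPos (I.par v))) :=
    Fn.runs (by rw [fn_setN]; simp [h.par v hvn, hv]; omega) rfl (by decide)
  refine h0.seq (N₂ := 40 * I.n + 35) ?_ (by omega)
  rintro s₁ f₁ rfl
  refine (Runs.forUp (B := B) (c := 20) (N := I.n) (fun j s' =>
      ∀ u < I.n, s'.ia aPos u = if u < j ∧ s.ia aPos (I.par v) < s.ia aPos u then s.ia aPos u + 1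
        else s.ia aPos u)
      (h.frame f₁ rfl).n (by omega) rfl rfl ?_ ?_).mono (by omega) ?_
  · intro u hu
    simp
  · rintro j s₁ hj hf hij hI
    have e1 : s₁.iv vPp = s.ia aPos (I.par v) := by rw [hf.iv vPp rfl]; simp
    have e2 := hI j hj
    simp only [lt_irrefl, false_and, if_false] at e2
    have := hp j hj
    refine Fn.runs ?_ rfl (by decide)
    simp only [fn_putN, fn_branch, fn_nop, eval_var, eval_get, setN_ia, ne_eq, eval_ofNat,
      eval_add, holds_lt, hij, e1, e2, putN_ia_self]
    refine ⟨fun h2 => ⟨by omega, by omega, fun u hu => ?_⟩, fun h2 u hu => ?_⟩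
    · rw [Function.update_apply, hI u hu]
      split_ifs <;> (first | omega | (subst u; omega))
    · rw [hI u hu]
      by_cases huj : u = j
      · subst huj; simp [h2]
      · congr 1; simp only [eq_iff_iff]; omega
  · intro s' hf h1
    refine ⟨by rw [hf.iv vPp rfl]; simp, fun u hu => ?_⟩
    simp [h1 u hu, hu]

/-- The vertices of a subtree with `i` vertices are numbered in preorder. -/
def Built (I : Inst) (i : ℕ) (s : State) : Prop :=
  ∃ S : Finset ℕ, S.card = i ∧ (∀ x ∈ S, x < I.n) ∧ I.r ∈ S ∧ (∀ x ∈ S, I.par x ∈ S) ∧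
    (∀ u < I.n, s.ia aPos u = 0 ↔ u ∉ S) ∧ IsPre I.par S (s.ia aPos) ∧
    (∀ u ∈ S, s.ia aPos u ≤ i) ∧ ∀ u ∈ S, s.ia aDep u = I.dp u ∧ s.ra bDs u = I.ds u

theorem runs_insert {B i : ℕ} {s : State} (h : I.InOk s) (hB : I.n + 1 ≤ B) (hi : i < I.n)
    (hs : I.Built i s) (hw : ∀ v < I.n, v ≠ I.r → s.ra bPw v = I.W v (I.par v)) :
    Runs B (cFind ;; cShift ;; cPlace) s (80 * I.n + 120) (fun s' => I.Built (i + 1) s') := by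
  obtain ⟨S, hcard, hSn, hrS, hSp, hpos, hpre, hle, hdd⟩ := hs
  refine (runs_cFind h (by omega)).seq (N₂ := 40 * I.n + 80) ?_ (by omega)
  intro s₁ f₁ h1
  -- a vertex of minimal depth outside the subtree is a candidate
  have hex : ∃ u < I.n, s.ia aPos u = 0 ∧ 1 ≤ s.ia aPos (I.par u) := by
    have hne : ((Finset.range I.n) \ S).Nonempty := by
      rw [Finset.sdiff_nonempty]
      intro hsub
      have := Finset.card_le_card hsub
      rw [Finset.card_range] at this
      omega
    obtain ⟨u, hu, hmin⟩ := Finset.exists_min_image _ I.dp hne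
    rw [Finset.mem_sdiff, Finset.mem_range] at hu
    refine ⟨u, hu.1, (hpos u hu.1).2 hu.2, ?_⟩
    by_contra h0
    have h2 := (hpos _ (I.par_lt u)).1 (by omega)
    have h3 := hmin _ (Finset.mem_sdiff.2 ⟨Finset.mem_range.2 (I.par_lt u), h2⟩)
    have h4 := I.tree.dep_eq_succ (v := u) fun h => hu.2 (h ▸ hrS)
    simp only [dp] at h3
    omega
  obtain ⟨hv, hv0, hpv⟩ := h1 hex
  set v := s₁.iv vNew with hvdef
  have hvS : v ∉ S := (hpos v hv).1 hv0
  have hpvS : I.par v ∈ S := by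
    by_contra h2
    have := (hpos _ (I.par_lt v)).2 h2
    omega
  have hvr : v ≠ I.r := fun h => hvS (h ▸ hrS)
  have hin₁ := h.frame f₁ rfl
  have hpos₁ : s₁.ia aPos = s.ia aPos := f₁.ia aPos rfl
  have hbd : ∀ u < I.n, s.ia aPos u ≤ i := fun u hu => by
    by_cases huS : u ∈ S
    · exact hle u huS
    · rw [(hpos u hu).2 huS]; omega
  refine (runs_cShift hin₁ hvdef.symm hv hB
    (fun u hu => by rw [hpos₁]; exact (hbd u hu).trans hi.le)).seq (N₂ := 40) ?_ (by omega)
  rintro s₂ f₂ ⟨hpp, hsh⟩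
  have hin₂ := hin₁.frame f₂ rfl
  have e1 : s₂.iv vNew = v := f₂.iv vNew rfl
  have e2 : s₂.ia aDep = s.ia aDep := by rw [f₂.ia aDep rfl, f₁.ia aDep rfl]
  have e3 : s₂.ra bDs = s.ra bDs := by rw [f₂.ra bDs rfl, f₁.ra bDs rfl]
  have e4 : s₂.ra bPw = s.ra bPw := by rw [f₂.ra bPw rfl, f₁.ra bPw rfl]
  rw [hpos₁] at hpp hsh
  have hdv : I.dp v = I.dp (I.par v) + 1 := I.tree.dep_eq_succ hvr
  have hsv : I.ds v = I.ds (I.par v) + I.W v (I.par v) := I.tree.tdist_eq I.W hvr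
  have hdlt : I.dp v < I.n := I.tree.dep_lt hv I.par_lt
  have hle' := hle _ hpvS
  refine Fn.runs ?_ rfl (by decide)
  simp only [cPlace, fn_seq, fn_putN, fn_putR, eval_var, eval_get, eval_add, eval_ofNat, reval_add,
    reval_get, putN_iv, putN_ia_self, putN_ia_ne, putN_ra, ne_eq, not_false_eq_true,
    Nat.reduceEqDiff, hin₂.par v hv, e1, e2, e3, e4, hpp, (hdd _ hpvS).1, (hdd _ hpvS).2, hw v hv hvr,
    ← hdv, ← hsv]
  refine ⟨by omega, by omega, by omega, by omega, by omega, insert v S, ?_, ?_, ?_, ?_, ?_, ?_, ?_,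
    ?_⟩
  · rw [Finset.card_insert_of_notMem hvS, hcard]
  · intro x hx
    rcases Finset.mem_insert.1 hx with rfl | hx
    · exact hv
    · exact hSn x hx
  · exact Finset.mem_insert_of_mem hrS
  · intro x hx
    rcases Finset.mem_insert.1 hx with hx | hx
    · rw [hx]; exact Finset.mem_insert_of_mem hpvS
    · exact Finset.mem_insert_of_mem (hSp x hx)
  all_goals
    simp only [putR_ia, putR_ra_self, putN_ia_self, putN_ia_ne, putN_ra, ne_eq,
      not_false_eq_true, Nat.reduceEqDiff, e2, e3]
  · intro u hu
    rw [Function.update_apply, Finset.mem_insert]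
    split_ifs with huv
    · simp [huv]
    · rw [hsh u hu]
      rw [show (¬ (u = v ∨ u ∈ S)) ↔ u ∉ S by simp [huv], ← hpos u hu]
      split_ifs
      · simp only [false_iff]
        omega
      · exact Iff.rfl
  · rw [Finset.coe_insert]
    refine hpre.insert (by simpa using hvS) (by simpa using hpvS) (by simpa using hSp)
      (fun x hx => ?_) (by simp)
    have hxv : x ≠ v := fun h => hvS (h ▸ hx)
    rw [Function.update_of_ne hxv, hsh x (hSn x hx)]
  · intro u hu
    rw [Function.update_apply]
    split_ifs with huv
    · omega
    · have hu : u ∈ S := (Finset.mem_insert.1 hu).resolve_left huv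
      have := hle u hu
      rw [hsh u (hSn u hu)]
      split_ifs <;> omega
  · intro u hu
    rw [Function.update_apply, Function.update_apply]
    split_ifs with huv
    · rw [huv]; exact ⟨rfl, rfl⟩
    · exact hdd u ((Finset.mem_insert.1 hu).resolve_left huv)

theorem runs_cTree {B : ℕ} {s : State} (h : I.InOk s) (hB : I.n + 1 ≤ B) (hm : I.m ≤ B)
    (h0 : ∀ v < I.n, s.ia aPos v = 0) :
    Runs B cTree s (60 * I.m + 1000 * (I.n * I.n)) (fun s' => I.TreeOk s' ∧
      IsPre I.par {x | x < I.n} (s'.ia aPos) ∧ (∀ v < I.n, 1 ≤ s'.ia aPos v) ∧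
      (∀ v < I.n, s'.ia aPos v ≤ I.n) ∧ (∀ v < I.n, s'.ia aAt (s'.ia aPos v) = v) ∧
      (∀ v < I.n, s'.ia aTop (s'.ia aPos v) = s'.ia aPos (I.par v)) ∧
      ∀ q ≤ I.n, s'.ia aTop q ≤ I.n) := by
  have hn1 := I.n_pos
  have hnn : I.n ≤ I.n * I.n := Nat.le_mul_of_pos_left _ hn1
  refine (runs_cPw h (by omega) hm).seq (N₂ := 940 * (I.n * I.n)) ?_ (by omega)
  intro s₁ f₁ hw
  have hin₁ := h.frame f₁ rfl
  have h1 : Runs B cRoot s₁ 30 (fun s' => s'.iv vNm = I.n - 1 ∧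
      s'.ia aPos = Function.update (s₁.ia aPos) I.r 1 ∧ s'.ia aDep I.r = 0 ∧ s'.ra bDs I.r = 0) := by
    refine Fn.runs ?_ rfl (by decide)
    have := I.r_lt
    simp only [cRoot, fn_seq, fn_putN, fn_putR, fn_setN, eval_var, eval_ofNat, eval_sub, reval_zero,
      putN_iv, putR_iv, putR_ia, putN_ra, setN_ra, putR_ra_self, setN_ia, ne_eq, not_false_eq_true,
      Nat.reduceEqDiff, putN_ia_self, putN_ia_ne, setN_iv_self, hin₁.n, hin₁.r,
      Function.update_self, and_true]
    omega
  refine h1.seq (N₂ := 910 * (I.n * I.n)) ?_ (by omega)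
  rintro s₂ f₂ ⟨hnm, hpos, hdep, hds⟩
  have hin₂ := hin₁.frame f₂ rfl
  have hb1 : I.Built 1 s₂ := by
    refine ⟨{I.r}, by simp, by simpa using I.r_lt, by simp, by simp [I.tree.root], ?_, ?_, ?_, ?_⟩
    · intro u hu
      rw [hpos, Function.update_apply, f₁.ia aPos rfl, h0 u hu]
      simp
    · refine ⟨?_, ?_, ?_⟩ <;> simp
    · simp [hpos]
    · simp only [Finset.mem_singleton, forall_eq, hdep, hds]
      exact ⟨IsTree.dep_root.symm, (IsTree.tdist_root _).symm⟩
  refine (Runs.forUp (B := B) (c := 80 * I.n + 120) (N := I.n - 1)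
    (fun i s' => I.Built (i + 1) s') hnm (by omega) rfl rfl hb1 ?_).seq
    (N₂ := 100 * (I.n * I.n)) ?_ ?_
  · intro j s₃ hj hf₃ _ hb
    refine (runs_insert (hin₂.frame hf₃ rfl) hB (by omega) hb ?_).mono le_rfl fun s' _ h => h
    intro v hv hvr
    rw [hf₃.ra bPw rfl, f₂.ra bPw rfl]
    exact hw v hv hvr
  · rintro s₃ f₃ ⟨S, hcard, hSn, -, -, hp0, hpre, hle, hdd⟩
    have hin₃ := hin₂.frame f₃ rfl
    have hS : ∀ x, x ∈ S ↔ x < I.n := fun x => by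
      have : S = Finset.range I.n := Finset.eq_of_subset_of_card_le
        (fun x hx => Finset.mem_range.2 (hSn x hx)) (by rw [hcard, Finset.card_range]; omega)
      rw [this, Finset.mem_range]
    have hSet : (S : Set ℕ) = {x | x < I.n} := by
      ext x
      exact hS x
    rw [hSet] at hpre
    have hpp : ∀ v < I.n, 1 ≤ s₃.ia aPos v := fun v hv => by
      by_contra hcon
      exact (hp0 v hv).1 (by omega) ((hS v).2 hv)
    have hpl : ∀ v < I.n, s₃.ia aPos v ≤ I.n := fun v hv => by
      have := hle v ((hS v).2 hv)
      omega
    have h2 : Runs B (putN aTop 0 0) s₃ 3 (fun s' => s' = s₃.putN aTop 0 0) :=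
      Fn.runs (by rw [fn_putN]; simp) rfl (by decide)
    refine h2.seq (N₂ := 90 * (I.n * I.n)) ?_ (by omega)
    rintro s₄ f₄ rfl
    refine (Runs.forUp (B := B) (c := 20) (N := I.n) (fun j s' =>
      (∀ v < j, s'.ia aAt (s₃.ia aPos v) = v) ∧
      (∀ v < j, s'.ia aTop (s₃.ia aPos v) = s₃.ia aPos (I.par v)) ∧
      ∀ q, q = 0 ∨ (∃ v < j, q = s₃.ia aPos v) → s'.ia aTop q ≤ I.n)
      (hin₃.frame f₄ rfl).n (by omega) rfl rfl ?_ ?_).mono (by omega) ?_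
    · refine ⟨fun v hv => absurd hv (by omega), fun v hv => absurd hv (by omega), ?_⟩
      rintro q (rfl | ⟨v, hv, -⟩)
      · simp
      · omega
    · rintro j s₅ hj hf₅ hij ⟨i1, i2, i3⟩
      have e1 : s₅.ia aPos = s₃.ia aPos := by rw [hf₅.ia aPos rfl, f₄.ia aPos rfl]
      have e2 := ((hin₃.frame f₄ rfl).frame hf₅ rfl).par j hj
      have := hpl j hj
      have hpj := hpl _ (I.par_lt j)
      refine Fn.runs ?_ rfl (by decide)
      simp only [fn_seq, fn_putN, eval_var, eval_get, putN_iv, putN_ia_self, putN_ia_ne, setN_ia,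
        ne_eq, not_false_eq_true, Nat.reduceEqDiff, hij, e1, e2]
      have hne : ∀ v < j, s₃.ia aPos v ≠ s₃.ia aPos j := fun v hv he => by
        have := hpre.inj v (by simp; omega) j hj he
        omega
      refine ⟨by omega, by omega, by omega, by omega, ?_, ?_, ?_⟩
      · intro v hv
        rcases Nat.lt_succ_iff_lt_or_eq.1 hv with hv | rfl
        · rw [Function.update_of_ne (hne v hv)]; exact i1 v hv
        · rw [Function.update_self]
      · intro v hv
        rcases Nat.lt_succ_iff_lt_or_eq.1 hv with hv | rfl
        · rw [Function.update_of_ne (hne v hv)]; exact i2 v hv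
        · rw [Function.update_self]
      · intro q hq
        rw [Function.update_apply]
        split_ifs with hqj
        · exact hpj
        · refine i3 q (hq.imp_right ?_)
          rintro ⟨v, hv, rfl⟩
          rcases Nat.lt_succ_iff_lt_or_eq.1 hv with hv | rfl
          · exact ⟨v, hv, rfl⟩
          · exact absurd rfl hqj
    · rintro s₅ f₅ ⟨i1, i2, i3⟩
      have e1 : s₅.ia aPos = s₃.ia aPos := by rw [f₅.ia aPos rfl, f₄.ia aPos rfl]
      have e2 : s₅.ia aDep = s₃.ia aDep := by rw [f₅.ia aDep rfl, f₄.ia aDep rfl]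
      have e3 : s₅.ra bDs = s₃.ra bDs := by rw [f₅.ra bDs rfl, f₄.ra bDs rfl]
      rw [e1]
      refine ⟨⟨((hin₃.frame f₄ rfl).frame f₅ rfl).par, ?_, ?_⟩, hpre, hpp, hpl, i1, i2, ?_⟩
      · intro v hv
        rw [e2]; exact (hdd v ((hS v).2 hv)).1
      · intro v hv
        rw [e3]; exact (hdd v ((hS v).2 hv)).2
      · intro q hq
        rcases Nat.eq_zero_or_pos q with rfl | hq0
        · exact i3 0 (Or.inl rfl)
        · have h5 := Finset.surj_on_of_inj_on_of_card_le (s := Finset.range I.n)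
            (t := Finset.Icc 1 I.n) (fun v _ => s₃.ia aPos v)
            (fun v hv => by
              rw [Finset.mem_range] at hv
              exact Finset.mem_Icc.2 ⟨hpp v hv, hpl v hv⟩)
            (fun v w hv hw he => hpre.inj v (by simpa using hv) w (by simpa using hw) he)
            (by simp) q (Finset.mem_Icc.2 ⟨hq0, hq⟩)
          obtain ⟨v, hv, he⟩ := h5
          exact i3 q (Or.inr ⟨v, Finset.mem_range.1 hv, he⟩)
  · have h3 : (I.n - 1) * (80 * I.n + 120 + 9) ≤ I.n * (80 * I.n + 129) :=
      Nat.mul_le_mul (by omega) (by omega)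
    nlinarith

end Inst

/-! ### Evaluating the oracle -/

-- The query `vQv`, `vQk`, `vQt`, its answer `vFlag`, `vLen`, `rD` (mark, number of edges, length),
-- and the component of `vQt` with the address of its entry.
notation "vQv" => (30 : ℕ)
notation "vQk" => (31 : ℕ)
notation "vQt" => (32 : ℕ)
notation "vFlag" => (33 : ℕ)
notation "vLen" => (34 : ℕ)
notation "vQi" => (35 : ℕ)
notation "vQx" => (36 : ℕ)
notation "rD" => (1 : ℕ)

/-- The address of the entry for the component `i` after the failure `vQv`, `vQk`. -/
def eEntry (i : NExpr) : NExpr := (var vQv * get aPrm 0 + (var vQk - 1)) * get aPrm 0 + i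

/-- The number of edges of the tree path between two vertices with a common ancestor `vLca`. -/
def eHops (x y : NExpr) : NExpr :=
  get aDep x - get aDep (var vLca) + (get aDep y - get aDep (var vLca))

/-- The length of the tree path between two vertices with a common ancestor `vLca`. -/
def eTlen (x y : NExpr) : RExpr :=
  .get bDs x - .get bDs (var vLca) + (.get bDs y - .get bDs (var vLca))

/-- The number of the component of `vQt` after the failure of the whole path to `vQv`. -/
def cComp : Cmd :=
  setN vU (var vQv) ;; setN vV (var vQt) ;; cLca ;;
  setN vQi (get aDep (var vQv) - get aDep (var vLca))

/-- The detour to `vQt` outside of the component of the root. -/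
def cAskEntry : Cmd :=
  setN vU (get aY (var vQx)) ;; cLca ;;
  setN vLen (get aH (var vQx) + eHops (var vU) (var vQt)) ;;
  setR rD (.get bD (var vQx) + eTlen (var vU) (var vQt))

/-- Is `vQt` reachable after the failure of the last `vQk` edges of the path to `vQv`, and what are
the number of edges and the length of the detour? -/
def cAsk : Cmd :=
  cComp ;;
  branch (.nle (var vQk) (var vQi))
    (setN vFlag 1 ;; setN vLen (get aDep (var vQt)) ;; setR rD (.get bDs (var vQt)))
    (setN vQx (eEntry (var vQi)) ;; setN vFlag (get aFl (var vQx)) ;;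
      branch (.eq (var vFlag) 0) nop cAskEntry)

namespace Inst

variable (I : Inst)

/-- The address of the entry for the component `i` after the failure of the last `k` edges of the
path to `v`. -/
def ent (v k i : ℕ) : ℕ := (v * I.f + (k - 1)) * I.f + i

variable {I}

theorem ent_lt {v k i : ℕ} (hv : v < I.n) (hk : 1 ≤ k) (hkf : k ≤ I.f) (hi : i < k) :
    I.ent v k i < I.n * I.f * I.f := by
  have h1 : (v + 1) * I.f ≤ I.n * I.f := Nat.mul_le_mul_right _ hv
  have h2 : (v * I.f + (k - 1) + 1) * I.f ≤ I.n * I.f * I.f :=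
    Nat.mul_le_mul_right _ (by rw [Nat.succ_mul] at h1; omega)
  rw [Nat.succ_mul] at h2
  rw [ent]
  omega

theorem ent_inj {v k i v' k' i' : ℕ} (hk : 1 ≤ k) (hkf : k ≤ I.f) (hi : i < k) (hk' : 1 ≤ k')
    (hkf' : k' ≤ I.f) (hi' : i' < k') (h : I.ent v k i = I.ent v' k' i') :
    v = v' ∧ k = k' ∧ i = i' := by
  have key : ∀ {a b c d : ℕ}, b < I.f → d < I.f → a * I.f + b = c * I.f + d → a = c ∧ b = d :=
    fun {a b c d} hb hd he => by
      have h1 : (a * I.f + b) / I.f = a := by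
        rw [Nat.mul_comm, Nat.mul_add_div (by omega), Nat.div_eq_of_lt hb, Nat.add_zero]
      have h2 : (c * I.f + d) / I.f = c := by
        rw [Nat.mul_comm, Nat.mul_add_div (by omega), Nat.div_eq_of_lt hd, Nat.add_zero]
      have h3 : a = c := by rw [← h1, he, h2]
      subst h3
      omega
  obtain ⟨h1, h2⟩ := key (by omega) (by omega) h
  obtain ⟨h3, h4⟩ := key (by omega) (by omega) h1
  omega

theorem hops_le {x y : ℕ} (hx : x < I.n) (hy : y < I.n) : I.hops x y ≤ 2 * I.n := by
  have h1 : I.dp x < I.n := I.tree.dep_lt hx I.par_lt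
  have h2 : I.dp y < I.n := I.tree.dep_lt hy I.par_lt
  rw [hops]
  omega

theorem lc_lt {x y : ℕ} (hx : x < I.n) : I.lc x y < I.n :=
  lt_of_anc hx (IsTree.lca_anc_left _ _)

theorem ix_le (v t : ℕ) : I.ix v t ≤ I.dp v := I.tree.idx_le_dep v t

theorem LcaOk.congr {s s' : State} (h : I.LcaOk s)
    (hs : ∀ a, 3 ≤ a → a ≤ 12 → s'.ia a = s.ia a) : I.LcaOk s' := by
  have e3 := hs aPrm (by omega) (by omega)
  have e5 := hs aPos (by omega) (by omega)
  have e6 := hs aTop (by omega) (by omega)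
  have e7 := hs aAt (by omega) (by omega)
  have e8 := hs aPow (by omega) (by omega)
  have e9 := hs aLog (by omega) (by omega)
  have e10 := hs aLow (by omega) (by omega)
  have e11 := hs aMask (by omega) (by omega)
  have e12 := hs aMin (by omega) (by omega)
  refine ⟨?_, ?_, ?_, ?_, ?_, ?_, ?_, ?_, ?_⟩ <;>
    simp only [e3, e5, e6, e7, e8, e9, e10, e11, e12]
  exacts [h.pre, h.pos_pos, h.pos_le, h.at_pos, h.top_pos, h.top_le, h.b_le, h.pow_le, h.rmq]

theorem fn_cComp {B : ℕ} {s : State} (hT : I.TreeOk s) (hL : I.LcaOk s) (hB : I.n + 1 ≤ B)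
    (hv : s.iv vQv < I.n) (ht : s.iv vQt < I.n) :
    Fn B cComp s (fun s' => s'.iv vQi = I.ix (s.iv vQv) (s.iv vQt) ∧
      s'.iv vV = s.iv vQt) := by
  rw [cComp, fn_seq, fn_setN]
  refine ⟨by rw [eval_var]; omega, ?_⟩
  rw [fn_seq, fn_setN]
  simp only [eval_var, ne_eq, not_false_eq_true, Nat.reduceEqDiff, setN_iv_ne]
  refine ⟨by omega, ?_⟩
  rw [fn_seq]
  have hL' : I.LcaOk ((s.setN vU (s.iv vQv)).setN vV (s.iv vQt)) := hL.congr fun _ _ _ => rfl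
  refine (fn_cLca hL' hB (by simpa using hv) (by simpa using ht)).mono fun s₁ f₁ h₁ => ?_
  have h1 := ix_le (I := I) (s.iv vQv) (s.iv vQt)
  have h2 : I.dp (s.iv vQv) < I.n := I.tree.dep_lt hv I.par_lt
  have h3 : I.ix (s.iv vQv) (s.iv vQt) = _ := I.tree.idx_eq _ _
  rw [fn_setN, eval_sub, eval_get, eval_get, eval_var, eval_var, f₁.ia aDep rfl, f₁.iv vQv rfl, h₁]
  simp only [setN_iv_self, setN_iv_ne, ne_eq, not_false_eq_true, Nat.reduceEqDiff, setN_ia]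
  rw [hT.dp _ hv, hT.dp _ (lc_lt hv)]
  have h4 := f₁.iv vV rfl
  simp only [setN_iv_self] at h4
  simp only [dp, lc] at *
  refine ⟨by omega, by omega, h4⟩

theorem fn_cAsk {B v k t : ℕ} {s : State} (hT : I.TreeOk s) (hL : I.LcaOk s)
    (hf : s.ia aPrm 0 = I.f) (hB : I.n + 1 ≤ B) (hB' : I.n * I.f * I.f ≤ B)
    (hv : v < I.n) (hk : 1 ≤ k) (hkf : k ≤ I.f) (ht : t < I.n)
    (hsv : s.iv vQv = v) (hsk : s.iv vQk = k) (hst : s.iv vQt = t)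
    (hE : I.ix v t < k → s.ia aFl (I.ent v k (I.ix v t)) ≤ 1 ∧
      (s.ia aFl (I.ent v k (I.ix v t)) ≠ 0 → s.ia aY (I.ent v k (I.ix v t)) < I.n ∧
        s.ia aH (I.ent v k (I.ix v t)) + 2 * I.n ≤ B)) :
    Fn B cAsk s (fun s' =>
      s'.iv vQi = I.ix v t ∧ (I.ix v t < k → s'.iv vQx = I.ent v k (I.ix v t)) ∧
      s'.iv vFlag = I.askFl v k (fun i => s.ia aFl (I.ent v k i)) t ∧
      (I.askFl v k (fun i => s.ia aFl (I.ent v k i)) t ≠ 0 →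
        s'.iv vLen = I.askLen v k (fun i => s.ia aY (I.ent v k i)) (fun i => s.ia aH (I.ent v k i)) t ∧
        s'.rv rD = I.askD v k (fun i => s.ia aY (I.ent v k i)) (fun i => s.ra bD (I.ent v k i)) t)) := by
  rw [cAsk, fn_seq]
  refine (fn_cComp hT hL hB (hsv ▸ hv) (hst ▸ ht)).mono fun s₁ f₁ ⟨h₁, hVt⟩ => ?_
  rw [hsv, hst] at h₁
  rw [hst] at hVt
  have e1 : s₁.ia = s.ia := funext fun a => f₁.ia a rfl
  have e2 : s₁.ra = s.ra := funext fun a => f₁.ra a rfl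
  have hdt : I.dp t < I.n := I.tree.dep_lt ht I.par_lt
  rw [fn_branch]
  simp only [holds_nle, eval_var, f₁.iv vQk rfl, hsk, h₁]
  constructor
  · intro h
    simp only [fn_seq, fn_setN, fn_setR, eval_ofNat, eval_get, eval_var, setN_ia, setN_iv_self,
      setN_iv_ne, ne_eq, not_false_eq_true, Nat.reduceEqDiff, f₁.iv vQt rfl, hst, e1, hT.dp t ht,
      reval_get, setN_ra, e2, hT.ds t ht, setR_iv, setR_rv_self, h₁, askFl, askLen, askD, if_pos h]
    exact ⟨by omega, by omega, trivial, fun h' => absurd h' (by omega), trivial,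
      fun _ => ⟨trivial, trivial⟩⟩
  · intro h
    obtain ⟨hE1, hE2⟩ := hE (by omega)
    have hent := ent_lt hv hk hkf (not_le.1 h)
    have hent' : (v * I.f + (k - 1)) * I.f + I.ix v t = I.ent v k (I.ix v t) := rfl
    simp only [fn_seq, fn_setN, fn_branch, fn_nop, eEntry, eval_ofNat, eval_get, eval_var, eval_add,
      eval_mul, eval_sub, setN_ia, setN_iv_self,
      setN_iv_ne, ne_eq, not_false_eq_true, Nat.reduceEqDiff, f₁.iv vQt rfl, f₁.iv vQv rfl,
      f₁.iv vQk rfl, hst, hsv, hsk, e1, hf, h₁, hent', holds_eq, askFl, askLen, askD, if_neg h]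
    refine ⟨by omega, by omega, fun h0 => ⟨trivial, fun _ => trivial, trivial,
      fun h' => absurd h0 h'⟩, fun h0 => ?_⟩
    obtain ⟨hY, hH⟩ := hE2 h0
    rw [cAskEntry, fn_seq, fn_setN]
    simp only [eval_get, eval_var, setN_ia, setN_iv_self, setN_iv_ne, ne_eq, not_false_eq_true,
      Nat.reduceEqDiff, e1]
    refine ⟨by omega, ?_⟩
    rw [fn_seq]
    have hL' : I.LcaOk (((s₁.setN vQx (I.ent v k (I.ix v t))).setN vFlag
        (s.ia aFl (I.ent v k (I.ix v t)))).setN vU (s.ia aY (I.ent v k (I.ix v t)))) :=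
      hL.congr fun _ _ _ => by simp only [setN_ia, e1]
    refine (fn_cLca hL' hB (by simpa using hY) (by simpa [hVt] using ht)).mono fun s₂ f₂ h₂ => ?_
    simp only [setN_iv_self, setN_iv_ne, ne_eq, not_false_eq_true, Nat.reduceEqDiff, hVt] at h₂
    have e3 : s₂.ia = s.ia := by rw [← e1]; exact funext fun a => f₂.ia a rfl
    have e4 : s₂.ra = s.ra := by rw [← e2]; exact funext fun a => f₂.ra a rfl
    have e5 := f₂.iv vQx rfl
    have e6 := f₂.iv vU rfl
    have e7 := f₂.iv vQt rfl
    have e8 := f₂.iv vFlag rfl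
    have e9 := f₂.iv vQi rfl
    simp only [setN_iv_self, setN_iv_ne, ne_eq, not_false_eq_true, Nat.reduceEqDiff,
      f₁.iv vQt rfl, hst, h₁] at e5 e6 e7 e8 e9
    have hl := lc_lt (I := I) (y := t) hY
    have hh := hops_le hY ht
    rw [hops] at hh
    simp only [fn_seq, fn_setN, fn_setR, eHops, eTlen, eval_get, eval_var, eval_add, eval_sub,
      reval_get, reval_add, reval_sub, setN_iv_self, setN_iv_ne, ne_eq, not_false_eq_true,
      Nat.reduceEqDiff, setN_ia, setN_ra, setR_iv, setR_rv_self, e3, e4, e5, e6, e7, e8, e9, h₂,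
      hT.dp _ hY, hT.dp _ ht, hT.dp _ hl, hT.ds _ hY, hT.ds _ ht, hT.ds _ hl, tlen, hops]
    refine ⟨by omega, trivial, fun _ => trivial, trivial, fun _ => ⟨trivial, trivial⟩⟩

end Inst

/-! ### The component graph -/

-- The costs of the edges, the components of the vertices, and the matrix of the cheapest edges.
notation "bEc" => (17 : ℕ)
notation "aCmp" => (18 : ℕ)
notation "aBest" => (19 : ℕ)
-- The number `vH` of the component of the root, and auxiliary variables.
notation "vH" => (60 : ℕ)
notation "vHs" => (61 : ℕ)
notation "vCi" => (62 : ℕ)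
notation "vCj" => (63 : ℕ)
notation "vHh" => (64 : ℕ)
notation "vIn" => (67 : ℕ)

/-- The costs of the edges. -/
def cCost : Cmd :=
  forUp vE vM (putR bEc (var vE + 1)
    (.get bDs (get aE1 (var vE)) + .get bW (var vE) + .get bDs (get aE2 (var vE))))

/-- The test whether the edge `d` costs at most as much as the edge `e`; a missing edge, which has the
name `0`, costs more than all others. -/
def tLe (d e : NExpr) : Test :=
  .neg (.conj (.neg (.eq e 0)) (.neg (.conj (.neg (.eq d 0)) (.rle (.get bEc d) (.get bEc e)))))

/-- The number of edges of the longest failure on the path to `vQv`. -/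
def cH : Cmd :=
  setN vH (get aPrm 0) ;;
  branch (.lt (get aDep (var vQv)) (var vH)) (setN vH (get aDep (var vQv))) nop ;;
  setN vHs (var vH + 1)

/-- The components of all vertices. -/
def cCmp : Cmd :=
  forUp vQt vN (cComp ;;
    branch (.lt (var vQi) (var vH)) (putN aCmp (var vQt) (var vQi)) (putN aCmp (var vQt) (var vH)))

/-- The address of the cheapest edge between two components. -/
def eCell (i j : NExpr) : NExpr := i * var vHs + j

/-- Replaces the cheapest edge between two components by the edge `vE` if this is cheaper. -/
def cEdge : Cmd :=
  setN vEx (get aE1 (var vE)) ;; setN vEy (get aE2 (var vE)) ;;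
  setN vCi (get aCmp (var vEx)) ;; setN vCj (get aCmp (var vEy)) ;;
  branch (.conj (.conj (.neg (.eq (get aPar (var vEx)) (var vEy)))
      (.neg (.eq (get aPar (var vEy)) (var vEx))))
      (tLe (var vE + 1) (get aBest (eCell (var vCi) (var vCj)))))
    (putN aBest (eCell (var vCi) (var vCj)) (var vE + 1) ;;
      putN aBest (eCell (var vCj) (var vCi)) (var vE + 1)) nop

/-- The cheapest edges between the components. -/
def cBest : Cmd :=
  setN vHh (var vHs * var vHs) ;; forUp vIn vHh (putN aBest (var vIn) 0) ;; forUp vE vM cEdge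

namespace Inst

variable (I : Inst)

/-- The length of the longest failure on the path to `v`. -/
noncomputable def mx (v : ℕ) : ℕ := min I.f (I.dp v)

/-- The state holds the input, the tree with its tables, and the costs of the edges. -/
structure Ready (s : State) : Prop where
  inp : I.InOk s
  tree : I.TreeOk s
  lca : I.LcaOk s
  prm : s.ia aPrm 0 = I.f
  ec : ∀ e, 1 ≤ e → e ≤ I.m → I.cost e = ((s.ra bEc e : ℝ) : WithTop ℝ)

variable {I}

theorem Ready.frame {p : Cmd} {s s' : State} (h : I.Ready s) (hf : Frame p s s')
    (hp : (p.wv vN || p.wv vM || p.wv vF || p.wv vR || p.wa aPar || p.wa aE1 || p.wa aE2 ||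
      p.wb bW) = false)
    (hq : (p.wa aPrm || p.wa aDep || p.wa aPos || p.wa aTop || p.wa aAt || p.wa aPow || p.wa aLog ||
      p.wa aLow || p.wa aMask || p.wa aMin || p.wb bDs || p.wb bEc) = false) : I.Ready s' := by
  have hp' := hp
  simp only [Bool.or_eq_false_iff] at hp' hq
  obtain ⟨⟨⟨⟨⟨⟨⟨⟨⟨⟨⟨h3, h4⟩, h5⟩, h6⟩, h7⟩, h8⟩, h9⟩, h10⟩, h11⟩, h12⟩, h1⟩, h17⟩ := hq
  have h0 := hp'.1.1.1.2
  refine ⟨h.inp.frame hf hp, ⟨?_, ?_, ?_⟩, h.lca.congr ?_, ?_, ?_⟩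
  · rw [hf.ia _ h0]; exact h.tree.par
  · rw [hf.ia _ h4]; exact h.tree.dp
  · rw [hf.ra _ h1]; exact h.tree.ds
  · intro a ha ha'
    interval_cases a <;> exact hf.ia _ (by assumption)
  · rw [hf.ia _ h3]; exact h.prm
  · rw [hf.ra _ h17]; exact h.ec

theorem runs_cCost {B : ℕ} {s : State} (h : I.InOk s) (ht : I.TreeOk s) (hm : I.m + 1 ≤ B) :
    Runs B cCost s (30 * I.m + 9)
      (fun s' => ∀ e, 1 ≤ e → e ≤ I.m → I.cost e = ((s'.ra bEc e : ℝ) : WithTop ℝ)) := by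
  refine (Runs.forUp (B := B) (c := 20) (N := I.m)
    (fun j s' => ∀ e, 1 ≤ e → e ≤ j → I.cost e = ((s'.ra bEc e : ℝ) : WithTop ℝ)) h.m (by omega)
    rfl rfl (fun e h1 h2 => by omega) ?_).mono (by omega) fun _ _ h => h
  intro j s₁ hj hf hij hI
  have h₁ := h.frame hf rfl
  have hx := I.ea_lt j hj
  have hy := I.eb_lt j hj
  have e0 : s₁.ra bDs = s.ra bDs := hf.ra _ rfl
  refine Fn.runs ?_ rfl (by decide)
  simp only [fn_putR, eval_add, eval_var, eval_ofNat, reval_add, reval_get, eval_get, hij,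
    h₁.e1 j hj, h₁.e2 j hj, h₁.w j hj, e0, ht.ds _ hx, ht.ds _ hy, setN_ra, putR_ra_self]
  refine ⟨by omega, fun e h1 h2 => ?_⟩
  rw [Function.update_apply]
  split_ifs with he
  · rw [he, cost]
  · exact hI e h1 (by omega)

theorem holds_tLe {s : State} (h : I.Ready s) {d e : NExpr} (hd : d.eval s ≤ I.m)
    (he : e.eval s ≤ I.m) : (tLe d e).Holds s ↔ I.cost (d.eval s) ≤ I.cost (e.eval s) := by
  simp only [tLe, holds_neg, holds_conj, holds_eq, holds_rle, eval_ofNat, reval_get]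
  rcases Nat.eq_zero_or_pos (e.eval s) with h0 | h0
  · simp [h0, cost]
  · rcases Nat.eq_zero_or_pos (d.eval s) with h1 | h1
    · rw [h1, h.ec _ h0 he, cost]
      simp [h0.ne']
    · rw [h.ec _ h0 he, h.ec _ h1 hd, WithTop.coe_le_coe]
      simp [h0.ne', h1.ne']

theorem runs_cH {B v : ℕ} {s : State} (h : I.Ready s) (hv : s.iv vQv = v) (hvn : v < I.n)
    (hB : I.f + 1 ≤ B) :
    Runs B cH s 30 (fun s' => s'.iv vH = I.mx v ∧ s'.iv vHs = I.mx v + 1) := by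
  refine Fn.runs ?_ rfl (by decide)
  simp only [cH, fn_seq, fn_setN, fn_branch, fn_nop, eval_get, eval_var, eval_ofNat, eval_add,
    setN_ia, setN_iv_self, setN_iv_ne, ne_eq, not_false_eq_true, Nat.reduceEqDiff, holds_lt, h.prm,
    hv, h.tree.dp v hvn, mx]
  omega

theorem runs_cCmp {B v h : ℕ} {s : State} (hs : I.Ready s) (hv : s.iv vQv = v) (hvn : v < I.n)
    (hh : s.iv vH = h) (hB : I.n + 1 ≤ B) (hhB : h ≤ B) :
    Runs B cCmp s (1000 * I.n + 9) (fun s' => ∀ a < I.n, s'.ia aCmp a = min h (I.ix v a)) := by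
  refine (Runs.forUp (B := B) (c := 991) (N := I.n)
    (fun j s' => ∀ a < j, s'.ia aCmp a = min h (I.ix v a)) hs.inp.n (by omega)
    rfl rfl (fun a ha => by omega) ?_).mono (by omega) fun _ _ h => h
  intro j s₁ hj hf hij hI
  have h₁ := hs.frame hf rfl rfl
  have hv₁ : s₁.iv vQv = v := (hf.iv _ rfl).trans hv
  have hh₁ : s₁.iv vH = h := (hf.iv _ rfl).trans hh
  have hix := ix_le (I := I) v j
  have hdv : I.dp v < I.n := I.tree.dep_lt hvn I.par_lt
  refine Fn.runs ?_ rfl (by decide)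
  rw [fn_seq]
  refine (fn_cComp h₁.tree h₁.lca hB (hv₁ ▸ hvn) (hij ▸ hj)).mono fun s₂ f₂ ⟨h₂, _⟩ => ?_
  rw [hv₁, hij] at h₂
  have e1 : s₂.ia aCmp = s₁.ia aCmp := f₂.ia _ rfl
  simp only [fn_branch, fn_putN, holds_lt, eval_var, h₂, f₂.iv vH rfl, hh₁, f₂.iv vQt rfl, hij,
    setN_ia, putN_ia_self, e1]
  have key : ∀ c, c = min h (I.ix v j) → ∀ a < j + 1,
      Function.update (s₁.ia aCmp) j c a = min h (I.ix v a) := fun c hc a ha => by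
    rw [Function.update_apply]
    split_ifs with haj
    · rw [hc, haj]
    · exact hI a (by omega)
  exact ⟨fun h3 => ⟨by omega, by omega, key _ (by omega)⟩,
    fun h3 => ⟨by omega, by omega, key _ (by omega)⟩⟩

/-- The entries of the table `c` are cheapest edges among the first `m'` ones. -/
structure BestOk (I : Inst) (v h m' : ℕ) (c : ℕ → ℕ → ℕ) : Prop where
  symm : ∀ i ≤ h, ∀ j ≤ h, c i j = c j i
  mt : ∀ i ≤ h, ∀ j ≤ h, c i j = 0 ∨ I.Mt v h (c i j) i j
  le : ∀ i ≤ h, ∀ j ≤ h, c i j ≤ m'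
  least : ∀ e ≤ m', ∀ i j, I.Mt v h e i j → I.cost (c i j) ≤ I.cost e

theorem cell_inj {h i j i' j' : ℕ} (hj : j ≤ h) (hj' : j' ≤ h)
    (he : i * (h + 1) + j = i' * (h + 1) + j') : i = i' ∧ j = j' := by
  have h1 : (i * (h + 1) + j) / (h + 1) = i := by
    rw [Nat.mul_comm, Nat.mul_add_div (by omega), Nat.div_eq_of_lt (by omega), Nat.add_zero]
  have h2 : (i' * (h + 1) + j') / (h + 1) = i' := by
    rw [Nat.mul_comm, Nat.mul_add_div (by omega), Nat.div_eq_of_lt (by omega), Nat.add_zero]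
  have h3 : i = i' := by rw [← h1, he, h2]
  subst h3
  omega

theorem cell_lt {h i j : ℕ} (hi : i ≤ h) (hj : j ≤ h) :
    i * (h + 1) + j < (h + 1) * (h + 1) := by
  have : (i + 1) * (h + 1) ≤ (h + 1) * (h + 1) := Nat.mul_le_mul_right _ (by omega)
  rw [Nat.succ_mul] at this
  omega

theorem BestOk.skip {v h e : ℕ} {c : ℕ → ℕ → ℕ} (H : I.BestOk v h e c)
    (hnew : ∀ i j, I.Mt v h (e + 1) i j → I.cost (c i j) ≤ I.cost (e + 1)) :
    I.BestOk v h (e + 1) c :=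
  ⟨H.symm, H.mt, fun i hi j hj => (H.le i hi j hj).trans (Nat.le_succ e), fun e' he' i j hij => by
    rcases Nat.le_succ_iff.1 he' with h1 | rfl
    · exact H.least e' h1 i j hij
    · exact hnew i j hij⟩

theorem BestOk.update {v h e x y : ℕ} {c c' : ℕ → ℕ → ℕ} (H : I.BestOk v h e c)
    (hxy : I.Ends (e + 1) x y)
    (hle : I.cost (e + 1) ≤ I.cost (c (min h (I.ix v x)) (min h (I.ix v y))))
    (hc' : ∀ i ≤ h, ∀ j ≤ h, c' i j =
      if (i = min h (I.ix v x) ∧ j = min h (I.ix v y)) ∨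
        (i = min h (I.ix v y) ∧ j = min h (I.ix v x)) then e + 1 else c i j) :
    I.BestOk v h (e + 1) c' := by
  refine ⟨?_, ?_, ?_, ?_⟩
  · intro i hi j hj
    rw [hc' i hi j hj, hc' j hj i hi, H.symm i hi j hj]
    exact if_congr (by tauto) rfl rfl
  · intro i hi j hj
    rw [hc' i hi j hj]
    split_ifs with h1
    · right
      rcases h1 with ⟨rfl, rfl⟩ | ⟨rfl, rfl⟩
      · exact ⟨x, y, hxy, rfl, rfl⟩
      · exact ⟨y, x, hxy.symm, rfl, rfl⟩
    · exact H.mt i hi j hj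
  · intro i hi j hj
    rw [hc' i hi j hj]
    split_ifs
    · exact le_rfl
    · exact (H.le i hi j hj).trans (Nat.le_succ e)
  · intro e' he' i j hij
    have hlt := hij.le
    rw [hc' i hlt.1 j hlt.2]
    split_ifs with h1
    · rcases Nat.le_succ_iff.1 he' with h2 | rfl
      · refine hle.trans ?_
        rcases h1 with ⟨rfl, rfl⟩ | ⟨rfl, rfl⟩
        · exact H.least e' h2 _ _ hij
        · exact H.least e' h2 _ _ hij.symm
      · exact le_rfl
    · rcases Nat.le_succ_iff.1 he' with h2 | rfl
      · exact H.least e' h2 i j hij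
      · obtain ⟨x', y', hxy', rfl, rfl⟩ := hij
        exfalso
        have h3 := hxy.2.2.2.2
        have h4 := hxy'.2.2.2.2
        simp only [Nat.add_sub_cancel] at h3 h4
        rcases h3 with ⟨rfl, rfl⟩ | ⟨rfl, rfl⟩ <;> rcases h4 with ⟨rfl, rfl⟩ | ⟨rfl, rfl⟩ <;> tauto

theorem fn_cEdge {B v h e : ℕ} {s : State} (hs : I.Ready s) (he : e < I.m)
    (hij : s.iv vE = e) (e2 : s.iv vHs = h + 1) (hB : I.m + 1 ≤ B) (hnB : I.n ≤ B)
    (hhB : (h + 1) * (h + 1) ≤ B) (hcmp : ∀ a < I.n, s.ia aCmp a = min h (I.ix v a))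
    (hI : I.BestOk v h e (fun i j => s.ia aBest (i * (h + 1) + j))) :
    Fn B cEdge s (fun s' =>
      I.BestOk v h (e + 1) fun i j => s'.ia aBest (i * (h + 1) + j)) := by
  have hx := I.ea_lt e he
  have hy := I.eb_lt e he
  set x := I.ea e with hxe
  set y := I.eb e with hye
  have hci : min h (I.ix v x) ≤ h := min_le_left _ _
  have hcj : min h (I.ix v y) ≤ h := min_le_left _ _
  have hends : (I.par x ≠ y ∧ I.par y ≠ x) → I.Ends (e + 1) x y := fun h3 =>
    ⟨by omega, by omega, h3.1, h3.2, Or.inl ⟨rfl, rfl⟩⟩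
  have hends' : ∀ a b, I.Ends (e + 1) a b → (a = x ∧ b = y) ∨ (a = y ∧ b = x) := by
    rintro a b ⟨-, -, -, -, h3 | h3⟩ <;> simp only [Nat.add_sub_cancel] at h3
    · exact Or.inl ⟨h3.1.symm, h3.2.symm⟩
    · exact Or.inr ⟨h3.2.symm, h3.1.symm⟩
  have hsq : h + 1 ≤ (h + 1) * (h + 1) := Nat.le_mul_of_pos_left _ (by omega)
  have hl := hI.le _ hci _ hcj
  set ci := min h (I.ix v x) with hcie
  set cj := min h (I.ix v y) with hcje
  set s₄ := ((((s.setN vEx x).setN vEy y).setN vCi ci).setN vCj cj) with hs₄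
  have hiv : s₄.iv vE = e ∧ s₄.iv vCi = ci ∧ s₄.iv vCj = cj ∧ s₄.iv vEx = x ∧ s₄.iv vEy = y ∧
      s₄.iv vHs = h + 1 := by
    simp only [hs₄, setN_iv_self, setN_iv_ne, ne_eq, not_false_eq_true, Nat.reduceEqDiff, hij, e2,
      and_self]
  obtain ⟨i1, i2, i3, i4, i5, i6⟩ := hiv
  have hia : s₄.ia = s.ia := rfl
  have hr₄ : I.Ready s₄ := by
    refine ⟨⟨?_, ?_, ?_, ?_, hs.inp.par, hs.inp.e1, hs.inp.e2, hs.inp.w⟩, ⟨hs.tree.par,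
      hs.tree.dp, hs.tree.ds⟩, hs.lca.congr fun _ _ _ => rfl, hs.prm, hs.ec⟩ <;>
    simp only [hs₄, setN_iv_self, setN_iv_ne, ne_eq, not_false_eq_true, Nat.reduceEqDiff]
    exacts [hs.inp.n, hs.inp.m, hs.inp.f, hs.inp.r]
  simp only [cEdge, fn_seq, fn_setN, eval_get, eval_var, setN_ia, setN_iv_self, setN_iv_ne,
    ne_eq, not_false_eq_true, Nat.reduceEqDiff, hij, hs.inp.e1 e he, hs.inp.e2 e he,
    ← hxe, ← hye, hcmp x hx, hcmp y hy, ← hcie, ← hcje]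
  refine ⟨by omega, by omega, by omega, by omega, ?_⟩
  rw [← hs₄, fn_branch]
  have hcell : (eCell (var vCi) (var vCj)).eval s₄ = ci * (h + 1) + cj := by
    simp only [eCell, eval_add, eval_mul, eval_var, i2, i3, i6]
  have hcell' : (eCell (var vCj) (var vCi)).eval s₄ = cj * (h + 1) + ci := by
    simp only [eCell, eval_add, eval_mul, eval_var, i2, i3, i6]
  have hv1 : (var vE + 1).eval s₄ = e + 1 := by
    simp only [eval_add, eval_var, eval_ofNat, i1]
  have hg : (get aBest (eCell (var vCi) (var vCj))).eval s₄ =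
      s.ia aBest (ci * (h + 1) + cj) := by
    rw [eval_get, hcell, hia]
  have hpx := hr₄.tree.par x hx
  have hpy := hr₄.tree.par y hy
  rw [holds_conj, holds_conj, holds_neg, holds_neg, holds_eq, holds_eq,
    holds_tLe hr₄ (by rw [hv1]; omega) (by rw [hg]; omega), hv1, hg]
  simp only [eval_get, eval_var, i4, i5, hpx, hpy]
  constructor
  · rintro ⟨h1, h2⟩
    simp only [fn_seq, fn_putN, hcell, hv1]
    have hcell'' : (eCell (var vCj) (var vCi)).eval
        (s₄.putN aBest (ci * (h + 1) + cj) (e + 1)) = cj * (h + 1) + ci := hcell'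
    have hv2 : (var vE + 1).eval (s₄.putN aBest (ci * (h + 1) + cj) (e + 1)) = e + 1 := hv1
    have hb1 := cell_lt hci hcj
    have hb2 := cell_lt hcj hci
    rw [hcell'', hv2]
    refine ⟨by omega, by omega, by omega, by omega, hI.update (hends h1) h2 ?_⟩
    intro i hi j hj
    simp only [putN_ia_self, Function.update_apply, hia]
    have k1 : i * (h + 1) + j = cj * (h + 1) + ci ↔ i = cj ∧ j = ci :=
      ⟨cell_inj hj hci, fun ⟨h1, h2⟩ => by rw [h1, h2]⟩
    have k2 : i * (h + 1) + j = ci * (h + 1) + cj ↔ i = ci ∧ j = cj :=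
      ⟨cell_inj hj hcj, fun ⟨h1, h2⟩ => by rw [h1, h2]⟩
    rw [if_congr k1 rfl rfl, if_congr k2 rfl rfl]
    by_cases h3 : i = cj ∧ j = ci
    · rw [if_pos h3, if_pos (Or.inr h3)]
    · rw [if_neg h3]
      exact if_congr ⟨Or.inl, fun h4 => h4.resolve_right h3⟩ rfl rfl
  · intro h1
    rw [fn_nop]
    refine hI.skip ?_
    rintro i j ⟨a, b, hab, rfl, rfl⟩
    have h2 : I.par x ≠ y ∧ I.par y ≠ x := by
      rcases hends' a b hab with ⟨rfl, rfl⟩ | ⟨rfl, rfl⟩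
      · exact ⟨hab.2.2.1, hab.2.2.2.1⟩
      · exact ⟨hab.2.2.2.1, hab.2.2.1⟩
    have h3 := le_of_not_ge fun h3 => h1 ⟨h2, h3⟩
    rcases hends' a b hab with ⟨rfl, rfl⟩ | ⟨rfl, rfl⟩
    · exact h3
    · rw [hI.symm _ hcj _ hci]
      exact h3

theorem runs_cBest {B v h : ℕ} {s : State} (hs : I.Ready s)
    (hh1 : s.iv vHs = h + 1) (hB : I.m + 1 ≤ B) (hnB : I.n ≤ B)
    (hhB : (h + 1) * (h + 1) ≤ B)
    (hcmp : ∀ a < I.n, s.ia aCmp a = min h (I.ix v a)) :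
    Runs B cBest s (200 * I.m + 100 * ((h + 1) * (h + 1)))
      (fun s' => I.BestOk v h I.m (fun i j => s'.ia aBest (i * (h + 1) + j))) := by
  have hpos : 1 ≤ (h + 1) * (h + 1) := Nat.mul_pos (by omega) (by omega)
  have hsq : h + 1 ≤ (h + 1) * (h + 1) := Nat.le_mul_of_pos_left _ (by omega)
  have h0 : Runs B (setN vHh (var vHs * var vHs)) s 10
      (fun s' => s'.iv vHh = (h + 1) * (h + 1)) := by
    refine Fn.runs ?_ rfl (by decide)
    simp only [fn_setN, eval_mul, eval_var, hh1, setN_iv_self]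
    exact ⟨hhB, trivial⟩
  refine h0.seq (N₂ := 200 * I.m + 80 * ((h + 1) * (h + 1))) ?_ (by omega)
  intro s₁ f₁ hH
  have h1 : Runs B (forUp vIn vHh (putN aBest (var vIn) 0)) s₁ ((h + 1) * (h + 1) * 19 + 9)
      (fun s' => ∀ q < (h + 1) * (h + 1), s'.ia aBest q = 0) := by
    refine Runs.forUp (c := 10) (fun j s' => ∀ q < j, s'.ia aBest q = 0) hH hhB rfl rfl
      (fun q hq => by omega) ?_
    intro j s₂ hj hf hij hI
    refine Fn.runs ?_ rfl (by decide)
    simp only [fn_putN, eval_var, eval_ofNat, hij, setN_ia, putN_ia_self]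
    refine ⟨by omega, by omega, fun q hq => ?_⟩
    rw [Function.update_apply]
    split_ifs with hqj
    · rfl
    · exact hI q (by omega)
  refine h1.seq (N₂ := 200 * I.m + 20 * ((h + 1) * (h + 1))) ?_ (by omega)
  intro s₂ f₂ hz
  have hs₂ := (hs.frame f₁ rfl rfl).frame f₂ rfl rfl
  refine (Runs.forUp (B := B) (c := 180) (N := I.m)
    (fun m' s' => I.BestOk v h m' (fun i j => s'.ia aBest (i * (h + 1) + j))) hs₂.inp.m (by omega)
    rfl rfl ?_ ?_).mono (by omega) fun _ _ h => h
  · refine ⟨fun i hi j hj => ?_, fun i hi j hj => Or.inl (hz _ (cell_lt hi hj)),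
      fun i hi j hj => (hz _ (cell_lt hi hj)).le, ?_⟩
    · exact (hz _ (cell_lt hi hj)).trans (hz _ (cell_lt hj hi)).symm
    · rintro e he i j ⟨x, y, hxy, -⟩
      have := hxy.1
      omega
  · intro e s₃ he hf₃ hij hI
    have hs₃ := hs₂.frame hf₃ rfl rfl
    exact Fn.runs (fn_cEdge hs₃ he hij (by rw [hf₃.iv _ rfl, f₂.iv _ rfl, f₁.iv _ rfl, hh1]) hB hnB
      hhB (by rw [hf₃.ia _ rfl, f₂.ia _ rfl, f₁.ia _ rfl]; exact hcmp) hI) rfl (by decide)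

end Inst

/-! ### A minimum spanning tree of the component graph -/

-- Parents and parent edges in the component tree, the marks of the visited components, and their
-- sequence.
notation "aP" => (20 : ℕ)
notation "aPe" => (21 : ℕ)
notation "aVis" => (22 : ℕ)
notation "aSeq" => (23 : ℕ)
notation "vLc" => (65 : ℕ)
notation "vSel" => (66 : ℕ)

/-- Only the root `vH` is visited. -/
def cInit : Cmd :=
  forUp vIn vH (putN aP (var vIn) (var vH) ;;
    putN aPe (var vIn) (get aBest (eCell (var vH) (var vIn))) ;; putN aVis (var vIn) 0) ;;
  putN aSeq 0 (var vH)

/-- Selects the vertex `vSel` that has the cheapest connection to the visited ones. -/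
def cSel : Cmd :=
  setN vSel (var vH) ;;
  forUp vIn vH (branch (.conj (.eq (get aVis (var vIn)) 0)
    (.neg (.conj (.lt (var vSel) (var vH)) (tLe (get aPe (var vSel)) (get aPe (var vIn))))))
    (setN vSel (var vIn)) nop)

/-- Visits the selected vertex. -/
def cVisit : Cmd := putN aVis (var vSel) 1 ;; putN aSeq (var vLc + 1) (var vSel)

/-- Updates the connections of the other vertices. -/
def cRelax : Cmd :=
  forUp vIn vH (branch (.conj (.eq (get aVis (var vIn)) 0)
    (tLe (get aBest (eCell (var vSel) (var vIn))) (get aPe (var vIn))))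
    (putN aP (var vIn) (var vSel) ;; putN aPe (var vIn) (get aBest (eCell (var vSel) (var vIn))))
    nop)

/-- Prim's algorithm. -/
def cPrim : Cmd := cInit ;; forUp vLc vH (cSel ;; cVisit ;; cRelax)

namespace Inst

variable {I : Inst}

theorem runs_cInit {B h : ℕ} {s : State} (hh : s.iv vH = h) (hh1 : s.iv vHs = h + 1)
    (hm : ∀ u ≤ h, s.ia aBest (h * (h + 1) + u) ≤ B) (hB : h + 1 ≤ B) :
    Runs B cInit s (60 * h + 20) (fun s' => s'.ia aSeq 0 = h ∧ ∀ u < h, s'.ia aP u = h ∧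
      s'.ia aPe u = s.ia aBest (h * (h + 1) + u) ∧ s'.ia aVis u = 0) := by
  refine (Runs.forUp (B := B) (c := 50) (N := h) (fun j s' => ∀ u < j, s'.ia aP u = h ∧
      s'.ia aPe u = s.ia aBest (h * (h + 1) + u) ∧ s'.ia aVis u = 0) hh (by omega) rfl rfl
      (fun u hu => by omega) ?_).seq (N₂ := 10) ?_ (by omega)
  · intro j s₁ hj hf hij hI
    have e1 : s₁.ia aBest = s.ia aBest := hf.ia _ rfl
    have e2 : s₁.iv vH = h := (hf.iv _ rfl).trans hh
    have e3 : s₁.iv vHs = h + 1 := (hf.iv _ rfl).trans hh1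
    have := hm j hj.le
    refine Fn.runs ?_ rfl (by decide)
    simp only [fn_seq, fn_putN, eCell, eval_var, eval_get, eval_add, eval_mul, eval_ofNat, putN_iv,
      putN_ia_self, putN_ia_ne, ne_eq, not_false_eq_true, Nat.reduceEqDiff, setN_ia, e1, e2, e3, hij]
    refine ⟨by omega, by omega, by omega, by omega, by omega, by omega, fun u hu => ?_⟩
    simp only [Function.update_apply]
    split_ifs with huj
    · subst huj; exact ⟨rfl, rfl, rfl⟩
    · exact hI u (by omega)
  · intro s₁ f₁ h₁
    refine Fn.runs ?_ rfl (by decide)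
    simp only [fn_putN, eval_var, eval_ofNat, putN_ia_self, putN_ia_ne, ne_eq, not_false_eq_true,
      Nat.reduceEqDiff, Function.update_self, f₁.iv vH rfl, hh]
    exact ⟨by omega, by omega, trivial, h₁⟩

theorem runs_cSel {B h : ℕ} {s : State} (hs : I.Ready s) (hh : s.iv vH = h) (hB : h ≤ B)
    (hpe : ∀ u < h, s.ia aPe u ≤ I.m) :
    Runs B cSel s (60 * h + 20) (fun s' => (∃ u < h, s.ia aVis u = 0) → s'.iv vSel < h ∧
      s.ia aVis (s'.iv vSel) = 0 ∧ ∀ u < h, s.ia aVis u = 0 →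
        I.cost (s.ia aPe (s'.iv vSel)) ≤ I.cost (s.ia aPe u)) := by
  have h0 : Runs B (setN vSel (var vH)) s 2 (fun s' => s' = s.setN vSel h) :=
    Fn.runs (by rw [fn_setN]; simp [hh, hB]) rfl (by decide)
  refine h0.seq (N₂ := 60 * h + 18) ?_ (by omega)
  rintro s₁ f₁ rfl
  have hs₁ := hs.frame f₁ rfl rfl
  refine (Runs.forUp (B := B) (c := 50) (N := h) (fun j s' =>
      (s'.iv vSel = h ∧ ∀ u < j, s.ia aVis u ≠ 0) ∨ (s'.iv vSel < h ∧
      s.ia aVis (s'.iv vSel) = 0 ∧ ∀ u < j, s.ia aVis u = 0 →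
        I.cost (s.ia aPe (s'.iv vSel)) ≤ I.cost (s.ia aPe u))) (by simpa using hh) hB rfl rfl
      (Or.inl ⟨by simp, fun u hu => by omega⟩) ?_).mono (by omega) ?_
  · intro j s₂ hj hf hij hI
    have hs₂ := hs₁.frame hf rfl rfl
    have e1 : s₂.ia aVis = s.ia aVis := by rw [hf.ia _ rfl]; rfl
    have e2 : s₂.ia aPe = s.ia aPe := by rw [hf.ia _ rfl]; rfl
    have e3 : s₂.iv vH = h := by rw [hf.iv _ rfl]; simpa using hh
    refine Fn.runs ?_ rfl (by decide)
    rw [fn_branch, holds_conj, holds_eq, holds_neg, holds_conj, holds_lt, fn_setN, fn_nop]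
    simp only [eval_get, eval_var, eval_ofNat, e1, e3, hij, setN_iv_self, setN_iv_ne, ne_eq,
      not_false_eq_true, Nat.reduceEqDiff]
    constructor
    · rintro ⟨h1, h2⟩
      refine ⟨by omega, Or.inr ⟨hj, h1, fun u hu hu0 => ?_⟩⟩
      rcases Nat.lt_succ_iff_lt_or_eq.1 hu with hu | rfl
      · rcases hI with hI | hI
        · exact absurd hu0 (hI.2 u hu)
        · refine le_trans ?_ (hI.2.2 u hu hu0)
          have h3 := fun h4 => h2 ⟨hI.1, h4⟩
          rw [holds_tLe hs₂ (by simpa [e2] using hpe _ hI.1)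
            (by simpa [e2, hij] using hpe _ hj)] at h3
          simp only [eval_get, eval_var, e2, hij] at h3
          exact le_of_not_ge h3
      · exact le_rfl
    · intro h1
      rcases hI with hI | hI
      · refine Or.inl ⟨hI.1, fun u hu => ?_⟩
        rcases Nat.lt_succ_iff_lt_or_eq.1 hu with hu | rfl
        · exact hI.2 u hu
        · exact fun h2 => h1 ⟨h2, fun h3 => by omega⟩
      · refine Or.inr ⟨hI.1, hI.2.1, fun u hu hu0 => ?_⟩
        rcases Nat.lt_succ_iff_lt_or_eq.1 hu with hu | rfl
        · exact hI.2.2 u hu hu0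
        · have h3 := (not_not.1 fun h4 => h1 ⟨hu0, h4⟩).2
          rw [holds_tLe hs₂ (by simpa [e2] using hpe _ hI.1)
            (by simpa [e2, hij] using hpe _ hj)] at h3
          simpa [e2, hij] using h3
  · rintro s₂ - (h1 | h1) ⟨u, hu, hu0⟩
    · exact absurd hu0 (h1.2 u hu)
    · exact h1

theorem runs_cRelax {B h b : ℕ} {s : State} (hs : I.Ready s) (hh : s.iv vH = h)
    (hh1 : s.iv vHs = h + 1) (hb : s.iv vSel = b) (hB : h ≤ B) (hmB : I.m ≤ B) (hbh : b < h)
    (hpe : ∀ u < h, s.ia aPe u ≤ I.m) (hc : ∀ u < h, s.ia aBest (b * (h + 1) + u) ≤ I.m) :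
    Runs B cRelax s (80 * h + 9) (fun s' => ∀ u,
      (s'.ia aP u = s.ia aP u ∧ s'.ia aPe u = s.ia aPe u ∧
        (u < h → s.ia aVis u = 0 → I.cost (s.ia aPe u) ≤ I.cost (s.ia aBest (b * (h + 1) + u)))) ∨
      (s.ia aVis u = 0 ∧ s'.ia aP u = b ∧ s'.ia aPe u = s.ia aBest (b * (h + 1) + u) ∧ u < h ∧
        I.cost (s.ia aBest (b * (h + 1) + u)) ≤ I.cost (s.ia aPe u))) := by
  refine (Runs.forUp (B := B) (c := 70) (N := h) (fun j s' => ∀ u,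
      (s'.ia aP u = s.ia aP u ∧ s'.ia aPe u = s.ia aPe u ∧
        (u < j → s.ia aVis u = 0 → I.cost (s.ia aPe u) ≤ I.cost (s.ia aBest (b * (h + 1) + u)))) ∨
      (s.ia aVis u = 0 ∧ s'.ia aP u = b ∧ s'.ia aPe u = s.ia aBest (b * (h + 1) + u) ∧ u < j ∧
        I.cost (s.ia aBest (b * (h + 1) + u)) ≤ I.cost (s.ia aPe u))) hh hB rfl rfl
      (fun u => Or.inl ⟨rfl, rfl, fun hu => by omega⟩) ?_).mono (by omega) fun _ _ h => h
  intro j s₁ hj hf hij hI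
  have hs₁ := hs.frame hf rfl rfl
  have e1 : s₁.ia aVis = s.ia aVis := hf.ia _ rfl
  have e2 : s₁.ia aBest = s.ia aBest := hf.ia _ rfl
  have e3 : s₁.iv vHs = h + 1 := (hf.iv _ rfl).trans hh1
  have e4 : s₁.iv vSel = b := (hf.iv _ rfl).trans hb
  have e5 : s₁.ia aPe j = s.ia aPe j := by
    rcases hI j with h1 | h1
    · exact h1.2.1
    · omega
  have hcell : (get aBest (eCell (var vSel) (var vIn))).eval s₁ = s.ia aBest (b * (h + 1) + j) := by
    simp only [eCell, eval_get, eval_add, eval_mul, eval_var, e2, e3, e4, hij]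
  have hpj : (get aPe (var vIn)).eval s₁ = s.ia aPe j := by
    simp only [eval_get, eval_var, hij, e5]
  have hcell' : (get aBest (eCell (var vSel) (var vIn))).eval (s₁.putN aP j b) =
      s.ia aBest (b * (h + 1) + j) := by
    rw [← hcell]
    simp [eCell]
  have hcj := hc j hj
  refine Fn.runs ?_ rfl (by decide)
  rw [fn_branch, holds_conj, holds_eq, holds_tLe hs₁ (by rw [hcell]; exact hcj)
    (by rw [hpj]; exact hpe j hj), hcell, hpj, fn_seq, fn_putN, fn_nop]
  simp only [eval_get, eval_var, eval_ofNat, e1, hij, e4]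
  constructor
  · rintro ⟨h1, h2⟩
    rw [fn_putN, hcell']
    simp only [eval_var, putN_iv, hij]
    refine ⟨by omega, by omega, by omega, by omega, fun u => ?_⟩
    simp only [setN_ia, putN_ia_self, putN_ia_ne, ne_eq, not_false_eq_true, Nat.reduceEqDiff,
      Function.update_apply]
    by_cases huj : u = j
    · subst huj
      simp only [if_true]
      exact Or.inr ⟨h1, trivial, trivial, by omega, h2⟩
    · simp only [huj, if_false]
      rcases hI u with h3 | h3
      · exact Or.inl ⟨h3.1, h3.2.1, fun h4 => h3.2.2 (by omega)⟩
      · exact Or.inr ⟨h3.1, h3.2.1, h3.2.2.1, by omega, h3.2.2.2.2⟩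
  · intro h1 u
    rcases hI u with h3 | h3
    · refine Or.inl ⟨h3.1, h3.2.1, fun h4 h5 => ?_⟩
      rcases Nat.lt_succ_iff_lt_or_eq.1 h4 with h4 | rfl
      · exact h3.2.2 h4 h5
      · exact le_of_not_ge fun h6 => h1 ⟨h5, h6⟩
    · exact Or.inr ⟨h3.1, h3.2.1, h3.2.2.1, Nat.lt_succ_of_lt h3.2.2.2.1, h3.2.2.2.2⟩

/-- The first `j` entries of an array. -/
def prefixOf (a : ℕ → ℕ) (j : ℕ) : List ℕ := (List.range j).map a

theorem prefixOf_succ (a : ℕ → ℕ) (j : ℕ) : prefixOf a (j + 1) = prefixOf a j ++ [a j] := by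
  simp [prefixOf, List.range_succ]

theorem prefixOf_congr {a a' : ℕ → ℕ} {j : ℕ} (h : ∀ i < j, a i = a' i) :
    prefixOf a j = prefixOf a' j :=
  List.map_congr_left fun i hi => h i (List.mem_range.1 hi)

theorem length_prefixOf (a : ℕ → ℕ) (j : ℕ) : (prefixOf a j).length = j := by simp [prefixOf]

theorem mem_prefixOf {a : ℕ → ℕ} {j u : ℕ} : u ∈ prefixOf a j ↔ ∃ i < j, a i = u := by
  simp [prefixOf]

theorem runs_cPrim {B v h : ℕ} {s : State} (hs : I.Ready s) (hh : s.iv vH = h)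
    (hh1 : s.iv vHs = h + 1) (hB : h + 1 ≤ B) (hmB : I.m ≤ B)
    (hbest : I.BestOk v h I.m fun i j => s.ia aBest (i * (h + 1) + j)) :
    Runs B cPrim s (1000 * ((h + 1) * (h + 1))) (fun s' =>
      Span I.cost (I.Mt v h) h h (prefixOf (s'.ia aSeq) (h + 1)) (s'.ia aP) (s'.ia aPe)) := by
  have hsq : h + 1 ≤ (h + 1) * (h + 1) := Nat.le_mul_of_pos_left _ (by omega)
  set c : ℕ → ℕ → ℕ := fun i j => s.ia aBest (i * (h + 1) + j) with hc
  refine (runs_cInit hh hh1 (fun u hu => (hbest.le h le_rfl u hu).trans hmB) hB).seq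
    (N₂ := 900 * ((h + 1) * (h + 1))) ?_ (by omega)
  rintro s₁ f₁ ⟨hs0, h₁⟩
  have hs₁ := hs.frame f₁ rfl rfl
  refine (Runs.forUp (B := B) (c := 140 * h + 100) (N := h) (fun j s' =>
    Prim I.cost c h (prefixOf (s'.ia aSeq) (j + 1)) (s'.ia aP) (s'.ia aPe) ∧
      ∀ u < h, s'.ia aVis u = 0 ↔ u ∉ prefixOf (s'.ia aSeq) (j + 1))
    ((f₁.iv _ rfl).trans hh) (by omega) rfl rfl ?_ ?_).mono ?_ ?_
  · have : prefixOf ((s₁.setN vLc 0).ia aSeq) (0 + 1) = [h] := by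
      simp [prefixOf, hs0]
    rw [this]
    refine ⟨Prim.start (fun u hu => (h₁ u hu).1) fun u hu => (h₁ u hu).2.1, fun u hu => ?_⟩
    simp only [List.mem_singleton, setN_ia, (h₁ u hu).2.2, true_iff]
    omega
  · rintro j s₂ hj hf₂ hij ⟨hP, hvis⟩
    have hs₂ := hs₁.frame hf₂ rfl rfl
    have a1 : s₂.iv vH = h := by rw [hf₂.iv _ rfl, f₁.iv _ rfl, hh]
    have a2 : s₂.iv vHs = h + 1 := by rw [hf₂.iv _ rfl, f₁.iv _ rfl, hh1]
    have a3 : s₂.ia aBest = s.ia aBest := by rw [hf₂.ia _ rfl, f₁.ia _ rfl]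
    set l := prefixOf (s₂.ia aSeq) (j + 1) with hl
    have hpe : ∀ u < h, s₂.ia aPe u ≤ I.m := fun u hu => by
      rw [hP.pe_eq u hu]
      exact hbest.le _ (hP.le _ (hP.p_mem u hu)) _ hu.le
    refine (runs_cSel hs₂ a1 (by omega) hpe).seq (N₂ := 80 * h + 80) ?_ (by omega)
    intro s₃ f₃ hsel
    obtain ⟨u₀, hu₀, hu₀l⟩ : ∃ u < h, u ∉ l := by
      by_contra! hall
      have h2 : Finset.range (h + 1) ⊆ l.toFinset := fun u hu => by
        rw [List.mem_toFinset]
        rcases Nat.lt_succ_iff_lt_or_eq.1 (Finset.mem_range.1 hu) with h3 | rfl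
        · exact hall u h3
        · exact hP.root
      have h3 := Finset.card_le_card h2
      have h4 := l.toFinset_card_le
      rw [Finset.card_range] at h3
      have h5 : l.length = j + 1 := length_prefixOf _ _
      omega
    obtain ⟨hb, hb0, hbmin⟩ := hsel ⟨u₀, hu₀, (hvis u₀ hu₀).2 hu₀l⟩
    set b := s₃.iv vSel with hbdef
    have hs₃ := hs₂.frame f₃ rfl rfl
    have hvisit : Runs B cVisit s₃ 20 (fun s' => s'.ia aVis = Function.update (s₂.ia aVis) b 1 ∧
        s'.ia aSeq = Function.update (s₂.ia aSeq) (j + 1) b) := by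
      refine Fn.runs ?_ rfl (by decide)
      simp only [cVisit, fn_seq, fn_putN, eval_var, eval_add, eval_ofNat, putN_iv, putN_ia_self,
        putN_ia_ne, ne_eq, not_false_eq_true, Nat.reduceEqDiff, f₃.iv vLc rfl, hij, f₃.ia aVis rfl,
        f₃.ia aSeq rfl, ← hbdef]
      exact ⟨by omega, by omega, by omega, by omega, trivial, trivial⟩
    refine hvisit.seq (N₂ := 80 * h + 9) ?_ (by omega)
    rintro s₄ f₄ ⟨b1, b2⟩
    have hs₄ := hs₃.frame f₄ rfl rfl
    have c1 : s₄.ia aBest = s.ia aBest := by rw [f₄.ia _ rfl, f₃.ia _ rfl, a3]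
    have c2 : s₄.ia aPe = s₂.ia aPe := by rw [f₄.ia _ rfl, f₃.ia _ rfl]
    have c3 : s₄.ia aP = s₂.ia aP := by rw [f₄.ia _ rfl, f₃.ia _ rfl]
    refine (runs_cRelax hs₄ (by rw [f₄.iv _ rfl, f₃.iv _ rfl, a1])
      (by rw [f₄.iv _ rfl, f₃.iv _ rfl, a2]) (f₄.iv _ rfl) (by omega) hmB hb (by rwa [c2])
      (fun u hu => by rw [c1]; exact hbest.le _ hb.le _ hu.le)).mono le_rfl ?_
    intro s₅ f₅ hrel
    rw [← hbdef, c1, c2, c3, b1] at hrel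
    have d1 : s₅.ia aSeq = Function.update (s₂.ia aSeq) (j + 1) b := by rw [f₅.ia _ rfl, b2]
    have d2 : s₅.ia aVis = Function.update (s₂.ia aVis) b 1 := by rw [f₅.ia _ rfl, b1]
    have d3 : prefixOf (s₅.ia aSeq) (j + 1 + 1) = l ++ [b] := by
      rw [prefixOf_succ, d1, Function.update_self, hl]
      congr 1
      exact prefixOf_congr fun i hi => Function.update_of_ne (by omega) _ _
    have hbl : b ∉ l := (hvis b hb).1 hb0
    simp only [setN_ia, d3]
    constructor
    · refine hP.step hb hbl hbest.symm (fun u hu hul => hbmin u hu ((hvis u hu).2 hul)) ?_ ?_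
      · intro u hu
        rcases hrel u with h2 | ⟨h2, -, -, h3, -⟩
        · exact ⟨h2.1, h2.2.1⟩
        · exfalso
          rw [Function.update_apply] at h2
          split_ifs at h2 with hub
          exact hu.elim ((hvis u h3).1 h2) hub
      · intro u hu hul hub
        rcases hrel u with h2 | h2
        · refine Or.inl ⟨h2.1, h2.2.1, h2.2.2 hu ?_⟩
          rw [Function.update_of_ne hub]
          exact (hvis u hu).2 hul
        · exact Or.inr ⟨h2.2.1, h2.2.2.1, h2.2.2.2.2⟩
    · intro u hu
      rw [d2, Function.update_apply, List.mem_append, List.mem_singleton, not_or]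
      split_ifs with hub
      · simp [hub]
      · rw [hvis u hu]
        simp [hub]
  · nlinarith
  · rintro s₂ - ⟨hP, -⟩
    refine hP.span (fun u hu => ?_) (fun _ _ _ => Mt.symm) (fun _ _ _ h => h.le) hbest.mt
      fun e i j he => ?_
    · have h2 : (prefixOf (s₂.ia aSeq) (h + 1)).toFinset = Finset.range (h + 1) := by
        refine Finset.eq_of_subset_of_card_le (fun u hu => ?_) ?_
        · rw [List.mem_toFinset] at hu
          exact Finset.mem_range.2 (Nat.lt_succ_of_le (hP.le u hu))
        · rw [List.toFinset_card_of_nodup hP.nodup, length_prefixOf, Finset.card_range]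
      rw [← List.mem_toFinset, h2, Finset.mem_range]
      omega
    · obtain ⟨x, y, hxy, h3⟩ := id he
      exact hbest.least e hxy.2.1 i j he

end Inst

/-! ### The entries of the oracle for one failure -/

notation "vSi" => (68 : ℕ)
notation "vNo" => (69 : ℕ)
notation "vPe" => (70 : ℕ)
notation "vDst" => (71 : ℕ)

/-- Finds the ends of the edge `vPe`, such that `vEy` is the one in the component `vNo`. -/
def cEnds : Cmd :=
  setN vEx (get aE1 (var vPe - 1)) ;; setN vEy (get aE2 (var vPe - 1)) ;;
  branch (.eq (get aCmp (var vEy)) (var vNo)) nop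
    (setN vEx (get aE2 (var vPe - 1)) ;; setN vEy (get aE1 (var vPe - 1))) ;;
  setN vQt (var vEx)

/-- Stores the entry for a component that is entered through the edge `vPe`. -/
def cStore : Cmd :=
  putN aFl (var vDst) (var vFlag) ;;
  branch (.eq (var vFlag) 0) nop
    (putN aX (var vDst) (var vEx) ;; putN aY (var vDst) (var vEy) ;;
      putN aH (var vDst) (var vLen + 1) ;;
      putR bD (var vDst) (.var rD + .get bW (var vPe - 1)))

/-- The entry for the `vSi`-th component. -/
def cEntry : Cmd :=
  setN vNo (get aSeq (var vSi)) ;;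
  branch (.lt (var vNo) (var vQk))
    (setN vPe (get aPe (var vNo)) ;; setN vDst (eEntry (var vNo)) ;;
      branch (.eq (var vPe) 0) (putN aFl (var vDst) 0) (cEnds ;; cAsk ;; cStore))
    nop

/-- The entries for all components. -/
def cEntries : Cmd := forUp vSi vHs cEntry

namespace Inst

variable (I : Inst)

/-- The marks of the components, as they are stored for the failure of the last `k` edges of the path
to `v`. -/
abbrev cellFl (s : State) (v k : ℕ) : ℕ → ℕ := fun i => s.ia aFl (I.ent v k i)
/-- The ends outside of the components of the edges that enter them. -/
abbrev cellX (s : State) (v k : ℕ) : ℕ → ℕ := fun i => s.ia aX (I.ent v k i)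
/-- The ends inside of the components of the edges that enter them. -/
abbrev cellY (s : State) (v k : ℕ) : ℕ → ℕ := fun i => s.ia aY (I.ent v k i)
/-- The numbers of edges of the detours up to the vertices of `cellY`. -/
abbrev cellH (s : State) (v k : ℕ) : ℕ → ℕ := fun i => s.ia aH (I.ent v k i)
/-- The lengths of the detours up to the vertices of `cellY`. -/
abbrev cellD (s : State) (v k : ℕ) : ℕ → ℝ := fun i => s.ra bD (I.ent v k i)

/-- The two states have the same entry at the address `q`. -/
structure SameEnt (s s' : State) (q : ℕ) : Prop where
  fl : s'.ia aFl q = s.ia aFl q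
  x : s'.ia aX q = s.ia aX q
  y : s'.ia aY q = s.ia aY q
  h : s'.ia aH q = s.ia aH q
  d : s'.ra bD q = s.ra bD q

variable {I}

theorem SameEnt.trans {s s' s'' : State} {q : ℕ} (h : SameEnt s s' q) (h' : SameEnt s' s'' q) :
    SameEnt s s'' q :=
  ⟨h'.fl.trans h.fl, h'.x.trans h.x, h'.y.trans h.y, h'.h.trans h.h, h'.d.trans h.d⟩

theorem SameEnt.of_frame {p : Cmd} {s s' : State} (hf : Frame p s s')
    (hp : (p.wa aFl || p.wa aX || p.wa aY || p.wa aH || p.wb bD) = false) (q : ℕ) :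
    SameEnt s s' q := by
  simp only [Bool.or_eq_false_iff] at hp
  obtain ⟨⟨⟨⟨h1, h2⟩, h3⟩, h4⟩, h5⟩ := hp
  exact ⟨by rw [hf.ia _ h1], by rw [hf.ia _ h2], by rw [hf.ia _ h3], by rw [hf.ia _ h4],
    by rw [hf.ra _ h5]⟩

theorem askFl_congr {v k t : ℕ} {s s' : State}
    (h : I.ix v t < k → SameEnt s s' (I.ent v k (I.ix v t))) :
    I.askFl v k (I.cellFl s' v k) t = I.askFl v k (I.cellFl s v k) t := by
  rw [askFl, askFl]
  split_ifs with hk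
  · rfl
  · exact (h (not_le.1 hk)).fl

theorem askLen_congr {v k t : ℕ} {s s' : State}
    (h : I.ix v t < k → SameEnt s s' (I.ent v k (I.ix v t))) :
    I.askLen v k (I.cellY s' v k) (I.cellH s' v k) t =
      I.askLen v k (I.cellY s v k) (I.cellH s v k) t := by
  rw [askLen, askLen]
  split_ifs with hk
  · rfl
  · simp only [cellH, cellY, (h (not_le.1 hk)).h, (h (not_le.1 hk)).y]

theorem askD_congr {v k t : ℕ} {s s' : State}
    (h : I.ix v t < k → SameEnt s s' (I.ent v k (I.ix v t))) :
    I.askD v k (I.cellY s' v k) (I.cellD s' v k) t =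
      I.askD v k (I.cellY s v k) (I.cellD s v k) t := by
  rw [askD, askD]
  split_ifs with hk
  · rfl
  · simp only [cellD, cellY, (h (not_le.1 hk)).d, (h (not_le.1 hk)).y]

/-- The cells of the state hold the entry for the component `i`. -/
def CellOk (I : Inst) (v h k : ℕ) (p pe : ℕ → ℕ) (s : State) (i : ℕ) : Prop :=
  I.EntryOk v h k p pe (I.cellFl s v k) (I.cellX s v k) (I.cellY s v k) (I.cellH s v k)
    (I.cellD s v k) i

theorem CellOk.congr {v h k i : ℕ} {p pe : ℕ → ℕ} {s s' : State} (H : I.CellOk v h k p pe s i)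
    (hkh : k ≤ h) (hi : SameEnt s s' (I.ent v k i))
    (hp : p i < k → SameEnt s s' (I.ent v k (p i))) : I.CellOk v h k p pe s' i := by
  rcases H with ⟨h1, h2⟩ | ⟨x, y, h1, h2, h3, h4, h5⟩
  · exact Or.inl ⟨h1, hi.fl.trans h2⟩
  · have hc : I.ix v x < k → SameEnt s s' (I.ent v k (I.ix v x)) := fun h6 => by
      have h7 : p i = I.ix v x := by omega
      rw [← h7]
      exact hp (by omega)
    refine Or.inr ⟨x, y, h1, h2, h3, ?_, fun h6 => ?_⟩
    · rw [askFl_congr hc, ← h4]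
      exact hi.fl
    · obtain ⟨e1, e2, e3, e4⟩ := h5 (by simpa only [cellFl, hi.fl] using h6)
      exact ⟨hi.x.trans e1, hi.y.trans e2, by rw [askLen_congr hc, ← e3]; exact hi.h,
        by rw [askD_congr hc, ← e4]; exact hi.d⟩

/-- The entry for the component `i` is a flag, and its data are small. -/
def CellLe (I : Inst) (v k : ℕ) (s : State) (N i : ℕ) : Prop :=
  I.cellFl s v k i ≤ 1 ∧ (I.cellFl s v k i ≠ 0 → I.cellY s v k i < I.n ∧ I.cellH s v k i ≤ N)

theorem CellLe.congr {v k N i : ℕ} {s s' : State} (H : I.CellLe v k s N i)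
    (hi : SameEnt s s' (I.ent v k i)) : I.CellLe v k s' N i := by
  simp only [CellLe, cellFl, cellY, cellH, hi.fl, hi.y, hi.h]
  exact H

/-- The entries for the first `j` components of the sequence `seq` have been stored. -/
def Filled (I : Inst) (v h k : ℕ) (seq p pe : ℕ → ℕ) (j : ℕ) (s : State) : Prop :=
  ∀ i < j, seq i < k → I.CellOk v h k p pe s (seq i) ∧
    I.CellLe v k s ((i + 1) * (2 * I.n + 1)) (seq i)

theorem prefixOf_ne {a : ℕ → ℕ} {i j N : ℕ} (hn : (prefixOf a N).Nodup) (hi : i < N) (hj : j < N)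
    (hij : i ≠ j) : a i ≠ a j := by
  intro h
  rw [prefixOf, List.nodup_map_iff_inj_on List.nodup_range] at hn
  exact hij (hn i (List.mem_range.2 hi) j (List.mem_range.2 hj) h)

theorem Span.par_before {cost : ℕ → WithTop ℝ} {Mt : ℕ → ℕ → ℕ → Prop} {h k : ℕ} {a : ℕ → ℕ}
    {p pe : ℕ → ℕ} (H : Span cost Mt h k (prefixOf a (h + 1)) p pe) {i : ℕ} (hi : i ≤ h)
    (hk : a i < k) : ∃ i' < i, a i' = p (a i) := by
  obtain ⟨i', hi', he⟩ := mem_prefixOf.1 ((H.mem _).2 (H.p_le _ hk))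
  refine ⟨i', ?_, he⟩
  by_contra hlt
  rcases (not_lt.1 hlt).lt_or_eq with h1 | rfl
  · have h2 := H.topo
    rw [prefixOf, List.pairwise_map] at h2
    have h3 := List.pairwise_iff_getElem.1 h2 i i' (by simpa using by omega) (by simpa using hi') h1
    simp only [List.getElem_range] at h3
    exact h3 hk he.symm
  · exact H.p_ne _ hk he.symm

theorem Filled.succ {v h k j : ℕ} {seq p pe : ℕ → ℕ} {s s' : State}
    (HS : Span I.cost (I.Mt v h) h k (prefixOf seq (h + 1)) p pe) (hkh : k ≤ h) (hj : j ≤ h)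
    (H : I.Filled v h k seq p pe j s)
    (hsame : ∀ i < k, i ≠ seq j → SameEnt s s' (I.ent v k i))
    (hnew : seq j < k → I.CellOk v h k p pe s' (seq j) ∧
      I.CellLe v k s' ((j + 1) * (2 * I.n + 1)) (seq j)) :
    I.Filled v h k seq p pe (j + 1) s' := by
  intro i hi hk
  rcases Nat.lt_succ_iff_lt_or_eq.1 hi with hi | rfl
  · obtain ⟨h1, h2⟩ := H i hi hk
    have h3 := hsame _ hk (prefixOf_ne HS.nodup (by omega) (by omega) hi.ne)
    obtain ⟨i', hi', he⟩ := Span.par_before HS (i := i) (by omega) hk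
    refine ⟨h1.congr hkh h3 fun h4 => hsame _ h4 ?_, h2.congr h3⟩
    rw [← he]
    exact prefixOf_ne HS.nodup (by omega) (by omega) (by omega)
  · exact hnew hk

theorem fn_cEnds {B h e u pu v : ℕ} {s : State} (hs : I.Ready s) (hB : I.n ≤ B)
    (he : s.iv vPe = e) (hu : s.iv vNo = u) (hmt : I.Mt v h e u pu) (hne : pu ≠ u)
    (hcmp : ∀ a < I.n, s.ia aCmp a = min h (I.ix v a)) :
    Fn B cEnds s (fun s' => ∃ x y, I.Ends e x y ∧ min h (I.ix v x) = pu ∧ min h (I.ix v y) = u ∧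
      s'.iv vEx = x ∧ s'.iv vEy = y ∧ s'.iv vQt = x) := by
  obtain ⟨y, x, hyx, hy, hx⟩ := hmt
  have hxy := hyx.symm
  have he1 : e - 1 < I.m := by have := hxy.1; have := hxy.2.1; omega
  have hea := I.ea_lt _ he1
  have heb := I.eb_lt _ he1
  have d1 := hs.inp.e1 _ he1
  have d2 := hs.inp.e2 _ he1
  simp only [cEnds, fn_seq, fn_setN, fn_branch, fn_nop, eval_get, eval_var, eval_sub, eval_ofNat,
    setN_ia, setN_iv_self, setN_iv_ne, ne_eq, not_false_eq_true, Nat.reduceEqDiff, holds_eq, he, hu,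
    d1, d2, hcmp _ heb]
  refine ⟨by omega, by omega, fun h1 => ⟨by omega, ?_⟩,
    fun h1 => ⟨by omega, by omega, by omega, ?_⟩⟩
  · rcases hxy.2.2.2.2 with ⟨h2, h3⟩ | ⟨h2, h3⟩
    · exact ⟨x, y, hxy, hx, hy, h2, h3, h2⟩
    · rw [h3] at h1; omega
  · rcases hxy.2.2.2.2 with ⟨h2, h3⟩ | ⟨h2, h3⟩
    · rw [h3] at h1; omega
    · exact ⟨x, y, hxy, hx, hy, h3, h2, h3⟩

theorem sameEnt_setN (s : State) (x k q : ℕ) : SameEnt s (s.setN x k) q :=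
  ⟨rfl, rfl, rfl, rfl, rfl⟩

/-- Storing an entry changes no other one. -/
theorem fn_cStore {B e dst fl : ℕ} {s : State}
    (he : s.iv vPe = e) (hd : s.iv vDst = dst) (hfl : s.iv vFlag = fl) (hflB : fl ≤ B)
    (hdB : dst ≤ B) (hx : s.iv vEx ≤ B) (hy : s.iv vEy ≤ B) (hl : fl ≠ 0 → s.iv vLen + 1 ≤ B) :
    Fn B cStore s (fun s' => (∀ q, q ≠ dst → SameEnt s s' q) ∧ s'.ia aFl dst = fl ∧
      (fl ≠ 0 → s'.ia aX dst = s.iv vEx ∧ s'.ia aY dst = s.iv vEy ∧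
        s'.ia aH dst = s.iv vLen + 1 ∧ s'.ra bD dst = s.rv rD + s.ra bW (e - 1))) := by
  simp only [cStore, fn_seq, fn_putN, fn_putR, fn_branch, fn_nop, eval_get, eval_var, eval_add,
    eval_sub, eval_ofNat, reval_add, reval_var, reval_get, putN_iv, putN_ra, putN_rv, putR_ia,
    putN_ia_self, putN_ia_ne, putR_ra_self, ne_eq, not_false_eq_true, Nat.reduceEqDiff, holds_eq,
    he, hd, hfl, Function.update_self]
  refine ⟨hdB, hflB, fun h0 => ⟨fun q hq => ⟨?_, rfl, rfl, rfl, rfl⟩, trivial, fun h1 => absurd h0 h1⟩,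
    fun h0 => ⟨hdB, hx, hdB, hy, hdB, hl h0, hdB, fun q hq => ⟨?_, ?_, ?_, ?_, ?_⟩, trivial,
      fun _ => ⟨trivial, trivial, trivial, trivial⟩⟩⟩ <;>
  simp [Function.update_of_ne hq]

theorem fn_cEntry {B v h k j : ℕ} {p : ℕ → ℕ} {s : State} (hs : I.Ready s) (hB : I.n + 1 ≤ B)
    (hB' : I.n * I.f * I.f ≤ B) (hB'' : (h + 1) * (2 * I.n + 1) ≤ B) (hmB : I.m ≤ B)
    (hv : s.iv vQv = v) (hk : s.iv vQk = k) (hvn : v < I.n) (hk1 : 1 ≤ k) (hkh : k ≤ h)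
    (hhf : h ≤ I.f) (hj : s.iv vSi = j) (hjh : j ≤ h)
    (hcmp : ∀ a < I.n, s.ia aCmp a = min h (I.ix v a))
    (HS : Span I.cost (I.Mt v h) h k (prefixOf (s.ia aSeq) (h + 1)) p (s.ia aPe))
    (H : I.Filled v h k (s.ia aSeq) p (s.ia aPe) j s) :
    Fn B cEntry s (fun s' => I.Filled v h k (s.ia aSeq) p (s.ia aPe) (j + 1) s' ∧
      ∀ q, (∀ i < k, q ≠ I.ent v k i) → SameEnt s s' q) := by
  set seq := s.ia aSeq with hseq
  set pe := s.ia aPe with hpe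
  set u := seq j with hu
  have huh : u ≤ h := (HS.mem u).1 (mem_prefixOf.2 ⟨j, by omega, rfl⟩)
  have hn1 := I.n_pos
  have hhB : h ≤ B := by nlinarith
  rw [cEntry, fn_seq, fn_setN]
  simp only [eval_get, eval_var, hj, ← hseq, ← hu]
  refine ⟨by omega, ?_⟩
  rw [fn_branch, fn_nop]
  simp only [holds_lt, eval_var, setN_iv_self, setN_iv_ne, ne_eq, not_false_eq_true,
    Nat.reduceEqDiff, hk]
  constructor
  swap
  · intro h1
    exact ⟨H.succ HS hkh hjh (fun i _ _ => sameEnt_setN _ _ _ _) fun h2 => absurd h2 h1,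
      fun q _ => sameEnt_setN _ _ _ _⟩
  intro huk
  have hent := ent_lt hvn hk1 (hkh.trans hhf) huk
  have hent' : (v * I.f + (k - 1)) * I.f + u = I.ent v k u := rfl
  have hinj : ∀ i < k, i ≠ u → I.ent v k i ≠ I.ent v k u := fun i hi hne he =>
    hne (ent_inj hk1 (hkh.trans hhf) hi hk1 (hkh.trans hhf) huk he).2.2
  have hpeB : pe u ≤ B := by
    rcases HS.pe_spec u huk with h1 | ⟨x, y, h1, -⟩
    · omega
    · have := h1.2.1; omega
  simp only [fn_seq, fn_setN, eEntry, eval_get, eval_var, eval_add, eval_mul, eval_sub, eval_ofNat,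
    setN_ia, setN_iv_self, setN_iv_ne, ne_eq, not_false_eq_true, Nat.reduceEqDiff, ← hpe, hv, hk,
    hs.prm, hent']
  refine ⟨hpeB, by omega, ?_⟩
  set s₁ := ((s.setN vNo u).setN vPe (pe u)).setN vDst (I.ent v k u) with hs₁
  have i1 : s₁.iv vNo = u := by simp [hs₁]
  have i2 : s₁.iv vPe = pe u := by simp [hs₁]
  have i3 : s₁.iv vDst = I.ent v k u := by simp [hs₁]
  have i4 : s₁.iv vQv = v := by simp [hs₁, hv]
  have i5 : s₁.iv vQk = k := by simp [hs₁, hk]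
  have hsame₁ : ∀ q, SameEnt s s₁ q := fun q => ⟨rfl, rfl, rfl, rfl, rfl⟩
  have hr₁ : I.Ready s₁ := by
    refine ⟨⟨?_, ?_, ?_, ?_, hs.inp.par, hs.inp.e1, hs.inp.e2, hs.inp.w⟩, ⟨hs.tree.par,
      hs.tree.dp, hs.tree.ds⟩, hs.lca.congr fun _ _ _ => rfl, hs.prm, hs.ec⟩ <;>
    simp only [hs₁, setN_iv_self, setN_iv_ne, ne_eq, not_false_eq_true, Nat.reduceEqDiff]
    exacts [hs.inp.n, hs.inp.m, hs.inp.f, hs.inp.r]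
  rw [fn_branch]
  simp only [holds_eq, eval_var, eval_ofNat, i2]
  constructor
  · -- no edge leaves the component
    intro h0
    rw [fn_putN]
    simp only [eval_var, eval_ofNat, i3]
    have hw : ∀ q, q ≠ I.ent v k u → SameEnt s (s₁.putN aFl (I.ent v k u) 0) q := fun q hq => by
      refine ⟨?_, rfl, rfl, rfl, rfl⟩
      simp [hs₁, Function.update_of_ne hq]
    refine ⟨by omega, by omega, H.succ HS hkh hjh (fun i hi hne => hw _ (hinj i hi hne)) fun _ => ?_,
      fun q hq => hw q (hq u huk)⟩
    refine ⟨Or.inl ⟨h0, ?_⟩, ?_⟩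
    · simp [cellFl, ← hu]
    · simp [CellLe, cellFl, ← hu]
  · intro h0
    have hmt := (HS.pe_spec u huk).resolve_left h0
    rw [fn_seq]
    refine (fn_cEnds hr₁ (by omega) i2 i1 hmt (HS.p_ne u huk) hcmp).mono fun s₂ f₂ h₂ => ?_
    obtain ⟨x, y, hxy, hx, hy, j1, j2, j3⟩ := h₂
    have hr₂ := hr₁.frame f₂ rfl rfl
    have hsame₂ : ∀ q, SameEnt s s₂ q := fun q => (hsame₁ q).trans (.of_frame f₂ rfl q)
    obtain ⟨j', hj', hje⟩ : ∃ j' < j, seq j' = p u := Span.par_before HS hjh huk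
    have hxu : ∀ h1 : I.ix v x < k, I.ix v x = seq j' := fun h1 => by
      rw [hje]; omega
    have hcell : I.ix v x < k → I.CellLe v k s ((j' + 1) * (2 * I.n + 1)) (I.ix v x) := fun h1 => by
      have h2 := hxu h1
      rw [h2] at h1 ⊢
      exact (H j' hj' h1).2
    have hjj : (j' + 1 + 1) * (2 * I.n + 1) ≤ (h + 1) * (2 * I.n + 1) :=
      Nat.mul_le_mul_right _ (by omega)
    rw [Nat.succ_mul] at hjj
    rw [fn_seq]
    refine (fn_cAsk hr₂.tree hr₂.lca hr₂.prm hB hB' hvn hk1 (hkh.trans hhf) hxy.lt.1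
      ((f₂.iv _ rfl).trans i4) ((f₂.iv _ rfl).trans i5) j3 fun h1 => ?_).mono fun s₃ f₃ h₃ => ?_
    · obtain ⟨h2, h3⟩ := (hcell h1).congr (hsame₂ _)
      refine ⟨h2, fun h4 => ⟨(h3 h4).1, ?_⟩⟩
      have := (h3 h4).2
      simp only [cellH] at this
      omega
    obtain ⟨-, -, hfl, hld⟩ := h₃
    change s₃.iv vFlag = I.askFl v k (I.cellFl s₂ v k) x at hfl
    change I.askFl v k (I.cellFl s₂ v k) x ≠ 0 → s₃.iv vLen =
      I.askLen v k (I.cellY s₂ v k) (I.cellH s₂ v k) x ∧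
      s₃.rv rD = I.askD v k (I.cellY s₂ v k) (I.cellD s₂ v k) x at hld
    rw [askFl_congr fun _ => hsame₂ _] at hfl hld
    rw [askLen_congr fun _ => hsame₂ _, askD_congr fun _ => hsame₂ _] at hld
    have hr₃ := hr₂.frame f₃ rfl rfl
    have hsame₃ : ∀ q, SameEnt s s₃ q := fun q => (hsame₂ q).trans (.of_frame f₃ rfl q)
    -- the number of edges grows by at most `2 n + 1` from component to component
    have hle : I.askFl v k (I.cellFl s v k) x ≤ 1 ∧ (I.askFl v k (I.cellFl s v k) x ≠ 0 →
        I.askLen v k (I.cellY s v k) (I.cellH s v k) x + 1 ≤ (j + 1) * (2 * I.n + 1)) := by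
      have hjn : 2 * I.n + 1 ≤ (j + 1) * (2 * I.n + 1) := Nat.le_mul_of_pos_left _ (by omega)
      rw [askFl, askLen]
      split_ifs with h1
      · have : I.dp x < I.n := I.tree.dep_lt hxy.lt.1 I.par_lt
        exact ⟨le_rfl, fun _ => by omega⟩
      · obtain ⟨h2, h3⟩ := hcell (by omega)
        refine ⟨h2, fun h4 => ?_⟩
        obtain ⟨h5, h6⟩ := h3 h4
        have h7 := hops_le h5 hxy.lt.1
        have h8 : (j' + 1 + 1) * (2 * I.n + 1) ≤ (j + 1) * (2 * I.n + 1) :=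
          Nat.mul_le_mul_right _ (by omega)
        rw [Nat.succ_mul] at h8
        omega
    have hjh' : (j + 1) * (2 * I.n + 1) ≤ (h + 1) * (2 * I.n + 1) :=
      Nat.mul_le_mul_right _ (by omega)
    have k1 : s₃.iv vEx = x := (f₃.iv _ rfl).trans j1
    have k2 : s₃.iv vEy = y := (f₃.iv _ rfl).trans j2
    have hxlt := hxy.lt
    refine (fn_cStore (e := pe u) (by rw [f₃.iv _ rfl, f₂.iv _ rfl, i2])
      (by rw [f₃.iv _ rfl, f₂.iv _ rfl, i3]) hfl (by omega) (by omega) (by omega) (by omega)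
      fun h1 => ?_).mono fun s₄ _ h₄ => ?_
    · rw [(hld h1).1]
      have := hle.2 h1
      omega
    obtain ⟨g1, g2, g3⟩ := h₄
    have hw : ∀ q, q ≠ I.ent v k u → SameEnt s s₄ q := fun q hq => (hsame₃ q).trans (g1 q hq)
    refine ⟨H.succ HS hkh hjh (fun i hi hne => hw _ (hinj i hi hne)) fun _ => ?_,
      fun q hq => hw q (hq u huk)⟩
    have hxs : I.ix v x < k → SameEnt s s₄ (I.ent v k (I.ix v x)) := fun h1 => by
      refine hw _ (hinj _ h1 ?_)
      have := HS.p_ne u huk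
      omega
    have he1 : pe u - 1 < I.m := by have := hxy.1; have := hxy.2.1; omega
    have hwt : s₃.ra bW (pe u - 1) = I.W x y := by
      rw [hr₃.inp.w _ he1]
      rcases hxy.2.2.2.2 with ⟨h1, h2⟩ | ⟨h1, h2⟩ <;> rw [h1, h2]
      exact I.W_symm _ _
    rw [← hu]
    constructor
    · refine Or.inr ⟨x, y, hxy, hx, hy, ?_, fun h1 => ?_⟩
      · rw [askFl_congr hxs]
        exact g2
      · have h2 : I.askFl v k (I.cellFl s v k) x ≠ 0 := by rwa [cellFl, g2] at h1
        obtain ⟨g4, g5, g6, g7⟩ := g3 h2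
        rw [askLen_congr hxs, askD_congr hxs, ← (hld h2).1, ← (hld h2).2, ← hwt]
        exact ⟨g4.trans k1, g5.trans k2, g6, g7⟩
    · refine ⟨(g2.trans_le hle.1), fun h1 => ?_⟩
      have h2 : I.askFl v k (I.cellFl s v k) x ≠ 0 := by rwa [cellFl, g2] at h1
      obtain ⟨g4, g5, g6, g7⟩ := g3 h2
      refine ⟨(g5.trans k2).trans_lt hxlt.2, ?_⟩
      rw [cellH, g6, (hld h2).1]
      exact hle.2 h2

theorem runs_cEntries {B v h k : ℕ} {p : ℕ → ℕ} {s : State} (hs : I.Ready s) (hB : I.n + 1 ≤ B)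
    (hB' : I.n * I.f * I.f ≤ B) (hB'' : (h + 1) * (2 * I.n + 1) ≤ B) (hmB : I.m ≤ B)
    (hv : s.iv vQv = v) (hk : s.iv vQk = k) (hh1 : s.iv vHs = h + 1) (hvn : v < I.n) (hk1 : 1 ≤ k)
    (hkh : k ≤ h) (hhf : h ≤ I.f) (hcmp : ∀ a < I.n, s.ia aCmp a = min h (I.ix v a))
    (HS : Span I.cost (I.Mt v h) h k (prefixOf (s.ia aSeq) (h + 1)) p (s.ia aPe)) :
    Runs B cEntries s (4000 * (h + 1)) (fun s' =>
      (∀ i < k, I.CellOk v h k p (s.ia aPe) s' i ∧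
        I.CellLe v k s' ((h + 1) * (2 * I.n + 1)) i) ∧
      ∀ q, (∀ i < k, q ≠ I.ent v k i) → SameEnt s s' q) := by
  have hn1 := I.n_pos
  have hhB : h + 1 ≤ B := by nlinarith
  refine (Runs.forUp (B := B) (c := 3900) (N := h + 1) (fun j s' =>
      I.Filled v h k (s.ia aSeq) p (s.ia aPe) j s' ∧
      ∀ q, (∀ i < k, q ≠ I.ent v k i) → SameEnt s s' q) hh1 hhB rfl rfl
      ⟨fun i hi => by omega, fun q _ => sameEnt_setN _ _ _ _⟩ ?_).mono (by omega) ?_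
  · rintro j s₁ hj hf hij ⟨h1, h2⟩
    have e1 : s₁.ia aSeq = s.ia aSeq := hf.ia _ rfl
    have e2 : s₁.ia aPe = s.ia aPe := hf.ia _ rfl
    refine Fn.runs ?_ rfl (by decide)
    refine (fn_cEntry (p := p) (hs.frame hf rfl rfl) hB hB' hB'' hmB ((hf.iv _ rfl).trans hv)
      ((hf.iv _ rfl).trans hk) hvn hk1 hkh hhf hij (by omega) (by rwa [hf.ia aCmp rfl])
      (by rwa [e1, e2]) (by rwa [e1, e2])).mono fun s₂ _ h₂ => ?_
    rw [e1, e2] at h₂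
    exact ⟨h₂.1, fun q hq => ((h2 q hq).trans (h₂.2 q hq)).trans (sameEnt_setN _ _ _ _)⟩
  · rintro s₁ - ⟨h1, h2⟩
    refine ⟨fun i hi => ?_, h2⟩
    obtain ⟨j, hj, rfl⟩ := mem_prefixOf.1 ((HS.mem i).2 (by omega))
    obtain ⟨h3, h4, h5⟩ := h1 j hj hi
    refine ⟨h3, h4, fun h6 => ⟨(h5 h6).1, (h5 h6).2.trans ?_⟩⟩
    exact Nat.mul_le_mul_right _ (by omega)

end Inst

/-! ### Contracting the minimum spanning tree -/

-- The new sequence of the components, and the marks of those that are already in it.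
notation "aNew" => (24 : ℕ)
notation "aMark" => (25 : ℕ)
-- variables of the contraction
notation "vKk" => (72 : ℕ)
notation "vZ" => (73 : ℕ)
notation "vPt" => (74 : ℕ)
notation "vPrv" => (75 : ℕ)
notation "vPrE" => (76 : ℕ)
notation "vStop" => (77 : ℕ)
notation "vNx" => (78 : ℕ)
notation "vNxE" => (79 : ℕ)
notation "vCnt" => (80 : ℕ)

/-- Finds the vertex `vZ` below a most expensive edge on the path from `vKk` to the root. -/
def cMax : Cmd :=
  setN vZ (var vKk) ;; setN vPt (var vKk) ;;
  loop (.lt (var vPt) (var vQk))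
    (branch (tLe (get aPe (var vZ)) (get aPe (var vPt))) (setN vZ (var vPt)) nop ;;
      setN vPt (get aP (var vPt)))

/-- Prepares the reversal of the path from `vKk` to `vZ`. -/
def cRevInit : Cmd :=
  setN vStop (get aP (var vZ)) ;; setN vPt (var vKk) ;; setN vCnt 0 ;; setN vPrv 0 ;; setN vPrE 0

/-- Reverses an edge of the path, and stores the vertex. -/
def cRevStep : Cmd :=
  setN vNx (get aP (var vPt)) ;; setN vNxE (get aPe (var vPt)) ;;
  putN aP (var vPt) (var vPrv) ;; putN aPe (var vPt) (var vPrE) ;;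
  putN aNew (var vCnt) (var vPt) ;; putN aMark (var vPt) 1 ;;
  setN vPrv (var vPt) ;; setN vPrE (var vNxE) ;; setN vPt (var vNx) ;;
  setN vCnt (var vCnt + 1)

/-- Reverses the path from `vKk` to `vZ`. -/
def cRev : Cmd := cRevInit ;; loop (.neg (.eq (var vPt) (var vStop))) cRevStep

/-- Appends the vertices that are not on the path. -/
def cMerge : Cmd :=
  forUp vIn vHs (setN vPt (get aSeq (var vIn)) ;;
    branch (.eq (get aMark (var vPt)) 0)
      (putN aNew (var vCnt) (var vPt) ;; setN vCnt (var vCnt + 1)) nop)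

/-- Replaces the sequence of the vertices by the new one. -/
def cCopy : Cmd :=
  forUp vIn vHs (putN aSeq (var vIn) (get aNew (var vIn)) ;; putN aMark (var vIn) 0)

/-- Identifies the vertex `vKk` with the root. -/
def cContract : Cmd := cMax ;; cRev ;; cMerge ;; cCopy

namespace Inst

variable {I : Inst}

theorem runs_cMax {B v h k : ℕ} {s : State} (hs : I.Ready s) (hB : h ≤ B)
    (hk : s.iv vKk = k) (hk' : s.iv vQk = k + 1) (hkh : k < h)
    (HS : Span I.cost (I.Mt v h) h (k + 1) (prefixOf (s.ia aSeq) (h + 1)) (s.ia aP) (s.ia aPe)) :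
    Runs B cMax s (80 * (h + 1)) (fun s' => ∃ J, s'.iv vZ = (s.ia aP)^[J] k ∧
      (∀ i ≤ J, (s.ia aP)^[i] k < k + 1) ∧
      ∀ i, (∀ l ≤ i, (s.ia aP)^[l] k < k + 1) →
        I.cost (s.ia aPe ((s.ia aP)^[i] k)) ≤ I.cost (s.ia aPe ((s.ia aP)^[J] k))) := by
  set p := s.ia aP with hp
  set pe := s.ia aPe with hpe
  set seq := prefixOf (s.ia aSeq) (h + 1) with hseq
  have h0 : Runs B (setN vZ (var vKk)) s 2 (fun s' => s' = s.setN vZ k) :=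
    Fn.runs (by rw [fn_setN]; simp [hk]; omega) rfl (by decide)
  refine h0.seq (N₂ := 78 * (h + 1)) ?_ (by omega)
  rintro s₁ f₁ rfl
  have h1 : Runs B (setN vPt (var vKk)) (s.setN vZ k) 2
      (fun s' => s' = (s.setN vZ k).setN vPt k) :=
    Fn.runs (by rw [fn_setN]; simp [hk]; omega) rfl (by decide)
  refine h1.seq (N₂ := 76 * (h + 1)) ?_ (by omega)
  rintro s₂ f₂ rfl
  have hs₂ := (hs.frame f₁ rfl rfl).frame f₂ rfl rfl
  have hpem : ∀ u < k + 1, pe u ≤ I.m := fun u hu => by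
    rcases HS.pe_spec u hu with h1 | ⟨x, y, h1, -⟩
    · omega
    · exact h1.2.1
  set s₀ := (s.setN vZ k).setN vPt k with hs₀
  refine (Runs.while (B := B) (c := 50)
    (I := fun s' => ∃ i J, s'.iv vPt = p^[i] k ∧ s'.iv vZ = p^[J] k ∧ (∀ l < i, p^[l] k < k + 1) ∧
      (J < i ∨ (i = 0 ∧ J = 0)) ∧ ∀ l < i, I.cost (pe (p^[l] k)) ≤ I.cost (pe (p^[J] k)))
    (fun s' => seq.idxOf (s'.iv vPt)) ⟨0, 0, by simp [hs₀], by simp [hs₀],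
      fun l hl => by omega, Or.inr ⟨rfl, rfl⟩, fun l hl => by omega⟩ ?_).mono ?_ ?_
  · rintro s₃ f₃ ⟨i, J, i1, i2, i3, i4, i5⟩ hb
    have hs₃ := hs₂.frame (p := loop (.lt (var vPt) (var vQk)) _) f₃.loop rfl rfl
    have e1 : s₃.ia aP = p := by rw [f₃.ia _ rfl]; rfl
    have e2 : s₃.ia aPe = pe := by rw [f₃.ia _ rfl]; rfl
    have e3 : s₃.iv vQk = k + 1 := by rw [f₃.iv _ rfl, hs₀]; simpa using hk'
    simp only [holds_lt, eval_var, i1, e3] at hb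
    have hJ : p^[J] k < k + 1 := by
      rcases i4 with h1 | ⟨-, rfl⟩
      · exact i3 J h1
      · simp
    have hrk := HS.rank_lt hkh hb
    have hpl := HS.p_le _ hb
    refine Fn.runs ?_ rfl (by decide)
    rw [fn_seq, fn_branch, holds_tLe hs₃ (by simpa [e2, i2] using hpem _ hJ)
      (by simpa [e2, i1] using hpem _ hb), fn_setN, fn_nop]
    simp only [eval_get, eval_var, e1, e2, i1, i2, fn_setN, setN_ia, setN_iv_self, setN_iv_ne, ne_eq,
      not_false_eq_true, Nat.reduceEqDiff]
    have hlt : ∀ l < i + 1, p^[l] k < k + 1 := fun l hl => by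
      rcases Nat.lt_succ_iff_lt_or_eq.1 hl with hl | rfl
      · exact i3 l hl
      · exact hb
    constructor
    · intro hle
      refine ⟨by omega, by omega, ⟨i + 1, i, ?_, rfl, hlt, Or.inl (by omega), ?_⟩, hrk⟩
      · rw [Function.iterate_succ_apply']
      · intro l hl
        rcases Nat.lt_succ_iff_lt_or_eq.1 hl with hl | rfl
        · exact (i5 l hl).trans hle
        · exact le_rfl
    · intro hle
      refine ⟨by omega, ⟨i + 1, J, ?_, rfl, hlt, Or.inl ?_, ?_⟩, hrk⟩
      · rw [Function.iterate_succ_apply']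
      · rcases i4 with h1 | ⟨rfl, rfl⟩
        · omega
        · exact absurd le_rfl hle
      · intro l hl
        rcases Nat.lt_succ_iff_lt_or_eq.1 hl with hl | rfl
        · exact i5 l hl
        · exact le_of_not_ge hle
  · have h2 : seq.idxOf (s₀.iv vPt) < h + 1 := by
      have := List.idxOf_lt_length_iff.2 ((HS.mem k).2 hkh.le)
      rw [HS.length] at this
      simpa [hs₀] using this
    have h3 : (Test.lt (var vPt) (var vQk)).cost = 4 := rfl
    rw [h3]
    omega
  · rintro s₃ f₃ ⟨⟨i, J, i1, i2, i3, i4, i5⟩, hb⟩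
    have e3 : s₃.iv vQk = k + 1 := by rw [f₃.iv _ rfl, hs₀]; simpa using hk'
    simp only [holds_lt, eval_var, i1, e3, not_lt] at hb
    have hi : J < i := by
      rcases i4 with h1 | ⟨rfl, rfl⟩
      · exact h1
      · simp at hb
    refine ⟨J, i2, fun l hl => i3 l (by omega), fun l hl => i5 l ?_⟩
    by_contra hcon
    have := hl i (by omega)
    omega

/-- The first `i` edges of the path from `k` to the root have been reversed. -/
structure Reversed (p pe : ℕ → ℕ) (k J : ℕ) (s : State) : Prop where
  le : s.iv vCnt ≤ J + 1
  cur : s.iv vPt = p^[s.iv vCnt] k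
  prv : ∀ l, s.iv vCnt = l + 1 → s.iv vPrv = p^[l] k ∧ s.iv vPrE = pe (p^[l] k)
  prv_zero : s.iv vCnt = 0 → s.iv vPrv = 0 ∧ s.iv vPrE = 0
  new : ∀ l < s.iv vCnt, s.ia aNew l = p^[l] k
  mark : ∀ u, s.ia aMark u = 0 ↔ ∀ l < s.iv vCnt, u ≠ p^[l] k
  old : ∀ u, (∀ l < s.iv vCnt, u ≠ p^[l] k) → s.ia aP u = p u ∧ s.ia aPe u = pe u
  rev : ∀ l, l + 1 < s.iv vCnt → s.ia aP (p^[l + 1] k) = p^[l] k ∧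
    s.ia aPe (p^[l + 1] k) = pe (p^[l] k)

theorem Reversed.step {B k J : ℕ} {p pe : ℕ → ℕ} {s : State} (H : Reversed p pe k J s)
    (hinj : ∀ i ≤ J, ∀ l ≤ J, p^[i] k = p^[l] k → i = l) (hc : s.iv vCnt ≤ J)
    (hB : ∀ i ≤ J + 1, p^[i] k ≤ B) (hB' : ∀ i ≤ J, pe (p^[i] k) ≤ B) (hJ : J + 1 ≤ B) :
    Fn B cRevStep s (fun s' => Reversed p pe k J s' ∧ s'.iv vCnt = s.iv vCnt + 1) := by
  set i := s.iv vCnt with hi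
  have hpi := hB i (by omega)
  have hpi' := hB (i + 1) (by omega)
  have hpei := hB' i hc
  rw [Function.iterate_succ_apply'] at hpi'
  have hnew : ∀ l < i, p^[i] k ≠ p^[l] k := fun l hl he => by
    have := hinj i hc l (by omega) he
    omega
  obtain ⟨o1, o2⟩ := H.old _ hnew
  have hprv : s.iv vPrv ≤ B ∧ s.iv vPrE ≤ B := by
    rcases Nat.eq_zero_or_pos i with h0 | h0
    · have := H.prv_zero h0
      omega
    · have := H.prv (i - 1) (by omega)
      rw [this.1, this.2]
      exact ⟨hB _ (by omega), hB' _ (by omega)⟩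
  have hcur : s.iv vPt = p^[i] k := H.cur
  have hlast : ∀ Q : ℕ → Prop, (∀ l < i + 1, Q l) ↔ (∀ l < i, Q l) ∧ Q i := fun Q => by
    refine ⟨fun h => ⟨fun l hl => h l (by omega), h i (by omega)⟩, fun h l hl => ?_⟩
    rcases Nat.lt_succ_iff_lt_or_eq.1 hl with hl | rfl
    · exact h.1 l hl
    · exact h.2
  simp only [cRevStep, fn_seq, fn_setN, fn_putN, eval_var, eval_get, eval_add, eval_ofNat, setN_ia,
    putN_iv, putN_ia_self, putN_ia_ne, setN_iv_self, setN_iv_ne, ne_eq, not_false_eq_true,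
    Nat.reduceEqDiff, hcur, o1, o2, ← hi]
  refine ⟨by omega, by omega, by omega, by omega, by omega, by omega, by omega, by omega, by omega,
    by omega, by omega, by omega, by omega, by omega, ⟨?_, ?_, ?_, ?_, ?_, ?_, ?_, ?_⟩, trivial⟩ <;>
  simp only [setN_ia, putN_iv, putN_ia_self, putN_ia_ne, setN_iv_self, setN_iv_ne, ne_eq,
    not_false_eq_true, Nat.reduceEqDiff]
  · omega
  · rw [Function.iterate_succ_apply']
  · intro l hl
    obtain rfl : l = i := by omega
    exact ⟨rfl, rfl⟩
  · exact False.elim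
  · intro l hl
    rw [Function.update_apply]
    split_ifs with hli
    · rw [hli]
    · exact H.new l (by omega)
  · intro u
    rw [hlast, Function.update_apply]
    split_ifs with hui
    · simp [hui]
    · simpa [hui] using H.mark u
  · intro u hu
    rw [hlast] at hu
    rw [Function.update_of_ne hu.2, Function.update_of_ne hu.2]
    exact H.old u hu.1
  · intro l hl
    rcases Nat.lt_succ_iff_lt_or_eq.1 hl with hl' | hl'
    · have hne : p^[l + 1] k ≠ p^[i] k := (hnew _ hl').symm
      rw [Function.update_of_ne hne, Function.update_of_ne hne]
      exact H.rev l hl'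
    · rw [hl', Function.update_self, Function.update_self]
      exact H.prv l hl'.symm

theorem runs_cRev {B k J : ℕ} {p pe : ℕ → ℕ} {s : State}
    (hp : s.ia aP = p) (hpe : s.ia aPe = pe) (hz : s.iv vZ = p^[J] k) (hk : s.iv vKk = k)
    (hmark : ∀ u, s.ia aMark u = 0)
    (hinj : ∀ i ≤ J + 1, ∀ l ≤ J + 1, p^[i] k = p^[l] k → i = l)
    (hB : ∀ i ≤ J + 1, p^[i] k ≤ B) (hB' : ∀ i ≤ J, pe (p^[i] k) ≤ B) (hJ : J + 1 ≤ B) :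
    Runs B cRev s (60 * (J + 1) + 30) (fun s' => Reversed p pe k J s' ∧ s'.iv vCnt = J + 1) := by
  have hk0 : k ≤ B := hB 0 (by omega)
  have hlast : p^[J + 1] k = p (p^[J] k) := Function.iterate_succ_apply' _ _ _
  have hlastB := hB (J + 1) le_rfl
  have h0 : Runs B cRevInit s 20 (fun s' => Reversed p pe k J s' ∧ s'.iv vCnt = 0 ∧
      s'.iv vStop = p^[J + 1] k) := by
    refine Fn.runs ?_ rfl (by decide)
    simp only [cRevInit, fn_seq, fn_setN, eval_var, eval_get, eval_ofNat, setN_ia, setN_iv_self,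
      setN_iv_ne, ne_eq, not_false_eq_true, Nat.reduceEqDiff, hk, hz, hp, ← hlast]
    refine ⟨by omega, by omega, by omega, by omega, by omega, ⟨?_, ?_, ?_, ?_, ?_, ?_, ?_, ?_⟩,
      trivial, trivial⟩ <;>
    simp only [setN_ia, putN_iv, putN_ia_self, putN_ia_ne, setN_iv_self, setN_iv_ne, ne_eq,
      not_false_eq_true, Nat.reduceEqDiff, hp, hpe]
    · omega
    · simp
    · simp
    · simp
    · simp
    · intro u; simp [hmark u]
    · simp
    · simp
  refine h0.seq (N₂ := 60 * (J + 1) + 10) ?_ (by omega)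
  rintro s₁ f₁ ⟨hR, hc, hst⟩
  refine (Runs.while (B := B) (c := 50)
    (I := fun s' => Reversed p pe k J s') (fun s' => J + 1 - s'.iv vCnt) hR ?_).mono ?_ ?_
  · rintro s₂ f₂ hR₂ hb
    have e1 : s₂.iv vStop = p^[J + 1] k := by rw [f₂.iv _ rfl, hst]
    simp only [holds_neg, holds_eq, eval_var, e1, hR₂.cur] at hb
    have hle : s₂.iv vCnt ≤ J := by
      have := hR₂.le
      by_contra hcon
      exact hb (by rw [show s₂.iv vCnt = J + 1 by omega])
    refine Fn.runs ((hR₂.step (fun i hi l hl => hinj i (by omega) l (by omega)) hle hB hB' hJ).mono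
      fun s' _ h => ?_) rfl (by decide)
    exact ⟨h.1, by omega⟩
  · have h3 : (Test.neg (.eq (var vPt) (var vStop))).cost = 8 := rfl
    rw [h3, hc]
    omega
  · rintro s₂ f₂ ⟨hR₂, hb⟩
    have e1 : s₂.iv vStop = p^[J + 1] k := by rw [f₂.iv _ rfl, hst]
    simp only [holds_neg, holds_eq, eval_var, e1, hR₂.cur, not_not] at hb
    exact ⟨hR₂, hinj _ hR₂.le _ le_rfl hb⟩

theorem runs_cMerge {B h c : ℕ} {L : List ℕ} {s : State} (hh1 : s.iv vHs = h + 1)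
    (hc : s.iv vCnt = c) (hL : prefixOf (s.ia aNew) c = L)
    (hseq : ∀ i ≤ h, s.ia aSeq i ≤ h) (hmark : ∀ u, s.ia aMark u = 0 ↔ u ∉ L)
    (hB : c + h + 1 ≤ B) :
    Runs B cMerge s (60 * (h + 1) + 9) (fun s' =>
      prefixOf (s'.ia aNew) (s'.iv vCnt) =
        L ++ (prefixOf (s.ia aSeq) (h + 1)).filter fun u => u ∉ L) := by
  refine (Runs.forUp (B := B) (c := 50) (N := h + 1) (fun j s' => s'.iv vCnt ≤ c + j ∧
      prefixOf (s'.ia aNew) (s'.iv vCnt) =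
        L ++ (prefixOf (s.ia aSeq) j).filter fun u => u ∉ L) hh1 (by omega) rfl rfl
      ⟨by simp [hc], by simp [hc, hL, show prefixOf (s.ia aSeq) 0 = [] from rfl]⟩ ?_).mono (by omega) fun _ _ h => h.2
  rintro j s₁ hj hf hij ⟨i1, i2⟩
  have e1 : s₁.ia aSeq = s.ia aSeq := hf.ia _ rfl
  have e2 : s₁.ia aMark = s.ia aMark := hf.ia _ rfl
  have hu := hseq j (by omega)
  refine Fn.runs ?_ rfl (by decide)
  simp only [fn_seq, fn_setN, fn_putN, fn_branch, fn_nop, eval_var, eval_get, eval_add, eval_ofNat,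
    setN_ia, putN_iv, putN_ia_self, setN_iv_self, setN_iv_ne, ne_eq, not_false_eq_true,
    Nat.reduceEqDiff, holds_eq, e1, e2, hij, hmark, prefixOf_succ, List.filter_append,
    Function.update_self]
  refine ⟨by omega, fun h1 => ⟨by omega, by omega, by omega, by omega, ?_⟩, fun h1 => ⟨by omega, ?_⟩⟩
  · rw [← List.append_assoc, ← i2, List.filter_singleton]
    simp only [h1, not_false_eq_true, decide_true, cond_true]
    congr 1
    exact prefixOf_congr fun i hi => Function.update_of_ne (by omega) _ _
  · rw [i2, List.filter_singleton]
    simp [h1]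

theorem runs_cCopy {B h : ℕ} {s : State} (hh1 : s.iv vHs = h + 1)
    (hnew : ∀ i ≤ h, s.ia aNew i ≤ h) (hmark : ∀ u, h < u → s.ia aMark u = 0) (hB : h + 1 ≤ B) :
    Runs B cCopy s (40 * (h + 1) + 9) (fun s' =>
      prefixOf (s'.ia aSeq) (h + 1) = prefixOf (s.ia aNew) (h + 1) ∧ ∀ u, s'.ia aMark u = 0) := by
  refine (Runs.forUp (B := B) (c := 30) (N := h + 1) (fun j s' =>
      (∀ i < j, s'.ia aSeq i = s.ia aNew i) ∧ ∀ u, (u < j ∨ h < u) → s'.ia aMark u = 0) hh1 hB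
      rfl rfl ⟨fun i hi => by omega, fun u hu => hmark u (by omega)⟩ ?_).mono (by omega) ?_
  · rintro j s₁ hj hf hij ⟨i1, i2⟩
    have e1 : s₁.ia aNew = s.ia aNew := hf.ia _ rfl
    have hu := hnew j (by omega)
    refine Fn.runs ?_ rfl (by decide)
    simp only [fn_seq, fn_putN, eval_var, eval_get, eval_ofNat, setN_ia, putN_iv, putN_ia_self,
      putN_ia_ne, ne_eq, not_false_eq_true, Nat.reduceEqDiff, hij, e1]
    refine ⟨by omega, by omega, by omega, by omega, fun i hi => ?_, fun u hu => ?_⟩ <;>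
      rw [Function.update_apply] <;> split_ifs with hij'
    · rw [hij']
    · exact i1 i (by omega)
    · rfl
    · exact i2 u (by omega)
  · rintro s₁ - ⟨i1, i2⟩
    exact ⟨prefixOf_congr i1, fun u => i2 u (by omega)⟩

theorem runs_cContract {B v h k : ℕ} {s : State} (hs : I.Ready s) (hB : 2 * (h + 1) ≤ B)
    (hmB : I.m ≤ B) (hh1 : s.iv vHs = h + 1)
    (hk : s.iv vKk = k) (hk' : s.iv vQk = k + 1) (hkh : k < h) (hmark : ∀ u, s.ia aMark u = 0)
    (HS : Span I.cost (I.Mt v h) h (k + 1) (prefixOf (s.ia aSeq) (h + 1)) (s.ia aP) (s.ia aPe)) :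
    Runs B cContract s (400 * (h + 1)) (fun s' => (∀ u, s'.ia aMark u = 0) ∧
      Span I.cost (I.Mt v h) h k (prefixOf (s'.ia aSeq) (h + 1)) (s'.ia aP) (s'.ia aPe)) := by
  refine (runs_cMax hs (by omega) hk hk' hkh HS).seq (N₂ := 310 * (h + 1)) ?_ (by omega)
  rintro s₁ f₁ ⟨J, hz, hJ, hmax⟩
  set p := s.ia aP with hp
  set pe := s.ia aPe with hpe
  set seq := prefixOf (s.ia aSeq) (h + 1) with hseq
  have hrk : ∀ i ≤ J, seq.idxOf (p^[i + 1] k) < seq.idxOf (p^[i] k) := fun i hi => by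
    rw [Function.iterate_succ_apply']
    exact HS.rank_lt hkh (hJ i hi)
  have hanti : ∀ i l, i < l → l ≤ J + 1 → seq.idxOf (p^[l] k) < seq.idxOf (p^[i] k) := by
    intro i l hil
    induction l, hil using Nat.le_induction with
    | base => exact fun h => hrk i (by omega)
    | succ l hl ih => exact fun h => (hrk l (by omega)).trans (ih (by omega))
  have hinj : ∀ i ≤ J + 1, ∀ l ≤ J + 1, p^[i] k = p^[l] k → i = l := fun i hi l hl he => by
    rcases lt_trichotomy i l with h1 | h1 | h1
    · have := hanti i l h1 hl
      rw [he] at this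
      omega
    · exact h1
    · have := hanti l i h1 hi
      rw [he] at this
      omega
  have hle : ∀ i ≤ J + 1, p^[i] k ≤ h := fun i hi => by
    cases i with
    | zero => exact hkh.le
    | succ i =>
      rw [Function.iterate_succ_apply']
      exact HS.p_le _ (hJ i (by omega))
  have hJh : J + 1 ≤ h := by
    have h1 := Finset.card_le_card_of_injOn (s := Finset.range (J + 1)) (t := Finset.range (k + 1))
      (fun i => p^[i] k) (fun i hi => by simpa using hJ i (by simpa [Nat.lt_succ_iff] using hi))
      (fun i hi l hl he => hinj i (by have := Finset.mem_range.1 hi; omega) l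
        (by have := Finset.mem_range.1 hl; omega) he)
    simp only [Finset.card_range] at h1
    omega
  refine (runs_cRev (B := B) (J := J) (k := k) (p := p) (pe := pe) (f₁.ia _ rfl) (f₁.ia _ rfl) hz
    ((f₁.iv _ rfl).trans hk) (by rw [f₁.ia aMark rfl]; exact hmark) hinj
    (fun i hi => (hle i hi).trans (by omega)) (fun i hi => ?_) (by omega)).seq
    (N₂ := 200 * (h + 1)) ?_ (by omega)
  · rcases HS.pe_spec _ (hJ i hi) with h1 | ⟨x, y, h1, -⟩
    · omega
    · exact h1.2.1.trans hmB
  rintro s₂ f₂ ⟨hR, hcnt⟩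
  have hseq₂ : s₂.ia aSeq = s.ia aSeq := by rw [f₂.ia _ rfl, f₁.ia _ rfl]
  set L := (List.range (J + 1)).map (fun i => p^[i] k) with hL
  have hmemL : ∀ u, u ∉ L ↔ ∀ l < J + 1, u ≠ p^[l] k := fun u => by
    simp only [hL, List.mem_map, List.mem_range, not_exists, not_and, ne_eq]
    exact forall₂_congr fun l _ => not_congr eq_comm
  have hnewL : prefixOf (s₂.ia aNew) (J + 1) = L :=
    prefixOf_congr fun i hi => hR.new i (by omega)
  have hC := HS.contract (p' := s₂.ia aP) (pe' := s₂.ia aPe) hkh (fun _ _ _ => Mt.symm) hJ hmax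
    (fun i hi => (hR.rev i (by omega)).1) (fun i hi => (hR.rev i (by omega)).2)
    (fun u hu => (hR.old u fun l hl => hu l (by omega)).1)
    (fun u hu => (hR.old u fun l hl => hu l (by omega)).2)
  have hmemS : ∀ i ≤ h, s.ia aSeq i ≤ h := fun i hi =>
    (HS.mem _).1 (mem_prefixOf.2 ⟨i, by omega, rfl⟩)
  refine (runs_cMerge (B := B) (c := J + 1) (h := h) (L := L)
    (by rw [f₂.iv _ rfl, f₁.iv _ rfl, hh1]) hcnt hnewL (by rw [hseq₂]; exact hmemS)
    (fun u => by rw [hR.mark, hcnt, hmemL]) (by omega)).seq (N₂ := 60 * (h + 1)) ?_ (by omega)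
  intro s₃ f₃ h₃
  rw [hseq₂] at h₃
  have hlen : s₃.iv vCnt = h + 1 := by
    have h1 := hC.length
    rw [← h₃, length_prefixOf] at h1
    exact h1
  rw [hlen] at h₃
  rw [← h₃] at hC
  refine (runs_cCopy (B := B) (h := h) (by rw [f₃.iv _ rfl, f₂.iv _ rfl, f₁.iv _ rfl, hh1])
    (fun i hi => (hC.mem _).1 (mem_prefixOf.2 ⟨i, by omega, rfl⟩)) (fun u hu => ?_)
    (by omega)).mono (by omega) ?_
  · rw [f₃.ia _ rfl, hR.mark, hcnt]
    rintro l hl rfl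
    have := hle l (by omega)
    omega
  · rintro s₄ f₄ ⟨h4, h5⟩
    refine ⟨h5, ?_⟩
    rw [h4, f₄.ia aP rfl, f₄.ia aPe rfl, f₃.ia aP rfl, f₃.ia aPe rfl]
    exact hC

end Inst

/-! ### The preprocessing -/

notation "vKc" => (81 : ℕ)

/-- The entries for the failure of the last `vQk` edges, and the contraction for the next round. -/
def cRound : Cmd :=
  setN vKk (var vQk - 1) ;; cEntries ;; cContract ;; setN vQk (var vKk)

/-- The entries for all failures on the path to `vQv`. -/
def cRounds : Cmd := setN vQk (var vH) ;; forUp vKc vH cRound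

/-- All entries for the vertex `vQv`. -/
def cVertex : Cmd := cH ;; cCmp ;; cBest ;; cPrim ;; cRounds

/-- The preprocessing. -/
def cPreprocess : Cmd :=
  cTree ;; cTables ;; putN aPrm 0 (var vF) ;; cCost ;; forUp vQv vN cVertex

namespace Inst

variable {I : Inst}

/-- The cells of the state hold the entries for the failure of the last `k` edges of the path
to `v`. -/
def EntOk (I : Inst) (s : State) (v k : ℕ) : Prop :=
  ∃ seq p pe, Span I.cost (I.Mt v (I.mx v)) (I.mx v) k seq p pe ∧
    ∀ i < k, I.CellOk v (I.mx v) k p pe s i ∧ I.CellLe v k s ((I.f + 1) * (2 * I.n + 1)) i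

theorem EntOk.congr {v k : ℕ} {s s' : State} (H : I.EntOk s v k) (hk : k ≤ I.mx v)
    (h : ∀ i < k, SameEnt s s' (I.ent v k i)) : I.EntOk s' v k := by
  obtain ⟨seq, p, pe, h1, h2⟩ := H
  exact ⟨seq, p, pe, h1, fun i hi => ⟨(h2 i hi).1.congr hk (h i hi) fun h3 => h _ h3,
    (h2 i hi).2.congr (h i hi)⟩⟩

theorem mx_le (v : ℕ) : I.mx v ≤ I.f := min_le_left _ _

/-- The values that occur in the preprocessing are at most `B`. -/
structure Fits (I : Inst) (B : ℕ) : Prop where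
  n_le : 2 * I.n + 2 ≤ B
  m_le : I.m + 1 ≤ B
  f_le : 2 * (I.f + 1) ≤ B
  ff_le : (I.f + 1) * (I.f + 1) ≤ B
  fn_le : (I.f + 2) * (2 * I.n + 1) ≤ B
  nff_le : I.n * I.f * I.f ≤ B

theorem runs_cRound {B v k : ℕ} {s : State} (hs : I.Ready s) (hB : I.Fits B) (hvn : v < I.n)
    (hv : s.iv vQv = v) (hk : s.iv vQk = k + 1) (hh1 : s.iv vHs = I.mx v + 1) (hkh : k < I.mx v)
    (hcmp : ∀ a < I.n, s.ia aCmp a = min (I.mx v) (I.ix v a)) (hmark : ∀ u, s.ia aMark u = 0)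
    (HS : Span I.cost (I.Mt v (I.mx v)) (I.mx v) (k + 1) (prefixOf (s.ia aSeq) (I.mx v + 1))
      (s.ia aP) (s.ia aPe)) :
    Runs B cRound s (4500 * (I.mx v + 1)) (fun s' => s'.iv vQk = k ∧ (∀ u, s'.ia aMark u = 0) ∧
      Span I.cost (I.Mt v (I.mx v)) (I.mx v) k (prefixOf (s'.ia aSeq) (I.mx v + 1))
        (s'.ia aP) (s'.ia aPe) ∧
      I.EntOk s' v (k + 1) ∧ ∀ q, (∀ i < k + 1, q ≠ I.ent v (k + 1) i) → SameEnt s s' q) := by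
  have hf := I.mx_le v
  have hf2 := hB.f_le
  have hn2 := hB.n_le
  have hm2 := hB.m_le
  have hfn : (I.mx v + 1) * (2 * I.n + 1) ≤ (I.f + 1) * (2 * I.n + 1) :=
    Nat.mul_le_mul_right _ (by omega)
  have hfn' : (I.f + 1) * (2 * I.n + 1) ≤ (I.f + 2) * (2 * I.n + 1) :=
    Nat.mul_le_mul_right _ (by omega)
  have hfn2 := hB.fn_le
  have h0 : Runs B (setN vKk (var vQk - 1)) s 10 (fun s' => s'.iv vKk = k) :=
    Fn.runs (by rw [fn_setN]; simp [hk]; omega) rfl (by decide)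
  refine h0.seq (N₂ := 4410 * (I.mx v + 1)) ?_ (by omega)
  intro s₁ f₁ h₁
  have hs₁ := hs.frame f₁ rfl rfl
  have e1 : s₁.ia = s.ia := funext fun a => f₁.ia a rfl
  refine (runs_cEntries (B := B) (h := I.mx v) (k := k + 1) (v := v) (p := s₁.ia aP) hs₁ (by omega)
    hB.nff_le (by omega) (by omega) ((f₁.iv _ rfl).trans hv) ((f₁.iv _ rfl).trans hk)
    ((f₁.iv _ rfl).trans hh1) hvn (by omega) hkh hf (by rwa [e1]) (by rwa [e1])).seq
    (N₂ := 410 * (I.mx v + 1)) ?_ (by omega)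
  rintro s₂ f₂ ⟨h₂, h₂'⟩
  have hs₂ := hs₁.frame f₂ rfl rfl
  have hS₂ : Span I.cost (I.Mt v (I.mx v)) (I.mx v) (k + 1) (prefixOf (s₂.ia aSeq) (I.mx v + 1))
      (s₂.ia aP) (s₂.ia aPe) := by
    rw [f₂.ia aSeq rfl, f₂.ia aP rfl, f₂.ia aPe rfl, e1]
    exact HS
  refine (runs_cContract (B := B) (h := I.mx v) (k := k) hs₂ (by omega) (by omega)
    (by rw [f₂.iv _ rfl, f₁.iv _ rfl, hh1]) (by rw [f₂.iv _ rfl, h₁])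
    (by rw [f₂.iv _ rfl, f₁.iv _ rfl, hk]) hkh
    (by rw [f₂.ia aMark rfl, e1]; exact hmark) hS₂).seq (N₂ := 5) ?_ (by omega)
  rintro s₃ f₃ ⟨h₃, h₃'⟩
  refine Fn.runs ?_ rfl (by decide)
  rw [fn_setN, eval_var, f₃.iv vKk rfl, f₂.iv vKk rfl, h₁]
  have hsame : ∀ q, SameEnt s₂ (s₃.setN vQk k) q := fun q =>
    (SameEnt.of_frame f₃ rfl q).trans (sameEnt_setN _ _ _ _)
  refine ⟨by omega, by simp, h₃, h₃', ?_, fun q hq => ?_⟩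
  · refine EntOk.congr (s := s₂) ⟨_, _, _, HS, fun i hi => ?_⟩ hkh fun i _ => hsame _
    obtain ⟨h4, h5, h6⟩ := h₂ i hi
    rw [e1] at h4
    exact ⟨h4, h5, fun h7 => ⟨(h6 h7).1, (h6 h7).2.trans hfn⟩⟩
  · exact (SameEnt.of_frame f₁ rfl q).trans ((h₂' q hq).trans (hsame q))

theorem runs_cRounds {B v : ℕ} {s : State} (hs : I.Ready s) (hB : I.Fits B) (hvn : v < I.n)
    (hv : s.iv vQv = v) (hh : s.iv vH = I.mx v) (hh1 : s.iv vHs = I.mx v + 1)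
    (hcmp : ∀ a < I.n, s.ia aCmp a = min (I.mx v) (I.ix v a)) (hmark : ∀ u, s.ia aMark u = 0)
    (HS : Span I.cost (I.Mt v (I.mx v)) (I.mx v) (I.mx v) (prefixOf (s.ia aSeq) (I.mx v + 1))
      (s.ia aP) (s.ia aPe)) :
    Runs B cRounds s (5000 * ((I.mx v + 1) * (I.mx v + 1))) (fun s' => (∀ u, s'.ia aMark u = 0) ∧
      (∀ k, 1 ≤ k → k ≤ I.mx v → I.EntOk s' v k) ∧
      ∀ q, (∀ k i, 1 ≤ k → k ≤ I.mx v → i < k → q ≠ I.ent v k i) → SameEnt s s' q) := by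
  set h := I.mx v with hdef
  have hf : h ≤ I.f := I.mx_le v
  have hf2 := hB.f_le
  have hsq : h + 1 ≤ (h + 1) * (h + 1) := Nat.le_mul_of_pos_left _ (by omega)
  have h0 : Runs B (setN vQk (var vH)) s 10 (fun s' => s' = s.setN vQk h) :=
    Fn.runs (by rw [fn_setN]; simp [hh]; omega) rfl (by decide)
  refine h0.seq (N₂ := 4900 * ((h + 1) * (h + 1))) ?_ (by omega)
  rintro s₁ f₁ rfl
  have hs₁ := hs.frame f₁ rfl rfl
  refine (Runs.forUp (B := B) (i := vKc) (x := vH) (p := cRound) (s₀ := s.setN vQk h) (c := 4500 * (h + 1)) (N := h) (fun j s' => s'.iv vQk = h - j ∧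
      (∀ u, s'.ia aMark u = 0) ∧
      Span I.cost (I.Mt v h) h (h - j) (prefixOf (s'.ia aSeq) (h + 1)) (s'.ia aP) (s'.ia aPe) ∧
      (∀ k, h - j < k → k ≤ h → I.EntOk s' v k) ∧
      ∀ q, (∀ k i, 1 ≤ k → k ≤ h → i < k → q ≠ I.ent v k i) → SameEnt s s' q)
      (by simpa using hh) (by omega) rfl rfl ⟨by simp, hmark, HS, fun k h1 h2 => by omega,
        fun q _ => ⟨rfl, rfl, rfl, rfl, rfl⟩⟩ ?_).mono ?_ ?_
  · rintro j s₂ hj hf₂ hij ⟨i1, i2, i3, i4, i5⟩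
    have e1 : h - j = h - (j + 1) + 1 := by omega
    rw [e1] at i1 i3
    refine (runs_cRound (hs₁.frame hf₂ rfl rfl) hB hvn (by rw [hf₂.iv _ rfl]; simpa using hv) i1
      (by rw [hf₂.iv _ rfl]; simpa using hh1) (by omega) (by rw [hf₂.ia _ rfl]; exact hcmp) i2
      i3).mono le_rfl ?_
    rintro s₃ f₃ ⟨j1, j2, j3, j4, j5⟩
    refine ⟨by simpa using j1, j2, j3, fun k hk hk' => ?_, fun q hq => ?_⟩
    · rcases Nat.lt_or_ge (h - (j + 1) + 1) k with h1 | h1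
      · refine (i4 k (by omega) hk').congr hk' fun i hi => (j5 _ fun i' hi' he => ?_).trans
          (sameEnt_setN _ _ _ _)
        have := ent_inj (I := I) (by omega) (by omega) hi (by omega) (by omega) hi' he
        omega
      · obtain rfl : k = h - (j + 1) + 1 := by omega
        exact j4.congr hk' fun i _ => sameEnt_setN _ _ _ _
    · exact ((i5 q hq).trans (j5 q fun i hi => hq _ i (by omega) (by omega) hi)).trans
        (sameEnt_setN _ _ _ _)
  · nlinarith
  · rintro s₂ - ⟨-, i2, -, i4, i5⟩
    exact ⟨i2, fun k h1 h2 => i4 k (by omega) h2, i5⟩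

theorem runs_cVertex {B v : ℕ} {s : State} (hs : I.Ready s) (hB : I.Fits B) (hvn : v < I.n)
    (hv : s.iv vQv = v) (hmark : ∀ u, s.ia aMark u = 0) :
    Runs B cVertex s (1100 * I.n + 200 * I.m + 6200 * ((I.f + 1) * (I.f + 1)))
      (fun s' => (∀ u, s'.ia aMark u = 0) ∧ (∀ k, 1 ≤ k → k ≤ I.mx v → I.EntOk s' v k) ∧
      ∀ q, (∀ k i, 1 ≤ k → k ≤ I.mx v → i < k → q ≠ I.ent v k i) → SameEnt s s' q) := by
  have hf : I.mx v ≤ I.f := I.mx_le v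
  have hf2 := hB.f_le
  have hn1 := I.n_pos
  have hff := hB.ff_le
  have hn2 := hB.n_le
  have hm2 := hB.m_le
  have hsq : (I.mx v + 1) * (I.mx v + 1) ≤ (I.f + 1) * (I.f + 1) :=
    Nat.mul_le_mul (by omega) (by omega)
  refine (runs_cH hs hv hvn (by omega : I.f + 1 ≤ B)).seq
    (N₂ := 1050 * I.n + 200 * I.m + 6200 * ((I.f + 1) * (I.f + 1))) ?_ (by omega)
  rintro s₁ f₁ ⟨a1, a2⟩
  have hs₁ := hs.frame f₁ rfl rfl
  refine (runs_cCmp hs₁ (v := v) (by rw [f₁.iv _ rfl, hv]) hvn a1 (by omega : I.n + 1 ≤ B)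
    (by omega)).seq (N₂ := 200 * I.m + 6200 * ((I.f + 1) * (I.f + 1))) ?_ (by omega)
  rintro s₂ f₂ hcmp
  have hs₂ := hs₁.frame f₂ rfl rfl
  refine (runs_cBest hs₂ (B := B) (v := v) (h := I.mx v) (by rw [f₂.iv _ rfl, a2]) (by omega)
    (by omega) (by omega) hcmp).seq (N₂ := 6100 * ((I.f + 1) * (I.f + 1))) ?_ (by omega)
  rintro s₃ f₃ hbest
  have hs₃ := hs₂.frame f₃ rfl rfl
  refine (runs_cPrim hs₃ (B := B) (v := v) (h := I.mx v) (by rw [f₃.iv _ rfl, f₂.iv _ rfl, a1])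
    (by rw [f₃.iv _ rfl, f₂.iv _ rfl, a2]) (by omega) (by omega) hbest).seq
    (N₂ := 5000 * ((I.f + 1) * (I.f + 1))) ?_ (by omega)
  rintro s₄ f₄ hspan
  refine (runs_cRounds (hs₃.frame f₄ rfl rfl) hB hvn
    (by rw [f₄.iv _ rfl, f₃.iv _ rfl, f₂.iv _ rfl, f₁.iv _ rfl, hv])
    (by rw [f₄.iv _ rfl, f₃.iv _ rfl, f₂.iv _ rfl, a1])
    (by rw [f₄.iv _ rfl, f₃.iv _ rfl, f₂.iv _ rfl, a2])
    (by rw [f₄.ia _ rfl, f₃.ia _ rfl]; exact hcmp)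
    (by rw [f₄.ia _ rfl, f₃.ia _ rfl, f₂.ia _ rfl, f₁.ia _ rfl]; exact hmark)
    hspan).mono (by omega) ?_
  rintro s₅ f₅ ⟨i1, i2, i3⟩
  refine ⟨i1, i2, fun q hq => ?_⟩
  exact (((SameEnt.of_frame f₁ rfl q).trans (.of_frame f₂ rfl q)).trans
    ((SameEnt.of_frame f₃ rfl q).trans (.of_frame f₄ rfl q))).trans (i3 q hq)

/-- A spanning tree has `n - 1` edges. -/
theorem n_le : I.n ≤ I.m + 1 := by
  choose! j hj hj' using I.tree_edge
  have h1 := Finset.card_le_card_of_injOn (s := (Finset.range I.n).erase I.r)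
    (t := Finset.range I.m) j (fun v hv => ?_) ?_
  · rw [Finset.card_erase_of_mem (Finset.mem_range.2 I.r_lt), Finset.card_range,
      Finset.card_range] at h1
    omega
  · simp only [Finset.coe_erase, Finset.coe_range, Set.mem_sdiff, Set.mem_Iio,
      Set.mem_singleton_iff] at hv
    simpa using hj v hv.1 hv.2
  · intro v hv w hw he
    simp only [Finset.coe_erase, Finset.coe_range, Set.mem_sdiff, Set.mem_Iio,
      Set.mem_singleton_iff] at hv hw
    have h2 := hj' v hv.1 hv.2
    have h3 := hj' w hw.1 hw.2
    rw [he] at h2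
    have d1 := I.tree.dep_eq_succ hv.2
    have d2 := I.tree.dep_eq_succ hw.2
    rcases h2 with ⟨h2, h2'⟩ | ⟨h2, h2'⟩ <;> rcases h3 with ⟨h3, h3'⟩ | ⟨h3, h3'⟩
    · exact h2.symm.trans h3
    · have h4 : I.par w = v := h3.symm.trans h2
      have h5 : I.par v = w := h2'.symm.trans h3'
      rw [h5] at d1
      rw [h4] at d2
      omega
    · have h4 : I.par w = v := h3'.symm.trans h2'
      have h5 : I.par v = w := h2.symm.trans h3
      rw [h5] at d1
      rw [h4] at d2
      omega
    · exact h2'.symm.trans h3'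

/-- The state holds the oracle. -/
structure OracleOk (I : Inst) (s : State) : Prop where
  tree : I.TreeOk s
  lca : I.LcaOk s
  prm : s.ia aPrm 0 = I.f
  ent : ∀ v < I.n, ∀ k, 1 ≤ k → k ≤ I.mx v → I.EntOk s v k

/-- The preprocessing takes `O(n * n)` steps for the tree data and, for every vertex `v`, `O(m + h ^ 2)`
steps for the matrix of the cheapest edges and for Prim's algorithm, and `O(h)` steps for each of the
`h ≤ f` failures on the path to `v`; and `n ≤ m + 1`. -/
theorem runs_cPreprocess {B : ℕ} {s : State} (hs : I.InOk s) (hB : I.Fits B)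
    (hpos : ∀ v < I.n, s.ia aPos v = 0) (hmark : ∀ u, s.ia aMark u = 0) :
    Runs B cPreprocess s (40000 * (I.n * (I.m + I.f ^ 2))) (fun s' => I.OracleOk s') := by
  have hn1 := I.n_pos
  have hf1 := I.f_pos
  have hn2 := hB.n_le
  have hm2 := hB.m_le
  have hf2 := hB.f_le
  have hnm := I.n_le
  have hff : I.f * I.f ≥ 1 := Nat.mul_pos hf1 hf1
  have hnn : I.n * I.n ≤ I.n * (I.m + I.f ^ 2) :=
    Nat.mul_le_mul_left _ (by rw [pow_two]; omega)
  have hmn : I.m ≤ I.n * I.m := Nat.le_mul_of_pos_left _ hn1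
  have hfn : 1 ≤ I.n * I.f ^ 2 := Nat.mul_pos hn1 (by positivity)
  have hsum : I.n * (I.m + I.f ^ 2) = I.n * I.m + I.n * I.f ^ 2 := Nat.mul_add _ _ _
  refine (runs_cTree hs (by omega : I.n + 1 ≤ B) (by omega) hpos).seq
    (N₂ := 38900 * (I.n * (I.m + I.f ^ 2))) ?_ (by omega)
  rintro s₁ f₁ ⟨a2, a3, a4, a5, a6, a7, a8⟩
  have hs₁ := hs.frame f₁ rfl
  refine (runs_cTables hs₁.n hn1 (by omega : 2 * I.n + 2 ≤ B) a8).seq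
    (N₂ := 36900 * (I.n * (I.m + I.f ^ 2))) ?_ (by omega)
  rintro s₂ f₂ ⟨b1, b2, b3⟩
  have hs₂ := hs₁.frame f₂ rfl
  have ht₂ : I.TreeOk s₂ := by
    refine ⟨?_, ?_, ?_⟩
    · rw [f₂.ia _ rfl]; exact a2.par
    · rw [f₂.ia _ rfl]; exact a2.dp
    · rw [f₂.ra _ rfl]; exact a2.ds
  have hl₂ : I.LcaOk s₂ := by
    have e5 : s₂.ia aPos = s₁.ia aPos := f₂.ia _ rfl
    have e6 : s₂.ia aTop = s₁.ia aTop := f₂.ia _ rfl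
    have e7 : s₂.ia aAt = s₁.ia aAt := f₂.ia _ rfl
    refine ⟨?_, ?_, ?_, ?_, ?_, ?_, b1, b2, b3⟩ <;> simp only [e5, e6, e7]
    exacts [a3, a4, a5, a6, a7, a8]
  have h2 : Runs B (putN aPrm 0 (var vF)) s₂ 3 (fun s' => s' = s₂.putN aPrm 0 I.f) :=
    Fn.runs (by rw [fn_putN]; simp [hs₂.f]; omega) rfl (by decide)
  refine h2.seq (N₂ := 36850 * (I.n * (I.m + I.f ^ 2))) ?_ (by omega)
  rintro s₃ f₃ rfl
  have hs₃ := hs₂.frame f₃ rfl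
  have ht₃ : I.TreeOk (s₂.putN aPrm 0 I.f) := by
    refine ⟨?_, ?_, ht₂.ds⟩
    · rw [f₃.ia _ rfl]; exact ht₂.par
    · rw [f₃.ia _ rfl]; exact ht₂.dp
  have hl₃ : I.LcaOk (s₂.putN aPrm 0 I.f) := by
    have e3 : (s₂.putN aPrm 0 I.f).ia aPrm 1 = s₂.ia aPrm 1 := by
      rw [putN_ia_self, Function.update_of_ne (by omega)]
    refine ⟨?_, ?_, ?_, ?_, ?_, ?_, ?_, ?_, ?_⟩ <;>
      simp only [e3, putN_ia_ne, ne_eq, not_false_eq_true, Nat.reduceEqDiff]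
    exacts [hl₂.pre, hl₂.pos_pos, hl₂.pos_le, hl₂.at_pos, hl₂.top_pos, hl₂.top_le, b1, b2, b3]
  refine (runs_cCost hs₃ ht₃ hm2).seq (N₂ := 36800 * (I.n * (I.m + I.f ^ 2))) ?_ (by omega)
  rintro s₄ f₄ hec
  have hs₄ : I.Ready s₄ := by
    refine ⟨hs₃.frame f₄ rfl, ⟨?_, ?_, ?_⟩, hl₃.congr fun a ha ha' => ?_, ?_, hec⟩
    · rw [f₄.ia _ rfl]; exact ht₃.par
    · rw [f₄.ia _ rfl]; exact ht₃.dp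
    · rw [f₄.ra _ rfl]; exact ht₃.ds
    · interval_cases a <;> exact f₄.ia _ rfl
    · rw [f₄.ia _ rfl]; simp
  refine (Runs.forUp (B := B)
    (c := 1100 * I.n + 200 * I.m + 6200 * ((I.f + 1) * (I.f + 1))) (N := I.n) (fun j s' =>
      (∀ u, s'.ia aMark u = 0) ∧ ∀ v < j, ∀ k, 1 ≤ k → k ≤ I.mx v → I.EntOk s' v k)
      hs₄.inp.n (by omega) rfl rfl ⟨?_, fun v hv => by omega⟩ ?_).mono ?_ ?_
  · rw [setN_ia, f₄.ia _ rfl, f₃.ia _ rfl, f₂.ia _ rfl, f₁.ia _ rfl]; exact hmark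
  · rintro j s₅ hj hf₅ hij ⟨i1, i2⟩
    refine (runs_cVertex (hs₄.frame hf₅ rfl rfl) hB hj hij i1).mono le_rfl ?_
    rintro s₆ f₆ ⟨j1, j2, j3⟩
    refine ⟨j1, fun v hv k hk hk' => ?_⟩
    rcases Nat.lt_succ_iff_lt_or_eq.1 hv with hv | rfl
    · refine (i2 v hv k hk hk').congr hk' fun i hi => (j3 _ fun k' i' h1 h2 h3 he => ?_).trans
        (sameEnt_setN _ _ _ _)
      have := ent_inj (I := I) hk (hk'.trans (I.mx_le v)) hi h1 (h2.trans (I.mx_le j)) h3 he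
      omega
    · exact (j2 k hk hk').congr hk' fun i _ => sameEnt_setN _ _ _ _
  · have h1 : (I.f + 1) * (I.f + 1) ≤ 4 * I.f ^ 2 := by nlinarith
    have h2 : 1100 * I.n + 200 * I.m + 6200 * ((I.f + 1) * (I.f + 1)) + 9 ≤
        36000 * (I.m + I.f ^ 2) := by
      have : 1 ≤ I.f ^ 2 := Nat.pos_of_ne_zero (by positivity)
      omega
    have h3 := Nat.mul_le_mul_left I.n h2
    nlinarith
  · rintro s₅ f₅ ⟨-, i2⟩
    have hs₅ := hs₄.frame f₅ rfl rfl
    exact ⟨hs₅.tree, hs₅.lca, hs₅.prm, i2⟩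

end Inst

/-! ### The queries -/

-- The output of the path query, and the position at which the next vertex is stored.
notation "aOut" => (17 : ℕ)
notation "vWp" => (82 : ℕ)

/-- Reads the query. -/
def cLoad : Cmd := setN vQv (var 0) ;; setN vQk (var 1) ;; setN vQt (var 2)

/-- Evaluates the query. -/
def cQuery : Cmd := cLoad ;; cAsk ;; setN 0 (var vFlag)

/-- The distance query. -/
def cDist : Cmd := cQuery ;; setR 0 (.var rD)

/-- Stores the path from `vPt` towards the root, backwards from the position `vWp`. -/
def cDown : Cmd :=
  loop (.lt (var vStop) (var vWp))
    (putN aOut (var vWp) (var vPt) ;; setN vPt (get aPar (var vPt)) ;; setN vWp (var vWp - 1))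

/-- Stores the path from `vPt` towards the root, from the position `vWp` on. -/
def cUp : Cmd :=
  loop (.lt (var vWp) (var vStop))
    (putN aOut (var vWp) (var vPt) ;; setN vPt (get aPar (var vPt)) ;; setN vWp (var vWp + 1))

/-- Finds the entry and the tree path of the last part of a detour. -/
def cLast : Cmd :=
  setN vQx (eEntry (var vQi)) ;; setN vU (get aY (var vQx)) ;; cLca ;;
  setN vPt (var vQt) ;;
  setN vStop (var vWp - (get aDep (var vQt) - get aDep (var vLca)))

/-- Continues from the other end of the edge. -/
def cNext : Cmd :=
  putN aOut (var vWp) (var vPt) ;; setN vQt (get aX (var vQx)) ;;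
  setN vWp (get aH (var vQx) - 1) ;; cComp

/-- The last part of a detour. -/
def cStep : Cmd :=
  cLast ;; cDown ;; setN vPt (get aY (var vQx)) ;; setN vWp (get aH (var vQx)) ;; cUp ;; cNext

/-- A path in the shortest path tree. -/
def cBase : Cmd :=
  setN vPt (var vQt) ;; setN vStop 0 ;; cDown ;; putN aOut 0 (var vPt)

/-- All parts of a detour, from its end on. -/
def cParts : Cmd := loop (.lt (var vQi) (var vQk)) cStep ;; cBase

/-- The path query. -/
def cPath : Cmd :=
  cQuery ;;
  branch (.eq (var vFlag) 0) nop
    ((setN 1 (var vLen) ;; setN vWp (var vLen) ;; cComp) ;; cParts)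

theorem Runs.loop_done {B N : ℕ} {b : Test} {p q : Cmd} {s : State} {Q : State → Prop}
    (hb : ¬ b.Holds s) (h : Runs B q s N Q) : Runs B (loop b p ;; q) s (N + b.cost + 1) Q := by
  obtain ⟨k, s', he, hk, hq⟩ := h
  exact ⟨_, s', (Exec.loopDone hb).seq he, by omega, hq⟩

theorem Runs.loop_step {B N N' : ℕ} {b : Test} {p q : Cmd} {s : State} {R Q : State → Prop}
    (hb : b.Holds s) (h : Runs B p s N R)
    (h' : ∀ s', Frame p s s' → R s' → Runs B (loop b p ;; q) s' N' Q) :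
    Runs B (loop b p ;; q) s (N + N' + b.cost + 1) Q := by
  obtain ⟨k, s₁, he, hk, hr⟩ := h
  obtain ⟨l, s₂, he', hl, hq⟩ := h' s₁ he.frame hr
  cases he' with
  | seq h1 h2 => exact ⟨_, s₂, (Exec.loopStep hb he h1).seq h2, by omega, hq⟩

theorem IsMin.congr {A A' : ℕ → ℕ} {lo hi v : ℕ} (h : IsMin A lo hi v)
    (hA : ∀ q, lo ≤ q → q ≤ hi → A' q = A q) : IsMin A' lo hi v := by
  obtain ⟨h1, q, h2, h3, h4⟩ := h
  exact ⟨fun q hq hq' => by rw [hA q hq hq']; exact h1 q hq hq', q, h2, h3,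
    by rw [hA q h2 h3]; exact h4⟩

theorem Rmq.congr {n b : ℕ} {A mask low log pw mn A' mask' low' log' pw' mn' : ℕ → ℕ}
    (R : Rmq n b A mask low log pw mn) (hA : ∀ q ≤ n, A' q = A q)
    (hmask : ∀ q ≤ n, mask' q = mask q) (hlow : ∀ x < 2 ^ b, low' x = low x)
    (hlog : ∀ x < 2 ^ b, log' x = log x) (hpw : ∀ j < b, pw' j = pw j)
    (hmn : ∀ x ≤ n + b, mn' x = mn x) : Rmq n b A' mask' low' log' pw' mn' where
  b_pos := R.b_pos
  lt_pow := R.lt_pow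
  pw_eq j hj := by rw [hpw j hj, R.pw_eq j hj]
  low_spec x hx hx0 := by rw [hlow x hx]; exact R.low_spec x hx hx0
  log_eq x hx hx1 := by rw [hlog x hx, R.log_eq x hx hx1]
  mask_spec q hq j := by
    rw [hmask q hq, R.mask_spec q hq j]
    refine and_congr_right fun h1 => forall_congr' fun q' => forall_congr' fun h2 =>
      forall_congr' fun h3 => ?_
    rw [hA _ (h1.trans hq), hA q' (h3.trans hq)]
  mn_spec x hx j hj hn := by
    have h1 : x * b ≤ n := (Nat.mul_le_mul_right b hx).trans (Nat.div_mul_le_self n b)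
    rw [hmn _ (by omega)]
    exact (R.mn_spec x hx j hj hn).congr fun q _ hq => hA q (by omega)

namespace Inst

variable {I : Inst}

/-- The number of cells of every array of the oracle. -/
def size (I : Inst) : ℕ := 4 * (I.n * I.f ^ 2)

theorem le_size : 4 * I.n ≤ I.size :=
  Nat.mul_le_mul_left _ (Nat.le_mul_of_pos_right _ (pow_pos I.f_pos 2))

theorem SameEnt.of_sameOracle {s s' : State} (h : SameOracle 17 I.size s s') {v k i : ℕ}
    (hv : v < I.n) (hk : 1 ≤ k) (hkf : k ≤ I.f) (hi : i < k) : SameEnt s s' (I.ent v k i) := by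
  have h2 := ent_lt (I := I) hv hk hkf hi
  have h3 : I.ent v k i < I.size := by
    have : I.n * I.f ^ 2 = I.n * I.f * I.f := by ring
    rw [size, this]
    omega
  exact ⟨(h _ (by omega) _ h3).1.symm, (h _ (by omega) _ h3).1.symm, (h _ (by omega) _ h3).1.symm,
    (h _ (by omega) _ h3).1.symm, (h _ (by omega) _ h3).2.symm⟩

/-- The oracle occupies the cells below `size` of the first 17 arrays only. -/
theorem OracleOk.congr {s s' : State} (H : I.OracleOk s) (h : SameOracle 17 I.size s s') :
    I.OracleOk s' := by
  have hn := I.n_pos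
  have hL := I.le_size
  have ha : ∀ a < 17, ∀ i < I.size, s'.ia a i = s.ia a i := fun a ha i hi => (h a ha i hi).1.symm
  have hr : ∀ a < 17, ∀ i < I.size, s'.ra a i = s.ra a i := fun a ha i hi => (h a ha i hi).2.symm
  have h1 : s'.ia aPrm 1 = s.ia aPrm 1 := ha _ (by omega) _ (by omega)
  have hpos : ∀ v < I.n, s'.ia aPos v = s.ia aPos v := fun v hv => ha _ (by omega) _ (by omega)
  have hbl := H.lca.b_le
  have hpl := H.lca.pow_le
  refine ⟨⟨fun v hv => ?_, fun v hv => ?_, fun v hv => ?_⟩, ⟨?_, fun v hv => ?_, fun v hv => ?_,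
    fun v hv => ?_, fun v hv => ?_, fun q hq => ?_, ?_, ?_, ?_⟩, ?_, fun v hv k hk hk' => ?_⟩
  · rw [ha _ (by omega) _ (by omega), H.tree.par v hv]
  · rw [ha _ (by omega) _ (by omega), H.tree.dp v hv]
  · rw [hr _ (by omega) _ (by omega), H.tree.ds v hv]
  · exact ⟨fun x hx y hy h => H.lca.pre.inj x hx y hy (by rwa [hpos x hx, hpos y hy] at h),
      fun x hx y hy h => by rw [hpos x hx, hpos y hy]; exact H.lca.pre.le_of_anc x hx y hy h,
      fun x hx y hy z hz => by
        rw [hpos x hx, hpos y hy, hpos z hz]; exact H.lca.pre.anc_of_le x hx y hy z hz⟩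
  · rw [hpos v hv]; exact H.lca.pos_pos v hv
  · rw [hpos v hv]; exact H.lca.pos_le v hv
  · have := H.lca.pos_le v hv
    rw [hpos v hv, ha _ (by omega) _ (by omega)]; exact H.lca.at_pos v hv
  · have := H.lca.pos_le v hv
    rw [hpos v hv, hpos _ (I.par_lt v), ha _ (by omega) _ (by omega)]; exact H.lca.top_pos v hv
  · rw [ha _ (by omega) _ (by omega)]; exact H.lca.top_le q hq
  · rw [h1]; exact hbl
  · rw [h1]; exact hpl
  · rw [h1]
    exact H.lca.rmq.congr (fun q hq => ha _ (by omega) _ (by omega))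
      (fun q hq => ha _ (by omega) _ (by omega)) (fun q hq => ha _ (by omega) _ (by omega))
      (fun q hq => ha _ (by omega) _ (by omega)) (fun q hq => ha _ (by omega) _ (by omega))
      (fun q hq => ha _ (by omega) _ (by omega))
  · rw [ha _ (by omega) _ (by omega)]; exact H.prm
  · exact (H.ent v hv k hk hk').congr hk' fun i hi =>
      .of_sameOracle h hv hk (hk'.trans (I.mx_le v)) hi

theorem OracleOk.of_eq {s s' : State} (H : I.OracleOk s) (ha : ∀ a < 17, s'.ia a = s.ia a)
    (hr : s'.ra = s.ra) : I.OracleOk s' :=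
  H.congr fun a h i _ => ⟨by rw [ha a h], by rw [hr]⟩

/-- The vertices on the way up from `t` are written backwards, from the position `P` on. -/
theorem runs_cDown {B P b t : ℕ} {s : State} (hpar : ∀ v < I.n, s.ia aPar v = I.par v)
    (ht : t < I.n) (hB : I.n ≤ B) (hPB : P ≤ B) (hb : b ≤ P) (hs : s.iv vStop = P - b)
    (hp : s.iv vWp = P) (hx : s.iv vPt = t) :
    Runs B cDown s (30 * b + 30) (fun s' => s'.iv vPt = I.par^[b] t ∧
      (∀ j < b, s'.ia aOut (P - j) = I.par^[j] t) ∧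
      ∀ q, q + b ≤ P ∨ P < q → s'.ia aOut q = s.ia aOut q) := by
  refine (Runs.while (B := B) (c := 20) (I := fun s' => ∃ j ≤ b, s'.iv vWp = P - j ∧
      s'.iv vPt = I.par^[j] t ∧ (∀ i < j, s'.ia aOut (P - i) = I.par^[i] t) ∧
      ∀ q, q + b ≤ P ∨ P < q → s'.ia aOut q = s.ia aOut q) (fun s' => s'.iv vWp - (P - b))
      ⟨0, by omega, by omega, hx, fun i hi => by omega, fun q _ => rfl⟩ ?_).mono ?_ ?_
  · rintro s₁ f₁ ⟨j, i1, i2, i3, i4, i5⟩ hb'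
    have e1 : s₁.iv vStop = P - b := (f₁.iv _ rfl).trans hs
    have e2 : s₁.ia aPar = s.ia aPar := f₁.ia _ rfl
    simp only [holds_lt, eval_var, e1, i2] at hb'
    have hlt : I.par^[j] t < I.n := lt_of_anc ht (anc_iterate _ _ _)
    have hlt' := I.par_lt (I.par^[j] t)
    refine Fn.runs ?_ rfl (by decide)
    simp only [fn_seq, fn_setN, fn_putN, eval_var, eval_get, eval_sub, eval_ofNat, setN_ia, putN_iv,
      putN_ia_self, putN_ia_ne, setN_iv_self, setN_iv_ne, ne_eq, not_false_eq_true,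
      Nat.reduceEqDiff, i2, i3, e2, hpar _ hlt]
    refine ⟨by omega, by omega, by omega, by omega, ⟨j + 1, by omega, by omega, ?_, ?_, ?_⟩,
      by omega⟩
    · rw [Function.iterate_succ_apply']
    · intro i hi
      rw [Function.update_apply]
      split_ifs with hij
      · rw [show i = j by omega]
      · exact i4 i (by omega)
    · intro q hq
      rw [Function.update_of_ne (by omega)]
      exact i5 q hq
  · have h3 : (Test.lt (var vStop) (var vWp)).cost = 4 := rfl
    rw [h3, hp]
    have : P - (P - b) = b := by omega
    rw [this]
    omega
  · rintro s₁ f₁ ⟨⟨j, i1, i2, i3, i4, i5⟩, hb'⟩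
    have e1 : s₁.iv vStop = P - b := (f₁.iv _ rfl).trans hs
    simp only [holds_lt, eval_var, e1, i2, not_lt] at hb'
    obtain rfl : j = b := by omega
    exact ⟨i3, i4, i5⟩

/-- The vertices on the way up from `t` are written forwards, from the position `P` on. -/
theorem runs_cUp {B P b t : ℕ} {s : State} (hpar : ∀ v < I.n, s.ia aPar v = I.par v)
    (ht : t < I.n) (hB : I.n ≤ B) (hPB : P + b ≤ B) (hs : s.iv vStop = P + b)
    (hp : s.iv vWp = P) (hx : s.iv vPt = t) :
    Runs B cUp s (30 * b + 30) (fun s' => s'.iv vPt = I.par^[b] t ∧ s'.iv vWp = P + b ∧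
      (∀ j < b, s'.ia aOut (P + j) = I.par^[j] t) ∧
      ∀ q, q < P ∨ P + b ≤ q → s'.ia aOut q = s.ia aOut q) := by
  refine (Runs.while (B := B) (c := 20) (I := fun s' => ∃ j ≤ b, s'.iv vWp = P + j ∧
      s'.iv vPt = I.par^[j] t ∧ (∀ i < j, s'.ia aOut (P + i) = I.par^[i] t) ∧
      ∀ q, q < P ∨ P + b ≤ q → s'.ia aOut q = s.ia aOut q) (fun s' => P + b - s'.iv vWp)
      ⟨0, by omega, by omega, hx, fun i hi => by omega, fun q _ => rfl⟩ ?_).mono ?_ ?_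
  · rintro s₁ f₁ ⟨j, i1, i2, i3, i4, i5⟩ hb'
    have e1 : s₁.iv vStop = P + b := (f₁.iv _ rfl).trans hs
    have e2 : s₁.ia aPar = s.ia aPar := f₁.ia _ rfl
    simp only [holds_lt, eval_var, e1, i2] at hb'
    have hlt : I.par^[j] t < I.n := lt_of_anc ht (anc_iterate _ _ _)
    have hlt' := I.par_lt (I.par^[j] t)
    refine Fn.runs ?_ rfl (by decide)
    simp only [fn_seq, fn_setN, fn_putN, eval_var, eval_get, eval_add, eval_ofNat, setN_ia, putN_iv,
      putN_ia_self, putN_ia_ne, setN_iv_self, setN_iv_ne, ne_eq, not_false_eq_true,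
      Nat.reduceEqDiff, i2, i3, e2, hpar _ hlt]
    refine ⟨by omega, by omega, by omega, by omega, ⟨j + 1, by omega, by omega, ?_, ?_, ?_⟩,
      by omega⟩
    · rw [Function.iterate_succ_apply']
    · intro i hi
      rw [Function.update_apply]
      split_ifs with hij
      · rw [show i = j by omega]
      · exact i4 i (by omega)
    · intro q hq
      rw [Function.update_of_ne (by omega)]
      exact i5 q hq
  · have h3 : (Test.lt (var vWp) (var vStop)).cost = 4 := rfl
    rw [h3, hp]
    have : P + b - P = b := by omega
    rw [this]
    omega
  · rintro s₁ f₁ ⟨⟨j, i1, i2, i3, i4, i5⟩, hb'⟩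
    have e1 : s₁.iv vStop = P + b := (f₁.iv _ rfl).trans hs
    simp only [holds_lt, eval_var, e1, i2, not_lt] at hb'
    obtain rfl : j = b := by omega
    exact ⟨i3, i2, i4, i5⟩

theorem runs_cBase {B t : ℕ} {g : ℕ → ℕ} {s : State} (H : I.OracleOk s) (hB : I.n ≤ B)
    (ht : t < I.n) (hst : s.iv vQt = t) (hp : s.iv vWp = I.dp t) (hg : I.IsTreeSeq g 0 I.r t) :
    Runs B cBase s (30 * I.dp t + 60) (fun s' => (∀ j ≤ I.dp t, s'.ia aOut j = g j) ∧
      ∀ q, I.dp t < q → s'.ia aOut q = s.ia aOut q) := by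
  have hd : I.dp t < I.n := I.tree.dep_lt ht I.par_lt
  have h0 : Runs B (setN vPt (var vQt)) s 5 (fun s' => s' = s.setN vPt t) :=
    Fn.runs (by rw [fn_setN]; simp [hst]; omega) rfl (by decide)
  refine h0.seq (N₂ := 30 * I.dp t + 55) ?_ (by omega)
  rintro s₁ f₁ rfl
  have h1 : Runs B (setN vStop 0) (s.setN vPt t) 5 (fun s' => s' = (s.setN vPt t).setN vStop 0) :=
    Fn.runs (by rw [fn_setN]; simp) rfl (by decide)
  refine h1.seq (N₂ := 30 * I.dp t + 50) ?_ (by omega)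
  rintro s₂ f₂ rfl
  refine (runs_cDown (s := (s.setN vPt t).setN vStop 0) (B := B) (P := I.dp t) (b := I.dp t) (t := t)
    H.tree.par ht hB (by omega) le_rfl (by simp) (by simpa using hp) (by simp)).seq (N₂ := 10) ?_ (by omega)
  rintro s₃ f₃ ⟨i1, i2, i3⟩
  refine Fn.runs ?_ rfl (by decide)
  have hlt : I.par^[I.dp t] t < I.n := lt_of_anc ht (anc_iterate _ _ _)
  simp only [fn_putN, eval_var, eval_ofNat, i1, putN_ia_self]
  have hg2 := hg.2
  rw [hops_root, lc_root, show I.dp I.r = 0 from IsTree.dep_root] at hg2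
  refine ⟨by omega, by omega, fun j hj => ?_, fun q hq => ?_⟩
  · rw [Function.update_apply]
    split_ifs with hj0
    · rw [hj0, ← hg2 (I.dp t) (by omega)]
      congr 1; omega
    · have h2 := i2 (I.dp t - j) (by omega)
      rw [← hg2 (I.dp t - j) (by omega)] at h2
      rw [show I.dp t - (I.dp t - j) = j by omega] at h2
      rw [h2]
      congr 1; omega
  · rw [Function.update_of_ne (by omega), i3 q (Or.inr hq)]
    rfl

/-- One component is left through the edge by which the detour enters it: the tree path from the end `y`
of this edge to `t` is written, and `t` is replaced by the other end of the edge. -/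
theorem runs_cStep {B v k t P : ℕ} {g : ℕ → ℕ} {s : State} (H : I.OracleOk s) (hB : I.n + 1 ≤ B)
    (hB' : I.n * I.f * I.f ≤ B) (hvn : v < I.n) (hk1 : 1 ≤ k) (hkf : k ≤ I.f) (ht : t < I.n)
    (hv : s.iv vQv = v) (hk : s.iv vQk = k) (hst : s.iv vQt = t) (hi : s.iv vQi = I.ix v t)
    (hV : s.iv vV = t) (hp : s.iv vWp = P) (hPB : P ≤ B) (hik : I.ix v t < k)
    (hX : I.cellX s v k (I.ix v t) < I.n) (hY : I.cellY s v k (I.ix v t) < I.n)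
    (hP : P = I.cellH s v k (I.ix v t) + I.hops (I.cellY s v k (I.ix v t)) t)
    (hg : I.IsTreeSeq g (I.cellH s v k (I.ix v t)) (I.cellY s v k (I.ix v t)) t) :
    Runs B cStep s (30 * I.hops (I.cellY s v k (I.ix v t)) t + 1500) (fun s' =>
      s'.iv vQt = I.cellX s v k (I.ix v t) ∧ s'.iv vV = I.cellX s v k (I.ix v t) ∧
      s'.iv vWp = I.cellH s v k (I.ix v t) - 1 ∧
      s'.iv vQi = I.ix v (I.cellX s v k (I.ix v t)) ∧
      (∀ j, I.cellH s v k (I.ix v t) ≤ j → j ≤ P → s'.ia aOut j = g j) ∧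
      ∀ q, P < q → s'.ia aOut q = s.ia aOut q) := by
  set x := I.cellX s v k (I.ix v t) with hx
  set y := I.cellY s v k (I.ix v t) with hy
  set o := I.cellH s v k (I.ix v t) with ho
  have hent := ent_lt hvn hk1 hkf hik
  have hent' : (v * I.f + (k - 1)) * I.f + I.ix v t = I.ent v k (I.ix v t) := rfl
  have hl : I.lc y t < I.n := lc_lt hY
  have hh : I.hops y t = (I.dp y - I.dp (I.lc y t)) + (I.dp t - I.dp (I.lc y t)) := rfl
  set a := I.dp y - I.dp (I.lc y t) with ha
  set b := I.dp t - I.dp (I.lc y t) with hb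
  have hyl : I.par^[a] y = I.lc y t := I.tree.iterate_of_anc (IsTree.lca_anc_left y t)
  have h1 : Runs B cLast s 500 (fun s' => s'.iv vQx = I.ent v k (I.ix v t) ∧ s'.iv vPt = t ∧
      s'.iv vStop = o + a) := by
    refine Fn.runs ?_ rfl (by decide)
    simp only [cLast, fn_seq, fn_setN, eEntry, eval_get, eval_var, eval_add, eval_mul, eval_sub,
      eval_ofNat, setN_ia, setN_iv_self, setN_iv_ne, ne_eq, not_false_eq_true, Nat.reduceEqDiff,
      hv, hk, hi, H.prm, hent']
    refine ⟨by omega, hY.le.trans (by omega), ?_⟩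
    have hL' : I.LcaOk ((s.setN vQx (I.ent v k (I.ix v t))).setN vU
        (s.ia aY (I.ent v k (I.ix v t)))) := H.lca.congr fun _ _ _ => rfl
    refine (fn_cLca hL' hB (by simpa using hY) (by simpa [hV] using ht)).mono fun s₂ f₂ h₂ => ?_
    have e1 : s₂.iv vLca = I.lc y t := by
      simpa [hV] using h₂
    have e2 : s₂.iv vQt = t := by rw [f₂.iv _ rfl]; simpa using hst
    have e3 : s₂.iv vWp = P := by rw [f₂.iv _ rfl]; simpa using hp
    have e4 : s₂.iv vQx = I.ent v k (I.ix v t) := by rw [f₂.iv _ rfl]; simp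
    have e5 : s₂.ia = s.ia := funext fun a => f₂.ia a rfl
    simp only [setN_ia, setN_iv_self, setN_iv_ne, ne_eq, not_false_eq_true, Nat.reduceEqDiff, e1,
      e2, e3, e4, e5, H.tree.dp t ht, H.tree.dp _ hl]
    refine ⟨by omega, by omega, trivial, trivial, by omega⟩
  refine h1.seq (N₂ := 30 * (a + b) + 1000) ?_ (by omega)
  rintro s₁ f₁ ⟨a1, a2, a3⟩
  have E1 : s₁.ia = s.ia := funext fun a => f₁.ia a rfl
  refine (runs_cDown (I := I) (B := B) (P := P) (b := b) (t := t) (by rw [E1]; exact H.tree.par) ht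
    (by omega) hPB (by omega) (by omega) ((f₁.iv _ rfl).trans hp) a2).seq
    (N₂ := 30 * a + 970) ?_ (by omega)
  rintro s₂ f₂ ⟨-, b2, b3⟩
  have E2 : ∀ c, c ≠ aOut → s₂.ia c = s.ia c := fun c hc => by
    rw [f₂.ia c (by simpa [cDown, Cmd.wa] using hc), E1]
  have c1 : s₂.iv vQx = I.ent v k (I.ix v t) := (f₂.iv _ rfl).trans a1
  have h3 : Runs B (setN vPt (get aY (var vQx))) s₂ 5 (fun s' => s' = s₂.setN vPt y) :=
    Fn.runs (by
      rw [fn_setN, eval_get, eval_var, c1, E2 aY (by omega)]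
      exact ⟨hY.le.trans (by omega), rfl⟩) rfl (by decide)
  refine h3.seq (N₂ := 30 * a + 960) ?_ (by omega)
  rintro s₃ f₃ rfl
  have h4 : Runs B (setN vWp (get aH (var vQx))) (s₂.setN vPt y) 5
      (fun s' => s' = (s₂.setN vPt y).setN vWp o) :=
    Fn.runs (by
      rw [fn_setN, eval_get, eval_var, setN_ia, setN_iv_ne _ _ _ _ (by omega), c1, E2 aH (by omega)]
      exact ⟨(by omega : o ≤ B), rfl⟩) rfl (by decide)
  refine h4.seq (N₂ := 30 * a + 950) ?_ (by omega)
  rintro s₄ f₄ rfl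
  refine (runs_cUp (I := I) (B := B) (P := o) (b := a) (t := y)
    (by simp only [setN_ia]; rw [E2 aPar (by omega)]; exact H.tree.par) hY (by omega) (by omega)
    (by simpa [f₂.iv vStop rfl] using a3) (by simp) (by simp)).seq (N₂ := 900) ?_ (by omega)
  rintro s₅ f₅ ⟨d1, d2, d3, d4⟩
  rw [setN_ia, setN_ia] at d4
  have E5 : ∀ c, c ≠ aOut → s₅.ia c = s.ia c := fun c hc => by
    rw [f₅.ia c (by simpa [cUp, Cmd.wa] using hc), setN_ia, setN_ia, E2 c hc]
  have E5r : s₅.ra = s.ra := by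
    funext c
    rw [f₅.ra c rfl, setN_ra, setN_ra, f₂.ra c rfl, f₁.ra c rfl]
  have g1 : s₅.iv vQx = I.ent v k (I.ix v t) := by rw [f₅.iv _ rfl]; simpa using c1
  have g2 : s₅.iv vQv = v := by
    rw [f₅.iv _ rfl, setN_iv_ne _ _ _ _ (by omega), setN_iv_ne _ _ _ _ (by omega), f₂.iv _ rfl,
      f₁.iv _ rfl, hv]
  refine Fn.runs ?_ rfl (by decide)
  simp only [cNext, fn_seq, fn_putN, fn_setN, eval_var, eval_get, eval_sub, eval_ofNat, putN_iv,
    putN_ia_ne, setN_ia, setN_iv_self, setN_iv_ne, ne_eq, not_false_eq_true, Nat.reduceEqDiff, d1,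
    d2, g1, E5 aX (by omega), E5 aH (by omega), hyl]
  have hxe : s.ia aX (I.ent v k (I.ix v t)) = x := rfl
  have hoe : s.ia aH (I.ent v k (I.ix v t)) = o := rfl
  rw [hxe, hoe]
  refine ⟨by omega, by omega, by omega, by omega, ?_⟩
  set s₆ := ((s₅.putN aOut (o + a) (I.lc y t)).setN vQt x).setN vWp (o - 1) with hs₆
  have H₆ : I.OracleOk s₆ := by
    refine H.of_eq (fun c hc => ?_) E5r
    rw [hs₆, setN_ia, setN_ia, putN_ia_ne _ _ _ _ _ (by omega), E5 c (by omega)]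
  have k1 : s₆.iv vQv = v := by simpa [hs₆] using g2
  have k2 : s₆.iv vQt = x := by simp [hs₆]
  refine (fn_cComp H₆.tree H₆.lca hB (by rw [k1]; exact hvn) (by rw [k2]; exact hX)).mono
    fun s₇ f₇ ⟨h₇, h₇'⟩ => ?_
  rw [k1, k2] at h₇
  rw [k2] at h₇'
  have m1 : s₇.ia aOut = Function.update (s₅.ia aOut) (o + a) (I.lc y t) := by
    rw [f₇.ia _ rfl, hs₆]
    simp
  refine ⟨by rw [f₇.iv _ rfl, k2], h₇', by rw [f₇.iv _ rfl]; simp [hs₆], h₇, fun j hj hj' => ?_,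
    fun q hq => ?_⟩
  · rw [m1, Function.update_apply]
    split_ifs with hja
    · rw [hja, hg.1 a le_rfl, hyl]
    · rcases lt_or_ge j (o + a) with h5 | h5
      · have h6 := d3 (j - o) (by omega)
        rw [show o + (j - o) = j by omega] at h6
        rw [h6, ← hg.1 (j - o) (by omega)]
        congr 1; omega
      · have h6 := b2 (P - j) (by omega)
        rw [show P - (P - j) = j by omega] at h6
        rw [d4 j (by omega), h6, ← hg.2 (P - j) (by omega)]
        congr 1; omega
  · rw [m1, Function.update_of_ne (by omega), d4 q (by omega), b3 q (by omega), E1]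

/-- The number of steps is linear in the number of edges of the detour, since every component on the way
is entered by an edge of the detour. -/
theorem runs_cParts {B v k : ℕ} {g X Y H : ℕ → ℕ} {D : ℕ → ℝ} {t ℓ : ℕ} {d : ℝ}
    (hR : I.Route v k X Y H D g t ℓ d) (hB : I.n + 1 ≤ B)
    (hB' : I.n * I.f * I.f ≤ B) (hvn : v < I.n) (hk1 : 1 ≤ k) (hkf : k ≤ I.f) :
    ∀ s : State, I.OracleOk s → t < I.n → ℓ ≤ B → s.iv vQv = v → s.iv vQk = k → s.iv vQt = t →
      s.iv vQi = I.ix v t → s.iv vV = t → s.iv vWp = ℓ →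
      (∀ i < k, I.cellX s v k i = X i ∧ I.cellY s v k i = Y i ∧ I.cellH s v k i = H i) →
      Runs B cParts s (1600 * ℓ + 100) (fun s' => (∀ j ≤ ℓ, s'.ia aOut j = g j) ∧
        ∀ q, ℓ < q → s'.ia aOut q = s.ia aOut q) := by
  induction hR with
  | base t ht hg =>
    intro s hs htn hℓ hv hk hst hi hV hp hcell
    refine (Runs.loop_done (by simp [hi, hk, ht]) (runs_cBase hs (by omega) htn hst hp hg)).mono
      ?_ fun _ _ h => h
    have h3 : (Test.lt (var vQi) (var vQk)).cost = 4 := rfl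
    rw [h3]
    omega
  | step t ℓ d ht hr hH hX hY hg ih =>
    intro s hs htn hℓ hv hk hst hi hV hp hcell
    obtain ⟨c1, c2, c3⟩ := hcell _ ht
    rw [← c1] at hX
    rw [← c2] at hY hg
    rw [← c3] at hH
    rw [← hH] at hg
    refine (Runs.loop_step (by simp [hi, hk, ht]) (runs_cStep hs hB hB' hvn hk1 hkf htn hv hk hst hi
      hV hp hℓ ht hX hY (by rw [hH, c2]) hg) (N' := 1600 * ℓ + 100)
      (Q := fun s' => (∀ j ≤ ℓ + 1 + I.hops (Y (I.ix v t)) t, s'.ia aOut j = g j) ∧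
        ∀ q, ℓ + 1 + I.hops (Y (I.ix v t)) t < q → s'.ia aOut q = s.ia aOut q) ?_).mono
      ?_ fun _ _ h => h
    · rintro s₁ f₁ ⟨d1, d2, d3, d4, d5, d6⟩
      have E1 : ∀ a < 17, s₁.ia a = s.ia a := fun a ha => by
        interval_cases a <;> exact f₁.ia _ rfl
      refine (ih s₁ (hs.of_eq E1 (funext fun c => f₁.ra c rfl)) (c1 ▸ hX) (by omega)
        ((f₁.iv _ rfl).trans hv) ((f₁.iv _ rfl).trans hk) (d1.trans c1) (c1 ▸ d4) (d2.trans c1)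
        (by omega) fun i hik => ?_).mono le_rfl ?_
      · simp only [cellX, cellY, cellH, E1 aX (by omega), E1 aY (by omega), E1 aH (by omega)]
        exact hcell i hik
      · rintro s₂ f₂ ⟨i1, i2⟩
        refine ⟨fun j hj => ?_, fun q hq => ?_⟩
        · rcases le_or_gt j ℓ with h | h
          · exact i1 j h
          · rw [i2 j h]
            exact d5 j (by omega) hj
        · rw [i2 q (by omega)]
          exact d6 q hq
    · have h3 : (Test.lt (var vQi) (var vQk)).cost = 4 := rfl
      rw [h3, c2]
      omega

theorem fn_cQuery {B v k t : ℕ} {s : State} (hs : I.OracleOk s) (hB : I.Fits B) (hv : v < I.n)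
    (hk : 1 ≤ k) (hkx : k ≤ I.mx v) (ht : t < I.n) (h0 : s.iv 0 = v) (h1 : s.iv 1 = k)
    (h2 : s.iv 2 = t) :
    Fn B cQuery s (fun s' => s'.iv vQv = v ∧ s'.iv vQk = k ∧ s'.iv vQt = t ∧
      s'.iv vFlag = I.askFl v k (I.cellFl s v k) t ∧ s'.iv 0 = I.askFl v k (I.cellFl s v k) t ∧
      (I.askFl v k (I.cellFl s v k) t ≠ 0 →
        s'.iv vLen = I.askLen v k (I.cellY s v k) (I.cellH s v k) t ∧
        s'.rv rD = I.askD v k (I.cellY s v k) (I.cellD s v k) t)) := by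
  have hkf := hkx.trans (I.mx_le v)
  have hn := hB.n_le
  have hff := hB.ff_le
  have hfn := hB.fn_le
  have hf := hB.f_le
  obtain ⟨seq, p, pe, -, hE⟩ := hs.ent v hv k hk hkx
  rw [cQuery, fn_seq]
  have hload : Fn B cLoad s (fun s' => s'.iv vQv = v ∧ s'.iv vQk = k ∧ s'.iv vQt = t) := by
    simp only [cLoad, fn_seq, fn_setN, eval_var, setN_iv_self, setN_iv_ne, ne_eq, not_false_eq_true,
      Nat.reduceEqDiff, h0, h1, h2]
    exact ⟨by omega, by omega, by omega, trivial, trivial, trivial⟩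
  refine hload.mono fun s₁ f₁ ⟨a1, a2, a3⟩ => ?_
  have e1 : s₁.ia = s.ia := funext fun a => f₁.ia a rfl
  have e2 : s₁.ra = s.ra := funext fun a => f₁.ra a rfl
  have H₁ : I.OracleOk s₁ := hs.of_eq (fun a _ => by rw [e1]) e2
  rw [fn_seq]
  refine (fn_cAsk H₁.tree H₁.lca H₁.prm (by omega) hB.nff_le hv hk hkf ht a1 a2 a3
    fun h => ?_).mono fun s₂ f₂ ⟨_, _, b1, b2⟩ => ?_
  · rw [e1]
    obtain ⟨c1, c2⟩ := (hE _ h).2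
    refine ⟨c1, fun h => ⟨(c2 h).1, ?_⟩⟩
    have h3 := (c2 h).2
    have h4 : (I.f + 2) * (2 * I.n + 1) = (I.f + 1) * (2 * I.n + 1) + (2 * I.n + 1) := by ring
    simp only [cellH] at h3
    omega
  · rw [e1, e2] at b2
    rw [e1] at b1
    have h5 : I.askFl v k (I.cellFl s v k) t ≤ 1 := by
      rw [askFl]
      split_ifs with h6
      · exact le_rfl
      · exact ((hE _ (not_le.1 h6)).2).1
    rw [fn_setN, eval_var, b1]
    have h6 : 1 ≤ B := by omega
    exact ⟨le_trans h5 h6, (f₂.iv _ rfl).trans a1, (f₂.iv _ rfl).trans a2, (f₂.iv _ rfl).trans a3,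
      b1, rfl, b2⟩

theorem runs_cDist {B v k t : ℕ} {s : State} (hs : I.OracleOk s) (hB : I.Fits B) (hv : v < I.n)
    (hk : 1 ≤ k) (hkx : k ≤ I.mx v) (ht : t < I.n) (h0 : s.iv 0 = v) (h1 : s.iv 1 = k)
    (h2 : s.iv 2 = t) :
    Runs B cDist s 2000 (fun s' => s'.iv 0 = I.askFl v k (I.cellFl s v k) t ∧
      (I.askFl v k (I.cellFl s v k) t ≠ 0 →
        s'.rv 0 = I.askD v k (I.cellY s v k) (I.cellD s v k) t)) := by
  refine Fn.runs ?_ rfl (by decide)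
  rw [cDist, fn_seq]
  refine (fn_cQuery hs hB hv hk hkx ht h0 h1 h2).mono fun s₁ f₁ ⟨_, _, _, _, a1, a2⟩ => ?_
  rw [fn_setR, setR_iv, setR_rv_self, reval_var]
  exact ⟨a1, fun h => (a2 h).2⟩

/-- The path query writes the vertices of the detour to the output array. -/
theorem runs_cPath {B v k t : ℕ} {s : State} (hs : I.OracleOk s) (hB : I.Fits B) (hv : v < I.n)
    (hk : 1 ≤ k) (hkx : k ≤ I.mx v) (ht : t < I.n) (h0 : s.iv 0 = v) (h1 : s.iv 1 = k)
    (h2 : s.iv 2 = t) {g X Y H : ℕ → ℕ} {D : ℕ → ℝ} {ℓ : ℕ} {d : ℝ}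
    (hcell : ∀ i < k, I.cellX s v k i = X i ∧ I.cellY s v k i = Y i ∧ I.cellH s v k i = H i)
    (hR : I.askFl v k (I.cellFl s v k) t ≠ 0 → I.Route v k X Y H D g t ℓ d ∧
      ℓ = I.askLen v k (I.cellY s v k) (I.cellH s v k) t ∧ ℓ ≤ I.n) :
    Runs B cPath s (if I.askFl v k (I.cellFl s v k) t = 0 then 4000 else 4000 * (ℓ + 1))
      (fun s' => s'.iv 0 = I.askFl v k (I.cellFl s v k) t ∧
        (I.askFl v k (I.cellFl s v k) t ≠ 0 → s'.iv 1 = ℓ ∧ ∀ j ≤ ℓ, s'.ia aOut j = g j)) := by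
  have hkf := hkx.trans (I.mx_le v)
  have hn := hB.n_le
  have hq : Runs B cQuery s 2000 _ :=
    (fn_cQuery hs hB hv hk hkx ht h0 h1 h2).runs rfl (by decide)
  split_ifs with hz
  · refine hq.seq (N₂ := 2000) ?_ (by omega)
    rintro s₁ f₁ ⟨a1, a2, a3, a4, a5, a6⟩
    refine Runs.branch (N := 1)
      (fun _ => Fn.runs (by rw [fn_nop]; exact ⟨a5, fun h => absurd hz h⟩) rfl (by decide))
      (fun h => absurd (by simp [a4, hz]) h) (by decide)
  · obtain ⟨b2, b1, b3⟩ := hR hz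
    refine hq.seq (N₂ := 1600 * ℓ + 2000) ?_ (by omega)
    rintro s₁ f₁ ⟨a1, a2, a3, a4, a5, a6⟩
    have e1 : s₁.ia = s.ia := funext fun a => f₁.ia a rfl
    have e2 : s₁.ra = s.ra := funext fun a => f₁.ra a rfl
    have H₁ : I.OracleOk s₁ := hs.of_eq (fun a _ => by rw [e1]) e2
    have hlen := (a6 hz).1
    rw [← b1] at hlen
    have hcomp : Runs B (setN 1 (var vLen) ;; setN vWp (var vLen) ;; cComp) s₁ 600 (fun s' =>
        s'.iv vQi = I.ix v t ∧ s'.iv vV = t ∧ s'.iv 1 = ℓ ∧ s'.iv vWp = ℓ) := by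
      refine Fn.runs ?_ rfl (by decide)
      simp only [fn_seq, fn_setN, eval_var, setN_iv_ne, ne_eq, not_false_eq_true, Nat.reduceEqDiff,
        hlen]
      refine ⟨by omega, by omega, ?_⟩
      have H₂ : I.OracleOk ((s₁.setN 1 ℓ).setN vWp ℓ) := H₁.of_eq (fun _ _ => rfl) rfl
      refine (fn_cComp H₂.tree H₂.lca (by omega) (by simpa [a1] using hv)
        (by simpa [a3] using ht)).mono fun s₂ f₂ ⟨c1, c2⟩ => ?_
      refine ⟨by simpa [a1, a3] using c1, by simpa [a3] using c2, ?_, ?_⟩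
      · rw [f₂.iv _ rfl]; simp
      · rw [f₂.iv _ rfl]; simp
    refine Runs.branch (N := 1600 * ℓ + 1000) (fun h => absurd (by simpa [a4] using h) hz)
      (fun _ => hcomp.seq (N₂ := 1600 * ℓ + 100) ?_ (by omega))
      (by have : (Test.eq (var vFlag) 0).cost ≤ 100 := by decide
          omega)
    rintro s₂ f₂ ⟨c1, c2, c3, c4⟩
    have e3 : s₂.ia = s.ia := by rw [← e1]; exact funext fun a => f₂.ia a rfl
    have e4 : s₂.ra = s.ra := by rw [← e2]; exact funext fun a => f₂.ra a rfl
    refine (runs_cParts b2 (by omega) hB.nff_le hv hk hkf s₂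
      (hs.of_eq (fun a _ => by rw [e3]) e4) ht (by omega) ((f₂.iv _ rfl).trans a1)
      ((f₂.iv _ rfl).trans a2) ((f₂.iv _ rfl).trans a3) c1 c2 c4
      fun i hi => by simp only [cellX, cellY, cellH, e3]; exact hcell i hi).mono
      le_rfl fun s₃ f₃ ⟨d1, _⟩ => ?_
    exact ⟨by rw [f₃.iv _ rfl, f₂.iv _ rfl, a5], fun _ => ⟨by rw [f₃.iv _ rfl, c3], d1⟩⟩

end Inst

/-! ### Walks and distances -/

section Walks

variable {n : ℕ} {G : SimpleGraph (Fin n)} {w : Sym2 (Fin n) → ℝ≥0}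

@[simp] theorem wlen_nil {x : Fin n} : wlen w (SimpleGraph.Walk.nil : G.Walk x x) = 0 := rfl

@[simp] theorem wlen_cons {x y z : Fin n} (h : G.Adj x y) (p : G.Walk y z) :
    wlen w (.cons h p) = w s(x, y) + wlen w p := by
  simp [wlen]

theorem wlen_concat {x y z : Fin n} (p : G.Walk x y) (h : G.Adj y z) :
    wlen w (p.concat h) = wlen w p + w s(y, z) := by
  induction p with
  | nil => simp [SimpleGraph.Walk.concat]
  | cons h' p ih => rw [SimpleGraph.Walk.concat_cons, wlen_cons, ih, wlen_cons, add_assoc]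

theorem wlen_mapLe {G' : SimpleGraph (Fin n)} (h : G ≤ G') {x y : Fin n} (p : G.Walk x y) :
    wlen w (p.mapLe h) = wlen w p := by
  simp [wlen]

theorem wdist_le {x y : Fin n} (p : G.Walk x y) : wdist G w x y ≤ wlen w p := iInf_le _ p

theorem exists_walk_of_wdist_ne_top {x y : Fin n} (h : wdist G w x y ≠ ⊤) : Nonempty (G.Walk x y) := by
  by_contra hn
  rw [not_nonempty_iff] at hn
  exact h (by rw [wdist, iInf_of_empty])

/-- A potential that increases along every edge by at most the weight of the edge increases along
every walk by at most its length. -/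
theorem le_add_wlen {φ : Fin n → ℝ} (hφ : ∀ x y, G.Adj x y → φ y ≤ φ x + w s(x, y)) {x y : Fin n}
    (p : G.Walk x y) : φ y ≤ φ x + wlen w p := by
  induction p with
  | nil => simp
  | cons h p ih =>
    have := hφ _ _ h
    rw [wlen_cons]
    push_cast
    linarith

/-- A sequence of successively adjacent vertices is a walk. -/
theorem exists_walk_of_adj (g : ℕ → Fin n) (ℓ : ℕ) (hg : ∀ j < ℓ, G.Adj (g j) (g (j + 1))) :
    ∃ p : G.Walk (g 0) (g ℓ), p.length = ℓ ∧ (∀ i ≤ ℓ, p.getVert i = g i) ∧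
      wlen w p = ∑ j ∈ Finset.range ℓ, w s(g j, g (j + 1)) := by
  induction ℓ generalizing g with
  | zero =>
    refine ⟨.nil, rfl, fun i hi => ?_, by simp⟩
    rw [Nat.le_zero.1 hi]
    rfl
  | succ ℓ ih =>
    obtain ⟨p, h1, h2, h3⟩ := ih (fun j => g (j + 1)) fun j hj => hg (j + 1) (by omega)
    refine ⟨.cons (hg 0 (by omega)) p, by rw [SimpleGraph.Walk.length_cons, h1], fun i hi => ?_, ?_⟩
    · cases i with
      | zero => rfl
      | succ i => rw [SimpleGraph.Walk.getVert_cons_succ, h2 i (by omega)]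
    · rw [wlen_cons, h3, Finset.sum_range_succ', add_comm]

end Walks

/-! ### The instance of a weighted graph -/

section Instances

variable {n : ℕ}

/-- The parents of the vertices; numbers that are not vertices get the parent `r`. -/
def natPar (r : Fin n) (par : Fin n → Fin n) (x : ℕ) : ℕ := if h : x < n then par ⟨x, h⟩ else r

/-- The weight of the edge between two vertices, and `0` for numbers that are not vertices. -/
noncomputable def natW (w : Sym2 (Fin n) → ℝ≥0) (x y : ℕ) : ℝ :=
  if h : x < n ∧ y < n then w s(⟨x, h.1⟩, ⟨y, h.2⟩) else 0

variable {r : Fin n} {par : Fin n → Fin n} {w : Sym2 (Fin n) → ℝ≥0}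

@[simp] theorem natPar_val (v : Fin n) : natPar r par v = par v := by simp [natPar]

@[simp] theorem natPar_iterate_val (k : ℕ) (v : Fin n) : (natPar r par)^[k] v = (par^[k] v : Fin n) := by
  induction k with
  | zero => rfl
  | succ k ih => rw [Function.iterate_succ_apply', Function.iterate_succ_apply', ih, natPar_val]

@[simp] theorem natW_val (x y : Fin n) : natW w x y = w s(x, y) := by simp [natW]

variable {G : SimpleGraph (Fin n)}

theorem IsSPT.isTree (h : IsSPT G w r par) : IsTree r (natPar r par) where
  root := by rw [natPar_val, h.root]
  reach v := by
    by_cases hv : v < n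
    · obtain ⟨k, hk⟩ := h.reaches_root ⟨v, hv⟩
      exact ⟨k, by rw [show v = (⟨v, hv⟩ : Fin n) from rfl, natPar_iterate_val, hk]⟩
    · exact ⟨1, by simp [natPar, hv]⟩

theorem IsSPT.adj_par (h : IsSPT G w r par) {v : Fin n} (hv : v ≠ r) :
    (parentTree par).Adj v (par v) := by
  refine (SimpleGraph.fromRel_adj _ _ _).2 ⟨fun h' => h.isTree.par_ne (v := v) ?_ ?_, Or.inl rfl⟩
  · exact fun h'' => hv (Fin.ext h'')
  · rw [natPar_val, ← h']

theorem parentTree_adj {x y : Fin n} (h : (parentTree par).Adj x y) : par x = y ∨ par y = x :=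
  ((SimpleGraph.fromRel_adj _ _ _).1 h).2

/-- The tree path from the root to a vertex. -/
theorem IsSPT.exists_treeWalk (h : IsSPT G w r par) (v : Fin n) :
    ∃ p : (parentTree par).Walk r v, p.length = dep r (natPar r par) v ∧
      (wlen w p : ℝ) = tdist r (natPar r par) (natW w) v := by
  suffices hs : ∀ d, ∀ v : Fin n, dep r (natPar r par) v = d →
      ∃ p : (parentTree par).Walk r v, p.length = d ∧
        (wlen w p : ℝ) = tdist r (natPar r par) (natW w) v by
    obtain ⟨p, hp⟩ := hs _ v rfl
    exact ⟨p, hp⟩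
  intro d
  induction d with
  | zero =>
    intro v hv
    obtain rfl : v = r := Fin.ext (h.isTree.dep_eq_zero.1 hv)
    exact ⟨.nil, rfl, by rw [wlen_nil, IsTree.tdist_root, NNReal.coe_zero]⟩
  | succ d ih =>
    intro v hv
    have hvr : v ≠ r := by
      rintro rfl
      rw [IsTree.dep_root] at hv
      omega
    have hvr' : (v : ℕ) ≠ r := fun h' => hvr (Fin.ext h')
    obtain ⟨p, h1, h2⟩ := ih (par v) (by
      rw [← natPar_val (r := r), h.isTree.dep_par, hv, Nat.add_sub_cancel])
    refine ⟨p.concat (h.adj_par hvr).symm, by rw [SimpleGraph.Walk.length_concat, h1], ?_⟩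
    rw [wlen_concat, h.isTree.tdist_eq _ hvr', natPar_val, NNReal.coe_add, h2, natW_val, Sym2.eq_swap]

theorem IsSPT.level_eq (h : IsSPT G w r par) (v : Fin n) :
    level r par v = dep r (natPar r par) v := by
  obtain ⟨p, hp, -⟩ := h.exists_treeWalk v
  refine le_antisymm (hp ▸ SimpleGraph.dist_le p) ?_
  obtain ⟨q, hq⟩ := p.reachable.exists_walk_length_eq_dist
  rw [level, ← hq]
  have : ∀ {x y : Fin n} (q : (parentTree par).Walk x y),
      dep r (natPar r par) y ≤ dep r (natPar r par) x + q.length := fun {x y} q => by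
    induction q with
    | nil => simp
    | @cons x z y hxz q ih =>
      have h3 : dep r (natPar r par) z ≤ dep r (natPar r par) x + 1 := by
        rcases parentTree_adj hxz with rfl | rfl
        · have := h.isTree.dep_par x
          rw [natPar_val] at this
          omega
        · have := h.isTree.dep_par z
          rw [natPar_val] at this
          omega
      rw [SimpleGraph.Walk.length_cons]
      omega
  simpa [IsTree.dep_root] using this q

theorem IsSPT.wdist_eq (h : IsSPT G w r par) (v : Fin n) :
    wdist G w r v = ENNReal.ofReal (tdist r (natPar r par) (natW w) v) := by
  rw [← h.dist_eq]
  obtain ⟨p, -, hp⟩ := h.exists_treeWalk v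
  refine le_antisymm ((wdist_le p).trans ?_) (le_iInf fun q => ?_)
  · rw [← hp, ENNReal.ofReal_coe_nnreal]
  · have h1 := le_add_wlen (w := w) (G := parentTree par)
      (φ := fun v => tdist r (natPar r par) (natW w) v) (fun x y hxy => ?_) q
    · simp only [IsTree.tdist_root, zero_add] at h1
      exact ENNReal.ofReal_le_of_le_toReal (by simpa using h1)
    · have hedge : ∀ x : Fin n, tdist r (natPar r par) (natW w) (par x) ≤
            tdist r (natPar r par) (natW w) x ∧ tdist r (natPar r par) (natW w) x ≤
            tdist r (natPar r par) (natW w) (par x) + w s(x, par x) := fun x => by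
        rcases eq_or_ne x r with rfl | hx
        · rw [h.root]
          exact ⟨le_rfl, le_add_of_nonneg_right (NNReal.coe_nonneg _)⟩
        · have h2 := h.isTree.tdist_eq (natW w) fun h' => hx (Fin.ext h')
          rw [natPar_val, natW_val] at h2
          have h3 : (0 : ℝ) ≤ w s(x, par x) := NNReal.coe_nonneg _
          constructor <;> linarith
      rcases parentTree_adj hxy with rfl | rfl
      · exact (hedge x).1.trans (le_add_of_nonneg_right (NNReal.coe_nonneg _))
      · rw [Sym2.eq_swap]; exact (hedge y).2

theorem IsSPT.tdist_le (h : IsSPT G w r par) {x y : Fin n} (hxy : G.Adj x y) :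
    tdist r (natPar r par) (natW w) y ≤ tdist r (natPar r par) (natW w) x + w s(x, y) := by
  obtain ⟨p, -, hp⟩ := h.exists_treeWalk x
  have h1 := wdist_le (w := w) ((p.mapLe h.le).concat hxy)
  rw [h.wdist_eq, wlen_concat, wlen_mapLe] at h1
  rw [ENNReal.ofReal_le_iff_le_toReal ENNReal.coe_ne_top, ENNReal.coe_toReal, NNReal.coe_add, hp] at h1
  exact h1

variable {m f : ℕ} {e : Fin m → Fin n × Fin n}

theorem IsEdgeList.exists_of_adj (he : IsEdgeList G e) {x y : Fin n} (h : G.Adj x y) :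
    ∃ j : Fin m, ((e j).1 = x ∧ (e j).2 = y) ∨ ((e j).1 = y ∧ (e j).2 = x) := by
  obtain ⟨j, -, hj⟩ := he.surjOn ((SimpleGraph.mem_edgeSet G).2 h)
  exact ⟨j, Sym2.eq_iff.1 hj⟩

theorem IsEdgeList.adj (he : IsEdgeList G e) (j : Fin m) : G.Adj (e j).1 (e j).2 :=
  (SimpleGraph.mem_edgeSet G).1 (he.mapsTo (Set.mem_univ j))

theorem IsEdgeList.le_sq (he : IsEdgeList G e) : m ≤ n * n := by
  have h1 : Function.Injective e := fun i j hij =>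
    he.injOn (Set.mem_univ i) (Set.mem_univ j) (by simp [hij])
  simpa using Fintype.card_le_of_injective e h1

/-- The weighted graph with its shortest path tree, on natural numbers as vertices. -/
noncomputable def toInst (hf : 1 ≤ f) (h : IsSPT G w r par) (he : IsEdgeList G e) : Inst where
  n := n
  m := m
  f := f
  r := r
  par := natPar r par
  ea j := if h : j < m then (e ⟨j, h⟩).1 else 0
  eb j := if h : j < m then (e ⟨j, h⟩).2 else 0
  W := natW w
  tree := h.isTree
  r_lt := r.2
  f_pos := hf
  par_lt v := by
    rw [natPar]
    split_ifs
    · exact Fin.is_lt _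
    · exact r.2
  ea_lt j hj := by simp [hj]
  eb_lt j hj := by simp [hj]
  W_nonneg x y := by
    rw [natW]
    split_ifs
    · exact NNReal.coe_nonneg _
    · exact le_rfl
  W_symm x y := by
    by_cases hx : x < n <;> by_cases hy : y < n <;> simp [natW, hx, hy]
    rw [Sym2.eq_swap]
  tree_edge v hv hvr := by
    obtain ⟨j, hj⟩ := he.exists_of_adj (h.le (h.adj_par (v := ⟨v, hv⟩) fun h' =>
      hvr (congrArg Fin.val h')))
    refine ⟨j, j.2, ?_⟩
    rcases hj with ⟨h1, h2⟩ | ⟨h1, h2⟩ <;> simp [h1, h2, natPar, hv]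
  spt j hj := by
    have h1 := he.adj ⟨j, hj⟩
    have h2 := h.tdist_le h1
    have h3 := h.tdist_le h1.symm
    rw [Sym2.eq_swap] at h3
    simp only [hj, ↓reduceDIte, natW_val]
    exact ⟨h2, h3⟩

variable (hf : 1 ≤ f) (h : IsSPT G w r par) (he : IsEdgeList G e)

theorem inOk_inputState : (toInst hf h he).InOk (inputState f w r par e) where
  n := rfl
  m := rfl
  f := rfl
  r := rfl
  par v hv := by
    have hv' : v < n := hv
    simp [inputState, toInst, natPar, hv']
  e1 j _ := rfl
  e2 j _ := rfl
  w j hj := by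
    have hj' : j < m := hj
    simp [inputState, toInst, hj']

theorem fits_toInst : (toInst hf h he).Fits ((n + f) ^ 4) := by
  have hn : 1 ≤ n := by have := r.2; omega
  have hm := he.le_sq
  set N := n + f with hN
  have h2 : 2 * N ≤ N ^ 2 := by rw [sq]; exact Nat.mul_le_mul_right N (by omega)
  have h4 : N ^ 2 ≤ N ^ 4 := Nat.pow_le_pow_right (by omega) (by omega)
  have h22 : N ^ 2 * N ^ 2 = N ^ 4 := by ring
  have h3 : N ^ 3 ≤ N ^ 4 := Nat.pow_le_pow_right (by omega) (by omega)
  have hnn : n * n ≤ N ^ 2 := by rw [sq]; exact Nat.mul_le_mul (by omega) (by omega)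
  have h5 : 2 * N ^ 2 ≤ N ^ 4 := by
    rw [← h22]
    exact Nat.mul_le_mul_right _ (by omega)
  refine ⟨?_, ?_, ?_, ?_, ?_, ?_⟩
  · show 2 * n + 2 ≤ _
    omega
  · show m + 1 ≤ _
    omega
  · show 2 * (f + 1) ≤ _
    omega
  · show (f + 1) * (f + 1) ≤ _
    refine le_trans ?_ h4
    rw [sq]
    exact Nat.mul_le_mul (by omega) (by omega)
  · show (f + 2) * (2 * n + 1) ≤ _
    rw [← h22]
    exact Nat.mul_le_mul (by omega) (by omega)
  · show n * f * f ≤ _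
    refine le_trans ?_ h3
    rw [pow_succ, sq]
    exact Nat.mul_le_mul (Nat.mul_le_mul (by omega) (by omega)) (by omega)

variable {F : Finset (Sym2 (Fin n))} {v : Fin n}

theorem fails_iff (hF : F = (Finset.range F.card).image fun i => s(par^[i] v, par^[i + 1] v))
    (x y : Fin n) : (toInst hf h he).Fails v F.card x y ↔ s(x, y) ∈ F := by
  have h1 : s(x, y) ∈ F ↔
      s(x, y) ∈ (Finset.range F.card).image fun i => s(par^[i] v, par^[i + 1] v) := by rw [← hF]
  rw [h1, Finset.mem_image, Inst.Fails]
  refine exists_congr fun i => ?_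
  rw [Finset.mem_range]
  refine and_congr_right fun _ => ?_
  have h2 : ∀ k, (toInst hf h he).par^[k] v = (par^[k] v : Fin n) := fun k => natPar_iterate_val k v
  rw [h2, h2, Fin.val_inj, Fin.val_inj, Fin.val_inj, Fin.val_inj, Sym2.eq_iff]
  constructor <;> rintro (⟨h3, h4⟩ | ⟨h3, h4⟩) <;> simp [h3, h4]

theorem adj_iff (hF : F = (Finset.range F.card).image fun i => s(par^[i] v, par^[i + 1] v))
    (x y : Fin n) : (toInst hf h he).Adj v F.card x y ↔
      (G.deleteEdges (F : Set (Sym2 (Fin n)))).Adj x y := by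
  rw [Inst.Adj, fails_iff hf h he hF, SimpleGraph.deleteEdges_adj, Finset.mem_coe]
  refine and_congr_left fun _ => ⟨?_, fun hxy => ?_⟩
  · rintro ⟨j, hj, h1⟩
    have hj' : j < m := hj
    have h2 := he.adj ⟨j, hj'⟩
    simp only [toInst, hj', ↓reduceDIte, Fin.val_inj] at h1
    rcases h1 with ⟨h3, h4⟩ | ⟨h3, h4⟩ <;> rw [h3, h4] at h2
    · exact h2
    · exact h2.symm
  · obtain ⟨j, hj⟩ := he.exists_of_adj hxy
    exact ⟨j, j.2, by simpa [toInst, Fin.val_inj] using hj⟩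

end Instances

/-! ### Correctness of the oracle -/

theorem Answers.mono {B K L N N' : ℕ} {p : Cmd} {q : State} {P P' : State → Prop}
    (h : Answers B K L p q N P) (hN : N ≤ N') (hP : ∀ s, P s → P' s) : Answers B K L p q N' P' := by
  obtain ⟨k, q', h1, h2, h3, h4⟩ := h
  exact ⟨k, q', h1, h2.trans hN, h3, hP _ h4⟩

namespace Inst

variable {I : Inst}

theorem answers_of_runs {B N : ℕ} {p : Cmd} {q : State} {P : State → Prop} (h : Runs B p q N P)
    (hp : ∀ a < 17, p.wa a = false ∧ p.wb a = false) : Answers B 17 I.size p q N P := by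
  obtain ⟨k, q', h1, h2, h3⟩ := h
  refine ⟨k, q', h1, h2, fun a ha i _ => ?_, h3⟩
  rw [h1.frame.ia a (hp a ha).1, h1.frame.ra a (hp a ha).2]
  exact ⟨rfl, rfl⟩

theorem answers_cDist {B v k t : ℕ} {s q : State} (hs : I.OracleOk s) (hB : I.Fits B) (hv : v < I.n)
    (hk : 1 ≤ k) (hkx : k ≤ I.mx v) (ht : t < I.n) (hsq : SameOracle 17 I.size s q) (h0 : q.iv 0 = v)
    (h1 : q.iv 1 = k) (h2 : q.iv 2 = t) :
    Answers B 17 I.size cDist q 2000 (fun q' => q'.iv 0 = I.askFl v k (I.cellFl s v k) t ∧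
      (I.askFl v k (I.cellFl s v k) t ≠ 0 →
        q'.rv 0 = I.askD v k (I.cellY s v k) (I.cellD s v k) t)) := by
  have hE : I.ix v t < k → _ := SameEnt.of_sameOracle hsq hv hk (hkx.trans (I.mx_le v))
  have := runs_cDist (hs.congr hsq) hB hv hk hkx ht h0 h1 h2
  rw [askFl_congr hE, askD_congr hE] at this
  exact answers_of_runs this (by decide)

theorem answers_cPath {B v k t : ℕ} {s q : State} (hs : I.OracleOk s) (hB : I.Fits B) (hv : v < I.n)
    (hk : 1 ≤ k) (hkx : k ≤ I.mx v) (ht : t < I.n) (hsq : SameOracle 17 I.size s q) (h0 : q.iv 0 = v)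
    (h1 : q.iv 1 = k) (h2 : q.iv 2 = t) {g : ℕ → ℕ} {ℓ : ℕ} {d : ℝ}
    (hR : I.askFl v k (I.cellFl s v k) t ≠ 0 →
      I.Route v k (I.cellX s v k) (I.cellY s v k) (I.cellH s v k) (I.cellD s v k) g t ℓ d ∧
      ℓ = I.askLen v k (I.cellY s v k) (I.cellH s v k) t ∧ ℓ ≤ I.n) :
    Answers B 17 I.size cPath q
      (if I.askFl v k (I.cellFl s v k) t = 0 then 4000 else 4000 * (ℓ + 1))
      (fun q' => q'.iv 0 = I.askFl v k (I.cellFl s v k) t ∧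
        (I.askFl v k (I.cellFl s v k) t ≠ 0 → q'.iv 1 = ℓ ∧ ∀ j ≤ ℓ, q'.ia aOut j = g j)) := by
  have hE : ∀ i < k, _ := fun i => SameEnt.of_sameOracle hsq hv hk (hkx.trans (I.mx_le v)) (i := i)
  have hfl := askFl_congr (t := t) fun h => hE _ h
  have := runs_cPath (hs.congr hsq) hB hv hk hkx ht h0 h1 h2 (X := I.cellX s v k)
    (Y := I.cellY s v k) (H := I.cellH s v k) (D := I.cellD s v k) (g := g) (ℓ := ℓ) (d := d)
    (fun i hi => ⟨(hE i hi).x, (hE i hi).y, (hE i hi).h⟩) (by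
      rw [hfl, askLen_congr fun h => hE _ h]
      exact hR)
  rw [hfl] at this
  exact answers_of_runs this (by decide)

end Inst

section Correctness

variable {n m f : ℕ} {G : SimpleGraph (Fin n)} {w : Sym2 (Fin n) → ℝ≥0} {r : Fin n}
  {par : Fin n → Fin n} {e : Fin m → Fin n × Fin n} (hf : 1 ≤ f) (h : IsSPT G w r par)
  (he : IsEdgeList G e) {F : Finset (Sym2 (Fin n))} {v : Fin n}

theorem IsPathFailure.le_mx (hF : IsPathFailure r par F v) (hFf : F.card ≤ f) :
    F.card ≤ (toInst hf h he).mx v :=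
  le_min hFf (hF.2.1.trans_eq (h.level_eq v))

/-- A valid sequence of vertices is a path that avoids the failure. -/
theorem Inst.ValidSeq.exists_walk (hF : IsPathFailure r par F v) {rk g : ℕ → ℕ} {t : Fin n}
    {ℓ : ℕ} {d : ℝ} (hg : (toInst hf h he).ValidSeq v F.card rk g t ℓ d) :
    ∃ p : (G.deleteEdges (F : Set (Sym2 (Fin n)))).Walk r t, p.IsPath ∧ p.length = ℓ ∧
      (∀ i ≤ ℓ, (p.getVert i : ℕ) = g i) ∧ (wlen w p : ℝ) = d := by
  obtain ⟨g', hg'⟩ : ∃ g' : ℕ → Fin n, ∀ j ≤ ℓ, (g' j : ℕ) = g j :=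
    ⟨fun j => if hj : g j < n then ⟨g j, hj⟩ else r, fun j hj => by
      have : g j < n := hg.lt j hj
      simp [this]⟩
  have h0 : g' 0 = r := Fin.ext ((hg' 0 (by omega)).trans hg.first)
  have h1 : g' ℓ = t := Fin.ext ((hg' ℓ le_rfl).trans hg.last)
  subst h1
  obtain ⟨p, h2, h3, h4⟩ := exists_walk_of_adj (w := w)
    (G := G.deleteEdges (F : Set (Sym2 (Fin n)))) g' ℓ fun j hj => by
      rw [← adj_iff hf h he hF.2.2, hg' j hj.le, hg' (j + 1) hj]
      exact hg.adj j hj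
  refine ⟨p.copy h0 rfl, ?_, by simpa using h2, fun i hi => ?_, ?_⟩
  · rw [← SimpleGraph.Walk.IsPath.getVert_injOn_iff]
    intro i hi j hj hij
    simp only [SimpleGraph.Walk.length_copy, h2, Set.mem_ofPred_eq] at hi hj
    simp only [SimpleGraph.Walk.getVert_copy, h3 i hi, h3 j hj] at hij
    refine hg.inj i hi j hj ?_
    rw [← hg' i hi, ← hg' j hj, hij]
  · rw [SimpleGraph.Walk.getVert_copy, h3 i hi, hg' i hi]
  · have h5 : wlen w (p.copy h0 rfl) = wlen w p := by simp [wlen]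
    rw [h5, h4, ← hg.sum]
    push_cast
    refine Finset.sum_congr rfl fun j hj => ?_
    have hj := Finset.mem_range.1 hj
    rw [← hg' j hj.le, ← hg' (j + 1) hj]
    exact (natW_val _ _).symm

/-- The components that a walk from the root visits are joined to the root by edges of the component
tree that cost at most twice the length of the walk. -/
theorem chain_of_walk (hF : IsPathFailure r par F v) {h' : ℕ} (hk : F.card ≤ h') {seq : List ℕ}
    {p pe : ℕ → ℕ}
    (HS : Span (toInst hf h he).cost ((toInst hf h he).Mt v h') h' F.card seq p pe) {ω : ℝ}
    {x y : Fin n} (q : (G.deleteEdges (F : Set (Sym2 (Fin n)))).Walk x y)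
    (hω : (toInst hf h he).ds x + wlen w q ≤ ω)
    (hx : Inst.Chain (toInst hf h he).cost F.card p pe ((2 * ω : ℝ) : WithTop ℝ)
      (min h' ((toInst hf h he).ix v x))) :
    Inst.Chain (toInst hf h he).cost F.card p pe ((2 * ω : ℝ) : WithTop ℝ)
      (min h' ((toInst hf h he).ix v y)) ∧ (toInst hf h he).ds y ≤ ω := by
  induction q with
  | nil => exact ⟨hx, by simpa using hω⟩
  | @cons x z y hxz q ih =>
    have h1 := (adj_iff hf h he hF.2.2 x z).2 hxz
    have h2 := h1.ds_le
    have h3 : (toInst hf h he).W x z = w s(x, z) := natW_val _ _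
    have h4 : (0 : ℝ) ≤ wlen w q := NNReal.coe_nonneg _
    rw [wlen_cons, NNReal.coe_add] at hω
    refine ih (by linarith) (Inst.chain_of_adj hk HS h1 (by linarith) hx)

/-- What the oracle holds about the vertex `t` after the failure `F`: either `t` has been cut off, or
there is a path to `t` whose length and vertices can be read off. -/
theorem exists_detour (hF : IsPathFailure r par F v) (hFf : F.card ≤ f) {s : State}
    (hs : (toInst hf h he).OracleOk s) (t : Fin n) :
    (wdist (G.deleteEdges (F : Set (Sym2 (Fin n)))) w r t = ⊤ ∧
      (toInst hf h he).askFl v F.card ((toInst hf h he).cellFl s v F.card) t = 0) ∨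
    ((toInst hf h he).askFl v F.card ((toInst hf h he).cellFl s v F.card) t = 1 ∧
      wdist (G.deleteEdges (F : Set (Sym2 (Fin n)))) w r t ≠ ⊤ ∧
      ∃ (p : (G.deleteEdges (F : Set (Sym2 (Fin n)))).Walk r t) (g : ℕ → ℕ), p.IsPath ∧
        (wlen w p : ℝ≥0∞) ≤ (2 * (F.card : ℝ≥0∞) + 1) *
          wdist (G.deleteEdges (F : Set (Sym2 (Fin n)))) w r t ∧
        (∀ i ≤ p.length, (p.getVert i : ℕ) = g i) ∧
        (wlen w p : ℝ) = (toInst hf h he).askD v F.card ((toInst hf h he).cellY s v F.card)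
          ((toInst hf h he).cellD s v F.card) t ∧
        (toInst hf h he).Route v F.card ((toInst hf h he).cellX s v F.card)
          ((toInst hf h he).cellY s v F.card) ((toInst hf h he).cellH s v F.card)
          ((toInst hf h he).cellD s v F.card) g t p.length (wlen w p) ∧
        p.length = (toInst hf h he).askLen v F.card ((toInst hf h he).cellY s v F.card)
          ((toInst hf h he).cellH s v F.card) t) := by
  set I := toInst hf h he with hI
  have hk : F.card ≤ I.mx v := hF.le_mx hf h he hFf
  have hkd : F.card ≤ I.dp v := hk.trans (min_le_right _ _)
  obtain ⟨seq, p, pe, HS, hE⟩ := hs.ent v v.2 F.card hF.1 hk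
  have HE := fun i hi => (hE i hi).1
  -- every walk to `t` bounds the length of the detour from above
  have hup : ∀ q : (G.deleteEdges (F : Set (Sym2 (Fin n)))).Walk r t,
      I.askFl v F.card (I.cellFl s v F.card) t = 1 ∧
      I.askD v F.card (I.cellY s v F.card) (I.cellD s v F.card) t ≤
        (2 * F.card + 1) * (wlen w q : ℝ) := fun q => by
    have h0 : I.ds r = 0 := IsTree.tdist_root _
    have h1 : I.ix v r = I.dp v := I.tree.idx_root v
    obtain ⟨h2, h3⟩ := chain_of_walk hf h he hF hk HS q (ω := wlen w q) (by rw [← hI, h0, zero_add])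
      (.root _ (by rw [← hI, h1]; exact le_min hk hkd))
    exact Inst.ask_le_of_chain hk HS HE (NNReal.coe_nonneg _) h2 h3
  by_cases htop : wdist (G.deleteEdges (F : Set (Sym2 (Fin n)))) w r t = ⊤
  · refine Or.inl ⟨htop, ?_⟩
    by_contra hne
    obtain ⟨g, -, hg⟩ := Inst.exists_route hk hkd HS HE t t.2 hne
    obtain ⟨p, -⟩ := hg.exists_walk hf h he hF
    exact absurd (htop ▸ wdist_le p) (by simp)
  · obtain ⟨q⟩ := exists_walk_of_wdist_ne_top htop
    have h1 := (hup q).1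
    obtain ⟨g, hr, hg⟩ := Inst.exists_route hk hkd HS HE t t.2 (by rw [h1]; exact one_ne_zero)
    obtain ⟨p, a1, a2, a3, a4⟩ := hg.exists_walk hf h he hF
    refine Or.inr ⟨h1, htop, p, g, a1, ?_, by rw [a2]; exact a3, a4, by rw [a2, a4]; exact hr, a2⟩
    rw [wdist, ENNReal.mul_iInf_of_ne (by simp) (by finiteness)]
    refine le_iInf fun q => ?_
    have h2 := (hup q).2
    rw [← a4] at h2
    exact_mod_cast h2

end Correctness

end PathOracle

open PathOracle
theorem mainTheorem3 :
    ∃ (preprocess distQuery pathQuery : Cmd) (C c K : ℕ),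
      ∀ (n m f : ℕ) (G : SimpleGraph (Fin n)) (w : Sym2 (Fin n) → ℝ≥0) (r : Fin n)
        (par : Fin n → Fin n) (e : Fin m → Fin n × Fin n),
        1 ≤ f → IsSPT G w r par → IsEdgeList G e →
        ∃ (T L : ℕ) (σ : State),
          Exec ((n + f) ^ c) preprocess (inputState f w r par e) T σ ∧
          T ≤ C * (n * (m + f ^ 2)) ∧
          2 * K * L ≤ C * (n * f ^ 2) ∧
          ∀ (F : Finset (Sym2 (Fin n))) (v t : Fin n),
            IsPathFailure r par F v → F.card ≤ f →
            -- `t` is disconnected from `r` by the failure: both queries report this by a zero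
            (wdist (G.deleteEdges (F : Set (Sym2 (Fin n)))) w r t = ⊤ →
              ∀ q : State, IsQuery K L σ v F.card t q →
                Answers ((n + f) ^ c) K L distQuery q C (fun q' => q'.iv 0 = 0) ∧
                Answers ((n + f) ^ c) K L pathQuery q C (fun q' => q'.iv 0 = 0)) ∧
            -- otherwise they report the length and the vertices of a path in `G - F`
            (wdist (G.deleteEdges (F : Set (Sym2 (Fin n)))) w r t ≠ ⊤ →
              ∃ p : (G.deleteEdges (F : Set (Sym2 (Fin n)))).Walk r t,
                p.IsPath ∧
                wdist (G.deleteEdges (F : Set (Sym2 (Fin n)))) w r t ≤ (wlen w p : ℝ≥0∞) ∧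
                (wlen w p : ℝ≥0∞) ≤
                  (2 * (F.card : ℝ≥0∞) + 1) *
                    wdist (G.deleteEdges (F : Set (Sym2 (Fin n)))) w r t ∧
                ∀ q : State, IsQuery K L σ v F.card t q →
                  Answers ((n + f) ^ c) K L distQuery q C
                    (fun q' => q'.iv 0 = 1 ∧ q'.rv 0 = (wlen w p : ℝ)) ∧
                  Answers ((n + f) ^ c) K L pathQuery q (C * (p.length + 1))
                    (fun q' => q'.iv 0 = 1 ∧ q'.iv 1 = p.length ∧
                      ∀ i ≤ p.length, q'.ia K i = (p.getVert i : ℕ))) := by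
  refine ⟨cPreprocess, cDist, cPath, 40000, 4, 17, fun n m f G w r par e hf h he => ?_⟩
  have hin := inOk_inputState hf h he
  have hfit := fits_toInst hf h he
  set I := toInst hf h he with hI
  obtain ⟨T, σ, hexec, hT, hσ⟩ :=
    Inst.runs_cPreprocess hin hfit (fun _ _ => rfl) fun _ => rfl
  refine ⟨T, I.size, σ, hexec, hT, ?_, fun F v t hF hFf => ?_⟩
  · have h1 : I.size = 4 * (n * f ^ 2) := rfl
    rw [h1]
    omega
  have hk : F.card ≤ I.mx v := hF.le_mx hf h he hFf
  rcases exists_detour hf h he hF hFf hσ t with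
    ⟨htop, hfl⟩ | ⟨hfl, htop, p, g, a1, a2, a3, a4, a5, a6⟩
  · refine ⟨fun _ q ⟨hq, h0, h1, h2⟩ => ?_, fun h' => absurd htop h'⟩
    have h3 := Inst.answers_cDist hσ hfit v.2 hF.1 hk t.2 hq h0 h1 h2
    -- there is no path to be written, so that `g`, `ℓ` and `d` do not matter
    have h4 := Inst.answers_cPath hσ hfit v.2 hF.1 hk t.2 hq h0 h1 h2 (g := id) (ℓ := 0) (d := 0)
      fun h' => absurd hfl h'
    rw [hfl] at h3 h4
    exact ⟨h3.mono (by omega) fun _ h' => h'.1, h4.mono (by simp) fun _ h' => h'.1⟩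
  · refine ⟨fun h' => absurd h' htop, fun _ => ⟨p, a1, wdist_le p, a2, fun q ⟨hq, h0, h1, h2⟩ => ?_⟩⟩
    have h3 := Inst.answers_cDist hσ hfit v.2 hF.1 hk t.2 hq h0 h1 h2
    have h4 := Inst.answers_cPath hσ hfit v.2 hF.1 hk t.2 hq h0 h1 h2
      fun _ => ⟨a5, a6, a1.length_lt.le.trans_eq (Fintype.card_fin n)⟩
    rw [hfl] at h3 h4
    rw [← a4] at h3
    refine ⟨h3.mono (by omega) fun _ h' => ⟨h'.1, h'.2 one_ne_zero⟩, h4.mono ?_ fun _ h' =>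
      ⟨h'.1, (h'.2 one_ne_zero).1, fun i hi => ((h'.2 one_ne_zero).2 i hi).trans (a3 i hi).symm⟩⟩
    rw [if_neg one_ne_zero]
    omega
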